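/- **Setting.** Let $\mathfrak g$ be a finite-dimensional Lie algebra of compact type with a basis $\xi_a$ of hermitean matrices, $i[\xi_a,\xi_b]=\sum_c f_{abc}\xi_c$ with real, completely antisymmetric $f_{abc}$, and let $\pi$ be a finite-dimensional unitary representation, $\tau_a=\pi(\xi_a)$ hermitean. Write $\mathrm{ad}_{is}(v)=i[s,v]$. Let $c^\mu$ be a string function on Minkowski space $\mathbb R^{1+3}$: real distributions supported in a closed convex cone containing no line, with $\partial_\mu c^\mu=\delta$; put $I_c^\mu(f_\mu)(x)=\int d^4y\,c^\mu(y)f_\mu(x+y)$. Fields are functionals of a $\mathfrak g$-valued potential $A_\mu$ (smooth, with support meeting $K+\text{cone}$ in a bounded set for every compact $K$) and of a quark field $\psi$ in the representation $\pi$ with Dirac adjoint $\overline\psi$; the Wick product is the pointwise product. Put $F_{\mu\nu}=\partial_\mu A_\nu-\partial_\nu A_\mu$, $A_\mu(c)=I_c^\nu(F_{\mu\nu})$, $j^\mu_a=\overline\psi\gamma^\mu\tau_a\psi$, $\langle\beta|j^\mu\rangle=\sum_a\beta_a j^\mu_a$. Let $\mathcal S^{\mathfrak g}$ be the smallest real space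 of $\mathfrak g$-valued scalar fields that contains $I_c^\nu(\mathrm{ad}_{is_k}\cdots\mathrm{ad}_{is_1}(A_\nu))$ ($k\ge0$) and $I_c^\nu(\mathrm{ad}_{is_k}\cdots\mathrm{ad}_{is_1}(\partial_\nu s_0))$ ($k\ge1$) whenever $s_0,\dots,s_k\in\mathcal S^{\mathfrak g}$, and let $\mathcal V^{\mathfrak g}$ be the real span of the $\mathfrak g$-valued vector fields $\mathrm{ad}_{is_k}\cdots\mathrm{ad}_{is_1}(A_\nu)$ and $\mathrm{ad}_{is_k}\cdots\mathrm{ad}_{is_1}(\partial_\nu s_0)$ ($k\ge0$). For a vector-valued field $U^\mu$ the obstruction map is the derivation $\omega_U(X)(x)=i\int dx'\,O_\mu(U^\mu(x'),X(x))$, $O_\mu(Y(x'),X(x))=T\,\partial'_\mu Y(x')\cdot X(x)-\partial'_\mu\,T\,Y(x')\cdot X(x)$ at tree level. It is computed by Wick expansion from two-point functions, where elements of $\mathcal S^{\mathfrak g}$ (as well as $v\in\mathcal V^{\mathfrak g}$ in $O_{[\mu}(v_{\nu]},\cdot)$) are inert in the first argument, and where $\langle TA^a_\mu(x')A^b_\nu(x)\rangle=-\delta_{ab}\eta_{\mu\nu}T_0(x'-x)$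 and $\langle T\psi(x')\overline\psi(x)\rangle=(m+i\gamma^\mu\partial_\mu)\Delta(x'-x)$, with $T_0,\Delta$ any distributions satisfying $\square T_0=-i\delta$, $(\square+m^2)\Delta=-i\delta$; the equations of motion $\partial^\mu F_{\mu\nu}=-\partial_\nu(\partial^\mu A_\mu)$ and $(i\gamma^\mu\partial_\mu-m)\psi=0$ are used inside $T$. Everything extends to formal power series in the coupling constant $g$. **Proposition (Dressed quark field).** Let $\gamma\in g\mathcal S^{\mathfrak g}[[g]]$, $W=e^{i\gamma}$, and let $U^\mu=\langle F^{\mu\nu}|\alpha_\nu\rangle$ with $\alpha\in g\mathcal V^{\mathfrak g}[[g]]$, be such that $$e^{\omega_U}(A_\mu(c))=W\big(A_\mu+ig^{-1}\partial_\mu\big)W^{-1}.$$ Then there is a unique mediator field $\widetilde U^\mu$ of the form $\widetilde U^\mu=\langle\beta|j^\mu\rangle$ with $\beta\in g\mathcal S^{\mathfrak g}[[g]]$ such that $$e^{\omega}(\psi(x))=\pi(W(x))\,\psi(x),\qquad \omega=\omega_U+\omega_{\widetilde U}.$$ One may take for $\beta$ the unique element of $g\mathcal S^{\mathfrak g}[[g]]$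 satisfying the Baker–Campbell–Hausdorff identity $$e^{\omega_U+R_{i\beta}}=e^{R_{i\gamma}}\circ e^{\omega_U}$$ on the associative algebra generated by $\mathcal S^{\mathfrak g}[[g]]$, where $R_{is}$ is right multiplication by $is$; it satisfies $$\beta=\gamma-\tfrac12\omega_U(\gamma)+\tfrac1{12}\big(i[\gamma,\omega_U(\gamma)]+\omega_U^2(\gamma)\big)+\mathcal O(g^4).$$ Moreover, the dressed quark field $e^\omega(\psi)$ is gauge invariant: its value does not change under $A_\mu\mapsto\Theta^{-1}(A_\mu+ig^{-1}\partial_\mu)\Theta$, $\psi\mapsto\pi(\Theta^{-1})\psi$, $\overline\psi\mapsto\overline\psi\,\pi(\Theta)$, for every $\Theta=e^{i\theta}$, where $\theta$ is a formal power series in $g$ without constant term, with coefficients smooth $\mathfrak g$-valued functions satisfying the support condition imposed on $A_\mu$. -/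

import Mathlib

open scoped Distributions ContDiff Pointwise LineDeriv

namespace StringQFT

noncomputable section

/-! ### Spacetime, distributions, string integration -/

/-- Minkowski spacetime `ℝ^{1+3}`; the coordinate `0` is time. -/
abbrev Spacetime : Type := Fin 4 → ℝ

/-- The diagonal entries `η_{μμ} = η^{μμ}` of the Minkowski metric, signature `(+,-,-,-)`. -/
def eta (μ : Fin 4) : ℝ := if μ = 0 then 1 else -1

/-- The metric `η_{μν}`. -/
def metric (μ ν : Fin 4) : ℝ := if μ = ν then eta μ else 0

/-- The coordinate vector `e_μ`. -/
def basisVec (μ : Fin 4) : Spacetime := Pi.single μ 1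

/-- The partial derivative `∂_μ f` of a function on spacetime. -/
def pderiv {E : Type*} [NormedAddCommGroup E] [NormedSpace ℝ E]
    (μ : Fin 4) (f : Spacetime → E) : Spacetime → E :=
  fun x => fderiv ℝ f x (basisVec μ)

/-- Distributions on all of spacetime with values in `F` (`F = ℝ` or `F = ℂ`). -/
abbrev Distr (F : Type*) [NormedAddCommGroup F] [NormedSpace ℝ F] : Type _ :=
  𝓓'((⊤ : TopologicalSpace.Opens Spacetime), F)

/-- Test functions on spacetime. -/
abbrev Test : Type := 𝓓((⊤ : TopologicalSpace.Opens Spacetime), ℝ)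

/-- The distributional derivative `∂_μ T`. -/
def dpartial {F : Type*} [NormedAddCommGroup F] [NormedSpace ℝ F] (μ : Fin 4) (T : Distr F) :
    Distr F :=
  ∂_{basisVec μ} T

/-- `HasPairing T f v`: the smooth, not necessarily compactly supported function `f` can be paired
with the distribution `T` and `∫ T f = v`. That is, cutting `f` off by a test function `χ` which
is `1` near a sufficiently large compact set always gives `T (χ f) = v`. This is the usual
extension of `T` to smooth functions `f` for which `supp T ∩ supp f` is compact. -/
def HasPairing {F : Type*} [NormedAddCommGroup F] [NormedSpace ℝ F]
    (T : Distr F) (f : Spacetime → ℝ) (v : F) : Prop :=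
  ContDiff ℝ ∞ f ∧ ∃ K : Set Spacetime, IsCompact K ∧
    ∀ χ φ : Test, (∀ᶠ x in nhdsSet K, χ x = 1) → (∀ x, φ x = χ x * f x) → T φ = v

open Classical in
/-- The number `∫ T(z) f(z) dz` (zero if the pairing does not exist). -/
def pairing {F : Type*} [NormedAddCommGroup F] [NormedSpace ℝ F]
    (T : Distr F) (f : Spacetime → ℝ) : F :=
  if h : ∃ v, HasPairing T f v then h.choose else 0

/-- The same for complex-valued functions. -/
def pairingC (T : Distr ℂ) (f : Spacetime → ℂ) : ℂ :=
  pairing T (fun z => (f z).re) + Complex.I * pairing T (fun z => (f z).im)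

/-- A string function: real distributions `c^μ`, supported in a closed convex cone (the "string")
that contains no line, with `∂_μ c^μ = δ`. -/
structure StringFunction where
  /-- the components `c^μ` -/
  comp : Fin 4 → Distr ℝ
  /-- the cone -/
  cone : PointedCone ℝ Spacetime
  cone_closed : IsClosed (cone : Set Spacetime)
  cone_salient : (cone : ConvexCone ℝ Spacetime).Salient
  supp_subset : ∀ μ, Distribution.dsupport (comp μ) ⊆ (cone : Set Spacetime)
  div_eq_delta : ∑ μ, dpartial μ (comp μ) = Distribution.delta 0

/-- String integration `I_c^μ(f_μ)(x) = ∫ d⁴y c^μ(y) f_μ(x+y)` of a function with values in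
covectors with coefficients in `ℝ^ι`. -/
def stringInt {ι : Type*} (c : StringFunction) (f : Spacetime → Fin 4 → ι → ℝ) :
    Spacetime → ι → ℝ :=
  fun x a => ∑ μ, pairing (c.comp μ) (fun y => f (x + y) μ a)

/-- Smooth functions whose support meets every union of translated strings `x + cone`, with `x`
in a compact set, in a bounded set. This contains the test functions and, for a spacelike cone,
the smooth functions with spacelike compact support, and makes string integrals finite. -/
def stringFunctions (c : StringFunction) (E : Type*) [NormedAddCommGroup E] [NormedSpace ℝ E] :
    Submodule ℝ (Spacetime → E) where
  carrier := {f | ContDiff ℝ ∞ f ∧ ∀ K : Set Spacetime, IsCompact K →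
    Bornology.IsBounded (tsupport f ∩ (K + (c.cone : Set Spacetime)))}
  zero_mem' := by
    refine ⟨contDiff_const, fun K _ => ?_⟩
    have h : tsupport (0 : Spacetime → E) = ∅ := tsupport_eq_empty_iff.mpr rfl
    simp [h]
  add_mem' := by
    rintro f g ⟨hf, hf'⟩ ⟨hg, hg'⟩
    refine ⟨hf.add hg, fun K hK => ((hf' K hK).union (hg' K hK)).subset ?_⟩
    rintro x ⟨hx, hx'⟩
    rcases tsupport_add f g hx with h | h
    · exact Or.inl ⟨h, hx'⟩
    · exact Or.inr ⟨h, hx'⟩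
  smul_mem' := by
    rintro r f ⟨hf, hf'⟩
    refine ⟨contDiff_const.smul hf, fun K hK => (hf' K hK).subset ?_⟩
    rintro x ⟨hx, hx'⟩
    exact ⟨closure_mono (Function.support_const_smul_subset r f) hx, hx'⟩

/-- All smooth functions on spacetime. -/
def smoothFunctions (E : Type*) [NormedAddCommGroup E] [NormedSpace ℝ E] :
    Submodule ℝ (Spacetime → E) where
  carrier := {f | ContDiff ℝ ∞ f}
  zero_mem' := by
    change ContDiff ℝ ∞ (fun _ : Spacetime => (0 : E))
    exact contDiff_const
  add_mem' := by
    intro f g hf hg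
    have hf' : ContDiff ℝ ∞ f := hf
    have hg' : ContDiff ℝ ∞ g := hg
    exact hf'.add hg'
  smul_mem' := by
    intro r f hf
    have hf' : ContDiff ℝ ∞ f := hf
    exact contDiff_const.smul hf'

/-! ### The gauge algebra, its representations, Dirac matrices -/

/-- A Lie algebra of compact type: a basis `ξ_a` of hermitean matrices with
`i[ξ_a,ξ_b] = ∑ f_{abc} ξ_c`, the real structure constants being completely antisymmetric. -/
structure GaugeAlgebra (ι d : Type*) [Fintype ι] [Fintype d] where
  /-- the basis -/
  gen : ι → Matrix d d ℂ
  /-- the structure constants -/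
  struct : ι → ι → ι → ℝ
  hermitian : ∀ a, (gen a).IsHermitian
  independent : LinearIndependent ℝ gen
  comm : ∀ a b, Complex.I • (gen a * gen b - gen b * gen a) = ∑ e, (struct a b e : ℂ) • gen e
  antisymm : ∀ a b e, struct b a e = - struct a b e
  cyclic : ∀ a b e, struct b e a = struct a b e

/-- A finite-dimensional unitary representation `π`, `τ_a = π(ξ_a)`. -/
structure GaugeRep {ι d : Type*} [Fintype ι] [Fintype d] (L : GaugeAlgebra ι d)
    (J : Type*) [Fintype J] where
  /-- the matrices `τ_a` -/
  gen : ι → Matrix J J ℂ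
  hermitian : ∀ a, (gen a).IsHermitian
  comm : ∀ a b, Complex.I • (gen a * gen b - gen b * gen a) = ∑ e, (L.struct a b e : ℂ) • gen e

/-- The bracket `i[X,Y] = ∑ f_{abe} X_a Y_b ξ_e` in components. -/
def GaugeAlgebra.bracket {ι d : Type*} [Fintype ι] [Fintype d] (L : GaugeAlgebra ι d)
    (X Y : ι → ℝ) : ι → ℝ :=
  fun e => ∑ a, ∑ b, L.struct a b e * X a * Y b

/-- Dirac matrices: `γ^μ γ^ν + γ^ν γ^μ = 2 η^{μν}`. -/
def IsDirac (Γ : Fin 4 → Matrix (Fin 4) (Fin 4) ℂ) : Prop :=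
  ∀ μ ν, Γ μ * Γ ν + Γ ν * Γ μ = (2 * (metric μ ν : ℂ)) • (1 : Matrix (Fin 4) (Fin 4) ℂ)

/-! ### Fields -/

/-- Configurations `(A, ψ, ψ̄)`. The Wick product is the pointwise product of the functionals of
these; no equation of motion is imposed, those enter only through the time-ordered functions. -/
abbrev Config (c : StringFunction) (ι J : Type*) [Fintype ι] [Fintype J] : Type _ :=
  stringFunctions c (Fin 4 → ι → ℝ) ×
    (smoothFunctions (J → Fin 4 → ℂ) × smoothFunctions (J → Fin 4 → ℂ))

/-- Fields `X(x)` with values in `E`, as functionals of the configuration. -/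
abbrev QField (c : StringFunction) (ι J : Type*) [Fintype ι] [Fintype J] (E : Type*) : Type _ :=
  Config c ι J → Spacetime → E

/-- A power series `∑ gⁿ Xₙ` of fields. -/
abbrev FieldSeries (c : StringFunction) (ι J : Type*) [Fintype ι] [Fintype J] (E : Type*) :
    Type _ :=
  ℕ → QField c ι J E

section Fields

variable {c : StringFunction} {ι d J : Type*} [Fintype ι] [Fintype d] [Fintype J]

/-- The gauge potential `A_μ`. -/
def gaugeField : QField c ι J (Fin 4 → ι → ℝ) := fun Φ => Φ.1.1

/-- The quark field `ψ`. -/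
def quarkField : QField c ι J (J → Fin 4 → ℂ) := fun Φ => Φ.2.1.1

/-- The Dirac adjoint `ψ̄`. -/
def antiquarkField : QField c ι J (J → Fin 4 → ℂ) := fun Φ => Φ.2.2.1

/-- The field strength `F_{μν} = ∂_μ A_ν - ∂_ν A_μ`. -/
def fieldStrength (μ ν : Fin 4) : QField c ι J (ι → ℝ) := fun Φ x =>
  pderiv μ (fun y => gaugeField Φ y ν) x - pderiv ν (fun y => gaugeField Φ y μ) x

/-- The string-localized potential `A_μ(c) = I_c^ν(F_{μν})`. -/
def stringPotential (μ : Fin 4) : QField c ι J (ι → ℝ) := fun Φ =>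
  stringInt c (fun y ν => fieldStrength μ ν Φ y)

/-- `ad_{is}(v) = i[s,v]` for a Lie-algebra-valued vector field `v`. -/
def adVec (L : GaugeAlgebra ι d) (s : QField c ι J (ι → ℝ)) (v : QField c ι J (Fin 4 → ι → ℝ)) :
    QField c ι J (Fin 4 → ι → ℝ) :=
  fun Φ x μ => L.bracket (s Φ x) (v Φ x μ)

/-- `ad_{is_k} ⋯ ad_{is_1}(v)` for the list `[s_k, …, s_1]`. -/
def adList (L : GaugeAlgebra ι d) (l : List (QField c ι J (ι → ℝ)))
    (v : QField c ι J (Fin 4 → ι → ℝ)) : QField c ι J (Fin 4 → ι → ℝ) :=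
  l.foldr (adVec L) v

/-- `I_c^ν(v_ν)` for a vector field `v`. -/
def stringIntField (v : QField c ι J (Fin 4 → ι → ℝ)) : QField c ι J (ι → ℝ) :=
  fun Φ => stringInt c (v Φ)

/-- `∂_ν s` for a scalar field `s`. -/
def gradField (s : QField c ι J (ι → ℝ)) : QField c ι J (Fin 4 → ι → ℝ) :=
  fun Φ x ν => pderiv ν (s Φ) x

/-- The space `𝒮^𝔤` of (hermitean) scalar fields: the smallest real subspace that contains
`I_c^ν(ad_{is_k} ⋯ ad_{is_1}(A_ν))`, `k ≥ 0`, and `I_c^ν(ad_{is_k} ⋯ ad_{is_1}(∂_ν s_0))`,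
`k ≥ 1`, whenever it contains `s_0, …, s_k`. -/
inductive InS (L : GaugeAlgebra ι d) : QField c ι J (ι → ℝ) → Prop
  | zero : InS L 0
  | add {s t : QField c ι J (ι → ℝ)} : InS L s → InS L t → InS L (s + t)
  | smul (r : ℝ) {s : QField c ι J (ι → ℝ)} : InS L s → InS L (r • s)
  | potential (l : List (QField c ι J (ι → ℝ))) : (∀ s ∈ l, InS L s) →
      InS L (stringIntField (adList L l gaugeField))
  | gradient (l : List (QField c ι J (ι → ℝ))) (s₀ : QField c ι J (ι → ℝ)) : l ≠ [] →
      (∀ s ∈ l, InS L s) → InS L s₀ → InS L (stringIntField (adList L l (gradField s₀)))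

/-- The space `𝒱^𝔤` of vector fields: the real span of `ad_{is_k} ⋯ ad_{is_1}(A_ν)` and
`ad_{is_k} ⋯ ad_{is_1}(∂_ν s_0)`, `k ≥ 0`, with `s_0, …, s_k ∈ 𝒮^𝔤`. -/
def spaceV (L : GaugeAlgebra ι d) : Submodule ℝ (QField c ι J (Fin 4 → ι → ℝ)) :=
  Submodule.span ℝ
    ({v | ∃ l : List (QField c ι J (ι → ℝ)), (∀ s ∈ l, InS L s) ∧ v = adList L l gaugeField} ∪
     {v | ∃ (l : List (QField c ι J (ι → ℝ))) (s₀ : QField c ι J (ι → ℝ)),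
        (∀ s ∈ l, InS L s) ∧ InS L s₀ ∧ v = adList L l (gradField s₀)})

/-- `γ ∈ g 𝒮^𝔤[[g]]`. -/
def InGS (L : GaugeAlgebra ι d) (γ : FieldSeries c ι J (ι → ℝ)) : Prop :=
  γ 0 = 0 ∧ ∀ n, InS L (γ n)

/-- `α ∈ g 𝒱^𝔤[[g]]`. -/
def InGV (L : GaugeAlgebra ι d) (α : FieldSeries c ι J (Fin 4 → ι → ℝ)) : Prop :=
  α 0 = 0 ∧ ∀ n, α n ∈ spaceV L

end Fields

/-! ### Time-ordered two-point functions and two-point obstructions -/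

/-- `Δ` is a propagator of a scalar field of mass `m`: `(□ + m²)Δ = -iδ`. -/
def IsPropagator (m : ℝ) (Δ : Distr ℂ) : Prop :=
  ∀ φ : Test, (∑ μ, eta μ • dpartial μ (dpartial μ Δ)) φ + (m : ℂ) ^ 2 * Δ φ = -Complex.I * φ 0

/-- `⟨T A_μ(x') A_κ(x)⟩ = -η_{μκ} T₀(x'-x)`, as a distribution in `z = x'-x`. -/
def timeOrderedAA (T₀ : Distr ℂ) (μ κ : Fin 4) : Distr ℂ := -(metric μ κ • T₀)

/-- `⟨T F_{μν}(x') A_κ(x)⟩`, from `F = ∂A`. -/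
def timeOrderedFA (T₀ : Distr ℂ) (μ ν κ : Fin 4) : Distr ℂ :=
  dpartial μ (timeOrderedAA T₀ ν κ) - dpartial ν (timeOrderedAA T₀ μ κ)

/-- `⟨T N(x') A_κ(x)⟩`, from `N = ∂^μ A_μ`. -/
def timeOrderedNA (T₀ : Distr ℂ) (κ : Fin 4) : Distr ℂ :=
  ∑ μ, eta μ • dpartial μ (timeOrderedAA T₀ μ κ)

/-- `⟨T (∂^μ F_{μν})(x') A_κ(x)⟩`, from the equation of motion `∂^μ F_{μν} = -∂_ν N`. -/
def timeOrderedDivFA (T₀ : Distr ℂ) (ν κ : Fin 4) : Distr ℂ :=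
  -dpartial ν (timeOrderedNA T₀ κ)

/-- The two-point obstruction
`O^μ(F_{μν}(x'), A_κ(x)) = ⟨T (∂^μ F_{μν})(x') A_κ(x)⟩ - ∂'^μ ⟨T F_{μν}(x') A_κ(x)⟩`. -/
def obstructionFA (T₀ : Distr ℂ) (ν κ : Fin 4) : Distr ℂ :=
  timeOrderedDivFA T₀ ν κ - ∑ μ, eta μ • dpartial μ (timeOrderedFA T₀ μ ν κ)

/-- The Dirac propagator `⟨T ψ_ρ(x) ψ̄_σ(x')⟩ = ((m + iγ^μ∂_μ)Δ)_{ρσ}(x-x')`. -/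
def diracPropagator (Γ : Fin 4 → Matrix (Fin 4) (Fin 4) ℂ) (m : ℝ) (Δ : Distr ℂ)
    (ρ σ : Fin 4) : Distr ℂ :=
  (if ρ = σ then (m : ℂ) else 0) • Δ + ∑ μ, (Complex.I * Γ μ ρ σ) • dpartial μ Δ

/-- The two-point obstruction of `(ψ̄γ^μ)_σ(x')` with `ψ_ρ(x)`,
`⟨T ψ_ρ(x) (∂_μψ̄γ^μ)_σ(x')⟩ - ∂'_μ ⟨T ψ_ρ(x) (ψ̄γ^μ)_σ(x')⟩`, where `∂_μψ̄γ^μ = imψ̄`,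
as a distribution in `z = x-x'` (so that `∂' = -∂`). -/
def obstructionQuark (Γ : Fin 4 → Matrix (Fin 4) (Fin 4) ℂ) (m : ℝ) (Δ : Distr ℂ)
    (ρ σ : Fin 4) : Distr ℂ :=
  (Complex.I * m) • diracPropagator Γ m Δ ρ σ
    + ∑ μ, ∑ κ, Γ μ κ σ • dpartial μ (diracPropagator Γ m Δ ρ κ)

/-- The two-point obstruction of `(γ^μψ)_ρ(x')` with `ψ̄_σ(x)`,
`⟨T (γ^μ∂_μψ)_ρ(x') ψ̄_σ(x)⟩ - ∂'_μ ⟨T (γ^μψ)_ρ(x') ψ̄_σ(x)⟩`, where `γ^μ∂_μψ = -imψ`,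
as a distribution in `z = x'-x`. -/
def obstructionAntiquark (Γ : Fin 4 → Matrix (Fin 4) (Fin 4) ℂ) (m : ℝ) (Δ : Distr ℂ)
    (ρ σ : Fin 4) : Distr ℂ :=
  -((Complex.I * m) • diracPropagator Γ m Δ ρ σ)
    - ∑ μ, ∑ κ, Γ μ ρ κ • dpartial μ (diracPropagator Γ m Δ κ σ)

/-! ### Obstruction maps -/

section Obstruction

variable {c : StringFunction} {ι d J : Type*} [Fintype ι] [Fintype d] [Fintype J]

open Classical in
/-- The variation `d/dt X[A + t a[Φ], ψ + t p[Φ], ψ̄ + t q[Φ]]` at `t = 0`, that is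
`∫ dy (a(y) δX/δA(y) + p(y) δX/δψ(y) + q(y) δX/δψ̄(y))`. -/
def variation {E : Type*} [NormedAddCommGroup E] [NormedSpace ℝ E]
    (a : QField c ι J (Fin 4 → ι → ℝ)) (p q : QField c ι J (J → Fin 4 → ℂ))
    (X : QField c ι J E) : QField c ι J E := fun Φ x =>
  if h : a Φ ∈ stringFunctions c (Fin 4 → ι → ℝ) ∧ p Φ ∈ smoothFunctions (J → Fin 4 → ℂ) ∧
      q Φ ∈ smoothFunctions (J → Fin 4 → ℂ) then
    deriv (fun t : ℝ => X (Φ + t • (⟨a Φ, h.1⟩, ⟨p Φ, h.2.1⟩, ⟨q Φ, h.2.2⟩)) x) 0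
  else 0

/-- The contraction `i ∫ dx' O_μ(U^μ(x'), A_κ(y))` for `U^μ = ⟨F^{μν}|α_ν⟩`. By the Wick expansion
in the first argument it equals `i ∫ dx' α^ν(x') O^μ(F_{μν}(x'), A_κ(y))`: the fields in `𝒮^𝔤` are
inert, and so are `A_ν` and `∂_ν s` when antisymmetrized as in `F^{μν} O_μ(α_ν, ·)`. The kernel is
real, so taking the real part changes nothing. -/
def contractionA (T₀ : Distr ℂ) (α : QField c ι J (Fin 4 → ι → ℝ)) :
    QField c ι J (Fin 4 → ι → ℝ) := fun Φ y κ a =>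
  (Complex.I * ∑ ν, (eta ν : ℂ) *
    pairing (obstructionFA T₀ ν κ) (fun z => α Φ (y + z) ν a)).re

/-- The obstruction map `ω_U(X)(x) = i ∫ dx' O_μ(U^μ(x'), X(x))` of one coefficient of
`U^μ = ⟨F^{μν}|α_ν⟩`: the Wick expansion in the second argument is the variation of `X` along the
contraction with the potential. -/
def omegaYM₁ {E : Type*} [NormedAddCommGroup E] [NormedSpace ℝ E] (T₀ : Distr ℂ)
    (α : QField c ι J (Fin 4 → ι → ℝ)) (X : QField c ι J E) : QField c ι J E :=
  variation (contractionA T₀ α) 0 0 X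

/-- `ω_U` for power series `U` and `X`. -/
def omegaYM {E : Type*} [NormedAddCommGroup E] [NormedSpace ℝ E] (T₀ : Distr ℂ)
    (α : FieldSeries c ι J (Fin 4 → ι → ℝ)) (X : FieldSeries c ι J E) : FieldSeries c ι J E :=
  fun n => ∑ k ∈ Finset.HasAntidiagonal.antidiagonal n, omegaYM₁ T₀ (α k.1) (X k.2)

/-- The matrix `π(s) = ∑ s_a τ_a` of a Lie-algebra element with components `s_a`. -/
def GaugeRep.map {L : GaugeAlgebra ι d} (π : GaugeRep L J) (s : ι → ℝ) : Matrix J J ℂ :=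
  ∑ a, (s a : ℂ) • π.gen a

/-- The contraction `i ∫ dx' O_μ(Ũ^μ(x'), ψ(x))` for `Ũ^μ = ψ̄γ^μπ(β)ψ` with inert `β`. -/
def contractionQuark {L : GaugeAlgebra ι d} (π : GaugeRep L J)
    (Γ : Fin 4 → Matrix (Fin 4) (Fin 4) ℂ) (m : ℝ) (Δ : Distr ℂ)
    (β : QField c ι J (ι → ℝ)) : QField c ι J (J → Fin 4 → ℂ) := fun Φ x j ρ =>
  Complex.I * ∑ σ, pairingC (obstructionQuark Γ m Δ ρ σ)
    (fun z => ∑ k, π.map (β Φ (x - z)) j k * quarkField Φ (x - z) k σ)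

/-- The contraction `i ∫ dx' O_μ(Ũ^μ(x'), ψ̄(x))` for `Ũ^μ = ψ̄γ^μπ(β)ψ` with inert `β`. -/
def contractionAntiquark {L : GaugeAlgebra ι d} (π : GaugeRep L J)
    (Γ : Fin 4 → Matrix (Fin 4) (Fin 4) ℂ) (m : ℝ) (Δ : Distr ℂ)
    (β : QField c ι J (ι → ℝ)) : QField c ι J (J → Fin 4 → ℂ) := fun Φ x j σ =>
  Complex.I * ∑ ρ, pairingC (obstructionAntiquark Γ m Δ ρ σ)
    (fun z => ∑ k, antiquarkField Φ (x + z) k ρ * π.map (β Φ (x + z)) k j)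

/-- The obstruction map `ω_Ũ` of one coefficient of `Ũ^μ = ψ̄γ^μπ(β)ψ`. -/
def omegaQuark₁ {E : Type*} [NormedAddCommGroup E] [NormedSpace ℝ E]
    {L : GaugeAlgebra ι d} (π : GaugeRep L J)
    (Γ : Fin 4 → Matrix (Fin 4) (Fin 4) ℂ) (m : ℝ) (Δ : Distr ℂ)
    (β : QField c ι J (ι → ℝ)) (X : QField c ι J E) : QField c ι J E :=
  variation 0 (contractionQuark π Γ m Δ β) (contractionAntiquark π Γ m Δ β) X

/-- `ω_Ũ` for power series `Ũ` and `X`. -/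
def omegaQuark {E : Type*} [NormedAddCommGroup E] [NormedSpace ℝ E]
    {L : GaugeAlgebra ι d} (π : GaugeRep L J)
    (Γ : Fin 4 → Matrix (Fin 4) (Fin 4) ℂ) (m : ℝ) (Δ : Distr ℂ)
    (β : FieldSeries c ι J (ι → ℝ)) (X : FieldSeries c ι J E) : FieldSeries c ι J E :=
  fun n => ∑ k ∈ Finset.HasAntidiagonal.antidiagonal n, omegaQuark₁ π Γ m Δ (β k.1) (X k.2)

/-- The current `j^μ_a = ψ̄γ^μτ_aψ`. -/
def current {L : GaugeAlgebra ι d} (π : GaugeRep L J)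
    (Γ : Fin 4 → Matrix (Fin 4) (Fin 4) ℂ) (μ : Fin 4) (a : ι) : QField c ι J ℂ := fun Φ x =>
  ∑ j, ∑ k, ∑ σ, ∑ ρ,
    antiquarkField Φ x j σ * Γ μ σ ρ * π.gen a j k * quarkField Φ x k ρ

/-- The mediator field `Ũ^μ = ⟨β|j^μ⟩`. -/
def quarkMediator {L : GaugeAlgebra ι d} (π : GaugeRep L J)
    (Γ : Fin 4 → Matrix (Fin 4) (Fin 4) ℂ) (β : FieldSeries c ι J (ι → ℝ)) (μ : Fin 4) :
    FieldSeries c ι J ℂ := fun n Φ x =>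
  ∑ a, (β n Φ x a : ℂ) * current π Γ μ a Φ x

/-- The field `X` as a power series without higher orders. -/
def constSeries {E : Type*} [Zero E] (X : QField c ι J E) : FieldSeries c ι J E :=
  fun n => if n = 0 then X else 0

/-- `e^D = ∑ D^j/j!` for an operation `D` on power series that raises the order in `g` by at least
one, so that only `j ≤ n` contributes at order `gⁿ`. -/
def expMap {V : Type*} [AddCommMonoid V] [Module ℝ V] (D : (ℕ → V) → ℕ → V) (X : ℕ → V) : ℕ → V :=
  fun n => ∑ j ∈ Finset.range (n + 1), ((j.factorial : ℝ)⁻¹) • (D^[j] X) n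

/-- The dressed quark field `e^ω(ψ)`, `ω = ω_U + ω_Ũ`. -/
def dressedQuark {L : GaugeAlgebra ι d} (π : GaugeRep L J)
    (Γ : Fin 4 → Matrix (Fin 4) (Fin 4) ℂ) (m : ℝ) (T₀ Δ : Distr ℂ)
    (α : FieldSeries c ι J (Fin 4 → ι → ℝ)) (β : FieldSeries c ι J (ι → ℝ)) :
    FieldSeries c ι J (J → Fin 4 → ℂ) :=
  expMap (fun X => omegaYM T₀ α X + omegaQuark π Γ m Δ β X) (constSeries quarkField)

end Obstruction

/-! ### Matrix-valued power series and the dressing factor -/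

section MatrixSeries

variable {R : Type*} [CommRing R] [Algebra ℂ R] {ι d J : Type*} [Fintype ι]
  [Fintype d] [DecidableEq d] [Fintype J] [DecidableEq J]

/-- The matrix `∑ v_a τ_a` with entries in `R[[g]]`. -/
def lieMatrix (τ : ι → Matrix J J ℂ) (v : ι → PowerSeries R) : Matrix J J (PowerSeries R) :=
  ∑ a, v a • (τ a).map (algebraMap ℂ (PowerSeries R))

/-- `e^Y = ∑ Y^k/k!` for a matrix `Y` of power series without constant term, so that only `k ≤ n`
contributes at order `gⁿ`. -/
def matrixExp (Y : Matrix J J (PowerSeries R)) : Matrix J J (PowerSeries R) :=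
  Matrix.of fun i j => PowerSeries.mk fun n =>
    ∑ k ∈ Finset.range (n + 1), ((k.factorial : ℂ)⁻¹) • PowerSeries.coeff n ((Y ^ k) i j)

/-- Coefficientwise action of an operation of `R` on matrices of power series. -/
def mapCoeff (D : R → R) (Y : Matrix J J (PowerSeries R)) : Matrix J J (PowerSeries R) :=
  Y.map fun p => PowerSeries.mk fun n => D (PowerSeries.coeff n p)

variable {c : StringFunction}

/-- The components of a Lie-algebra-valued power series of fields, with complex coefficients. -/
def toComponents (γ : FieldSeries c ι J (ι → ℝ)) : ι → PowerSeries (QField c ι J ℂ) :=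
  fun a => PowerSeries.mk fun n Φ x => (γ n Φ x a : ℂ)

/-- `e^{iρ(γ)}`, where `ρ(γ) = ∑ γ_a ρ_a`. For `ρ_a = ξ_a` this is `W = e^{iγ}`, for `ρ_a = τ_a` it
is `π(W)`. -/
def dressingFactor (ρ : ι → Matrix d d ℂ) (γ : FieldSeries c ι J (ι → ℝ)) :
    Matrix d d (PowerSeries (QField c ι J ℂ)) :=
  matrixExp (Complex.I • lieMatrix ρ (toComponents γ))

/-- The derivative `∂_μ` of a field. -/
def fieldDeriv (μ : Fin 4) (X : QField c ι J ℂ) : QField c ι J ℂ := fun Φ => pderiv μ (X Φ)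

/-- The dressing transformation of the Yang-Mills part,
`g e^{ω_U}(A_μ(c)) = W (g A_μ + i∂_μ) W⁻¹` with `W = e^{iγ}`, `U^μ = ⟨F^{μν}|α_ν⟩`. -/
def IsYangMillsDressing (L : GaugeAlgebra ι d) (T₀ : Distr ℂ)
    (γ : FieldSeries c ι J (ι → ℝ)) (α : FieldSeries c ι J (Fin 4 → ι → ℝ)) : Prop :=
  ∀ μ : Fin 4,
    (PowerSeries.X : PowerSeries (QField c ι J ℂ)) • lieMatrix L.gen (toComponents
        (expMap (omegaYM T₀ α) (constSeries (stringPotential μ)))) =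
      dressingFactor L.gen γ * ((PowerSeries.X : PowerSeries (QField c ι J ℂ)) •
          lieMatrix L.gen (toComponents (constSeries fun Φ x => gaugeField Φ x μ))) *
          dressingFactor L.gen (-γ)
        + Complex.I • (dressingFactor L.gen γ *
            mapCoeff (fieldDeriv μ) (dressingFactor L.gen (-γ)))

/-- `π(W)ψ` as a power series of fields. -/
def rotatedQuark {L : GaugeAlgebra ι d} (π : GaugeRep L J) (γ : FieldSeries c ι J (ι → ℝ)) :
    FieldSeries c ι J (J → Fin 4 → ℂ) := fun n Φ x j σ =>
  ∑ k, PowerSeries.coeff n (dressingFactor π.gen γ j k) Φ x * quarkField Φ x k σ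

/-! ### The enveloping algebra and the Baker-Campbell-Hausdorff identity -/

/-- The polynomial enveloping algebra of `𝒮^𝔤[[g]]`, generated by the matrices `∑ s_a ξ_a`. -/
def envelope (L : GaugeAlgebra ι d) :
    Subalgebra ℂ (Matrix d d (PowerSeries (QField c ι J ℂ))) :=
  Algebra.adjoin ℂ {Y | ∃ s : FieldSeries c ι J (ι → ℝ), (∀ n, InS L (s n)) ∧
    Y = lieMatrix L.gen (toComponents s)}

/-- `ω_U` on matrices of power series. -/
def omegaMatrix (T₀ : Distr ℂ) (α : FieldSeries c ι J (Fin 4 → ι → ℝ))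
    (Y : Matrix d d (PowerSeries (QField c ι J ℂ))) : Matrix d d (PowerSeries (QField c ι J ℂ)) :=
  Y.map fun p => PowerSeries.mk (omegaYM T₀ α fun n => PowerSeries.coeff n p)

/-- `e^D` for an order-raising operation `D` on matrices of power series. -/
def expMatrixMap (D : Matrix d d (PowerSeries R) → Matrix d d (PowerSeries R))
    (Y : Matrix d d (PowerSeries R)) : Matrix d d (PowerSeries R) :=
  Matrix.of fun i j => PowerSeries.mk fun n =>
    ∑ k ∈ Finset.range (n + 1), ((k.factorial : ℂ)⁻¹) • PowerSeries.coeff n ((D^[k] Y) i j)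

/-- `e^{ω_U + R_{iβ}} = e^{R_{iγ}} ∘ e^{ω_U}` on the enveloping algebra, where `R_{is}` is the right
multiplication by `is`, so that `e^{R_{iγ}}` is the right multiplication by `e^{iγ}`. -/
def IsBCH (L : GaugeAlgebra ι d) (T₀ : Distr ℂ) (α : FieldSeries c ι J (Fin 4 → ι → ℝ))
    (γ β : FieldSeries c ι J (ι → ℝ)) : Prop :=
  ∀ Y ∈ envelope (c := c) (J := J) L,
    expMatrixMap (fun Z => omegaMatrix T₀ α Z
        + Z * (Complex.I • lieMatrix L.gen (toComponents β))) Y =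
      expMatrixMap (omegaMatrix T₀ α) Y * dressingFactor L.gen γ

/-- The bracket `i[s,t]` of power series of Lie-algebra-valued fields. -/
def seriesBracket (L : GaugeAlgebra ι d) (s t : FieldSeries c ι J (ι → ℝ)) :
    FieldSeries c ι J (ι → ℝ) :=
  fun n Φ x => ∑ k ∈ Finset.HasAntidiagonal.antidiagonal n, L.bracket (s k.1 Φ x) (t k.2 Φ x)

/-- `γ - ½ω_U(γ) + (1/12)(i[γ,ω_U(γ)] + ω_U²(γ))`. -/
def bchLowOrder (L : GaugeAlgebra ι d) (T₀ : Distr ℂ) (α : FieldSeries c ι J (Fin 4 → ι → ℝ))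
    (γ : FieldSeries c ι J (ι → ℝ)) : FieldSeries c ι J (ι → ℝ) :=
  γ - (1 / 2 : ℝ) • omegaYM T₀ α γ
    + (1 / 12 : ℝ) • (seriesBracket L γ (omegaYM T₀ α γ) + omegaYM T₀ α (omegaYM T₀ α γ))

/-! ### Gauge transformations -/

/-- The components of a power series of functions on spacetime, with complex coefficients. -/
def functionComponents (v : ℕ → Spacetime → ι → ℝ) : ι → PowerSeries (Spacetime → ℂ) :=
  fun a => PowerSeries.mk fun n x => (v n x a : ℂ)

/-- `e^{iρ(θ)}` for a power series `θ` of Lie-algebra-valued functions. -/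
def gaugeFunction (ρ : ι → Matrix d d ℂ) (θ : ℕ → Spacetime → ι → ℝ) :
    Matrix d d (PowerSeries (Spacetime → ℂ)) :=
  matrixExp (Complex.I • lieMatrix ρ (functionComponents θ))

/-- `Φ'` is the gauge transform of the configuration `Φ = (A,ψ,ψ̄)` by the group-valued function
`Θ = e^{iθ}`: `gA' = Θ⁻¹(gA + i∂)Θ`, `ψ' = π(Θ⁻¹)ψ`, `ψ̄' = ψ̄π(Θ)`, as power series in `g`. -/
def IsGaugeTransform {L : GaugeAlgebra ι d} (π : GaugeRep L J) (θ : ℕ → Spacetime → ι → ℝ)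
    (Φ : Config c ι J) (Φ' : ℕ → Config c ι J) : Prop :=
  (∀ μ : Fin 4,
    (PowerSeries.X : PowerSeries (Spacetime → ℂ)) •
        lieMatrix L.gen (functionComponents fun n x => gaugeField (Φ' n) x μ) =
      gaugeFunction L.gen (-θ) * ((PowerSeries.X : PowerSeries (Spacetime → ℂ)) •
          lieMatrix L.gen (functionComponents fun n x => if n = 0 then gaugeField Φ x μ else 0)) *
          gaugeFunction L.gen θ
        + Complex.I • (gaugeFunction L.gen (-θ) *
            mapCoeff (pderiv μ) (gaugeFunction L.gen θ))) ∧
  (∀ n x j σ, quarkField (Φ' n) x j σ =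
    ∑ k, PowerSeries.coeff n (gaugeFunction π.gen (-θ) j k) x * quarkField Φ x k σ) ∧
  (∀ n x j σ, antiquarkField (Φ' n) x j σ =
    ∑ k, antiquarkField Φ x k σ * PowerSeries.coeff n (gaugeFunction π.gen θ k j) x)

/-- The value `X[Φ']` of a power series `X` of (polynomial) fields at a formal power series
`Φ' = ∑ gᵐ Φ'_m` of configurations. The coefficient of `gˡ` in `X_k[∑ gᵐ Φ'_m]` involves only
`Φ'_0, …, Φ'_l` and is read off by differentiation. -/
def evalSeries {E : Type*} [NormedAddCommGroup E] [NormedSpace ℝ E]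
    (X : FieldSeries c ι J E) (Φ' : ℕ → Config c ι J) : ℕ → Spacetime → E := fun n x =>
  ∑ k ∈ Finset.HasAntidiagonal.antidiagonal n, ((k.2.factorial : ℝ)⁻¹) •
    iteratedDeriv k.2 (fun t : ℝ => X k.1 (∑ m ∈ Finset.range (k.2 + 1), t ^ m • Φ' m) x) 0

/-- `X` is invariant under the gauge transformations `Θ = e^{iθ}`, `θ` a power series without
constant term of Lie-algebra-valued functions that are trivial at infinity along the strings: the
transform of a configuration exists and is unique, and `X` has the same value on it. -/
def IsGaugeInvariant {E : Type*} [NormedAddCommGroup E] [NormedSpace ℝ E]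
    {L : GaugeAlgebra ι d} (π : GaugeRep L J) (X : FieldSeries c ι J E) : Prop :=
  ∀ θ : ℕ → Spacetime → ι → ℝ, θ 0 = 0 → (∀ n, θ n ∈ stringFunctions c (ι → ℝ)) →
    ∀ Φ : Config c ι J, (∃! Φ' : ℕ → Config c ι J, IsGaugeTransform π θ Φ Φ') ∧
      ∀ Φ' : ℕ → Config c ι J, IsGaugeTransform π θ Φ Φ' →
        ∀ n x, evalSeries X Φ' n x = X n Φ x

end MatrixSeries

end

end StringQFT

open StringQFT

/-! The propagators solve their field equations up to a delta, so every two-point obstruction is a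
multiple of `δ` (`obstructionFA_eq`, `obstructionQuark_eq`, `obstructionAntiquark_eq`). Hence `ω_U`
is the derivative of a functional in the direction `α` of the potential (`omegaYM₁_eq`), and `ω_Ũ`
is the derivative in the direction `ψ ↦ iπ(β)ψ`, `ψ̄ ↦ -iψ̄π(β)`. On fields `Yψ`, with `Y` a matrix
of functionals of `A` alone, their sum acts on `Y` as a derivation plus right multiplication by
`iπ(β)`. The dressed quark is therefore `e^{ω_U + R_{iπ(β)}}(1) ψ` (`dressedQuark_eq`), and the
first part of the theorem becomes algebra.

Existence of `β` is a Baker-Campbell-Hausdorff theorem relative to an ideal. The space `𝒮^𝔤` is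
stable under `ω_U` (`InS.omegaYM₁`) and under the bracket (`InS.bracket`); both rest on `I_c^ν(∂_ν
s) = -s`. So right multiplications by elements of `i𝒮^𝔤` form an ideal in the Lie algebra that they
generate together with the derivations preserving `i𝒮^𝔤`, and `e^{R_{iγ}} e^{ω_U}` has a logarithm
of the form `ω_U + R_{iβ}` (`exists_pexp_add_eq_mul`, `exists_act_pexp_eq`). Applied to `1` this
gives `e^{iγ}`, because a derivation annihilates `1`. The argument runs in the product of the two
matrix algebras (`exists_bch`), so that one `β` serves the defining representation and `π` alike.
The absolute theorem `exists_pexp_eq_mul` follows from the Euler derivation `g d/dg`: the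
logarithmic derivative of `e^P e^Q` consists of iterated commutators, and it determines the exponent
order by order.

Uniqueness and the low orders come from the value on `1` alone: at each order it equals the
coefficient of `iβ` plus terms fixed by lower orders (`eq_of_act_pexp_one_eq`,
`coeff_eq_of_act_pexp_one`). In `π` this determines only `π(β)`, which is exactly what the mediator
field sees; in the defining representation it determines `β`.

Gauge invariance concerns `π(W)ψ`. The hypothesis on `U` says that `W` intertwines the covariant
derivatives of `A` and of the dressed potential `B = e^{ω_U}(A(c))`, and `B` has vanishing string
integral, as `A(c)` does. If `A'` is the gauge transform of `A`, then `V = W[A] Θ W[A']⁻¹` satisfies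
`∂V = g (B V - V B')`. Inductively `∂V_{m+1}` is a combination of fields with vanishing string
integral, and since string integration inverts the gradient up to sign, `V_{m+1} = 0`
(`eq_one_of_intertwines`). Thus `W[A'] = W[A] Θ`; the equation passes to `π` by
Baker-Campbell-Hausdorff (`pexp_eq_mul_rep`), and `Θ` cancels against the transformation of `ψ`.

The analytic input is that string integration maps smooth functions with the support condition to
themselves (`contDiff_stringPair`, `stringPair_mem`), and that all fields in question are polynomial
along polynomial paths of configurations (`HasExp`). The latter supplies the Leibniz rule for
variations and the evaluation at power series of configurations. -/

namespace StringQFT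

noncomputable section

/-! ### Formal exponentials in noncommutative power series rings -/

section FormalExp

open PowerSeries

section Order

variable {B : Type*} [Ring B]

/-- The power series `p` is divisible by `X ^ n`. -/
def OrdGE (n : ℕ) (p : PowerSeries B) : Prop := ∀ m < n, coeff m p = 0

theorem OrdGE.mono {m n : ℕ} {p : PowerSeries B} (h : OrdGE n p) (hmn : m ≤ n) : OrdGE m p :=
  fun k hk => h k (hk.trans_le hmn)

theorem OrdGE.zero_right (n : ℕ) : OrdGE n (0 : PowerSeries B) := fun m _ => by simp

theorem ordGE_zero (p : PowerSeries B) : OrdGE 0 p := fun m hm => absurd hm (by omega)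

theorem OrdGE.add {n : ℕ} {p q : PowerSeries B} (hp : OrdGE n p) (hq : OrdGE n q) :
    OrdGE n (p + q) := fun m hm => by simp [hp m hm, hq m hm]

theorem OrdGE.neg {n : ℕ} {p : PowerSeries B} (hp : OrdGE n p) : OrdGE n (-p) :=
  fun m hm => by simp [hp m hm]

theorem OrdGE.sub {n : ℕ} {p q : PowerSeries B} (hp : OrdGE n p) (hq : OrdGE n q) :
    OrdGE n (p - q) := fun m hm => by simp [hp m hm, hq m hm]

theorem OrdGE.mul {m n : ℕ} {p q : PowerSeries B} (hp : OrdGE m p) (hq : OrdGE n q) :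
    OrdGE (m + n) (p * q) := by
  intro k hk
  rw [coeff_mul]
  refine Finset.sum_eq_zero fun ij hij => ?_
  have := Finset.HasAntidiagonal.mem_antidiagonal.mp hij
  rcases lt_or_ge ij.1 m with h | h
  · simp [hp _ h]
  · simp [hq ij.2 (by omega)]

theorem OrdGE.mul_left {n : ℕ} (p : PowerSeries B) {q : PowerSeries B} (hq : OrdGE n q) :
    OrdGE n (p * q) := by simpa using (ordGE_zero p).mul hq

theorem OrdGE.mul_right {n : ℕ} {p : PowerSeries B} (hp : OrdGE n p) (q : PowerSeries B) :
    OrdGE n (p * q) := by simpa using hp.mul (ordGE_zero q)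

theorem OrdGE.pow {p : PowerSeries B} (hp : OrdGE 1 p) (k : ℕ) : OrdGE k (p ^ k) := by
  induction k with
  | zero => exact ordGE_zero _
  | succ k ih => rw [pow_succ]; exact ih.mul hp

theorem ordGE_one_iff {p : PowerSeries B} : OrdGE 1 p ↔ coeff 0 p = 0 :=
  ⟨fun h => h 0 one_pos, fun h m hm => by obtain rfl : m = 0 := by omega
                                          exact h⟩

theorem OrdGE.coeff_mul_eq {n : ℕ} {p q : PowerSeries B} (hp : OrdGE n p) :
    coeff n (p * q) = coeff n p * coeff 0 q := by
  rw [coeff_mul, Finset.sum_eq_single (n, 0)]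
  · rintro ⟨i, j⟩ hij hne
    have := Finset.HasAntidiagonal.mem_antidiagonal.mp hij
    have : i < n := by
      rcases Nat.eq_zero_or_pos j with rfl | h
      · exact absurd (by simp_all) hne
      · simp_all; omega
    simp [hp i this]
  · simp

/-- The sum of a family of power series whose `k`-th member is divisible by `X ^ k`. -/
def fsum (p : ℕ → PowerSeries B) : PowerSeries B :=
  PowerSeries.mk fun n => ∑ k ∈ Finset.range (n + 1), coeff n (p k)

theorem coeff_fsum (p : ℕ → PowerSeries B) (n : ℕ) :
    coeff n (fsum p) = ∑ k ∈ Finset.range (n + 1), coeff n (p k) := by simp [fsum]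

/-- Members beyond index `n` do not reach order `n`, so any longer truncation gives the same
coefficient. This allows one cutoff for several orders at once. -/
theorem coeff_fsum_of_lt {p : ℕ → PowerSeries B} (hp : ∀ k, OrdGE k (p k)) {n N : ℕ}
    (h : n < N) : coeff n (fsum p) = ∑ k ∈ Finset.range N, coeff n (p k) := by
  rw [coeff_fsum]
  refine Finset.sum_subset (fun k => by simp; omega) fun k _ hk => ?_
  exact hp k n (by simpa using hk)

theorem OrdGE.fsum {p : ℕ → PowerSeries B} {n : ℕ} (hp : ∀ k, OrdGE n (p k)) :
    OrdGE n (fsum p) := fun m hm => by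
  rw [coeff_fsum]; exact Finset.sum_eq_zero fun k _ => hp k m hm

theorem fsum_eq_add_succ {p : ℕ → PowerSeries B} (hp : ∀ k, OrdGE k (p k)) :
    fsum p = p 0 + fsum (fun k => p (k + 1)) := by
  ext n
  have h : ∀ k, OrdGE k (p (k + 1)) := fun k => (hp (k + 1)).mono (by omega)
  rw [coeff_fsum_of_lt hp (Nat.lt_succ_of_lt (Nat.lt_succ_self n)), Finset.sum_range_succ', map_add,
    coeff_fsum, add_comm]

/-- At order `n` both factors may be truncated to `n + 1` members. In the resulting square of index
pairs those with `i + j > n` contribute nothing, and the remaining triangle is summed along its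
diagonals. -/
theorem fsum_mul {p q : ℕ → PowerSeries B} (hp : ∀ k, OrdGE k (p k)) (hq : ∀ k, OrdGE k (q k)) :
    fsum p * fsum q =
      fsum fun k => ∑ ij ∈ Finset.HasAntidiagonal.antidiagonal k, p ij.1 * q ij.2 := by
  ext n
  have h1 : coeff n (fsum p * fsum q) =
      ∑ i ∈ Finset.range (n + 1), ∑ j ∈ Finset.range (n + 1), coeff n (p i * q j) := by
    rw [coeff_mul]
    have : ∀ ab ∈ Finset.HasAntidiagonal.antidiagonal n, coeff ab.1 (fsum p) * coeff ab.2 (fsum q) =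
        ∑ i ∈ Finset.range (n + 1), ∑ j ∈ Finset.range (n + 1),
          coeff ab.1 (p i) * coeff ab.2 (q j) := by
      intro ab hab
      have := Finset.HasAntidiagonal.mem_antidiagonal.mp hab
      rw [coeff_fsum_of_lt hp (show ab.1 < n + 1 by omega),
        coeff_fsum_of_lt hq (show ab.2 < n + 1 by omega), Finset.sum_mul_sum]
    rw [Finset.sum_congr rfl this, Finset.sum_comm]
    refine Finset.sum_congr rfl fun i _ => ?_
    rw [Finset.sum_comm]
    exact Finset.sum_congr rfl fun j _ => (coeff_mul _ _ _).symm
  rw [h1, coeff_fsum]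
  have h2 : ∀ k, coeff n (∑ ij ∈ Finset.HasAntidiagonal.antidiagonal k, p ij.1 * q ij.2) =
      ∑ i ∈ Finset.range (k + 1), coeff n (p i * q (k - i)) := fun k => by
    rw [map_sum, Finset.Nat.sum_antidiagonal_eq_sum_range_succ (fun i j => coeff n (p i * q j))]
  simp_rw [h2]
  rw [Finset.sum_range_diag_flip (n + 1) (fun i j => coeff n (p i * q j))]
  refine Finset.sum_congr rfl fun i hi => ?_
  symm
  refine Finset.sum_subset (fun k => by simp; omega) fun j _ hj => ?_
  exact ((hp i).mul (hq j)) n (by simp at hj hi; omega)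

/-- The iterated commutators `[P, [P, … [P, y]]]`. -/
def adIter (P y : PowerSeries B) : ℕ → PowerSeries B
  | 0 => y
  | j + 1 => P * adIter P y j - adIter P y j * P

theorem ordGE_adIter {P y : PowerSeries B} (hP : OrdGE 1 P) (hy : OrdGE 1 y) (j : ℕ) :
    OrdGE (j + 1) (adIter P y j) := by
  induction j with
  | zero => exact hy
  | succ j ih =>
    exact ((hP.mul ih).mono (by omega)).sub ((ih.mul hP).mono (by omega))

/-- The derivative of a power, expanded in iterated commutators. -/
theorem deriv_pow_eq {P y : PowerSeries B} {z : ℕ → PowerSeries B} (h0 : z 0 = 0)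
    (hs : ∀ k, z (k + 1) = y * P ^ k + P * z k) (k : ℕ) :
    z (k + 1) =
      ∑ j ∈ Finset.range (k + 1), ((k + 1).choose (j + 1)) • (adIter P y j * P ^ (k - j)) := by
  induction k with
  | zero => simp [hs, h0, adIter]
  | succ k ih =>
    -- Here `z k` plays the derivative of `P ^ k` and `y` that of `P`; only the product rule on
    -- powers is assumed. Moving `P` to the right past an iterated commutator creates the next one,
    -- and Pascal's rule collects the two contributions.
    have key : ∀ j, P * adIter P y j = adIter P y (j + 1) + adIter P y j * P := fun j => by
      simp [adIter]
    rw [hs, ih, Finset.mul_sum]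
    have e1 : ∀ j ∈ Finset.range (k + 1),
        P * ((k + 1).choose (j + 1) • (adIter P y j * P ^ (k - j))) =
        (k + 1).choose (j + 1) • (adIter P y (j + 1) * P ^ (k - j)) +
        (k + 1).choose (j + 1) • (adIter P y j * P ^ (k + 1 - j)) := by
      intro j hj
      have hj' : k + 1 - j = (k - j) + 1 := by simp at hj; omega
      rw [mul_smul_comm, ← mul_assoc, key, add_mul, smul_add, mul_assoc, ← pow_succ', hj']
    rw [Finset.sum_congr rfl e1, Finset.sum_add_distrib]
    have e2 : ∑ j ∈ Finset.range (k + 1), (k + 1).choose (j + 1) • (adIter P y j * P ^ (k + 1 - j)) =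
        ∑ j ∈ Finset.range (k + 2), (k + 1).choose (j + 1) • (adIter P y j * P ^ (k + 1 - j)) := by
      rw [Finset.sum_range_succ _ (k + 1)]; simp
    have e3 : y * P ^ (k + 1) + ∑ j ∈ Finset.range (k + 1),
        (k + 1).choose (j + 1) • (adIter P y (j + 1) * P ^ (k - j)) =
        ∑ j ∈ Finset.range (k + 2), (k + 1).choose j • (adIter P y j * P ^ (k + 1 - j)) := by
      rw [Finset.sum_range_succ' _ (k + 1), add_comm]
      simp [adIter]
    rw [e2, ← add_assoc, e3, ← Finset.sum_add_distrib]
    refine Finset.sum_congr rfl fun j _ => ?_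
    rw [← add_smul, Nat.choose_succ_succ (k + 1) j]

end Order

/-! ### Exponential and logarithm of series without constant term. -/

section Exp

variable {B : Type*} [Ring B] [Algebra ℝ B]

theorem OrdGE.smul {n : ℕ} (r : ℝ) {p : PowerSeries B} (hp : OrdGE n p) : OrdGE n (r • p) :=
  fun m hm => by simp [hp m hm]

/-- The exponential `∑ P ^ k / k!` of a power series without constant term. -/
def pexp (P : PowerSeries B) : PowerSeries B := fsum fun k => ((k.factorial : ℝ)⁻¹) • P ^ k

theorem ordGE_pexp_term {P : PowerSeries B} (hP : OrdGE 1 P) (k : ℕ) :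
    OrdGE k (((k.factorial : ℝ)⁻¹) • P ^ k) := (hP.pow k).smul _

theorem coeff_pexp (P : PowerSeries B) (n : ℕ) :
    coeff n (pexp P) = ∑ k ∈ Finset.range (n + 1), ((k.factorial : ℝ)⁻¹) • coeff n (P ^ k) := by
  simp [pexp, coeff_fsum]

theorem coeff_zero_pexp (P : PowerSeries B) : coeff 0 (pexp P) = 1 := by
  simp [pexp, coeff_fsum]

theorem pexp_zero : pexp (0 : PowerSeries B) = 1 := by
  ext n
  rw [pexp, coeff_fsum, Finset.sum_range_succ']
  simp

theorem pexp_add {P Q : PowerSeries B} (hP : OrdGE 1 P) (hQ : OrdGE 1 Q) (h : Commute P Q) :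
    pexp (P + Q) = pexp P * pexp Q := by
  rw [pexp, pexp, pexp, fsum_mul (ordGE_pexp_term hP) (ordGE_pexp_term hQ)]
  congr 1
  funext k
  rw [h.add_pow', Finset.smul_sum]
  refine Finset.sum_congr rfl fun ij hij => ?_
  obtain rfl := Finset.HasAntidiagonal.mem_antidiagonal.mp hij
  rw [smul_mul_smul_comm, ← Nat.cast_smul_eq_nsmul ℝ, smul_smul]
  congr 1
  have h1 : ((ij.1.factorial : ℝ)) ≠ 0 := by positivity
  have h2 : ((ij.2.factorial : ℝ)) ≠ 0 := by positivity
  have h3 : (((ij.1 + ij.2).factorial : ℝ)) ≠ 0 := by positivity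
  have := Nat.add_choose_mul_factorial_mul_factorial ij.1 ij.2
  rw [← Nat.choose_symm_add] at this
  have h4 : ((ij.1 + ij.2).choose ij.1 : ℝ) * ij.1.factorial * ij.2.factorial =
      (ij.1 + ij.2).factorial := by exact_mod_cast this
  field_simp
  linarith

theorem pexp_mul_pexp_neg {P : PowerSeries B} (hP : OrdGE 1 P) : pexp P * pexp (-P) = 1 := by
  rw [← pexp_add hP hP.neg (Commute.neg_right (Commute.refl P)), add_neg_cancel, pexp_zero]

theorem pexp_neg_mul_pexp {P : PowerSeries B} (hP : OrdGE 1 P) : pexp (-P) * pexp P = 1 := by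
  simpa using pexp_mul_pexp_neg hP.neg

/-- `∑ ad_P ^ j (y) / (j + 1)!`. -/
def logDeriv (P y : PowerSeries B) : PowerSeries B :=
  fsum fun j => (((j + 1).factorial : ℝ)⁻¹) • adIter P y j

theorem ordGE_logDeriv {P y : PowerSeries B} (hP : OrdGE 1 P) (hy : OrdGE 1 y) :
    OrdGE 1 (logDeriv P y) :=
  OrdGE.fsum fun j => ((ordGE_adIter hP hy j).mono (by omega)).smul _

/-- The logarithmic derivative of a formal exponential. -/
theorem deriv_pexp_eq {P y Z : PowerSeries B} {z : ℕ → PowerSeries B} (hP : OrdGE 1 P)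
    (hy : OrdGE 1 y) (h0 : z 0 = 0) (hs : ∀ k, z (k + 1) = y * P ^ k + P * z k)
    (hZ : Z = fsum fun k => ((k.factorial : ℝ)⁻¹) • z k) :
    Z = logDeriv P y * pexp P := by
  have hz : ∀ k, OrdGE k (z k) := by
    intro k
    induction k with
    | zero => exact ordGE_zero _
    | succ k ih =>
      rw [hs]
      exact ((hy.mul (hP.pow k)).mono (by omega)).add ((hP.mul ih).mono (by omega))
  -- Since `z 0 = 0` the index can be shifted by one; `z (k + 1) / (k + 1)!` is then a Cauchy
  -- product, because the binomial coefficient over `(k + 1)!` splits as `1 / (j + 1)!` times `1 /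
  -- (k - j)!`.
  rw [hZ, fsum_eq_add_succ fun k => (hz k).smul _, h0, smul_zero, zero_add, logDeriv, pexp,
    fsum_mul (fun j => ((ordGE_adIter hP hy j).mono (by omega)).smul _) (ordGE_pexp_term hP)]
  congr 1
  funext k
  rw [deriv_pow_eq h0 hs, Finset.smul_sum, Finset.Nat.sum_antidiagonal_eq_sum_range_succ
    (fun i j => (((i + 1).factorial : ℝ)⁻¹ • adIter P y i) * (((j.factorial : ℝ)⁻¹) • P ^ j))]
  refine Finset.sum_congr rfl fun j hj => ?_
  have hj' : j ≤ k := by simp at hj; omega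
  rw [smul_mul_smul_comm, ← Nat.cast_smul_eq_nsmul ℝ, smul_smul]
  congr 1
  have h1 : (((j + 1).factorial : ℝ)) ≠ 0 := by positivity
  have h2 : (((k - j).factorial : ℝ)) ≠ 0 := by positivity
  have h3 : (((k + 1).factorial : ℝ)) ≠ 0 := by positivity
  have := Nat.choose_mul_factorial_mul_factorial (show j + 1 ≤ k + 1 by omega)
  rw [Nat.add_sub_add_right] at this
  have h4 : ((k + 1).choose (j + 1) : ℝ) * (j + 1).factorial * (k - j).factorial =
      (k + 1).factorial := by exact_mod_cast this
  field_simp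
  linarith

/-- Each further factor without constant term gains one order, so the quadratic and higher terms at
order `n` see only coefficients below `n`. This triangularity is what makes the exponential
invertible order by order, and every uniqueness argument below uses it. -/
theorem pexp_sub_pexp_ordGE {P Q : PowerSeries B} (hP : OrdGE 1 P) (hQ : OrdGE 1 Q) {n : ℕ}
    (h : OrdGE n (P - Q)) : OrdGE (n + 1) ((pexp P - P) - (pexp Q - Q)) := by
  have key : ∀ k, OrdGE (n + k) (P ^ (k + 1) - Q ^ (k + 1)) := by
    intro k
    induction k with
    | zero => simpa using h
    | succ k ih =>
      have : P ^ (k + 2) - Q ^ (k + 2) =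
          (P ^ (k + 1) - Q ^ (k + 1)) * P + Q ^ (k + 1) * (P - Q) := by
        rw [pow_succ P (k + 1), pow_succ Q (k + 1)]; noncomm_ring
      rw [this]
      exact ((ih.mul hP).mono (by omega)).add (((hQ.pow (k + 1)).mul h).mono (by omega))
  intro m hm
  simp only [pexp, map_sub]
  rw [coeff_fsum_of_lt (ordGE_pexp_term hP) (show m < m + 2 by omega),
    coeff_fsum_of_lt (ordGE_pexp_term hQ) (show m < m + 2 by omega)]
  rw [Finset.sum_range_succ', Finset.sum_range_succ', Finset.sum_range_succ' _ (m + 1),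
    Finset.sum_range_succ' _ m]
  have : ∀ k, coeff m (((k + 1 + 1).factorial : ℝ)⁻¹ • P ^ (k + 1 + 1)) =
      coeff m (((k + 1 + 1).factorial : ℝ)⁻¹ • Q ^ (k + 1 + 1)) := by
    intro k
    have := key (k + 1) m (by omega)
    rw [map_sub, sub_eq_zero] at this
    simp [this]
  rw [Finset.sum_congr rfl fun k _ => this k]
  simp only [zero_add, Nat.factorial_one, Nat.cast_one, inv_one, pow_one, one_smul,
    Nat.factorial_zero, pow_zero]
  abel

theorem pexp_injective {P Q : PowerSeries B} (hP : OrdGE 1 P) (hQ : OrdGE 1 Q)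
    (h : pexp P = pexp Q) : P = Q := by
  have key : ∀ n, OrdGE n (P - Q) := by
    intro n
    induction n with
    | zero => exact ordGE_zero _
    | succ n ih =>
      have := (pexp_sub_pexp_ordGE hP hQ ih).neg
      rw [h] at this
      have e : -(pexp Q - P - (pexp Q - Q)) = P - Q := by abel
      rwa [e] at this
  ext n
  have := key (n + 1) n (by omega)
  rwa [map_sub, sub_eq_zero] at this

/-- The coefficients of the formal logarithm of `Z`. -/
def logCoeff (Z : PowerSeries B) (n : ℕ) : B :=
  if n = 0 then 0 else
    coeff n Z - coeff n (pexp (PowerSeries.mk fun k => if _h : k < n then logCoeff Z k else 0))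

/-- The coefficient `logCoeff Z n` is the defect at order `n` of the exponential of the part below
`n`; adding it repairs order `n` and leaves the lower orders alone. -/
theorem exists_pexp_eq (Z : PowerSeries B) (hZ : coeff 0 Z = 1) :
    ∃ P : PowerSeries B, OrdGE 1 P ∧ pexp P = Z := by
  have h0 : logCoeff Z 0 = 0 := by rw [logCoeff]; simp
  refine ⟨PowerSeries.mk (logCoeff Z), ordGE_one_iff.mpr (by simp [h0]), ?_⟩
  ext n
  rcases Nat.eq_zero_or_pos n with rfl | hn
  · rw [coeff_zero_pexp, hZ]
  · set Q : PowerSeries B := PowerSeries.mk fun k => if _h : k < n then logCoeff Z k else 0 with hQ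
    have hQ1 : OrdGE 1 Q := ordGE_one_iff.mpr (by simp [hQ, h0])
    have hd : OrdGE n (PowerSeries.mk (logCoeff Z) - Q) := fun m hm => by simp [hQ, hm]
    have := pexp_sub_pexp_ordGE (ordGE_one_iff.mpr (by simp [h0])) hQ1 hd n (by omega)
    have e : logCoeff Z n = coeff n Z - coeff n (pexp Q) := by
      rw [logCoeff, if_neg (by omega)]
    simp only [map_sub, coeff_mk] at this
    rw [e] at this
    have hQn : coeff n Q = 0 := by simp [hQ]
    rw [hQn] at this
    have h' : coeff n (pexp (PowerSeries.mk (logCoeff Z))) - coeff n Z = 0 := by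
      rw [← this]; abel
    exact sub_eq_zero.mp h'

end Exp

/-! ### Lie subspaces and the Baker-Campbell-Hausdorff theorem. -/

section LieSubspace

variable {B : Type*} [Ring B] [Algebra ℝ B]

/-- A real subspace is closed under commutators. -/
def IsLieClosed (S : Submodule ℝ B) : Prop := ∀ x ∈ S, ∀ y ∈ S, x * y - y * x ∈ S

/-- All coefficients of the power series lie in `S`. -/
def CoeffsIn (S : Submodule ℝ B) (p : PowerSeries B) : Prop := ∀ n, coeff n p ∈ S

variable {S : Submodule ℝ B}

theorem CoeffsIn.add {p q : PowerSeries B} (hp : CoeffsIn S p) (hq : CoeffsIn S q) :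
    CoeffsIn S (p + q) := fun n => by simpa using S.add_mem (hp n) (hq n)

theorem CoeffsIn.sub {p q : PowerSeries B} (hp : CoeffsIn S p) (hq : CoeffsIn S q) :
    CoeffsIn S (p - q) := fun n => by simpa using S.sub_mem (hp n) (hq n)

/-- Swapping the antidiagonal in the second product pairs the terms into commutators of
coefficients. Only these lie in `S`; the single products need not. -/
theorem CoeffsIn.commutator (hS : IsLieClosed S) {p q : PowerSeries B} (hp : CoeffsIn S p)
    (hq : CoeffsIn S q) : CoeffsIn S (p * q - q * p) := by
  intro n
  have e : coeff n (p * q - q * p) = ∑ ij ∈ Finset.HasAntidiagonal.antidiagonal n,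
      (coeff ij.1 p * coeff ij.2 q - coeff ij.2 q * coeff ij.1 p) := by
    rw [map_sub, coeff_mul, coeff_mul, Finset.sum_sub_distrib,
      ← Finset.Nat.sum_antidiagonal_swap (n := n) (f := fun ij => coeff ij.1 q * coeff ij.2 p)]
    rfl
  rw [e]
  exact S.sum_mem fun ij _ => hS _ (hp _) _ (hq _)

theorem CoeffsIn.logDeriv (hS : IsLieClosed S) {P y : PowerSeries B} (hP : CoeffsIn S P)
    (hy : CoeffsIn S y) : CoeffsIn S (logDeriv P y) := by
  have h : ∀ j, CoeffsIn S (adIter P y j) := by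
    intro j
    induction j with
    | zero => exact hy
    | succ j ih => exact hP.commutator hS ih
  intro n
  rw [StringQFT.logDeriv, coeff_fsum]
  exact S.sum_mem fun j _ => by simpa using S.smul_mem _ (h j n)

/-- A derivation applied to a formal exponential. -/
theorem map_pexp_eq (δ : PowerSeries B →ₗ[ℝ] PowerSeries B)
    (hδ : ∀ p q, δ (p * q) = δ p * q + p * δ q) (hord : ∀ n p, OrdGE n p → OrdGE n (δ p))
    {P : PowerSeries B} (hP : OrdGE 1 P) : δ (pexp P) = logDeriv P (δ P) * pexp P := by
  have h1 : δ 1 = 0 := by have := hδ 1 1; simpa using this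
  refine deriv_pexp_eq (z := fun k => δ (P ^ k)) hP (hord 1 P hP) (by simp [h1])
    (fun k => by simp only [pow_succ', hδ]) ?_
  ext n
  rw [coeff_fsum]
  -- A linear map need not respect infinite sums. Preservation of order permits replacing the
  -- exponential by a finite sum at each fixed order.
  have hd : OrdGE (n + 1) (pexp P - ∑ k ∈ Finset.range (n + 1), ((k.factorial : ℝ)⁻¹) • P ^ k) := by
    intro m hm
    rw [map_sub, map_sum, pexp, coeff_fsum_of_lt (ordGE_pexp_term hP) hm, sub_self]
  have := hord _ _ hd n (by omega)
  rw [map_sub, map_sub, sub_eq_zero] at this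
  rw [this, map_sum, map_sum]
  simp

/-- The commutator with `y` is a derivation, so `e^P y - y e^P` is the logarithmic derivative built
from `[P, y]`, times `e^P`. Multiplying by `e^{-P}` leaves `y` plus iterated commutators. -/
theorem conj_pexp (hS : IsLieClosed S) {P y : PowerSeries B} (hP1 : OrdGE 1 P)
    (hP : CoeffsIn S P) (hy : CoeffsIn S y) : CoeffsIn S (pexp P * y * pexp (-P)) := by
  let δ : PowerSeries B →ₗ[ℝ] PowerSeries B := LinearMap.mulRight ℝ y - LinearMap.mulLeft ℝ y
  have h := map_pexp_eq δ (fun p q => by simp [δ]; noncomm_ring)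
    (fun n p hp => by simpa [δ] using (hp.mul_right y).sub (hp.mul_left y)) hP1
  have e : pexp P * y * pexp (-P) = logDeriv P (P * y - y * P) + y := by
    simp only [δ, LinearMap.sub_apply, LinearMap.mulRight_apply, LinearMap.mulLeft_apply] at h
    rw [sub_eq_iff_eq_add.mp h, add_mul, mul_assoc, mul_assoc, pexp_mul_pexp_neg hP1]
    simp
  rw [e]
  exact (CoeffsIn.logDeriv hS hP (hP.commutator hS hy)).add hy

/-- The Euler derivation `X d/dX`. -/
def euler : PowerSeries B →ₗ[ℝ] PowerSeries B where
  toFun p := PowerSeries.mk fun n => (n : ℝ) • coeff n p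
  map_add' p q := by ext n; simp
  map_smul' r p := by
    ext n
    simp only [coeff_mk, PowerSeries.coeff_smul, RingHom.id_apply]
    exact smul_comm _ _ _

theorem coeff_euler (p : PowerSeries B) (n : ℕ) : coeff n (euler p) = (n : ℝ) • coeff n p := by
  simp [euler]

theorem euler_mul (p q : PowerSeries B) : euler (p * q) = euler p * q + p * euler q := by
  ext n
  rw [map_add, coeff_euler, coeff_mul, coeff_mul, coeff_mul, ← Finset.sum_add_distrib,
    Finset.smul_sum]
  refine Finset.sum_congr rfl fun ij hij => ?_
  rw [coeff_euler, coeff_euler, ← Finset.HasAntidiagonal.mem_antidiagonal.mp hij]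
  push_cast
  rw [add_smul, smul_mul_assoc, mul_smul_comm]

theorem ordGE_euler (n : ℕ) (p : PowerSeries B) (h : OrdGE n p) : OrdGE n (euler p) :=
  fun m hm => by rw [coeff_euler, h m hm, smul_zero]

/-- If the logarithmic Euler derivative of `e^P` lies in a Lie subspace, then so does `P`. -/
theorem coeffsIn_of_euler (hS : IsLieClosed S) {P q : PowerSeries B} (hP : OrdGE 1 P)
    (hq : CoeffsIn S q) (h : euler (pexp P) = q * pexp P) : CoeffsIn S P := by
  intro n
  induction n using Nat.strong_induction_on with
  | _ n ih =>
  rcases Nat.eq_zero_or_pos n with rfl | hn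
  · rw [ordGE_one_iff.mp hP]; exact S.zero_mem
  -- The comparison series is `P` cut off below order `n`; by induction its coefficients, and hence
  -- those of its logarithmic Euler derivative, lie in `S`.
  set Q : PowerSeries B := PowerSeries.mk fun k => if k < n then coeff k P else 0 with hQ
  have hQS : CoeffsIn S Q := by
    intro k
    by_cases hk : k < n
    · simpa [hQ, hk] using ih k hk
    · simp [hQ, hk]
  have hQ1 : OrdGE 1 Q := ordGE_one_iff.mpr (by simp [hQ, ordGE_one_iff.mp hP])
  have hd : OrdGE n (P - Q) := fun m hm => by simp [hQ, hm]
  have hT := pexp_sub_pexp_ordGE hP hQ1 hd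
  have hT0 : OrdGE n (pexp P - pexp Q) := by
    have := (hT.mono (show n ≤ n + 1 by omega)).add hd
    have e : pexp P - P - (pexp Q - Q) + (P - Q) = pexp P - pexp Q := by abel
    rwa [e] at this
  have hTn : coeff n (pexp P - pexp Q) = coeff n P := by
    have := hT n (by omega)
    have hQn : coeff n Q = 0 := by simp [hQ]
    simp only [map_sub, hQn] at this ⊢
    rw [← sub_eq_zero, ← this]; abel
  have hqQ := map_pexp_eq euler euler_mul ordGE_euler hQ1
  set qQ := logDeriv Q (euler Q)
  have hEQ : CoeffsIn S (euler Q) := fun k => by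
    rw [coeff_euler]; exact S.smul_mem _ (hQS k)
  have hqQS : CoeffsIn S qQ := CoeffsIn.logDeriv hS hQS hEQ
  have hqQ1 : OrdGE 1 qQ := ordGE_logDeriv hQ1 (ordGE_euler 1 Q hQ1)
  have e1 : (q - qQ) * pexp P = euler (pexp P - pexp Q) - qQ * (pexp P - pexp Q) := by
    rw [map_sub, h, hqQ]; noncomm_ring
  have e2 : q - qQ = (euler (pexp P - pexp Q) - qQ * (pexp P - pexp Q)) * pexp (-P) := by
    rw [← e1, mul_assoc, pexp_mul_pexp_neg hP, mul_one]
  -- At order `n` the two exponentials differ by the coefficient of `P` only, and `X d/dX`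
  -- multiplies it by `n`. The other term drops out because `qQ` has no constant term. Dividing by
  -- `n > 0` recovers the coefficient.
  have e3 : coeff n (q - qQ) = (n : ℝ) • coeff n P := by
    rw [e2, OrdGE.coeff_mul_eq, coeff_zero_pexp, mul_one, map_sub, coeff_euler, hTn,
      (hqQ1.mul hT0) n (by omega), sub_zero]
    exact (ordGE_euler n _ hT0).sub (hT0.mul_left qQ)
  have e4 : coeff n P = (n : ℝ)⁻¹ • coeff n (q - qQ) := by
    rw [e3, smul_smul, inv_mul_cancel₀ (by positivity), one_smul]
  rw [e4]
  exact S.smul_mem _ (hq.sub hqQS n)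

/-- The Baker-Campbell-Hausdorff theorem for formal power series. -/
theorem exists_pexp_eq_mul (hS : IsLieClosed S) {P Q : PowerSeries B} (hP1 : OrdGE 1 P)
    (hQ1 : OrdGE 1 Q) (hP : CoeffsIn S P) (hQ : CoeffsIn S Q) :
    ∃ Z, OrdGE 1 Z ∧ CoeffsIn S Z ∧ pexp Z = pexp P * pexp Q := by
  obtain ⟨Z, hZ1, hZ⟩ := exists_pexp_eq (pexp P * pexp Q)
    (by simp [coeff_mul, coeff_zero_pexp])
  refine ⟨Z, hZ1, ?_, hZ⟩
  have hE : ∀ {Y : PowerSeries B}, CoeffsIn S Y → CoeffsIn S (euler Y) := fun hY k => by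
    rw [coeff_euler]; exact S.smul_mem _ (hY k)
  have hqP := map_pexp_eq euler euler_mul ordGE_euler hP1
  have hqQ := map_pexp_eq euler euler_mul ordGE_euler hQ1
  -- By the product rule the logarithmic derivative of `e^P e^Q` is that of `e^P` plus that of `e^Q`
  -- conjugated by `e^P`; both summands are made of iterated commutators.
  refine coeffsIn_of_euler hS hZ1 (q := logDeriv P (euler P) +
    pexp P * logDeriv Q (euler Q) * pexp (-P))
    ((CoeffsIn.logDeriv hS hP (hE hP)).add (conj_pexp hS hP1 hP (CoeffsIn.logDeriv hS hQ (hE hQ)))) ?_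
  rw [hZ, euler_mul, hqP, hqQ, add_mul]
  congr 1
  · rw [mul_assoc]
  · have : pexp P * logDeriv Q (euler Q) * pexp (-P) * (pexp P * pexp Q) =
      pexp P * logDeriv Q (euler Q) * (pexp (-P) * pexp P) * pexp Q := by noncomm_ring
    rw [this, pexp_neg_mul_pexp hP1]; noncomm_ring

end LieSubspace

/-! ### Functoriality and exponents relative to an ideal. -/

section Functorial

variable {B C : Type*} [Ring B] [Algebra ℝ B] [Ring C] [Algebra ℝ C]

theorem OrdGE.map {n : ℕ} {p : PowerSeries B} (hp : OrdGE n p) (φ : B →+* C) :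
    OrdGE n (PowerSeries.map φ p) := fun m hm => by rw [PowerSeries.coeff_map, hp m hm, map_zero]

theorem map_pexp (φ : B →ₐ[ℝ] C) (P : PowerSeries B) :
    PowerSeries.map (φ : B →+* C) (pexp P) = pexp (PowerSeries.map (φ : B →+* C) P) := by
  ext n
  rw [PowerSeries.coeff_map, pexp, pexp, coeff_fsum, coeff_fsum, map_sum]
  refine Finset.sum_congr rfl fun k _ => ?_
  rw [← map_pow, PowerSeries.coeff_smul, PowerSeries.coeff_smul, PowerSeries.coeff_map]
  exact map_smul φ _ _

/-- A pair of power series as a power series of pairs. -/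
def pairSeries (p : PowerSeries B) (q : PowerSeries C) : PowerSeries (B × C) :=
  PowerSeries.mk fun n => (coeff n p, coeff n q)

theorem map_fst_pairSeries (p : PowerSeries B) (q : PowerSeries C) :
    PowerSeries.map (AlgHom.fst ℝ B C : B × C →+* B) (pairSeries p q) = p := by
  ext n; simp [pairSeries]

theorem map_snd_pairSeries (p : PowerSeries B) (q : PowerSeries C) :
    PowerSeries.map (AlgHom.snd ℝ B C : B × C →+* C) (pairSeries p q) = q := by
  ext n; simp [pairSeries]

theorem OrdGE.pairSeries {n : ℕ} {p : PowerSeries B} {q : PowerSeries C} (hp : OrdGE n p)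
    (hq : OrdGE n q) : OrdGE n (pairSeries p q) := fun m hm => by
  simp [StringQFT.pairSeries, hp m hm, hq m hm]

/-- The Baker-Campbell-Hausdorff theorem relative to an ideal. -/
theorem exists_pexp_add_eq_mul {S I : Submodule ℝ B} (hS : IsLieClosed S) (hIS : I ≤ S)
    (hI : ∀ x ∈ S, ∀ y ∈ I, x * y - y * x ∈ I) {D P : PowerSeries B} (hD1 : OrdGE 1 D)
    (hP1 : OrdGE 1 P) (hD : CoeffsIn S D) (hP : CoeffsIn I P) :
    ∃ Z, OrdGE 1 Z ∧ CoeffsIn I Z ∧ pexp (D + Z) = pexp P * pexp D := by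
  -- Pairs in `S` that agree modulo `I` form a Lie subspace of the product algebra. The theorem for
  -- `(P, 0)` and `(D, D)` yields an exponent whose second component is `D` by injectivity of the
  -- exponential; the first then differs from `D` by a series with coefficients in `I`.
  let T : Submodule ℝ (B × B) :=
    { carrier := {x | x.1 ∈ S ∧ x.2 ∈ S ∧ x.1 - x.2 ∈ I}
      zero_mem' := by simp
      add_mem' := by
        rintro x y ⟨h1, h2, h3⟩ ⟨k1, k2, k3⟩
        refine ⟨S.add_mem h1 k1, S.add_mem h2 k2, ?_⟩
        have : (x + y).1 - (x + y).2 = (x.1 - x.2) + (y.1 - y.2) := by simp; abel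
        rw [this]; exact I.add_mem h3 k3
      smul_mem' := by
        rintro r x ⟨h1, h2, h3⟩
        refine ⟨S.smul_mem r h1, S.smul_mem r h2, ?_⟩
        have : (r • x).1 - (r • x).2 = r • (x.1 - x.2) := by simp [smul_sub]
        rw [this]; exact I.smul_mem r h3 }
  have hT : IsLieClosed T := by
    rintro x ⟨h1, h2, h3⟩ y ⟨k1, k2, k3⟩
    refine ⟨hS _ h1 _ k1, hS _ h2 _ k2, ?_⟩
    have : (x * y - y * x).1 - (x * y - y * x).2 =
        (x.1 * (y.1 - y.2) - (y.1 - y.2) * x.1) - (y.2 * (x.1 - x.2) - (x.1 - x.2) * y.2) := by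
      simp; noncomm_ring
    rw [this]
    exact I.sub_mem (hI _ h1 _ k3) (hI _ k2 _ h3)
  obtain ⟨Z, hZ1, hZT, hZ⟩ := exists_pexp_eq_mul hT (hP1.pairSeries (OrdGE.zero_right 1))
    (hD1.pairSeries hD1) (P := pairSeries P (0 : PowerSeries B)) (Q := pairSeries D D)
    (fun n => ⟨by simpa [pairSeries] using hIS (hP n), by simp [pairSeries],
      by simpa [pairSeries] using hP n⟩)
    (fun n => ⟨by simpa [pairSeries] using hD n, by simpa [pairSeries] using hD n,
      by simp [pairSeries]⟩)
  have e1 := congrArg (PowerSeries.map (AlgHom.fst ℝ B B : B × B →+* B)) hZ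
  have e2 := congrArg (PowerSeries.map (AlgHom.snd ℝ B B : B × B →+* B)) hZ
  rw [map_mul, map_pexp, map_pexp, map_pexp, map_fst_pairSeries, map_fst_pairSeries] at e1
  rw [map_mul, map_pexp, map_pexp, map_pexp, map_snd_pairSeries, map_snd_pairSeries, pexp_zero,
    one_mul] at e2
  have e3 := pexp_injective (hZ1.map _) hD1 e2
  refine ⟨PowerSeries.map (AlgHom.fst ℝ B B : B × B →+* B) Z - D, (hZ1.map _).sub hD1, ?_, ?_⟩
  · intro n
    have e4 : coeff n D = (coeff n Z).2 := by rw [← e3]; simp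
    simpa [e4] using (hZT n).2.2
  · rw [add_sub_cancel, e1]

end Functorial

/-! ### Matrices of power series as power series of matrices. -/

section MatrixSeries

variable {R d : Type*} [CommRing R] [Fintype d] [DecidableEq d]

/-- A matrix of power series as a power series of matrices. -/
def toSeries (Y : Matrix d d (PowerSeries R)) : PowerSeries (Matrix d d R) :=
  PowerSeries.mk fun n => Y.map (coeff n)

theorem coeff_toSeries (Y : Matrix d d (PowerSeries R)) (n : ℕ) :
    coeff n (toSeries Y) = Y.map (coeff n) := by simp [toSeries]

theorem toSeries_injective : Function.Injective (toSeries : Matrix d d (PowerSeries R) → _) := by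
  intro Y Z h
  ext i j n
  have h2 : Y.map (coeff n) = Z.map (coeff n) := by rw [← coeff_toSeries, h, coeff_toSeries]
  exact congrFun (congrFun h2 i) j

theorem toSeries_add (Y Z : Matrix d d (PowerSeries R)) :
    toSeries (Y + Z) = toSeries Y + toSeries Z := by
  ext n i j; simp [coeff_toSeries]

theorem toSeries_neg (Y : Matrix d d (PowerSeries R)) : toSeries (-Y) = -toSeries Y := by
  ext n i j; simp [coeff_toSeries]

theorem toSeries_mul (Y Z : Matrix d d (PowerSeries R)) :
    toSeries (Y * Z) = toSeries Y * toSeries Z := by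
  ext n i j
  rw [coeff_toSeries, coeff_mul, Matrix.map_apply, Matrix.mul_apply, map_sum, Matrix.sum_apply]
  simp_rw [coeff_mul, coeff_toSeries, Matrix.mul_apply, Matrix.map_apply]
  rw [Finset.sum_comm]

theorem toSeries_one : toSeries (1 : Matrix d d (PowerSeries R)) = 1 := by
  ext n i j
  rw [coeff_toSeries, coeff_one, Matrix.map_apply, Matrix.one_apply]
  by_cases h : i = j <;> by_cases hn : n = 0 <;> simp [h, hn, coeff_one, Matrix.one_apply]

theorem toSeries_pow (Y : Matrix d d (PowerSeries R)) (k : ℕ) :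
    toSeries (Y ^ k) = toSeries Y ^ k := by
  induction k with
  | zero => simp [toSeries_one]
  | succ k ih => rw [pow_succ, pow_succ, toSeries_mul, ih]

variable [Algebra ℂ R] [Algebra ℝ R]

/-- The compatibility hypothesis reconciles the complex factorials in `matrixExp` with the real ones
in `pexp`. -/
theorem toSeries_matrixExp (h : ∀ r : ℝ, algebraMap ℝ R r = algebraMap ℂ R r)
    (Y : Matrix d d (PowerSeries R)) :
    toSeries (matrixExp Y) = pexp (toSeries Y) := by
  ext n i j
  rw [coeff_toSeries, coeff_pexp, Matrix.sum_apply]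
  simp only [Matrix.map_apply, matrixExp, Matrix.of_apply, coeff_mk]
  refine Finset.sum_congr rfl fun k _ => ?_
  rw [← toSeries_pow, coeff_toSeries, Matrix.smul_apply, Matrix.map_apply, Algebra.smul_def,
    Algebra.smul_def, h]
  simp

end MatrixSeries

end FormalExp

/-! ### Test functions and pairings -/

section Pairings

open Set Filter Topology

variable {F : Type*} [NormedAddCommGroup F] [NormedSpace ℝ F]

/-- The test function `χ f` for a smooth function `f`. -/
def cutoff (χ : Test) (f : Spacetime → ℝ) (hf : ContDiff ℝ ∞ f) : Test where
  toFun x := χ x * f x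
  contDiff' := χ.contDiff.mul hf
  hasCompactSupport' := χ.hasCompactSupport.mul_right
  tsupport_subset' := by simp

@[simp]
theorem cutoff_apply (χ : Test) (f : Spacetime → ℝ) (hf : ContDiff ℝ ∞ f) (x : Spacetime) :
    cutoff χ f hf x = χ x * f x := rfl

theorem sum_test_apply {κ : Type*} (s : Finset κ) (φ : κ → Test) (x : Spacetime) :
    (∑ i ∈ s, φ i) x = ∑ i ∈ s, φ i x := by
  classical
  induction s using Finset.induction_on with
  | empty => simp
  | insert i s hi ih => rw [Finset.sum_insert hi, Finset.sum_insert hi, IsAddApply.add_apply, ih]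

theorem exists_test_eq_one {K : Set Spacetime} (hK : IsCompact K) :
    ∃ χ : Test, ∀ᶠ x in nhdsSet K, χ x = 1 := by
  obtain ⟨R, hR⟩ := hK.isBounded.subset_ball 0
  obtain ⟨f, h1, h0, -⟩ := exists_contMDiffMap_one_nhds_of_subset_interior
    (n := ⊤) (modelWithCornersSelf ℝ Spacetime) hK.isClosed
    (t := Metric.closedBall (0 : Spacetime) R)
    (hR.trans (Metric.isOpen_ball.subset_interior_iff.mpr Metric.ball_subset_closedBall))
  refine ⟨⟨f, f.contMDiff.contDiff, ?_, by simp⟩, h1⟩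
  exact HasCompactSupport.intro (isCompact_closedBall (0 : Spacetime) R) h0

/-- A distribution vanishes on test functions supported away from its support. -/
theorem apply_eq_zero_of_disjoint (T : Distr F) (φ : Test)
    (h : Disjoint (tsupport φ) (Distribution.dsupport T)) : T φ = 0 := by
  have hx : ∀ x : tsupport φ, ∃ s : Set Spacetime,
      Distribution.IsVanishingOn T s ∧ IsOpen s ∧ (x : Spacetime) ∈ s := fun x =>
    (Distribution.notMem_dsupport_iff _).mp (Set.disjoint_left.mp h x.2)
  choose U hU hUo hUx using hx
  -- A partition of unity subordinate to open sets on which `T` vanishes. Only finitely many members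
  -- meet the compact support of `φ`, so `φ` is a finite sum of test functions killed by `T`.
  obtain ⟨ρ, hρ⟩ := SmoothPartitionOfUnity.exists_isSubordinate
    (modelWithCornersSelf ℝ Spacetime) (isClosed_tsupport φ) U hUo
    (fun x hx => mem_iUnion.mpr ⟨⟨x, hx⟩, hUx ⟨x, hx⟩⟩)
  have hfin : {i | (Function.support (ρ i) ∩ tsupport φ).Nonempty}.Finite :=
    ρ.locallyFinite.finite_nonempty_inter_compact φ.hasCompactSupport
  have hs : ∀ i, ContDiff ℝ ∞ (ρ i) := fun i => (ρ i).contMDiff.contDiff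
  have key : φ = ∑ i ∈ hfin.toFinset, cutoff φ (ρ i) (hs i) := by
    ext x
    rw [sum_test_apply]
    simp only [cutoff_apply]
    rw [← Finset.mul_sum]
    by_cases hx : x ∈ tsupport φ
    · rw [ρ.sum_finsupport' x hx, mul_one]
      intro i hi
      rw [ρ.mem_finsupport] at hi
      exact hfin.mem_toFinset.mpr ⟨x, hi, hx⟩
    · rw [image_eq_zero_of_notMem_tsupport hx, zero_mul]
  rw [key, map_sum]
  refine Finset.sum_eq_zero fun i _ => hU i _ ?_
  exact (closure_mono (Function.support_mul_subset_right _ _)).trans (hρ i)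

/-- A cutoff equal to `1` near both compact sets computes both values, so the choice made in
`pairing` is immaterial. -/
theorem HasPairing.unique {T : Distr F} {f : Spacetime → ℝ} {v w : F} (h : HasPairing T f v)
    (h' : HasPairing T f w) : v = w := by
  obtain ⟨hf, K, hK, hv⟩ := h
  obtain ⟨-, L, hL, hw⟩ := h'
  obtain ⟨χ, hχ⟩ := exists_test_eq_one (hK.union hL)
  rw [nhdsSet_union, eventually_sup] at hχ
  rw [← hv χ (cutoff χ f hf) hχ.1 (fun x => rfl), hw χ (cutoff χ f hf) hχ.2 (fun x => rfl)]

theorem HasPairing.pairing_eq {T : Distr F} {f : Spacetime → ℝ} {v : F} (h : HasPairing T f v) :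
    pairing T f = v := by
  have hex : ∃ v, HasPairing T f v := ⟨v, h⟩
  rw [pairing, dif_pos hex]
  exact hex.choose_spec.unique h

theorem HasPairing.add {T : Distr F} {f g : Spacetime → ℝ} {v w : F} (h : HasPairing T f v)
    (h' : HasPairing T g w) : HasPairing T (f + g) (v + w) := by
  obtain ⟨hf, K, hK, hv⟩ := h
  obtain ⟨hg, L, hL, hw⟩ := h'
  refine ⟨hf.add hg, K ∪ L, hK.union hL, fun χ φ hχ hφ => ?_⟩
  rw [nhdsSet_union, eventually_sup] at hχ
  rw [← hv χ (cutoff χ f hf) hχ.1 (fun x => rfl), ← hw χ (cutoff χ g hg) hχ.2 (fun x => rfl),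
    ← map_add]
  congr 1
  ext x
  simp [hφ, mul_add]

theorem HasPairing.smul {T : Distr F} {f : Spacetime → ℝ} {v : F} (r : ℝ) (h : HasPairing T f v) :
    HasPairing T (r • f) (r • v) := by
  obtain ⟨hf, K, hK, hv⟩ := h
  refine ⟨contDiff_const.smul hf, K, hK, fun χ φ hχ hφ => ?_⟩
  rw [← hv χ (cutoff χ f hf) hχ (fun x => rfl), ← map_smul]
  congr 1
  ext x
  simp [hφ]; ring

/-- The pairing with a multiple of the Dirac distribution. -/
theorem hasPairing_of_delta {T : Distr F} {v : F} (hT : ∀ φ : Test, T φ = φ 0 • v)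
    {f : Spacetime → ℝ} (hf : ContDiff ℝ ∞ f) : HasPairing T f (f 0 • v) := by
  refine ⟨hf, {0}, isCompact_singleton, fun χ φ hχ hφ => ?_⟩
  rw [nhdsSet_singleton] at hχ
  rw [hT, hφ, hχ.self_of_nhds, one_mul]

end Pairings

/-! ### Smooth dependence of a distribution on a translation parameter -/

section Translation

open Set Filter Topology

/-- The first order Taylor remainder of `f` at `z`. -/
def taylorRem {E : Type*} [NormedAddCommGroup E] [NormedSpace ℝ E] (f : Spacetime → E)
    (h z : Spacetime) : E := f (z + h) - f z - fderiv ℝ f z h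

theorem contDiff_taylorRem {E : Type*} [NormedAddCommGroup E] [NormedSpace ℝ E]
    {f : Spacetime → E} (hf : ContDiff ℝ ∞ f) (h : Spacetime) : ContDiff ℝ ∞ (taylorRem f h) := by
  have h1 : ContDiff ℝ ∞ fun z => f (z + h) := hf.comp (contDiff_id.add contDiff_const)
  have h2 : ContDiff ℝ ∞ (fderiv ℝ f) := hf.fderiv_right (by simp)
  exact (h1.sub hf).sub (h2.clm_apply contDiff_const)

/-- Symmetry of the second derivative is the point. It reduces bounds on all derivatives of the
remainder to the bound on the remainder of a derivative. -/
theorem fderiv_taylorRem {E : Type*} [NormedAddCommGroup E] [NormedSpace ℝ E]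
    {f : Spacetime → E} (hf : ContDiff ℝ ∞ f) (h : Spacetime) :
    fderiv ℝ (taylorRem f h) = taylorRem (fderiv ℝ f) h := by
  have hd : Differentiable ℝ f := hf.differentiable (by simp)
  have hd2 : Differentiable ℝ (fderiv ℝ f) :=
    (hf.fderiv_right (m := ∞) (by simp)).differentiable (by simp)
  funext z
  have e1 : HasFDerivAt (fun z => f (z + h)) (fderiv ℝ f (z + h)) z := by
    have := (hd (z + h)).hasFDerivAt.comp z ((hasFDerivAt_id z).add_const h)
    simpa using! this
  have e3 : HasFDerivAt (fun z => fderiv ℝ f z h) ((fderiv ℝ (fderiv ℝ f) z).flip h) z := by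
    have := (hd2 z).hasFDerivAt.clm_apply (hasFDerivAt_const h z)
    simpa using! this
  have := ((e1.sub (hd z).hasFDerivAt).sub e3).fderiv
  have e4 : fderiv ℝ (taylorRem f h) z =
    fderiv ℝ f (z + h) - fderiv ℝ f z - (fderiv ℝ (fderiv ℝ f) z).flip h := this
  rw [e4, taylorRem]
  congr 1
  ext k
  have hs : IsSymmSndFDerivAt ℝ f z := (hf.contDiffAt (x := z)).isSymmSndFDerivAt
    (by rw [minSmoothness_of_isRCLikeNormedField]; exact WithTop.coe_le_coe.mpr (le_top (a := (2 : ℕ∞))))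
  simpa using hs k h

/-- The mean value inequality is used twice on the ball of radius `‖h‖` about `z`, first for the
derivative and then for `f`. The second derivative is bounded on the closed unit thickening of `K`,
which contains these balls. -/
theorem norm_taylorRem_le {E : Type*} [NormedAddCommGroup E] [NormedSpace ℝ E]
    {f : Spacetime → E} (hf : ContDiff ℝ ∞ f) {K : Set Spacetime} (hK : IsCompact K) :
    ∃ C : ℝ, 0 ≤ C ∧ ∀ z ∈ K, ∀ h : Spacetime, ‖h‖ ≤ 1 → ‖taylorRem f h z‖ ≤ C * ‖h‖ ^ 2 := by
  have hd : Differentiable ℝ f := hf.differentiable (by simp)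
  have hf2 : ContDiff ℝ ∞ (fderiv ℝ f) := hf.fderiv_right (by simp)
  have hd2 : Differentiable ℝ (fderiv ℝ f) := hf2.differentiable (by simp)
  have hc : Continuous (fderiv ℝ (fderiv ℝ f)) :=
    (hf2.fderiv_right (m := ∞) (by simp)).continuous
  obtain ⟨C, hC⟩ := (hK.cthickening (r := 1)).exists_bound_of_continuousOn
    (f := fderiv ℝ (fderiv ℝ f)) hc.continuousOn
  refine ⟨max C 0, le_max_right _ _, fun z hz h hh => ?_⟩
  have hsub : Metric.closedBall z ‖h‖ ⊆ Metric.cthickening 1 K := fun y hy =>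
    Metric.mem_cthickening_of_dist_le y z 1 K hz ((Metric.mem_closedBall.mp hy).trans hh)
  have b1 : ∀ y ∈ Metric.closedBall z ‖h‖,
      ‖fderiv ℝ f y - fderiv ℝ f z‖ ≤ max C 0 * ‖h‖ := by
    intro y hy
    have := (convex_closedBall z ‖h‖).norm_image_sub_le_of_norm_fderiv_le (𝕜 := ℝ)
      (f := fderiv ℝ f) (fun x _ => hd2 x)
      (fun x hx => (hC x (hsub hx)).trans (le_max_left C 0))
      (Metric.mem_closedBall_self (norm_nonneg h)) hy
    refine this.trans ?_
    gcongr
    simpa [dist_eq_norm] using hy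
  have := (convex_closedBall z ‖h‖).norm_image_sub_le_of_norm_fderiv_le' (𝕜 := ℝ)
    (f := f) (fun x _ => hd x) b1 (Metric.mem_closedBall_self (norm_nonneg h))
    (y := z + h) (by simp)
  simp only [add_sub_cancel_left] at this
  rw [taylorRem]
  calc _ ≤ _ := this
    _ = _ := by ring

theorem norm_iteratedFDeriv_taylorRem_le (i : ℕ) {E : Type*} [NormedAddCommGroup E]
    [NormedSpace ℝ E] {f : Spacetime → E} (hf : ContDiff ℝ ∞ f) {K : Set Spacetime}
    (hK : IsCompact K) : ∃ C : ℝ, 0 ≤ C ∧ ∀ z ∈ K, ∀ h : Spacetime, ‖h‖ ≤ 1 →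
      ‖iteratedFDeriv ℝ i (taylorRem f h) z‖ ≤ C * ‖h‖ ^ 2 := by
  induction i generalizing E with
  | zero =>
    simp only [norm_iteratedFDeriv_zero]
    exact norm_taylorRem_le hf hK
  | succ i ih =>
    obtain ⟨C, hC0, hC⟩ := ih (hf.fderiv_right (m := ∞) (by simp))
    refine ⟨C, hC0, fun z hz h hh => ?_⟩
    rw [← norm_iteratedFDeriv_fderiv, fderiv_taylorRem hf]
    exact hC z hz h hh

/-- Continuity of a distribution in terms of bounds on derivatives. -/
theorem exists_bound_distr (T : Distr ℝ) {K : Set Spacetime} (hK : IsCompact K) :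
    ∃ (s : Finset ℕ) (C : ℝ), 0 ≤ C ∧ ∀ (φ : Test) (ε : ℝ), 0 ≤ ε → Function.support φ ⊆ K →
      (∀ i ∈ s, ∀ x ∈ K, ‖iteratedFDeriv ℝ i φ x‖ ≤ ε) → ‖T φ‖ ≤ C * ε := by
  let K' : TopologicalSpace.Compacts Spacetime := ⟨K, hK⟩
  let A : 𝓓^{⊤}_{K'}(Spacetime, ℝ) →L[ℝ] ℝ :=
    (T : 𝓓((⊤ : TopologicalSpace.Opens Spacetime), ℝ) →L[ℝ] ℝ).comp
      (TestFunction.ofSupportedInCLM ℝ (K := K') (by simp))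
  obtain ⟨s, C, -, hC⟩ := Seminorm.bound_of_continuous
    (ContDiffMapSupportedIn.withSeminorms ℝ Spacetime ℝ ⊤ K')
    ((normSeminorm ℝ ℝ).comp (A : 𝓓^{⊤}_{K'}(Spacetime, ℝ) →ₗ[ℝ] ℝ)) (by
      exact continuous_norm.comp A.continuous)
  refine ⟨s, C, C.2, fun φ ε hε hφ hb => ?_⟩
  let ψ : 𝓓^{⊤}_{K'}(Spacetime, ℝ) := ContDiffMapSupportedIn.of_support_subset φ.contDiff hφ
  have h1 := hC ψ
  have h2 : A ψ = T φ := rfl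
  have h3 : (s.sup (ContDiffMapSupportedIn.seminorm ℝ Spacetime ℝ ⊤ K')) ψ ≤ ε := by
    refine Seminorm.finset_sup_apply_le hε fun i hi => ?_
    rw [ContDiffMapSupportedIn.seminorm_top_le_iff ℝ hε]
    exact hb i hi
  calc ‖T φ‖ = ((normSeminorm ℝ ℝ).comp (A : 𝓓^{⊤}_{K'}(Spacetime, ℝ) →ₗ[ℝ] ℝ)) ψ := rfl
    _ ≤ (C • s.sup (ContDiffMapSupportedIn.seminorm ℝ Spacetime ℝ ⊤ K')) ψ := h1
    _ = C * (s.sup (ContDiffMapSupportedIn.seminorm ℝ Spacetime ℝ ⊤ K')) ψ := rfl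
    _ ≤ C * ε := by gcongr

theorem contDiff_pderiv {E : Type*} [NormedAddCommGroup E] [NormedSpace ℝ E] {f : Spacetime → E}
    (hf : ContDiff ℝ ∞ f) (μ : Fin 4) : ContDiff ℝ ∞ (pderiv μ f) :=
  (hf.fderiv_right (m := ∞) (by simp)).clm_apply contDiff_const

theorem ContDiff.comp_translate {E : Type*} [NormedAddCommGroup E] [NormedSpace ℝ E]
    {f : Spacetime → E} (hf : ContDiff ℝ ∞ f) (x : Spacetime) :
    ContDiff ℝ ∞ fun y => f (x + y) := hf.comp (contDiff_const.add contDiff_id)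

theorem spacetime_eq_sum (h : Spacetime) : h = ∑ μ, h μ • basisVec μ := by
  ext ν
  simp [basisVec, Finset.sum_apply, Pi.single_apply]

theorem fderiv_eq_sum_pderiv {E : Type*} [NormedAddCommGroup E] [NormedSpace ℝ E]
    (f : Spacetime → E) (z h : Spacetime) : fderiv ℝ f z h = ∑ μ, h μ • pderiv μ f z := by
  conv_lhs => rw [spacetime_eq_sum h]
  simp [pderiv]

/-- Differentiation of `x ↦ T (χ f(x + ·))`. -/
theorem hasFDerivAt_distr_translate (T : Distr ℝ) (χ : Test) {f : Spacetime → ℝ}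
    (hf : ContDiff ℝ ∞ f) (x : Spacetime) :
    HasFDerivAt (fun x => T (cutoff χ (fun y => f (x + y)) (ContDiff.comp_translate hf x)))
      (∑ μ, T (cutoff χ (fun y => pderiv μ f (x + y))
        (ContDiff.comp_translate (contDiff_pderiv hf μ) x)) •
          (ContinuousLinearMap.proj (R := ℝ) (φ := fun _ : Fin 4 => ℝ) μ)) x := by
  set K : Set Spacetime := tsupport χ with hKdef
  have hK : IsCompact K := χ.hasCompactSupport
  obtain ⟨s, C, hC0, hC⟩ := exists_bound_distr T hK
  have hbχ : ∀ i : ℕ, ∃ M : ℝ, 0 ≤ M ∧ ∀ y ∈ K, ‖iteratedFDeriv ℝ i χ y‖ ≤ M := by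
    intro i
    obtain ⟨M, hM⟩ := hK.exists_bound_of_continuousOn
      (χ.contDiff.continuous_iteratedFDeriv (m := i) (by exact_mod_cast le_top)).continuousOn
    exact ⟨max M 0, le_max_right _ _, fun y hy => (hM y hy).trans (le_max_left _ _)⟩
  choose M hM0 hM using hbχ
  have hKx : IsCompact ((fun y => x + y) '' K) := hK.image (continuous_const.add continuous_id)
  choose M' hM'0 hM' using fun i => norm_iteratedFDeriv_taylorRem_le i hf hKx
  -- The constant from the Leibniz rule for `χ` times the Taylor remainder, summed over the finitely
  -- many derivative orders that control `T` on the support of `χ`.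
  set D : ℝ := ∑ i ∈ s, ∑ j ∈ Finset.range (i + 1), (i.choose j : ℝ) * M j * M' (i - j) with hD
  have hD0 : 0 ≤ D := Finset.sum_nonneg fun i _ => Finset.sum_nonneg fun j _ => by
    have := hM0 j; have := hM'0 (i - j); positivity
  rw [hasFDerivAt_iff_isLittleO_nhds_zero]
  have hbound : ∀ᶠ h in 𝓝 (0 : Spacetime),
      ‖T (cutoff χ (fun y => f (x + h + y)) (ContDiff.comp_translate hf (x + h))) -
        T (cutoff χ (fun y => f (x + y)) (ContDiff.comp_translate hf x)) -
        (∑ μ, T (cutoff χ (fun y => pderiv μ f (x + y))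
          (ContDiff.comp_translate (contDiff_pderiv hf μ) x)) •
          (ContinuousLinearMap.proj (R := ℝ) (φ := fun _ : Fin 4 => ℝ) μ)) h‖
      ≤ (C * D) * ‖‖h‖ ^ 2‖ := by
    filter_upwards [Metric.closedBall_mem_nhds (0 : Spacetime) one_pos] with h hh
    have hh1 : ‖h‖ ≤ 1 := by simpa using hh
    have hrem := contDiff_taylorRem hf h
    -- By linearity the error of the linear approximation is `T` applied to the cut-off Taylor
    -- remainder of `f`, which is quadratically small in `h` together with its derivatives.
    have e : T (cutoff χ (fun y => f (x + h + y)) (ContDiff.comp_translate hf (x + h))) -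
        T (cutoff χ (fun y => f (x + y)) (ContDiff.comp_translate hf x)) -
        (∑ μ, T (cutoff χ (fun y => pderiv μ f (x + y))
          (ContDiff.comp_translate (contDiff_pderiv hf μ) x)) •
          (ContinuousLinearMap.proj (R := ℝ) (φ := fun _ : Fin 4 => ℝ) μ)) h =
        T (cutoff χ (fun y => taylorRem f h (x + y)) (ContDiff.comp_translate hrem x)) := by
      have e2 : (∑ μ, T (cutoff χ (fun y => pderiv μ f (x + y))
          (ContDiff.comp_translate (contDiff_pderiv hf μ) x)) •
          (ContinuousLinearMap.proj (R := ℝ) (φ := fun _ : Fin 4 => ℝ) μ)) h =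
          T (∑ μ, h μ • cutoff χ (fun y => pderiv μ f (x + y))
          (ContDiff.comp_translate (contDiff_pderiv hf μ) x)) := by
        rw [map_sum, ContinuousLinearMap.sum_apply]
        refine Finset.sum_congr rfl fun μ _ => ?_
        rw [map_smul]
        simp [mul_comm]
      rw [e2, ← map_sub, ← map_sub]
      congr 1
      ext y
      rw [IsSubApply.sub_apply, IsSubApply.sub_apply, sum_test_apply]
      simp only [IsSMulApply.smul_apply, cutoff_apply, taylorRem, fderiv_eq_sum_pderiv, smul_eq_mul]
      rw [show x + h + y = x + y + h by abel, mul_sub, mul_sub, Finset.mul_sum]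
      congr 1
      exact Finset.sum_congr rfl fun μ _ => by ring
    rw [e]
    have h1 := hC (cutoff χ (fun y => taylorRem f h (x + y)) (ContDiff.comp_translate hrem x))
      (D * ‖h‖ ^ 2) (by positivity)
      ((Function.support_mul_subset_left _ _).trans (subset_tsupport _)) (by
        intro i hi y hy
        have hle := norm_iteratedFDeriv_mul_le (𝕜 := ℝ) (N := ∞) χ.contDiff
          (ContDiff.comp_translate hrem x) y (n := i) (by exact_mod_cast le_top)
        refine hle.trans ?_
        have : ∑ j ∈ Finset.range (i + 1), (i.choose j : ℝ) * ‖iteratedFDeriv ℝ j χ y‖ *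
            ‖iteratedFDeriv ℝ (i - j) (fun y => taylorRem f h (x + y)) y‖ ≤
            ∑ j ∈ Finset.range (i + 1), (i.choose j : ℝ) * M j * (M' (i - j) * ‖h‖ ^ 2) := by
          refine Finset.sum_le_sum fun j _ => ?_
          have a1 := hM j y hy
          have a2 : ‖iteratedFDeriv ℝ (i - j) (fun y => taylorRem f h (x + y)) y‖ ≤
              M' (i - j) * ‖h‖ ^ 2 := by
            rw [iteratedFDeriv_comp_add_left]
            exact hM' (i - j) (x + y) ⟨y, hy, rfl⟩ h hh1
          have := hM0 j
          gcongr
        refine this.trans ?_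
        rw [hD, Finset.sum_mul]
        refine le_trans (le_of_eq ?_) (Finset.single_le_sum (f := fun i =>
          (∑ j ∈ Finset.range (i + 1), (i.choose j : ℝ) * M j * M' (i - j)) * ‖h‖ ^ 2)
          (fun i _ => ?_) hi)
        · rw [Finset.sum_mul]
          exact Finset.sum_congr rfl fun j _ => by ring
        · refine mul_nonneg (Finset.sum_nonneg fun j _ => ?_) (by positivity)
          have := hM0 j; have := hM'0 (i - j); positivity)
    refine h1.trans (le_of_eq ?_)
    rw [norm_pow, norm_norm]; ring
  have hO := Asymptotics.IsBigO.of_bound _ hbound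
  refine hO.trans_isLittleO ?_
  rw [Asymptotics.isLittleO_norm_right.symm]
  have : (fun h : Spacetime => ‖h‖ ^ 2) =o[𝓝 0] fun h : Spacetime => ‖h‖ ^ 1 := by
    have h2 := (Asymptotics.isLittleO_pow_pow (𝕜 := ℝ) (show 1 < 2 by norm_num)).comp_tendsto
      (tendsto_norm_zero (E := Spacetime))
    exact h2
  simpa using this

end Translation

/-! ### String functions and string integration -/

section StringFunctions

open Set Filter Topology

variable {c : StringFunction} {E : Type*} [NormedAddCommGroup E] [NormedSpace ℝ E]

theorem mem_smoothFunctions {f : Spacetime → E} : f ∈ smoothFunctions E ↔ ContDiff ℝ ∞ f := Iff.rfl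

/-- It suffices to control the support instead of its closure. -/
theorem mem_stringFunctions_of_support {f : Spacetime → E} (hf : ContDiff ℝ ∞ f)
    (h : ∀ K : Set Spacetime, IsCompact K →
      Bornology.IsBounded (Function.support f ∩ (K + (c.cone : Set Spacetime)))) :
    f ∈ stringFunctions c E := by
  refine ⟨hf, fun K hK => ?_⟩
  -- Enlarging `K` by a unit ball suffices: a point of the closed support has a support point within
  -- distance `1`, and that point lies in the enlarged union of strings.
  have hK1 : IsCompact (K + Metric.closedBall (0 : Spacetime) 1) :=
    hK.add (isCompact_closedBall _ _)
  obtain ⟨R, hR⟩ := (h _ hK1).subset_closedBall 0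
  refine (Metric.isBounded_closedBall (x := (0 : Spacetime)) (r := R + 1)).subset ?_
  rintro x ⟨hx, k, hk, v, hv, rfl⟩
  obtain ⟨y, hy, hd⟩ := Metric.mem_closure_iff.mp hx 1 one_pos
  have hy' : y ∈ Function.support f ∩
      (K + Metric.closedBall (0 : Spacetime) 1 + (c.cone : Set Spacetime)) := by
    refine ⟨hy, k + (y - (k + v)), ⟨k, hk, _, ?_, rfl⟩, v, hv, by dsimp only; abel⟩
    rw [mem_closedBall_zero_iff, ← dist_eq_norm, dist_comm]
    exact hd.le
  have := hR hy'
  rw [Metric.mem_closedBall] at this ⊢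
  calc _ ≤ _ := dist_triangle _ y _
    _ ≤ 1 + R := by gcongr
    _ = _ := by ring

theorem mem_stringFunctions_of_support_subset {E' : Type*} [NormedAddCommGroup E']
    [NormedSpace ℝ E'] {f : Spacetime → E} {g : Spacetime → E'} (hf : f ∈ stringFunctions c E)
    (hg : ContDiff ℝ ∞ g) (h : Function.support g ⊆ tsupport f) : g ∈ stringFunctions c E' :=
  ⟨hg, fun K hK => (hf.2 K hK).subset
    (inter_subset_inter_left _ (closure_minimal h (isClosed_tsupport f)))⟩

theorem mul_mem_stringFunctions {𝕜 : Type*} [NormedRing 𝕜] [NormedAlgebra ℝ 𝕜]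
    {f g : Spacetime → 𝕜}
    (hf : ContDiff ℝ ∞ f) (hg : g ∈ stringFunctions c 𝕜) : f * g ∈ stringFunctions c 𝕜 :=
  mem_stringFunctions_of_support_subset hg (hf.mul hg.1)
    ((Function.support_mul_subset_right _ _).trans (subset_tsupport _))

theorem pderiv_mem_stringFunctions {f : Spacetime → E} (hf : f ∈ stringFunctions c E)
    (μ : Fin 4) : pderiv μ f ∈ stringFunctions c E := by
  refine mem_stringFunctions_of_support_subset hf (contDiff_pderiv hf.1 μ) ?_
  intro x hx
  by_contra h
  refine hx ?_
  have : fderiv ℝ f x = 0 := image_eq_zero_of_notMem_tsupport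
    (fun h' => h (tsupport_fderiv_subset ℝ h'))
  simp [pderiv, this]

theorem mem_stringFunctions_pi {κ : Type*} [Fintype κ] {E : κ → Type*}
    [∀ i, NormedAddCommGroup (E i)] [∀ i, NormedSpace ℝ (E i)] {f : Spacetime → ∀ i, E i} :
    f ∈ stringFunctions c (∀ i, E i) ↔ ∀ i, (fun x => f x i) ∈ stringFunctions c (E i) := by
  constructor
  · intro hf i
    refine mem_stringFunctions_of_support_subset hf (contDiff_pi.mp hf.1 i) ?_
    intro x hx
    refine subset_tsupport _ fun h => hx ?_
    simp [h]
  · intro hf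
    refine mem_stringFunctions_of_support (contDiff_pi.mpr fun i => (hf i).1) fun K hK => ?_
    refine ((Bornology.isBounded_iUnion (ι := κ)
      (s := fun i => tsupport (fun x => f x i) ∩ (K + (c.cone : Set Spacetime)))).mpr
        fun i => (hf i).2 K hK).subset ?_
    rintro x ⟨hx, hx'⟩
    obtain ⟨i, hi⟩ := Function.ne_iff.mp hx
    exact mem_iUnion.mpr ⟨i, subset_tsupport _ hi, hx'⟩

/-- In a closed cone without lines, a summand is controlled by the sum. -/
theorem exists_norm_le_norm_add (c : StringFunction) :
    ∃ C : ℝ, 0 ≤ C ∧ ∀ v ∈ c.cone, ∀ w ∈ c.cone, ‖v‖ ≤ C * ‖v + w‖ := by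
  set S : Set Spacetime := Metric.sphere 0 1 ∩ (c.cone : Set Spacetime) with hS
  have hSc : IsCompact S := (isCompact_sphere _ _).inter_right c.cone_closed
  have hne : (c.cone : Set Spacetime).Nonempty := ⟨0, c.cone.zero_mem⟩
  have hpos : ∀ v ∈ S, 0 < Metric.infDist (-v) (c.cone : Set Spacetime) := by
    intro v hv
    refine (c.cone_closed.notMem_iff_infDist_pos hne).mp fun h => ?_
    refine c.cone_salient v hv.2 ?_ h
    rintro rfl
    simp [hS] at hv
  -- For a unit vector `v` of the cone, `-v` is not in the cone, so its distance from the closed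
  -- cone is positive, uniformly by compactness. After rescaling to `‖v‖ = 1` this distance bounds
  -- `‖v + w‖` from below.
  obtain ⟨m, hm0, hm⟩ : ∃ m : ℝ, 0 < m ∧ ∀ v ∈ S,
      m ≤ Metric.infDist (-v) (c.cone : Set Spacetime) := by
    rcases S.eq_empty_or_nonempty with h | h
    · exact ⟨1, one_pos, by simp [h]⟩
    · obtain ⟨v, hv, hmin⟩ := hSc.exists_isMinOn h
        ((Metric.continuous_infDist_pt (c.cone : Set Spacetime)).comp
          continuous_neg).continuousOn
      exact ⟨_, hpos v hv, fun w hw => hmin hw⟩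
  refine ⟨m⁻¹, by positivity, fun v hv w hw => ?_⟩
  rcases eq_or_ne v 0 with rfl | hv0
  · simp; positivity
  have hn : 0 < ‖v‖ := norm_pos_iff.mpr hv0
  have hsc : ∀ u ∈ c.cone, ‖v‖⁻¹ • u ∈ c.cone := fun u hu =>
    PointedCone.smul_mem c.cone (by positivity) hu
  have h1 := hm (‖v‖⁻¹ • v) ⟨by simp [norm_smul, hn.ne'], hsc v hv⟩
  have h2 := Metric.infDist_le_dist_of_mem (x := -(‖v‖⁻¹ • v)) (hsc w hw)
  have h3 : dist (-(‖v‖⁻¹ • v)) (‖v‖⁻¹ • w) = ‖v‖⁻¹ * ‖v + w‖ := by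
    rw [dist_eq_norm, ← norm_neg, show -(-(‖v‖⁻¹ • v) - ‖v‖⁻¹ • w) = ‖v‖⁻¹ • (v + w) by
      rw [smul_add]; abel, norm_smul, norm_inv, norm_norm]
  rw [h3] at h2
  have h4 := h1.trans h2
  rw [inv_mul_eq_div, le_div_iff₀ hm0]
  rw [inv_mul_eq_div, le_div_iff₀ hn] at h4
  linarith

end StringFunctions

/-! ### Smoothness and support of string integrals; inversion of the gradient. -/

section StringIntegration

open Set Filter Topology

variable {c : StringFunction}

/-- A common cutoff computes the string pairings of all translates by points of a compact set. -/
theorem exists_cutoff_pairing (c : StringFunction) {f : Spacetime → ℝ}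
    (hf : f ∈ stringFunctions c ℝ) {K : Set Spacetime} (hK : IsCompact K) :
    ∃ L : Set Spacetime, IsCompact L ∧ ∀ χ : Test, (∀ᶠ x in nhdsSet L, χ x = 1) →
      ∀ x ∈ K, (∀ μ, HasPairing (c.comp μ) (fun y => f (x + y))
        (c.comp μ (cutoff χ (fun y => f (x + y)) (ContDiff.comp_translate hf.1 x)))) ∧
      ∀ y ∈ c.cone, x + y ∈ tsupport f → y ∈ L := by
  -- If `x` is in `K`, `y` in the cone and `x + y` in the support, then `y = (x + y) - x` lies in
  -- this set, which is bounded by the support condition.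
  set B : Set Spacetime := (tsupport f ∩ (K + (c.cone : Set Spacetime))) + (-K) with hB
  have hBb : Bornology.IsBounded B := (hf.2 K hK).add hK.neg.isBounded
  have hL : IsCompact (closure B) := hBb.isCompact_closure
  have hmem : ∀ x ∈ K, ∀ y ∈ c.cone, x + y ∈ tsupport f → y ∈ closure B := by
    intro x hx y hy hxy
    exact subset_closure ⟨x + y, ⟨hxy, x, hx, y, hy, rfl⟩, -x, by simpa using hx, by simp⟩
  refine ⟨closure B, hL, fun χ hχ x hx => ⟨fun μ => ?_, hmem x hx⟩⟩
  refine ⟨ContDiff.comp_translate hf.1 x, closure B, hL, fun χ' φ hχ' hφ => ?_⟩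
  rw [← sub_eq_zero, ← map_sub]
  refine apply_eq_zero_of_disjoint _ _ (Set.disjoint_left.mpr fun y hy hy' => ?_)
  have hyc : y ∈ c.cone := c.supp_subset μ hy'
  have hfy : x + y ∈ tsupport f := by
    have h1 : tsupport (φ - cutoff χ (fun y => f (x + y)) (ContDiff.comp_translate hf.1 x)) ⊆
        (fun y => x + y) ⁻¹' tsupport f := by
      refine closure_minimal ?_ ((isClosed_tsupport f).preimage (continuous_const.add continuous_id))
      intro z hz
      refine subset_tsupport _ fun h0 => hz ?_
      have h0' : f (x + z) = 0 := h0
      rw [IsSubApply.sub_apply, cutoff_apply, hφ]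
      simp [h0']
    exact h1 hy
  have hyB := hmem x hx y hyc hfy
  have hev : ∀ᶠ z in 𝓝 y, χ z = 1 ∧ χ' z = 1 :=
    ((hχ.filter_mono (nhds_le_nhdsSet hyB)).and (hχ'.filter_mono (nhds_le_nhdsSet hyB)))
  refine (notMem_tsupport_iff_eventuallyEq.mpr ?_) hy
  filter_upwards [hev] with z hz
  rw [IsSubApply.sub_apply, cutoff_apply, hφ, hz.1, hz.2]
  simp

theorem exists_hasPairing (c : StringFunction) {f : Spacetime → ℝ}
    (hf : f ∈ stringFunctions c ℝ) (x : Spacetime) (μ : Fin 4) :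
    ∃ v, HasPairing (c.comp μ) (fun y => f (x + y)) v := by
  obtain ⟨L, hL, h⟩ := exists_cutoff_pairing c hf (isCompact_singleton (x := x))
  obtain ⟨χ, hχ⟩ := exists_test_eq_one hL
  exact ⟨_, (h χ hχ x rfl).1 μ⟩

/-- One component `∫ c^μ(y) f(x + y)` of a string integral. -/
def stringPair (c : StringFunction) (μ : Fin 4) (f : Spacetime → ℝ) : Spacetime → ℝ :=
  fun x => pairing (c.comp μ) fun y => f (x + y)

theorem hasPairing_stringPair {f : Spacetime → ℝ} (hf : f ∈ stringFunctions c ℝ) (x : Spacetime)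
    (μ : Fin 4) : HasPairing (c.comp μ) (fun y => f (x + y)) (stringPair c μ f x) := by
  obtain ⟨v, hv⟩ := exists_hasPairing c hf x μ
  rwa [stringPair, hv.pairing_eq]

theorem stringPair_add {f g : Spacetime → ℝ} (hf : f ∈ stringFunctions c ℝ)
    (hg : g ∈ stringFunctions c ℝ) (μ : Fin 4) :
    stringPair c μ (f + g) = stringPair c μ f + stringPair c μ g := by
  funext x
  exact ((hasPairing_stringPair hf x μ).add (hasPairing_stringPair hg x μ)).pairing_eq

theorem stringPair_smul (r : ℝ) {f : Spacetime → ℝ} (hf : f ∈ stringFunctions c ℝ) (μ : Fin 4) :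
    stringPair c μ (r • f) = r • stringPair c μ f := by
  funext x
  exact ((hasPairing_stringPair hf x μ).smul r).pairing_eq

/-- One cutoff that works for `f` and its first derivatives near `x₀` reduces the differentiation of
a string integral to that of a fixed distribution applied to translates. -/
theorem stringPair_eventually_eq {f : Spacetime → ℝ} (hf : f ∈ stringFunctions c ℝ)
    (x₀ : Spacetime) : ∃ χ : Test, (∀ᶠ x in 𝓝 x₀, ∀ μ, stringPair c μ f x =
      c.comp μ (cutoff χ (fun y => f (x + y)) (ContDiff.comp_translate hf.1 x))) ∧
      ∀ᶠ x in 𝓝 x₀, ∀ μ ν, stringPair c μ (pderiv ν f) x =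
      c.comp μ (cutoff χ (fun y => pderiv ν f (x + y))
        (ContDiff.comp_translate (contDiff_pderiv hf.1 ν) x)) := by
  have hK := isCompact_closedBall x₀ 1
  obtain ⟨L, hL, h⟩ := exists_cutoff_pairing c hf hK
  choose L' hL' h' using fun ν => exists_cutoff_pairing c (pderiv_mem_stringFunctions hf ν) hK
  obtain ⟨χ, hχ⟩ := exists_test_eq_one (hL.union (isCompact_iUnion hL'))
  rw [nhdsSet_union, eventually_sup] at hχ
  refine ⟨χ, ?_, ?_⟩
  · filter_upwards [Metric.closedBall_mem_nhds x₀ one_pos] with x hx μ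
    exact ((h χ hχ.1 x hx).1 μ).pairing_eq
  · filter_upwards [Metric.closedBall_mem_nhds x₀ one_pos] with x hx μ ν
    exact ((h' ν χ (hχ.2.filter_mono (nhdsSet_mono (subset_iUnion L' ν))) x hx).1 μ).pairing_eq

theorem hasFDerivAt_stringPair {f : Spacetime → ℝ} (hf : f ∈ stringFunctions c ℝ) (μ : Fin 4)
    (x : Spacetime) : HasFDerivAt (stringPair c μ f) (∑ ν, stringPair c μ (pderiv ν f) x •
      (ContinuousLinearMap.proj (R := ℝ) (φ := fun _ : Fin 4 => ℝ) ν)) x := by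
  obtain ⟨χ, h1, h2⟩ := stringPair_eventually_eq hf x
  have h := hasFDerivAt_distr_translate (c.comp μ) χ hf.1 x
  have e : ∀ ν, stringPair c μ (pderiv ν f) x = _ := fun ν => h2.self_of_nhds μ ν
  simp_rw [e]
  exact h.congr_of_eventuallyEq (h1.mono fun y hy => hy μ)

/-- The derivative is made of string integrals of the partial derivatives, which obey the same
support condition; the induction therefore has to vary `f`. -/
theorem contDiff_stringPair {f : Spacetime → ℝ} (hf : f ∈ stringFunctions c ℝ) (μ : Fin 4) :
    ContDiff ℝ ∞ (stringPair c μ f) := by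
  rw [contDiff_infty]
  intro n
  induction n generalizing f with
  | zero =>
    rw [CharP.cast_eq_zero, contDiff_zero]
    exact continuous_iff_continuousAt.mpr fun x => (hasFDerivAt_stringPair hf μ x).continuousAt
  | succ n ih =>
    push_cast
    rw [contDiff_succ_iff_hasFDerivAt]
    refine ⟨_, ?_, fun x => hasFDerivAt_stringPair hf μ x⟩
    exact ContDiff.sum fun ν _ => (ih (pderiv_mem_stringFunctions hf ν)).smul contDiff_const

theorem pderiv_stringPair {f : Spacetime → ℝ} (hf : f ∈ stringFunctions c ℝ) (μ ν : Fin 4) :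
    pderiv ν (stringPair c μ f) = stringPair c μ (pderiv ν f) := by
  funext x
  rw [pderiv, (hasFDerivAt_stringPair hf μ x).fderiv]
  simp [basisVec, Pi.single_apply]

/-- If the integral is nonzero at `k + v`, the string from there meets the support of `f` at some `k
+ v + y`. The support condition bounds `v + y`, and in a cone without lines this bounds `v`. -/
theorem stringPair_mem {f : Spacetime → ℝ} (hf : f ∈ stringFunctions c ℝ) (μ : Fin 4) :
    stringPair c μ f ∈ stringFunctions c ℝ := by
  refine mem_stringFunctions_of_support (contDiff_stringPair hf μ) fun K hK => ?_
  obtain ⟨C, hC0, hC⟩ := exists_norm_le_norm_add c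
  obtain ⟨R, hR⟩ := (hf.2 K hK).subset_closedBall 0
  obtain ⟨R', hR'⟩ := hK.isBounded.subset_closedBall 0
  refine (Metric.isBounded_closedBall (x := (0 : Spacetime)) (r := R' + C * (R + R'))).subset ?_
  rintro _ ⟨hx, k, hk, v, hv, rfl⟩
  dsimp only at hx ⊢
  obtain ⟨y, hy, hfy⟩ : ∃ y ∈ c.cone, k + v + y ∈ tsupport f := by
    by_contra hno
    push Not at hno
    refine hx ?_
    obtain ⟨L, hL, h⟩ := exists_cutoff_pairing c hf (isCompact_singleton (x := k + v))
    obtain ⟨χ, hχ⟩ := exists_test_eq_one hL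
    refine ((h χ hχ _ rfl).1 μ).pairing_eq.trans ?_
    refine apply_eq_zero_of_disjoint _ _ (Set.disjoint_left.mpr fun y hy hy' => ?_)
    refine hno y (c.supp_subset μ hy') ?_
    have h1 : tsupport (cutoff χ (fun y => f (k + v + y)) (ContDiff.comp_translate hf.1 (k + v))) ⊆
        (fun y => k + v + y) ⁻¹' tsupport f := by
      refine closure_minimal ?_ ((isClosed_tsupport f).preimage (continuous_const.add continuous_id))
      intro z hz
      refine subset_tsupport _ fun h0 => hz ?_
      rw [cutoff_apply, h0, mul_zero]
    exact h1 hy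
  have ha := hR (show k + v + y ∈ _ from
    ⟨hfy, k, hk, v + y, c.cone.add_mem hv hy, by dsimp only; abel⟩)
  have hk' := hR' hk
  rw [mem_closedBall_zero_iff] at ha hk' ⊢
  have h1 : ‖v + y‖ ≤ R + R' := by
    calc ‖v + y‖ = ‖(k + v + y) - k‖ := by congr 1; abel
      _ ≤ _ := norm_sub_le _ _
      _ ≤ _ := add_le_add ha hk'
  calc ‖k + v‖ ≤ ‖k‖ + ‖v‖ := norm_add_le _ _
    _ ≤ R' + C * (R + R') := by
      gcongr
      exact (hC v hv y hy).trans (by gcongr)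

/-- The string integral `∑ ∫ c^μ(y) f_μ(x + y)` of a scalar-valued covector field. -/
def scalarStringInt (c : StringFunction) (f : Fin 4 → Spacetime → ℝ) : Spacetime → ℝ :=
  ∑ μ, stringPair c μ (f μ)

theorem stringInt_apply {ι : Type*} (f : Spacetime → Fin 4 → ι → ℝ) (x : Spacetime) (a : ι) :
    stringInt c f x a = scalarStringInt c (fun μ y => f y μ a) x := by
  simp [stringInt, scalarStringInt, stringPair]

theorem scalarStringInt_mem {f : Fin 4 → Spacetime → ℝ} (hf : ∀ μ, f μ ∈ stringFunctions c ℝ) :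
    scalarStringInt c f ∈ stringFunctions c ℝ :=
  Submodule.sum_mem _ fun μ _ => stringPair_mem (hf μ) μ

/-- The string integral as a linear map. -/
def scalarStringIntLin (c : StringFunction) :
    (Fin 4 → stringFunctions c ℝ) →ₗ[ℝ] stringFunctions c ℝ where
  toFun f := ⟨scalarStringInt c fun μ => f μ, scalarStringInt_mem fun μ => (f μ).2⟩
  map_add' f g := by
    ext1
    simp only [scalarStringInt, Submodule.coe_add, Pi.add_apply]
    rw [← Finset.sum_add_distrib]
    exact Finset.sum_congr rfl fun μ _ => stringPair_add (f μ).2 (g μ).2 μ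
  map_smul' r f := by
    ext1
    simp only [scalarStringInt, Submodule.coe_smul, Pi.smul_apply, RingHom.id_apply]
    rw [Finset.smul_sum]
    exact Finset.sum_congr rfl fun μ _ => stringPair_smul r (f μ).2 μ

theorem pderiv_add {E : Type*} [NormedAddCommGroup E] [NormedSpace ℝ E] {f g : Spacetime → E}
    (hf : ContDiff ℝ ∞ f) (hg : ContDiff ℝ ∞ g) (ν : Fin 4) :
    pderiv ν (f + g) = pderiv ν f + pderiv ν g := by
  funext x
  rw [Pi.add_apply, pderiv, fderiv_add (hf.differentiable (by simp) x)
    (hg.differentiable (by simp) x)]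
  rfl

theorem pderiv_const_smul {E : Type*} [NormedAddCommGroup E] [NormedSpace ℝ E] {𝕜 : Type*}
    [NormedField 𝕜] [NormedSpace 𝕜 E] [SMulCommClass ℝ 𝕜 E] {f : Spacetime → E}
    (hf : ContDiff ℝ ∞ f) (r : 𝕜) (ν : Fin 4) : pderiv ν (r • f) = r • pderiv ν f := by
  funext x
  rw [Pi.smul_apply, pderiv, fderiv_const_smul (hf.differentiable (by simp) x)]
  rfl

theorem pderiv_mul {𝕜 : Type*} [NormedCommRing 𝕜] [NormedAlgebra ℝ 𝕜] {f g : Spacetime → 𝕜}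
    (hf : ContDiff ℝ ∞ f) (hg : ContDiff ℝ ∞ g) (ν : Fin 4) :
    pderiv ν (f * g) = pderiv ν f * g + f * pderiv ν g := by
  funext x
  rw [pderiv, fderiv_mul (hf.differentiable (by simp) x) (hg.differentiable (by simp) x)]
  simp [pderiv]; ring

theorem pderiv_pi {κ : Type*} [Fintype κ] {E : κ → Type*}
    [∀ i, NormedAddCommGroup (E i)] [∀ i, NormedSpace ℝ (E i)] {f : Spacetime → ∀ i, E i}
    (hf : ContDiff ℝ ∞ f) (ν : Fin 4) (x : Spacetime) (i : κ) :
    pderiv ν f x i = pderiv ν (fun y => f y i) x := by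
  have h := (hf.differentiable (by simp) x).hasFDerivAt
  rw [hasFDerivAt_pi'] at h
  rw [pderiv, pderiv, (h i).fderiv]
  rfl

/-- The string integral inverts the gradient: `I_c^μ(∂_μ s) = -s`. -/
theorem scalarStringInt_pderiv {s : Spacetime → ℝ} (hs : s ∈ stringFunctions c ℝ) :
    scalarStringInt c (fun μ => pderiv μ s) = -s := by
  funext x
  obtain ⟨L, hL, h⟩ := exists_cutoff_pairing c hs (isCompact_singleton (x := x))
  choose L' hL' h' using fun ν => exists_cutoff_pairing c (pderiv_mem_stringFunctions hs ν)
    (isCompact_singleton (x := x))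
  obtain ⟨χ, hχ⟩ := exists_test_eq_one ((hL.union (isCompact_iUnion hL')).union
    (isCompact_singleton (x := (0 : Spacetime))))
  rw [nhdsSet_union, eventually_sup, nhdsSet_union, eventually_sup, nhdsSet_singleton] at hχ
  obtain ⟨⟨hχL, hχL'⟩, hχ0⟩ := hχ
  -- The translate of `s`, cut off near the relevant part of the string and near `0`. Then `∑
  -- c^μ(∂_μ φ) = -(∂_μ c^μ)(φ) = -φ(0) = -s(x)`.
  set φ : Test := cutoff χ (fun y => s (x + y)) (ContDiff.comp_translate hs.1 x) with hφ
  have e1 : ∀ μ, stringPair c μ (pderiv μ s) x = c.comp μ (∂_{basisVec μ} φ) := by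
    intro μ
    refine ((h' μ χ (hχL'.filter_mono (nhdsSet_mono (subset_iUnion L' μ))) x rfl).1
      μ).pairing_eq.trans ?_
    rw [← sub_eq_zero, ← map_sub]
    refine apply_eq_zero_of_disjoint _ _ (Set.disjoint_left.mpr fun y hy hy' => ?_)
    -- Differentiating before or after the cutoff differs by a derivative of `χ`, which vanishes
    -- near the intersection of the string with the support of the translated `s`.
    have hval : ∀ z, (cutoff χ (fun y => pderiv μ s (x + y))
        (ContDiff.comp_translate (contDiff_pderiv hs.1 μ) x) - ∂_{basisVec μ} φ) z =
        - (s (x + z) * fderiv ℝ χ z (basisVec μ)) := by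
      intro z
      have hd1 : DifferentiableAt ℝ χ z := χ.contDiff.differentiable (by simp) z
      have hd2 : DifferentiableAt ℝ (fun y => s (x + y)) z :=
        (ContDiff.comp_translate hs.1 x).differentiable (by simp) z
      have e2 : (∂_{basisVec μ} φ) z = fderiv ℝ φ z (basisVec μ) := by
        rw [TestFunction.lineDerivOp_eq_lineDerivCLM ℝ,
          TestFunction.lineDerivCLM_apply_of_le (by simp)]
        exact (φ.contDiff.differentiable (by simp) z).lineDeriv_eq_fderiv
      have e3 : fderiv ℝ φ z = χ z • fderiv ℝ (fun y => s (x + y)) z + s (x + z) • fderiv ℝ χ z := by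
        exact fderiv_mul hd1 hd2
      have e4 : fderiv ℝ (fun y => s (x + y)) z = fderiv ℝ s (x + z) :=
        fderiv_comp_add_left x
      rw [IsSubApply.sub_apply, cutoff_apply, e2, e3, e4]
      simp [pderiv]
    have hyc : y ∈ c.cone := c.supp_subset μ hy'
    have hfy : x + y ∈ tsupport s := by
      have h1 : tsupport (cutoff χ (fun y => pderiv μ s (x + y))
        (ContDiff.comp_translate (contDiff_pderiv hs.1 μ) x) - ∂_{basisVec μ} φ) ⊆
          (fun y => x + y) ⁻¹' tsupport s := by
        refine closure_minimal ?_
          ((isClosed_tsupport s).preimage (continuous_const.add continuous_id))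
        intro z hz
        refine subset_tsupport _ fun h0 => hz ?_
        rw [hval, h0]; simp
      exact h1 hy
    have hyL := (h χ hχL x rfl).2 y hyc hfy
    have hev : ∀ᶠ z in 𝓝 y, χ z = 1 := hχL.filter_mono (nhds_le_nhdsSet hyL)
    refine (notMem_tsupport_iff_eventuallyEq.mpr ?_) hy
    filter_upwards [hev.eventually_nhds] with z hz
    rw [hval]
    have : fderiv ℝ χ z = 0 := by
      have h5 : (χ : Spacetime → ℝ) =ᶠ[𝓝 z] fun _ => (1 : ℝ) := hz
      rw [h5.fderiv_eq]; simp
    simp [this]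
  have e2 := congrArg (fun T : Distr ℝ => T φ) c.div_eq_delta
  have e3 : (∑ μ, dpartial μ (c.comp μ)) φ = -∑ μ, c.comp μ (∂_{basisVec μ} φ) := by
    have h6 : (∑ μ, dpartial μ (c.comp μ)) φ = ∑ μ, (dpartial μ (c.comp μ)) φ := by
      exact ContinuousLinearMap.sum_apply _ _ _
    rw [h6, ← Finset.sum_neg_distrib]
    refine Finset.sum_congr rfl fun μ _ => ?_
    rw [dpartial, Distribution.lineDerivOp_apply_apply, map_neg]
  simp only [e3] at e2
  have e4 : (Distribution.delta 0 : Distr ℝ) φ = s x := by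
    rw [Distribution.delta_apply, hφ, cutoff_apply, hχ0.self_of_nhds]; simp
  rw [e4] at e2
  rw [scalarStringInt, Finset.sum_apply, Pi.neg_apply, Finset.sum_congr rfl fun μ _ => e1 μ]
  linarith

end StringIntegration

/-! ### The two-point obstructions -/

section TwoPoint

theorem dpartial_apply (μ : Fin 4) (T : Distr ℂ) (φ : Test) :
    dpartial μ T φ = -T (∂_{basisVec μ} φ) := by
  rw [dpartial, Distribution.lineDerivOp_apply_apply, map_neg]

/-- The distributional derivative as a complex-linear map. -/
def dpartialLin (μ : Fin 4) : Distr ℂ →ₗ[ℂ] Distr ℂ where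
  toFun := dpartial μ
  map_add' S T := by
    ext φ
    simp only [IsAddApply.add_apply, dpartial_apply]
    ring
  map_smul' z T := by
    ext φ
    simp only [IsSMulApply.smul_apply, dpartial_apply, RingHom.id_apply, smul_neg]

theorem lineDeriv_test_apply (μ : Fin 4) (φ : Test) (x : Spacetime) :
    (∂_{basisVec μ} φ) x = pderiv μ φ x := by
  rw [TestFunction.lineDerivOp_eq_lineDerivCLM ℝ,
    TestFunction.lineDerivCLM_apply_of_le (by simp)]
  exact (φ.contDiff.differentiable (by simp) x).lineDeriv_eq_fderiv

theorem pderiv_comm {E : Type*} [NormedAddCommGroup E] [NormedSpace ℝ E] {f : Spacetime → E}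
    (hf : ContDiff ℝ ∞ f) (μ ν : Fin 4) :
    pderiv μ (pderiv ν f) = pderiv ν (pderiv μ f) := by
  have hd2 : Differentiable ℝ (fderiv ℝ f) :=
    (hf.fderiv_right (m := ∞) (by simp)).differentiable (by simp)
  have key : ∀ (μ ν : Fin 4) (x : Spacetime), pderiv μ (pderiv ν f) x =
      fderiv ℝ (fderiv ℝ f) x (basisVec μ) (basisVec ν) := by
    intro μ ν x
    have := ((hd2 x).hasFDerivAt.clm_apply (hasFDerivAt_const (basisVec ν) x)).fderiv
    rw [pderiv]
    change fderiv ℝ (fun y => fderiv ℝ f y (basisVec ν)) x (basisVec μ) = _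
    rw [this]
    simp
  funext x
  have hs : IsSymmSndFDerivAt ℝ f x := (hf.contDiffAt (x := x)).isSymmSndFDerivAt
    (by rw [minSmoothness_of_isRCLikeNormedField]; exact WithTop.coe_le_coe.mpr (le_top (a := (2 : ℕ∞))))
  rw [key, key]
  exact hs _ _

theorem dpartial_comm (μ ν : Fin 4) (T : Distr ℂ) :
    dpartialLin μ (dpartialLin ν T) = dpartialLin ν (dpartialLin μ T) := by
  ext φ
  change dpartial μ (dpartial ν T) φ = dpartial ν (dpartial μ T) φ
  rw [dpartial_apply, dpartial_apply, dpartial_apply, dpartial_apply]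
  congr 3
  ext x
  have h : ∀ μ : Fin 4, ((∂_{basisVec μ} φ : Test) : Spacetime → ℝ) = pderiv μ φ :=
    fun μ => funext (lineDeriv_test_apply μ φ)
  rw [lineDeriv_test_apply, lineDeriv_test_apply, h, h, pderiv_comm φ.contDiff]

theorem real_smul_distr (r : ℝ) (T : Distr ℂ) : r • T = (r : ℂ) • T := by
  ext φ
  simp [IsSMulApply.smul_apply]

/-- The d'Alembertian `□ T`. -/
def dAlembert (T : Distr ℂ) : Distr ℂ :=
  ∑ μ, (eta μ : ℂ) • dpartialLin μ (dpartialLin μ T)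

theorem IsPropagator.dAlembert_apply {m : ℝ} {Δ : Distr ℂ} (h : IsPropagator m Δ) (φ : Test) :
    (dAlembert Δ) φ + (m : ℂ) ^ 2 * Δ φ = -Complex.I * φ 0 := by
  rw [← h φ]
  congr 2

theorem eta_mul_self (μ : Fin 4) : eta μ * eta μ = 1 := by
  unfold eta; split_ifs <;> norm_num

/-- The equation of motion contributes `∂_ν ∂_κ T₀`, which cancels the mixed term in the divergence
of the curl; the d'Alembertian remains. -/
theorem obstructionFA_eq (T₀ : Distr ℂ) (ν κ : Fin 4) :
    obstructionFA T₀ ν κ = (metric ν κ : ℂ) • dAlembert T₀ := by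
  have hd : ∀ (μ : Fin 4) (T : Distr ℂ), dpartial μ T = dpartialLin μ T := fun _ _ => rfl
  have hsum : ∀ G : Fin 4 → Distr ℂ, ∑ μ, (eta μ : ℂ) • ((metric μ κ : ℂ) • G μ) = G κ := by
    intro G
    rw [Finset.sum_eq_single κ]
    · rw [smul_smul, metric, if_pos rfl, ← Complex.ofReal_mul, eta_mul_self]; simp
    · intro μ _ h
      simp [metric, h]
    · simp
  have hN : timeOrderedNA T₀ κ = -dpartialLin κ T₀ := by
    rw [timeOrderedNA, ← hsum (fun μ => dpartialLin μ T₀), ← Finset.sum_neg_distrib]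
    refine Finset.sum_congr rfl fun μ _ => ?_
    rw [timeOrderedAA, real_smul_distr, real_smul_distr, hd, map_neg, map_smul, smul_neg]
  rw [obstructionFA, timeOrderedDivFA, hN, hd, map_neg, neg_neg]
  have h2 : ∑ μ, eta μ • dpartial μ (timeOrderedFA T₀ μ ν κ) =
      -((metric ν κ : ℂ) • dAlembert T₀) + dpartialLin κ (dpartialLin ν T₀) := by
    rw [← hsum (fun μ => dpartialLin μ (dpartialLin ν T₀)), dAlembert, Finset.smul_sum,
      ← Finset.sum_neg_distrib, ← Finset.sum_add_distrib]
    refine Finset.sum_congr rfl fun μ _ => ?_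
    rw [timeOrderedFA, timeOrderedAA, timeOrderedAA]
    simp only [real_smul_distr, hd, map_neg, map_smul, map_sub, smul_sub, smul_neg]
    rw [smul_comm (metric ν κ : ℂ) (eta μ : ℂ)]
    abel
  rw [h2, dpartial_comm ν κ]
  abel

theorem obstructionFA_apply {T₀ : Distr ℂ} (hT₀ : IsPropagator 0 T₀) (ν κ : Fin 4) (φ : Test) :
    obstructionFA T₀ ν κ φ = φ 0 • (-Complex.I * metric ν κ) := by
  have h := hT₀.dAlembert_apply φ
  have h' : dAlembert T₀ φ = -Complex.I * φ 0 := by simpa using h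
  rw [obstructionFA_eq, IsSMulApply.smul_apply, h', smul_eq_mul, Complex.real_smul]
  ring

/-- Distributional derivatives commute, so twice the sum involves only anticommutators of the Dirac
matrices. -/
theorem sum_dirac_dpartial {Γ : Fin 4 → Matrix (Fin 4) (Fin 4) ℂ} (hΓ : IsDirac Γ) (Δ : Distr ℂ)
    (ρ σ : Fin 4) : ∑ μ, ∑ ν, (Γ ν * Γ μ) ρ σ • dpartialLin μ (dpartialLin ν Δ) =
      (if ρ = σ then (1 : ℂ) else 0) • dAlembert Δ := by
  set G : Fin 4 → Fin 4 → Distr ℂ := fun μ ν => dpartialLin μ (dpartialLin ν Δ) with hG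
  have hsymm : ∀ μ ν, G μ ν = G ν μ := fun μ ν => dpartial_comm μ ν Δ
  have h1 : ∑ μ, ∑ ν, (Γ ν * Γ μ) ρ σ • G μ ν = ∑ μ, ∑ ν, (Γ μ * Γ ν) ρ σ • G μ ν := by
    rw [Finset.sum_comm]
    exact Finset.sum_congr rfl fun μ _ => Finset.sum_congr rfl fun ν _ => by rw [hsymm]
  have h2 : (2 : ℂ) • ∑ μ, ∑ ν, (Γ ν * Γ μ) ρ σ • G μ ν =
      (2 : ℂ) • ((if ρ = σ then (1 : ℂ) else 0) • dAlembert Δ) := by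
    rw [two_smul]
    nth_rewrite 1 [h1]
    rw [← Finset.sum_add_distrib, dAlembert, Finset.smul_sum, Finset.smul_sum]
    refine Finset.sum_congr rfl fun μ _ => ?_
    rw [← Finset.sum_add_distrib, Finset.sum_eq_single μ]
    · rw [← add_smul, ← Matrix.add_apply, hΓ μ μ, smul_smul, smul_smul]
      congr 1
      rw [Matrix.smul_apply, Matrix.one_apply, metric, if_pos rfl, smul_eq_mul]
      split_ifs <;> ring
    · intro ν _ hν
      rw [← add_smul, ← Matrix.add_apply, hΓ μ ν, metric, if_neg (Ne.symm hν)]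
      simp
    · simp
  exact smul_right_injective _ (two_ne_zero : (2 : ℂ) ≠ 0) h2

/-- The first-order terms cancel because `im · i = -m`, and the square of the Dirac derivative is
the d'Alembertian. What is left is `i` times the Klein-Gordon operator. -/
theorem obstructionQuark_eq {Γ : Fin 4 → Matrix (Fin 4) (Fin 4) ℂ} (hΓ : IsDirac Γ) (m : ℝ)
    (Δ : Distr ℂ) (ρ σ : Fin 4) : obstructionQuark Γ m Δ ρ σ =
      (if ρ = σ then Complex.I else 0) • (dAlembert Δ + ((m : ℂ) ^ 2) • Δ) := by
  have hd : ∀ (μ : Fin 4) (T : Distr ℂ), dpartial μ T = dpartialLin μ T := fun _ _ => rfl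
  have h1 : ∑ μ, ∑ κ, Γ μ κ σ • dpartialLin μ (diracPropagator Γ m Δ ρ κ) =
      (m : ℂ) • ∑ μ, Γ μ ρ σ • dpartialLin μ Δ + Complex.I • ∑ μ, ∑ ν, (Γ ν * Γ μ) ρ σ •
        dpartialLin μ (dpartialLin ν Δ) := by
    rw [Finset.smul_sum, Finset.smul_sum, ← Finset.sum_add_distrib]
    refine Finset.sum_congr rfl fun μ _ => ?_
    simp only [diracPropagator, hd, map_add, map_smul, map_sum, smul_add, Finset.sum_add_distrib]
    congr 1
    · rw [Finset.sum_eq_single ρ]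
      · rw [if_pos rfl, smul_smul, smul_smul, mul_comm]
      · intro κ _ h; simp [Ne.symm h]
      · simp
    · simp only [Finset.smul_sum, Matrix.mul_apply, Finset.sum_smul]
      rw [Finset.sum_comm]
      refine Finset.sum_congr rfl fun ν _ => Finset.sum_congr rfl fun κ _ => ?_
      rw [smul_smul, smul_smul]
      congr 1; ring
  rw [obstructionQuark]
  simp only [hd]
  rw [h1, sum_dirac_dpartial hΓ, diracPropagator]
  simp only [hd]
  have h2 : ∑ μ, (Complex.I * Γ μ ρ σ) • dpartialLin μ Δ =
      Complex.I • ∑ μ, Γ μ ρ σ • dpartialLin μ Δ := by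
    rw [Finset.smul_sum]
    exact Finset.sum_congr rfl fun μ _ => by rw [smul_smul]
  rw [h2]
  set D := ∑ μ, Γ μ ρ σ • dpartialLin μ Δ
  have hI : Complex.I * m * Complex.I = -(m : ℂ) := by
    linear_combination (m : ℂ) * Complex.I_mul_I
  rw [smul_add, smul_smul, smul_smul, smul_smul, hI, smul_add, smul_smul]
  split_ifs
  · rw [mul_one, neg_smul, show Complex.I * (m : ℂ) * m = Complex.I * (m : ℂ) ^ 2 by ring]
    abel
  · simp

theorem obstructionAntiquark_eq {Γ : Fin 4 → Matrix (Fin 4) (Fin 4) ℂ} (hΓ : IsDirac Γ) (m : ℝ)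
    (Δ : Distr ℂ) (ρ σ : Fin 4) : obstructionAntiquark Γ m Δ ρ σ =
      (if ρ = σ then -Complex.I else 0) • (dAlembert Δ + ((m : ℂ) ^ 2) • Δ) := by
  have hd : ∀ (μ : Fin 4) (T : Distr ℂ), dpartial μ T = dpartialLin μ T := fun _ _ => rfl
  have h1 : ∑ μ, ∑ κ, Γ μ ρ κ • dpartialLin μ (diracPropagator Γ m Δ κ σ) =
      (m : ℂ) • ∑ μ, Γ μ ρ σ • dpartialLin μ Δ + Complex.I • ∑ μ, ∑ ν, (Γ μ * Γ ν) ρ σ •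
        dpartialLin μ (dpartialLin ν Δ) := by
    rw [Finset.smul_sum, Finset.smul_sum, ← Finset.sum_add_distrib]
    refine Finset.sum_congr rfl fun μ _ => ?_
    simp only [diracPropagator, hd, map_add, map_smul, map_sum, smul_add, Finset.sum_add_distrib]
    congr 1
    · rw [Finset.sum_eq_single σ]
      · rw [if_pos rfl, smul_smul, smul_smul, mul_comm]
      · intro κ _ h; simp [h]
      · simp
    · simp only [Finset.smul_sum, Matrix.mul_apply, Finset.sum_smul]
      rw [Finset.sum_comm]
      refine Finset.sum_congr rfl fun ν _ => Finset.sum_congr rfl fun κ _ => ?_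
      rw [smul_smul, smul_smul]
      congr 1; ring
  have h3 : ∑ μ, ∑ ν, (Γ μ * Γ ν) ρ σ • dpartialLin μ (dpartialLin ν Δ) =
      (if ρ = σ then (1 : ℂ) else 0) • dAlembert Δ := by
    rw [← sum_dirac_dpartial hΓ, Finset.sum_comm]
    exact Finset.sum_congr rfl fun μ _ => Finset.sum_congr rfl fun ν _ => by rw [dpartial_comm]
  rw [obstructionAntiquark]
  simp only [hd]
  rw [h1, h3, diracPropagator]
  simp only [hd]
  have h2 : ∑ μ, (Complex.I * Γ μ ρ σ) • dpartialLin μ Δ =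
      Complex.I • ∑ μ, Γ μ ρ σ • dpartialLin μ Δ := by
    rw [Finset.smul_sum]
    exact Finset.sum_congr rfl fun μ _ => by rw [smul_smul]
  rw [h2]
  set D := ∑ μ, Γ μ ρ σ • dpartialLin μ Δ
  have hI : Complex.I * m * Complex.I = -(m : ℂ) := by
    linear_combination (m : ℂ) * Complex.I_mul_I
  rw [smul_add, smul_smul, smul_smul, smul_smul, hI, smul_add, smul_smul]
  split_ifs
  · rw [mul_one, neg_smul, neg_smul, show Complex.I * (m : ℂ) * m = Complex.I * (m : ℂ) ^ 2 by ring,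
      neg_mul, neg_smul]
    abel
  · simp

theorem obstructionQuark_apply {Γ : Fin 4 → Matrix (Fin 4) (Fin 4) ℂ} (hΓ : IsDirac Γ) {m : ℝ}
    {Δ : Distr ℂ} (hΔ : IsPropagator m Δ) (ρ σ : Fin 4) (φ : Test) :
    obstructionQuark Γ m Δ ρ σ φ = φ 0 • (if ρ = σ then (1 : ℂ) else 0) := by
  rw [obstructionQuark_eq hΓ, IsSMulApply.smul_apply, IsAddApply.add_apply,
    IsSMulApply.smul_apply, smul_eq_mul, smul_eq_mul, hΔ.dAlembert_apply, Complex.real_smul]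
  split_ifs
  · linear_combination (-(φ 0 : ℂ)) * Complex.I_mul_I
  · simp

theorem obstructionAntiquark_apply {Γ : Fin 4 → Matrix (Fin 4) (Fin 4) ℂ} (hΓ : IsDirac Γ) {m : ℝ}
    {Δ : Distr ℂ} (hΔ : IsPropagator m Δ) (ρ σ : Fin 4) (φ : Test) :
    obstructionAntiquark Γ m Δ ρ σ φ = φ 0 • (if ρ = σ then (-1 : ℂ) else 0) := by
  rw [obstructionAntiquark_eq hΓ, IsSMulApply.smul_apply, IsAddApply.add_apply,
    IsSMulApply.smul_apply, smul_eq_mul, smul_eq_mul, hΔ.dAlembert_apply, Complex.real_smul]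
  split_ifs
  · linear_combination (φ 0 : ℂ) * Complex.I_mul_I
  · simp

theorem pairingC_of_delta {T : Distr ℂ} {v : ℂ} (hT : ∀ φ : Test, T φ = φ 0 • v)
    {f : Spacetime → ℂ} (hf : ContDiff ℝ ∞ f) : pairingC T f = f 0 * v := by
  have h1 : ContDiff ℝ ∞ fun z => (f z).re := Complex.reCLM.contDiff.comp hf
  have h2 : ContDiff ℝ ∞ fun z => (f z).im := Complex.imCLM.contDiff.comp hf
  rw [pairingC, (hasPairing_of_delta hT h1).pairing_eq, (hasPairing_of_delta hT h2).pairing_eq,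
    Complex.real_smul, Complex.real_smul]
  conv_rhs => rw [← Complex.re_add_im (f 0)]
  ring

end TwoPoint

/-! ### The contractions with the basic fields. -/

section Contractions

variable {c : StringFunction} {ι d J : Type*} [Fintype ι] [Fintype d] [Fintype J]

/-- The contraction with the potential is the field `α` itself. -/
theorem contractionA_eq {T₀ : Distr ℂ} (hT₀ : IsPropagator 0 T₀)
    {α : QField c ι J (Fin 4 → ι → ℝ)} {Φ : Config c ι J} (hα : ContDiff ℝ ∞ (α Φ)) :
    contractionA T₀ α Φ = α Φ := by
  funext y κ a
  have h : ∀ ν, pairing (obstructionFA T₀ ν κ) (fun z => α Φ (y + z) ν a) =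
      α Φ y ν a • (-Complex.I * metric ν κ) := by
    intro ν
    have hs : ContDiff ℝ ∞ fun z => α Φ (y + z) ν a :=
      ContDiff.comp_translate (contDiff_pi.mp (contDiff_pi.mp hα ν) a) y
    rw [(hasPairing_of_delta (obstructionFA_apply hT₀ ν κ) hs).pairing_eq, add_zero]
  rw [contractionA]
  simp only [h]
  rw [Finset.sum_eq_single κ]
  · rw [metric, if_pos rfl, Complex.real_smul]
    have : Complex.I * ((eta κ : ℂ) * ((α Φ y κ a : ℂ) * (-Complex.I * (eta κ : ℂ)))) =
        ((α Φ y κ a * (eta κ * eta κ) : ℝ) : ℂ) := by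
      push_cast
      linear_combination (-(α Φ y κ a : ℂ) * eta κ * eta κ) * Complex.I_mul_I
    rw [this, eta_mul_self, mul_one, Complex.ofReal_re]
  · intro ν _ h
    simp [metric, h]
  · simp

theorem contDiff_gaugeRep_map {L : GaugeAlgebra ι d} (π : GaugeRep L J) {s : Spacetime → ι → ℝ}
    (hs : ContDiff ℝ ∞ s) (j k : J) : ContDiff ℝ ∞ fun x => π.map (s x) j k := by
  simp only [GaugeRep.map, Matrix.sum_apply, Matrix.smul_apply, smul_eq_mul]
  refine ContDiff.sum fun a _ => ContDiff.mul ?_ contDiff_const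
  exact Complex.ofRealCLM.contDiff.comp (contDiff_pi.mp hs a)

/-- The contraction of the mediator field with `ψ` is `iπ(β)ψ`. -/
theorem contractionQuark_eq {L : GaugeAlgebra ι d} (π : GaugeRep L J)
    {Γ : Fin 4 → Matrix (Fin 4) (Fin 4) ℂ} (hΓ : IsDirac Γ) {m : ℝ} {Δ : Distr ℂ}
    (hΔ : IsPropagator m Δ) {β : QField c ι J (ι → ℝ)} {Φ : Config c ι J}
    (hβ : ContDiff ℝ ∞ (β Φ)) (x : Spacetime) (j : J) (ρ : Fin 4) :
    contractionQuark π Γ m Δ β Φ x j ρ =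
      Complex.I * ∑ k, π.map (β Φ x) j k * quarkField Φ x k ρ := by
  have hsm : ∀ σ, ContDiff ℝ ∞ fun z => ∑ k, π.map (β Φ (x - z)) j k * quarkField Φ (x - z) k σ := by
    intro σ
    have hxz : ContDiff ℝ ∞ fun z : Spacetime => x - z := contDiff_const.sub contDiff_id
    refine ContDiff.sum fun k _ => ContDiff.mul ?_ ?_
    · exact (contDiff_gaugeRep_map π hβ j k).comp hxz
    · have h1 : ContDiff ℝ ∞ (quarkField Φ) := Φ.2.1.2
      exact (contDiff_pi.mp (contDiff_pi.mp h1 k) σ).comp hxz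
  rw [contractionQuark]
  simp only [pairingC_of_delta (obstructionQuark_apply hΓ hΔ ρ _) (hsm _)]
  congr 1
  rw [Finset.sum_eq_single ρ]
  · simp
  · intro σ _ h; simp [Ne.symm h]
  · simp

/-- The contraction of the mediator field with `ψ̄` is `-iψ̄π(β)`. -/
theorem contractionAntiquark_eq {L : GaugeAlgebra ι d} (π : GaugeRep L J)
    {Γ : Fin 4 → Matrix (Fin 4) (Fin 4) ℂ} (hΓ : IsDirac Γ) {m : ℝ} {Δ : Distr ℂ}
    (hΔ : IsPropagator m Δ) {β : QField c ι J (ι → ℝ)} {Φ : Config c ι J}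
    (hβ : ContDiff ℝ ∞ (β Φ)) (x : Spacetime) (j : J) (σ : Fin 4) :
    contractionAntiquark π Γ m Δ β Φ x j σ =
      -Complex.I * ∑ k, antiquarkField Φ x k σ * π.map (β Φ x) k j := by
  have hsm : ∀ ρ, ContDiff ℝ ∞ fun z =>
      ∑ k, antiquarkField Φ (x + z) k ρ * π.map (β Φ (x + z)) k j := by
    intro ρ
    have hxz : ContDiff ℝ ∞ fun z : Spacetime => x + z := contDiff_const.add contDiff_id
    refine ContDiff.sum fun k _ => ContDiff.mul ?_ ?_
    · have h1 : ContDiff ℝ ∞ (antiquarkField Φ) := Φ.2.2.2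
      exact (contDiff_pi.mp (contDiff_pi.mp h1 k) ρ).comp hxz
    · exact (contDiff_gaugeRep_map π hβ k j).comp hxz
  rw [contractionAntiquark]
  simp only [pairingC_of_delta (obstructionAntiquark_apply hΓ hΔ _ σ) (hsm _)]
  rw [Finset.sum_eq_single σ]
  · simp
  · intro ρ _ h; simp [h]
  · simp

end Contractions

/-! ### Expansion of fields along formal power series of configurations -/

section Expansion

variable {c : StringFunction} {ι d J : Type*} [Fintype ι] [Fintype d] [Fintype J]
variable {E F G : Type*} [NormedAddCommGroup E] [NormedSpace ℝ E] [NormedAddCommGroup F]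
  [NormedSpace ℝ F] [NormedAddCommGroup G] [NormedSpace ℝ G]

/-- The field `X` is polynomial along the polynomial paths `∑_{m ≤ N} t^m Φ_m`, with coefficients
in `M`, and `∑ t^k f_k` is its formal power series along `∑ t^m Φ_m`. -/
def HasExp (M : Submodule ℝ (Spacetime → E)) (Φ : ℕ → Config c ι J) (X : QField c ι J E)
    (f : ℕ → Spacetime → E) : Prop :=
  ∀ N : ℕ, ∃ (D : ℕ) (r : ℕ → Spacetime → E), (∀ k, r k ∈ M) ∧ (∀ k ≤ N, r k = f k) ∧
    (∀ k ≥ D, r k = 0) ∧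
    ∀ t : ℝ, X (∑ m ∈ Finset.range (N + 1), t ^ m • Φ m) = ∑ k ∈ Finset.range D, t ^ k • r k

/-- `X` has an expansion along every formal power series of configurations. -/
def Expands (M : Submodule ℝ (Spacetime → E)) (X : QField c ι J E) : Prop :=
  ∀ Φ : ℕ → Config c ι J, ∃ f, HasExp M Φ X f

variable {M : Submodule ℝ (Spacetime → E)} {M' : Submodule ℝ (Spacetime → F)}
  {M'' : Submodule ℝ (Spacetime → G)} {Φ : ℕ → Config c ι J} {X Y : QField c ι J E}
  {f g : ℕ → Spacetime → E}

theorem HasExp.mem (h : HasExp M Φ X f) (k : ℕ) : f k ∈ M := by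
  obtain ⟨D, r, hr, hf, -⟩ := h k
  rw [← hf k le_rfl]; exact hr k

theorem sum_range_extend {V : Type*} [AddCommGroup V] [Module ℝ V] {r : ℕ → V} {D D' : ℕ}
    (hD : ∀ k ≥ D, r k = 0) (h : D ≤ D') (t : ℝ) :
    ∑ k ∈ Finset.range D, t ^ k • r k = ∑ k ∈ Finset.range D', t ^ k • r k := by
  refine Finset.sum_subset (Finset.range_mono h) fun k _ hk => ?_
  rw [hD k (by simpa using hk), smul_zero]

theorem Expands.mem (h : Expands M X) (Ψ : Config c ι J) : X Ψ ∈ M := by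
  obtain ⟨f, hf⟩ := h fun m => if m = 0 then Ψ else 0
  obtain ⟨D, r, hr, -, -, h⟩ := hf 0
  have := h 1
  simp only [one_pow, one_smul, zero_add, Finset.range_one, Finset.sum_singleton, if_true] at this
  rw [this]
  exact M.sum_mem fun k _ => hr k

theorem HasExp.map (h : HasExp M Φ X f) (T : (Spacetime → E) → Spacetime → F)
    (hadd : ∀ u ∈ M, ∀ v ∈ M, T (u + v) = T u + T v)
    (hsmul : ∀ (t : ℝ), ∀ u ∈ M, T (t • u) = t • T u) (hmem : ∀ u ∈ M, T u ∈ M') :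
    HasExp M' Φ (fun Ψ => T (X Ψ)) fun k => T (f k) := by
  have h0 : T 0 = 0 := by simpa using hsmul 0 0 M.zero_mem
  intro N
  obtain ⟨D, r, hr, hf, hD, ht⟩ := h N
  refine ⟨D, fun k => T (r k), fun k => hmem _ (hr k), fun k hk => congrArg T (hf k hk),
    fun k hk => (congrArg T (hD k hk)).trans h0, fun t => ?_⟩
  dsimp only
  rw [ht]
  clear ht hf hD
  induction D with
  | zero => simpa using h0
  | succ D ih =>
    rw [Finset.sum_range_succ, Finset.sum_range_succ, hadd _ (M.sum_mem fun k _ =>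
      M.smul_mem _ (hr k)) _ (M.smul_mem _ (hr D)), ih, hsmul _ _ (hr D)]

theorem Expands.map (h : Expands M X) (T : (Spacetime → E) → Spacetime → F)
    (hadd : ∀ u ∈ M, ∀ v ∈ M, T (u + v) = T u + T v)
    (hsmul : ∀ (t : ℝ), ∀ u ∈ M, T (t • u) = t • T u) (hmem : ∀ u ∈ M, T u ∈ M') :
    Expands M' fun Ψ => T (X Ψ) := fun Φ =>
  let ⟨_, hf⟩ := h Φ
  ⟨_, hf.map T hadd hsmul hmem⟩

theorem HasExp.mapLin (h : HasExp M Φ X f) (T : (Spacetime → E) →ₗ[ℝ] (Spacetime → F))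
    (hmem : ∀ u ∈ M, T u ∈ M') : HasExp M' Φ (fun Ψ => T (X Ψ)) fun k => T (f k) :=
  h.map T (fun u _ v _ => map_add T u v) (fun t u _ => map_smul T t u) hmem

theorem Expands.mapLin (h : Expands M X) (T : (Spacetime → E) →ₗ[ℝ] (Spacetime → F))
    (hmem : ∀ u ∈ M, T u ∈ M') : Expands M' fun Ψ => T (X Ψ) :=
  h.map T (fun u _ v _ => map_add T u v) (fun t u _ => map_smul T t u) hmem

theorem HasExp.smul (h : HasExp M Φ X f) (t : ℝ) : HasExp M Φ (t • X) (t • f) :=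
  h.mapLin (t • LinearMap.id) fun u hu => M.smul_mem t hu

theorem HasExp.add (hX : HasExp M Φ X f) (hY : HasExp M Φ Y g) : HasExp M Φ (X + Y) (f + g) := by
  intro N
  obtain ⟨D, r, hr, hf, hD, ht⟩ := hX N
  obtain ⟨D', r', hr', hf', hD', ht'⟩ := hY N
  refine ⟨max D D', r + r', fun k => M.add_mem (hr k) (hr' k), fun k hk => ?_, fun k hk => ?_,
    fun t => ?_⟩
  · rw [Pi.add_apply, Pi.add_apply, hf k hk, hf' k hk]
  · rw [Pi.add_apply, hD k ((le_max_left _ _).trans hk), hD' k ((le_max_right _ _).trans hk),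
      add_zero]
  · rw [Pi.add_apply, ht, ht', sum_range_extend hD (le_max_left D D'),
      sum_range_extend hD' (le_max_right D D'), ← Finset.sum_add_distrib]
    simp

theorem hasExp_zero : HasExp M Φ (0 : QField c ι J E) 0 :=
  fun _ => ⟨0, 0, fun _ => M.zero_mem, fun _ _ => rfl, fun _ _ => rfl, fun _ => by simp⟩

theorem hasExp_const {u : Spacetime → E} (hu : u ∈ M) :
    HasExp M Φ (fun _ => u) fun k => if k = 0 then u else 0 := by
  intro N
  refine ⟨1, fun k => if k = 0 then u else 0, fun k => ?_, fun _ _ => rfl, fun k hk => ?_,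
    fun t => by simp⟩
  · dsimp only
    split_ifs
    exacts [hu, M.zero_mem]
  · exact if_neg (by omega)

theorem HasExp.sum {κ : Type*} (s : Finset κ) {X : κ → QField c ι J E}
    {f : κ → ℕ → Spacetime → E} (h : ∀ i ∈ s, HasExp M Φ (X i) (f i)) :
    HasExp M Φ (∑ i ∈ s, X i) (∑ i ∈ s, f i) := by
  classical
  induction s using Finset.induction_on with
  | empty => exact hasExp_zero
  | insert i s hi ih =>
    rw [Finset.sum_insert hi, Finset.sum_insert hi]
    exact (h i (Finset.mem_insert_self i s)).add
      (ih fun j hj => h j (Finset.mem_insert_of_mem hj))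

theorem Expands.add (hX : Expands M X) (hY : Expands M Y) : Expands M (X + Y) := fun Φ =>
  let ⟨_, hf⟩ := hX Φ
  let ⟨_, hg⟩ := hY Φ
  ⟨_, hf.add hg⟩

theorem Expands.smul (hX : Expands M X) (t : ℝ) : Expands M (t • X) := fun Φ =>
  let ⟨_, hf⟩ := hX Φ
  ⟨_, hf.smul t⟩

theorem expands_zero : Expands M (0 : QField c ι J E) := fun _ => ⟨_, hasExp_zero⟩

theorem sum_range_bilin {U V W : Type*} [AddCommGroup U] [Module ℝ U] [AddCommGroup V] [Module ℝ V]
    [AddCommGroup W] [Module ℝ W] (B : U →ₗ[ℝ] V →ₗ[ℝ] W) {r : ℕ → U} {s : ℕ → V} {D D' : ℕ}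
    (hr : ∀ k ≥ D, r k = 0) (hs : ∀ k ≥ D', s k = 0) (t : ℝ) :
    B (∑ k ∈ Finset.range D, t ^ k • r k) (∑ k ∈ Finset.range D', t ^ k • s k) =
      ∑ n ∈ Finset.range (D + D'), t ^ n •
        ∑ k ∈ Finset.HasAntidiagonal.antidiagonal n, B (r k.1) (s k.2) := by
  have h1 : ∀ n, t ^ n • ∑ k ∈ Finset.HasAntidiagonal.antidiagonal n, B (r k.1) (s k.2) =
      ∑ k ∈ Finset.range (n + 1), B (t ^ k • r k) (t ^ (n - k) • s (n - k)) := by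
    intro n
    rw [Finset.smul_sum, Finset.Nat.sum_antidiagonal_eq_sum_range_succ
      (fun i j => t ^ n • B (r i) (s j))]
    refine Finset.sum_congr rfl fun k hk => ?_
    rw [map_smul, map_smul, LinearMap.smul_apply, smul_smul, ← pow_add,
      Nat.sub_add_cancel (by simpa [Nat.lt_succ_iff] using hk)]
  simp_rw [h1]
  rw [Finset.sum_range_diag_flip (D + D') (fun i j => B (t ^ i • r i) (t ^ j • s j)),
    sum_range_extend hr (Nat.le_add_right D D'), map_sum B, LinearMap.sum_apply]
  refine Finset.sum_congr rfl fun k hk => ?_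
  rcases lt_or_ge k D with h | h
  · rw [sum_range_extend hs (show D' ≤ D + D' - k by omega), map_sum]
  · simp [hr k h]

theorem HasExp.bilin {Y : QField c ι J F} {g : ℕ → Spacetime → F} (hX : HasExp M Φ X f)
    (hY : HasExp M' Φ Y g) (B : (Spacetime → E) →ₗ[ℝ] (Spacetime → F) →ₗ[ℝ] (Spacetime → G))
    (hmem : ∀ u ∈ M, ∀ v ∈ M', B u v ∈ M'') :
    HasExp M'' Φ (fun Ψ => B (X Ψ) (Y Ψ)) fun n =>
      ∑ k ∈ Finset.HasAntidiagonal.antidiagonal n, B (f k.1) (g k.2) := by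
  intro N
  obtain ⟨D, r, hr, hf, hD, ht⟩ := hX N
  obtain ⟨D', r', hr', hf', hD', ht'⟩ := hY N
  refine ⟨D + D', fun n => ∑ k ∈ Finset.HasAntidiagonal.antidiagonal n, B (r k.1) (r' k.2),
    fun k => M''.sum_mem fun i _ => hmem _ (hr _) _ (hr' _), fun n hn => ?_, fun n hn => ?_,
    fun t => ?_⟩
  -- Truncating the path at `N` alters only coefficients beyond `N`; these do not enter the Cauchy
  -- product up to order `N`.
  · refine Finset.sum_congr rfl fun k hk => ?_
    have := Finset.HasAntidiagonal.mem_antidiagonal.mp hk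
    rw [hf _ (by omega), hf' _ (by omega)]
  · refine Finset.sum_eq_zero fun k hk => ?_
    have := Finset.HasAntidiagonal.mem_antidiagonal.mp hk
    rcases lt_or_ge k.1 D with h | h
    · rw [hD' _ (by omega), map_zero]
    · rw [hD _ h, map_zero, LinearMap.zero_apply]
  · dsimp only
    rw [ht, ht', sum_range_bilin B hD hD']

theorem Expands.bilin {Y : QField c ι J F} (hX : Expands M X) (hY : Expands M' Y)
    (B : (Spacetime → E) →ₗ[ℝ] (Spacetime → F) →ₗ[ℝ] (Spacetime → G))
    (hmem : ∀ u ∈ M, ∀ v ∈ M', B u v ∈ M'') : Expands M'' fun Ψ => B (X Ψ) (Y Ψ) := fun Φ =>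
  let ⟨_, hf⟩ := hX Φ
  let ⟨_, hg⟩ := hY Φ
  ⟨_, hf.bilin hg B hmem⟩

theorem iteratedDeriv_sum_pow_smul (D l : ℕ) (v : ℕ → E) (hv : ∀ k ≥ D, v k = 0) :
    iteratedDeriv l (fun t : ℝ => ∑ k ∈ Finset.range D, t ^ k • v k) 0 = (l.factorial : ℝ) • v l := by
  have h1 : ∀ k, ContDiffAt ℝ l (fun t : ℝ => t ^ k) 0 := fun k => contDiffAt_id.pow k
  have h2 : iteratedDeriv l (fun t : ℝ => ∑ k ∈ Finset.range D, t ^ k • v k) 0 =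
      ∑ k ∈ Finset.range D, iteratedDeriv l (fun t : ℝ => t ^ k • v k) 0 := by
    simp only [← iteratedDerivWithin_univ]
    exact iteratedDerivWithin_fun_sum (Set.mem_univ _) uniqueDiffOn_univ
      fun k _ => ((h1 k).smul contDiffAt_const).contDiffWithinAt
  rw [h2]
  have h3 : ∀ k, iteratedDeriv l (fun t : ℝ => t ^ k • v k) 0 =
      if k = l then (l.factorial : ℝ) • v l else 0 := by
    intro k
    rw [iteratedDeriv_smul_const (h1 k), iteratedDeriv_pow]
    rcases lt_trichotomy k l with h | h | h
    · rw [if_neg h.ne, Nat.descFactorial_eq_zero_iff_lt.mpr h]; simp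
    · subst h; simp [Nat.descFactorial_self]
    · rw [if_neg h.ne', zero_pow (by omega)]; simp
  simp_rw [h3]
  rw [Finset.sum_ite_eq']
  split_ifs with h
  · rfl
  · rw [hv l (by simpa using h), smul_zero]

/-- Identifies the expansion coefficients with the Taylor coefficients used in `evalSeries`. In
particular they are determined by the field and the path. -/
theorem HasExp.iteratedDeriv_eq (h : HasExp M Φ X f) (l : ℕ) (x : Spacetime) :
    ((l.factorial : ℝ)⁻¹) • iteratedDeriv l
      (fun t : ℝ => X (∑ m ∈ Finset.range (l + 1), t ^ m • Φ m) x) 0 = f l x := by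
  obtain ⟨D, r, hr, hf, hD, ht⟩ := h l
  simp only [ht, Finset.sum_apply, Pi.smul_apply]
  rw [iteratedDeriv_sum_pow_smul D l (fun k => r k x) (fun k hk => by rw [hD k hk]; rfl), smul_smul,
    inv_mul_cancel₀ (by positivity), one_smul, hf l le_rfl]

theorem HasExp.zero_eq (h : HasExp M Φ X f) : f 0 = X (Φ 0) := by
  funext x
  rw [← h.iteratedDeriv_eq]
  simp

/-- The path `Φ + t δ`. -/
def linePath (Φ δ : Config c ι J) : ℕ → Config c ι J
  | 0 => Φ
  | 1 => δ
  | _ => 0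

/-- The derivative of a field in the direction of a configuration. -/
def lineVariation (X : QField c ι J E) (Ψ δ : Config c ι J) : Spacetime → E :=
  fun x => deriv (fun t : ℝ => X (Ψ + t • δ) x) 0

/-- A variation is the first-order coefficient along the line `Ψ + t δ`. Linearity and product rules
for variations are thus read off from expansions, with no differential calculus on the space of
configurations. -/
theorem HasExp.lineVariation_eq {Ψ δ : Config c ι J} (h : HasExp M (linePath Ψ δ) X f) :
    lineVariation X Ψ δ = f 1 := by
  funext x
  rw [← h.iteratedDeriv_eq 1 x]
  simp [iteratedDeriv_one, Finset.sum_range_succ, linePath, lineVariation]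

theorem Expands.hasExp_line {Ψ δ : Config c ι J} (h : Expands M X) :
    ∃ f, HasExp M (linePath Ψ δ) X f ∧ X Ψ = f 0 ∧ lineVariation X Ψ δ = f 1 := by
  obtain ⟨f, hf⟩ := h (linePath Ψ δ)
  exact ⟨f, hf, hf.zero_eq.symm, hf.lineVariation_eq⟩

theorem Expands.lineVariation_map (h : Expands M X) (T : (Spacetime → E) → Spacetime → F)
    (hadd : ∀ u ∈ M, ∀ v ∈ M, T (u + v) = T u + T v)
    (hsmul : ∀ (t : ℝ), ∀ u ∈ M, T (t • u) = t • T u) (Ψ δ : Config c ι J) :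
    lineVariation (fun Ψ => T (X Ψ)) Ψ δ = T (lineVariation X Ψ δ) := by
  obtain ⟨f, hf, -, h1⟩ := h.hasExp_line (Ψ := Ψ) (δ := δ)
  rw [(hf.map (M' := ⊤) T hadd hsmul fun _ _ => trivial).lineVariation_eq, h1]

theorem Expands.lineVariation_bilin {Y : QField c ι J F} (hX : Expands M X) (hY : Expands M' Y)
    (B : (Spacetime → E) →ₗ[ℝ] (Spacetime → F) →ₗ[ℝ] (Spacetime → G)) (Ψ δ : Config c ι J) :
    lineVariation (fun Ψ => B (X Ψ) (Y Ψ)) Ψ δ =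
      B (lineVariation X Ψ δ) (Y Ψ) + B (X Ψ) (lineVariation Y Ψ δ) := by
  obtain ⟨f, hf, h0, h1⟩ := hX.hasExp_line (Ψ := Ψ) (δ := δ)
  obtain ⟨g, hg, h0', h1'⟩ := hY.hasExp_line (Ψ := Ψ) (δ := δ)
  rw [(hf.bilin (M'' := ⊤) hg B fun _ _ _ _ => trivial).lineVariation_eq, h0, h1, h0', h1',
    Finset.Nat.antidiagonal_succ]
  simp [add_comm]

theorem Expands.lineVariation_add (hX : Expands M X) (hY : Expands M Y) (Ψ δ : Config c ι J) :
    lineVariation (X + Y) Ψ δ = lineVariation X Ψ δ + lineVariation Y Ψ δ := by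
  obtain ⟨f, hf, -, h1⟩ := hX.hasExp_line (Ψ := Ψ) (δ := δ)
  obtain ⟨g, hg, -, h1'⟩ := hY.hasExp_line (Ψ := Ψ) (δ := δ)
  rw [(hf.add hg).lineVariation_eq, h1, h1']
  rfl

theorem Expands.lineVariation_smul (hX : Expands M X) (t : ℝ) (Ψ δ : Config c ι J) :
    lineVariation (t • X) Ψ δ = t • lineVariation X Ψ δ :=
  hX.lineVariation_map (fun u => t • u) (fun _ _ _ _ => smul_add _ _ _)
    (fun _ _ _ => smul_comm _ _ _) Ψ δ

/-- A continuous linear functional of the configuration, expanded. -/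
theorem hasExp_of_linear (X : Config c ι J →ₗ[ℝ] (Spacetime → E)) (hX : ∀ Ψ, X Ψ ∈ M) :
    HasExp M Φ (fun Ψ => X Ψ) fun k => X (Φ k) := by
  intro N
  refine ⟨N + 1, fun k => if k ≤ N then X (Φ k) else 0, fun k => ?_, fun k hk => if_pos hk,
    fun k hk => if_neg (by omega), fun t => ?_⟩
  · dsimp only
    split_ifs
    exacts [hX _, M.zero_mem]
  · dsimp only
    rw [map_sum]
    refine Finset.sum_congr rfl fun k hk => ?_
    rw [map_smul, if_pos (by simpa [Nat.lt_succ_iff] using hk)]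

end Expansion

/-! ### The obstruction map on the spaces of scalar and vector fields -/

section OmegaYM

variable {c : StringFunction} {ι d J : Type*} [Fintype ι] [Fintype d] [Fintype J]
variable {E F G : Type*} [NormedAddCommGroup E] [NormedSpace ℝ E] [NormedAddCommGroup F]
  [NormedSpace ℝ F] [NormedAddCommGroup G] [NormedSpace ℝ G]
variable {M : Submodule ℝ (Spacetime → E)} {M' : Submodule ℝ (Spacetime → F)}
  {X Y : QField c ι J E} {T₀ : Distr ℂ} {α : QField c ι J (Fin 4 → ι → ℝ)}

theorem variation_eq_lineVariation {a : QField c ι J (Fin 4 → ι → ℝ)}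
    {p q : QField c ι J (J → Fin 4 → ℂ)} {Ψ : Config c ι J} (ha : a Ψ ∈ stringFunctions c _)
    (hp : p Ψ ∈ smoothFunctions _) (hq : q Ψ ∈ smoothFunctions _) :
    variation a p q X Ψ = lineVariation X Ψ (⟨a Ψ, ha⟩, ⟨p Ψ, hp⟩, ⟨q Ψ, hq⟩) := by
  funext x
  rw [variation, dif_pos ⟨ha, hp, hq⟩]
  rfl

/-- The direction `(a, 0, 0)` in the space of configurations. -/
def potentialDirection {a : Spacetime → Fin 4 → ι → ℝ} (ha : a ∈ stringFunctions c _) :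
    Config c ι J := (⟨a, ha⟩, 0, 0)

/-- The contraction with the potential is `α` itself, the kernel being a multiple of `δ`. -/
theorem omegaYM₁_eq (hT₀ : IsPropagator 0 T₀) (hα : ∀ Ψ, α Ψ ∈ stringFunctions c _)
    (X : QField c ι J E) (Ψ : Config c ι J) :
    omegaYM₁ T₀ α X Ψ = lineVariation X Ψ (potentialDirection (hα Ψ)) := by
  have h : contractionA T₀ α Ψ = α Ψ := contractionA_eq hT₀ (hα Ψ).1
  rw [omegaYM₁, variation_eq_lineVariation (by rw [h]; exact hα Ψ) (Submodule.zero_mem _)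
    (Submodule.zero_mem _)]
  congr 1
  refine Prod.ext (Subtype.ext h) rfl

theorem Expands.omegaYM₁_map (hT₀ : IsPropagator 0 T₀) (hα : ∀ Ψ, α Ψ ∈ stringFunctions c _)
    (h : Expands M X) (T : (Spacetime → E) → Spacetime → F)
    (hadd : ∀ u ∈ M, ∀ v ∈ M, T (u + v) = T u + T v)
    (hsmul : ∀ (t : ℝ), ∀ u ∈ M, T (t • u) = t • T u) :
    omegaYM₁ T₀ α (fun Ψ => T (X Ψ)) = fun Ψ => T (omegaYM₁ T₀ α X Ψ) := by
  funext Ψ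
  rw [omegaYM₁_eq hT₀ hα, omegaYM₁_eq hT₀ hα, h.lineVariation_map T hadd hsmul]

theorem Expands.omegaYM₁_bilin (hT₀ : IsPropagator 0 T₀) (hα : ∀ Ψ, α Ψ ∈ stringFunctions c _)
    {Y : QField c ι J F} (hX : Expands M X) (hY : Expands M' Y)
    (B : (Spacetime → E) →ₗ[ℝ] (Spacetime → F) →ₗ[ℝ] (Spacetime → G)) :
    omegaYM₁ T₀ α (fun Ψ => B (X Ψ) (Y Ψ)) =
      fun Ψ => B (omegaYM₁ T₀ α X Ψ) (Y Ψ) + B (X Ψ) (omegaYM₁ T₀ α Y Ψ) := by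
  funext Ψ
  rw [omegaYM₁_eq hT₀ hα, omegaYM₁_eq hT₀ hα, omegaYM₁_eq hT₀ hα, hX.lineVariation_bilin hY]

theorem Expands.omegaYM₁_add (hT₀ : IsPropagator 0 T₀) (hα : ∀ Ψ, α Ψ ∈ stringFunctions c _)
    (hX : Expands M X) (hY : Expands M Y) :
    omegaYM₁ T₀ α (X + Y) = omegaYM₁ T₀ α X + omegaYM₁ T₀ α Y := by
  funext Ψ
  rw [Pi.add_apply, omegaYM₁_eq hT₀ hα, omegaYM₁_eq hT₀ hα, omegaYM₁_eq hT₀ hα,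
    hX.lineVariation_add hY]

theorem Expands.omegaYM₁_smul (hT₀ : IsPropagator 0 T₀) (hα : ∀ Ψ, α Ψ ∈ stringFunctions c _)
    (hX : Expands M X) (t : ℝ) : omegaYM₁ T₀ α (t • X) = t • omegaYM₁ T₀ α X := by
  funext Ψ
  rw [Pi.smul_apply, omegaYM₁_eq hT₀ hα, omegaYM₁_eq hT₀ hα, hX.lineVariation_smul]

theorem omegaYM₁_const (hT₀ : IsPropagator 0 T₀) (hα : ∀ Ψ, α Ψ ∈ stringFunctions c _)
    (u : Spacetime → E) : omegaYM₁ T₀ α (fun _ => u) = (0 : QField c ι J E) := by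
  funext Ψ x
  rw [omegaYM₁_eq hT₀ hα]
  simp [lineVariation]

theorem omegaYM₁_zero_left (hT₀ : IsPropagator 0 T₀) (X : QField c ι J E) :
    omegaYM₁ T₀ 0 X = 0 := by
  funext Ψ x
  rw [omegaYM₁_eq (α := 0) hT₀ fun _ => Submodule.zero_mem _]
  have h0 : ∀ t : ℝ, t • (0 : Config c ι J) = 0 := fun t =>
    Prod.ext (smul_zero t) (Prod.ext (smul_zero t) (smul_zero t))
  have : (potentialDirection (J := J) (a := (0 : QField c ι J (Fin 4 → ι → ℝ)) Ψ)
      (Submodule.zero_mem (stringFunctions c (Fin 4 → ι → ℝ)))) = 0 := rfl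
  rw [this, lineVariation]
  simp_rw [h0]
  exact deriv_const _ _

/-- The potential as a linear functional of the configuration. -/
def gaugeFieldLin : Config c ι J →ₗ[ℝ] (Spacetime → Fin 4 → ι → ℝ) :=
  (stringFunctions c (Fin 4 → ι → ℝ)).subtype ∘ₗ LinearMap.fst ℝ _ _

theorem hasExp_gaugeField (Φ : ℕ → Config c ι J) :
    HasExp (stringFunctions c _) Φ gaugeField fun k => gaugeField (Φ k) :=
  hasExp_of_linear (M := stringFunctions c _) (gaugeFieldLin (c := c) (ι := ι) (J := J))
    fun Ψ => Ψ.1.2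

theorem expands_gaugeField :
    Expands (stringFunctions c _) (gaugeField : QField c ι J (Fin 4 → ι → ℝ)) :=
  fun Φ => ⟨_, hasExp_gaugeField Φ⟩

theorem omegaYM₁_gaugeField (hT₀ : IsPropagator 0 T₀) (hα : ∀ Ψ, α Ψ ∈ stringFunctions c _) :
    omegaYM₁ T₀ α gaugeField = α := by
  funext Ψ
  rw [omegaYM₁_eq hT₀ hα, (hasExp_gaugeField _).lineVariation_eq]
  rfl

/-- The pointwise bracket of a scalar function and a covector function. -/
def bracketLin (L : GaugeAlgebra ι d) : (Spacetime → ι → ℝ) →ₗ[ℝ] (Spacetime → Fin 4 → ι → ℝ) →ₗ[ℝ]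
    (Spacetime → Fin 4 → ι → ℝ) :=
  LinearMap.mk₂ ℝ (fun s v x μ => L.bracket (s x) (v x μ))
    (fun s s' v => by
      funext x μ e
      simp [GaugeAlgebra.bracket, mul_add, add_mul, Finset.sum_add_distrib])
    (fun t s v => by
      funext x μ e
      simp only [GaugeAlgebra.bracket, Pi.smul_apply, smul_eq_mul, Finset.mul_sum]
      exact Finset.sum_congr rfl fun a _ => Finset.sum_congr rfl fun b _ => by ring)
    (fun s v v' => by
      funext x μ e
      simp [GaugeAlgebra.bracket, mul_add, Finset.sum_add_distrib])
    (fun t s v => by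
      funext x μ e
      simp only [GaugeAlgebra.bracket, Pi.smul_apply, smul_eq_mul, Finset.mul_sum]
      exact Finset.sum_congr rfl fun a _ => Finset.sum_congr rfl fun b _ => by ring)

theorem bracket_apply_mem (L : GaugeAlgebra ι d) {u v : Spacetime → ι → ℝ}
    (hu : u ∈ stringFunctions c (ι → ℝ)) (hv : v ∈ stringFunctions c (ι → ℝ)) :
    (fun x => L.bracket (u x) (v x)) ∈ stringFunctions c (ι → ℝ) := by
  rw [mem_stringFunctions_pi] at hu hv ⊢
  intro e
  have : (fun x => L.bracket (u x) (v x) e) =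
      ∑ a, ∑ b, L.struct a b e • ((fun x => u x a) * fun x => v x b) := by
    funext x
    simp [GaugeAlgebra.bracket, mul_assoc]
  rw [this]
  exact Submodule.sum_mem _ fun a _ => Submodule.sum_mem _ fun b _ =>
    Submodule.smul_mem _ _ (mul_mem_stringFunctions (hu a).1 (hv b))

theorem bracketLin_mem (L : GaugeAlgebra ι d) {s : Spacetime → ι → ℝ}
    {v : Spacetime → Fin 4 → ι → ℝ} (hs : s ∈ stringFunctions c _) (hv : v ∈ stringFunctions c _) :
    bracketLin L s v ∈ stringFunctions c _ := by
  rw [mem_stringFunctions_pi] at hv ⊢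
  exact fun μ => bracket_apply_mem L hs (hv μ)

theorem stringInt_add {u v : Spacetime → Fin 4 → ι → ℝ} (hu : u ∈ stringFunctions c _)
    (hv : v ∈ stringFunctions c _) : stringInt c (u + v) = stringInt c u + stringInt c v := by
  simp only [mem_stringFunctions_pi] at hu hv
  funext x a
  simp only [Pi.add_apply, stringInt_apply]
  exact congrFun (congrArg Subtype.val ((scalarStringIntLin c).map_add
    (fun μ => ⟨_, hu μ a⟩) (fun μ => ⟨_, hv μ a⟩))) x

theorem stringInt_smul (t : ℝ) {u : Spacetime → Fin 4 → ι → ℝ} (hu : u ∈ stringFunctions c _) :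
    stringInt c (t • u) = t • stringInt c u := by
  simp only [mem_stringFunctions_pi] at hu
  funext x a
  simp only [Pi.smul_apply, stringInt_apply]
  exact congrFun (congrArg Subtype.val ((scalarStringIntLin c).map_smul t
    (fun μ => ⟨_, hu μ a⟩))) x

theorem stringInt_mem {u : Spacetime → Fin 4 → ι → ℝ} (hu : u ∈ stringFunctions c _) :
    stringInt c u ∈ stringFunctions c (ι → ℝ) := by
  simp only [mem_stringFunctions_pi] at hu ⊢
  intro a
  simp only [stringInt_apply]
  exact scalarStringInt_mem fun μ => hu μ a

/-- The gradient of a function. -/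
def gradFun (s : Spacetime → ι → ℝ) : Spacetime → Fin 4 → ι → ℝ := fun x ν => pderiv ν s x

theorem gradFun_add {u v : Spacetime → ι → ℝ} (hu : u ∈ stringFunctions c _)
    (hv : v ∈ stringFunctions c _) : gradFun (u + v) = gradFun u + gradFun v := by
  funext x ν
  exact congrFun (pderiv_add hu.1 hv.1 ν) x

theorem gradFun_smul (t : ℝ) {u : Spacetime → ι → ℝ} (hu : u ∈ stringFunctions c _) :
    gradFun (t • u) = t • gradFun u := by
  funext x ν
  exact congrFun (pderiv_const_smul hu.1 t ν) x

theorem gradFun_mem {u : Spacetime → ι → ℝ} (hu : u ∈ stringFunctions c _) :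
    gradFun u ∈ stringFunctions c _ := by
  rw [mem_stringFunctions_pi]
  exact fun ν => pderiv_mem_stringFunctions hu ν

theorem stringInt_gradFun {u : Spacetime → ι → ℝ} (hu : u ∈ stringFunctions c _) :
    stringInt c (gradFun u) = -u := by
  funext x a
  rw [stringInt_apply]
  have h : (fun μ y => gradFun u y μ a) = fun μ => pderiv μ (fun y => u y a) := by
    funext μ y
    exact pderiv_pi hu.1 μ y a
  rw [h, scalarStringInt_pderiv (mem_stringFunctions_pi.mp hu a)]
  rfl

variable {L : GaugeAlgebra ι d}

theorem expands_adVec {s : QField c ι J (ι → ℝ)} {v : QField c ι J (Fin 4 → ι → ℝ)}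
    (hs : Expands (stringFunctions c _) s) (hv : Expands (stringFunctions c _) v) :
    Expands (stringFunctions c _) (adVec L s v) :=
  hs.bilin hv (bracketLin L) fun _ hu _ hv => bracketLin_mem L hu hv

theorem expands_adList {l : List (QField c ι J (ι → ℝ))} {v : QField c ι J (Fin 4 → ι → ℝ)}
    (hl : ∀ s ∈ l, Expands (stringFunctions c _) s) (hv : Expands (stringFunctions c _) v) :
    Expands (stringFunctions c _) (adList L l v) := by
  induction l with
  | nil => exact hv
  | cons s l ih =>
    exact expands_adVec (hl s (by simp)) (ih fun t ht => hl t (List.mem_cons_of_mem _ ht))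

theorem expands_stringIntField {v : QField c ι J (Fin 4 → ι → ℝ)}
    (hv : Expands (stringFunctions c _) v) : Expands (stringFunctions c _) (stringIntField v) :=
  hv.map (stringInt c) (fun _ hu _ hv => stringInt_add hu hv) (fun t _ hu => stringInt_smul t hu)
    fun _ hu => stringInt_mem hu

theorem expands_gradField {s : QField c ι J (ι → ℝ)} (hs : Expands (stringFunctions c _) s) :
    Expands (stringFunctions c _) (gradField s) :=
  hs.map gradFun (fun _ hu _ hv => gradFun_add hu hv) (fun t _ hu => gradFun_smul t hu)
    fun _ hu => gradFun_mem hu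

/-- All these fields arise from the potential by linear operations and pointwise brackets, each of
which preserves polynomial dependence and the support condition. -/
theorem InS.expands {s : QField c ι J (ι → ℝ)} (h : InS L s) :
    Expands (stringFunctions c _) s := by
  induction h with
  | zero => exact expands_zero
  | add _ _ hs ht => exact hs.add ht
  | smul r _ hs => exact hs.smul r
  | potential l _ hl => exact expands_stringIntField (expands_adList hl expands_gaugeField)
  | gradient l s₀ _ _ _ hl hs =>
    exact expands_stringIntField (expands_adList hl (expands_gradField hs))

/-- The field depends on the gauge potential only. -/
def OnlyPotential {E : Type*} (X : QField c ι J E) : Prop :=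
  ∀ Φ Ψ : Config c ι J, Φ.1 = Ψ.1 → X Φ = X Ψ

theorem onlyPotential_adList {l : List (QField c ι J (ι → ℝ))} {v : QField c ι J (Fin 4 → ι → ℝ)}
    (hl : ∀ s ∈ l, OnlyPotential s) (hv : OnlyPotential v) : OnlyPotential (adList L l v) := by
  induction l with
  | nil => exact hv
  | cons s l ih =>
    intro Φ Ψ h
    have h1 := hl s (by simp) Φ Ψ h
    have h2 := ih (fun t ht => hl t (List.mem_cons_of_mem _ ht)) Φ Ψ h
    change bracketLin L (s Φ) (adList L l v Φ) = bracketLin L (s Ψ) (adList L l v Ψ)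
    rw [h1, h2]

/-- This is why the quark mediator annihilates the scalar fields and acts on `Yψ` through `ψ` alone.
-/
theorem InS.onlyPotential {s : QField c ι J (ι → ℝ)} (h : InS L s) : OnlyPotential s := by
  have hA : OnlyPotential (gaugeField : QField c ι J (Fin 4 → ι → ℝ)) :=
    fun Φ Ψ h => congrArg Subtype.val h
  induction h with
  | zero => exact fun _ _ _ => rfl
  | add _ _ hs ht => exact fun Φ Ψ h => congrArg₂ (· + ·) (hs Φ Ψ h) (ht Φ Ψ h)
  | smul r _ hs => exact fun Φ Ψ h => congrArg (r • ·) (hs Φ Ψ h)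
  | potential l _ hl =>
    exact fun Φ Ψ h => congrArg (stringInt c) (onlyPotential_adList hl hA Φ Ψ h)
  | gradient l s₀ _ _ _ hl hs =>
    exact fun Φ Ψ h => congrArg (stringInt c) (onlyPotential_adList hl
      (fun Φ Ψ h => congrArg gradFun (hs Φ Ψ h)) Φ Ψ h)

theorem InS.neg {s : QField c ι J (ι → ℝ)} (h : InS L s) : InS L (-s) := by
  have := h.smul (-1)
  rwa [neg_one_smul] at this

theorem adList_gaugeField_mem {l : List (QField c ι J (ι → ℝ))} (hl : ∀ s ∈ l, InS L s) :
    adList L l gaugeField ∈ spaceV (c := c) (J := J) L :=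
  Submodule.subset_span (Or.inl ⟨l, hl, rfl⟩)

theorem adList_gradField_mem {l : List (QField c ι J (ι → ℝ))} {s₀ : QField c ι J (ι → ℝ)}
    (hl : ∀ s ∈ l, InS L s) (hs : InS L s₀) : adList L l (gradField s₀) ∈ spaceV L :=
  Submodule.subset_span (Or.inr ⟨l, s₀, hl, hs, rfl⟩)

theorem gradField_mem {s : QField c ι J (ι → ℝ)} (hs : InS L s) : gradField s ∈ spaceV L :=
  adList_gradField_mem (l := []) (by simp) hs

theorem expands_of_mem_spaceV {v : QField c ι J (Fin 4 → ι → ℝ)} (hv : v ∈ spaceV L) :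
    Expands (stringFunctions c _) v := by
  induction hv using Submodule.span_induction with
  | mem v hv =>
    rcases hv with ⟨l, hl, rfl⟩ | ⟨l, s, hl, hs, rfl⟩
    · exact expands_adList (fun t ht => (hl t ht).expands) expands_gaugeField
    · exact expands_adList (fun t ht => (hl t ht).expands) (expands_gradField hs.expands)
  | zero => exact expands_zero
  | add _ _ _ _ h h' => exact h.add h'
  | smul t _ _ h => exact h.smul t

theorem adVec_mem_spaceV {s : QField c ι J (ι → ℝ)} (hs : InS L s)
    {v : QField c ι J (Fin 4 → ι → ℝ)} (hv : v ∈ spaceV L) : adVec L s v ∈ spaceV L := by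
  induction hv using Submodule.span_induction with
  | mem v hv =>
    have hl' : ∀ l : List (QField c ι J (ι → ℝ)), (∀ t ∈ l, InS L t) → ∀ t ∈ s :: l, InS L t := by
      intro l hl t ht
      rcases List.mem_cons.mp ht with rfl | h
      exacts [hs, hl t h]
    rcases hv with ⟨l, hl, rfl⟩ | ⟨l, s₀, hl, hs₀, rfl⟩
    · exact adList_gaugeField_mem (l := s :: l) (hl' l hl)
    · exact adList_gradField_mem (l := s :: l) (hl' l hl) hs₀
  | zero =>
    have : adVec L s (0 : QField c ι J (Fin 4 → ι → ℝ)) = 0 :=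
      funext fun Ψ => map_zero (bracketLin L (s Ψ))
    rw [this]; exact Submodule.zero_mem _
  | add v w _ _ h h' =>
    have : adVec L s (v + w) = adVec L s v + adVec L s w :=
      funext fun Ψ => map_add (bracketLin L (s Ψ)) _ _
    rw [this]; exact Submodule.add_mem _ h h'
  | smul t v _ h =>
    have : adVec L s (t • v) = t • adVec L s v :=
      funext fun Ψ => map_smul (bracketLin L (s Ψ)) _ _
    rw [this]; exact Submodule.smul_mem _ _ h

theorem stringIntField_gradField {s : QField c ι J (ι → ℝ)}
    (hs : Expands (stringFunctions c _) s) : stringIntField (gradField s) = -s :=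
  funext fun Ψ => stringInt_gradFun (hs.mem Ψ)

/-- The only generator of `𝒱^𝔤` not covered by the rules for `𝒮^𝔤` is a bare gradient, and its
string integral is `-s₀`. -/
theorem inS_stringIntField {v : QField c ι J (Fin 4 → ι → ℝ)} (hv : v ∈ spaceV L) :
    InS L (stringIntField v) := by
  induction hv using Submodule.span_induction with
  | mem v hv =>
    rcases hv with ⟨l, hl, rfl⟩ | ⟨l, s₀, hl, hs₀, rfl⟩
    · exact InS.potential l hl
    · rcases eq_or_ne l [] with rfl | h
      · change InS L (stringIntField (gradField s₀))
        rw [stringIntField_gradField hs₀.expands]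
        exact hs₀.neg
      · exact InS.gradient l s₀ h hl hs₀
  | zero =>
    have : stringIntField (0 : QField c ι J (Fin 4 → ι → ℝ)) = 0 := funext fun Ψ => by
      have := stringInt_smul (c := c) (ι := ι) 0 (Submodule.zero_mem _)
      rw [zero_smul, zero_smul] at this
      exact this
    rw [this]; exact InS.zero
  | add v w hv hw h h' =>
    have : stringIntField (v + w) = stringIntField v + stringIntField w :=
      funext fun Ψ => stringInt_add ((expands_of_mem_spaceV hv).mem Ψ)
        ((expands_of_mem_spaceV hw).mem Ψ)
    rw [this]; exact h.add h'
  | smul t v hv h =>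
    have : stringIntField (t • v) = t • stringIntField v :=
      funext fun Ψ => stringInt_smul t ((expands_of_mem_spaceV hv).mem Ψ)
    rw [this]; exact h.smul t

theorem mem_stringFunctions_of_mem_spaceV (hα : α ∈ spaceV L) (Ψ : Config c ι J) :
    α Ψ ∈ stringFunctions c _ := (expands_of_mem_spaceV hα).mem Ψ

theorem omegaYM₁_stringIntField (hT₀ : IsPropagator 0 T₀) (hα : ∀ Ψ, α Ψ ∈ stringFunctions c _)
    {v : QField c ι J (Fin 4 → ι → ℝ)} (hv : Expands (stringFunctions c _) v) :
    omegaYM₁ T₀ α (stringIntField v) = stringIntField (omegaYM₁ T₀ α v) :=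
  hv.omegaYM₁_map hT₀ hα (stringInt c) (fun _ hu _ hv => stringInt_add hu hv)
    fun t _ hu => stringInt_smul t hu

theorem omegaYM₁_gradField (hT₀ : IsPropagator 0 T₀) (hα : ∀ Ψ, α Ψ ∈ stringFunctions c _)
    {s : QField c ι J (ι → ℝ)} (hs : Expands (stringFunctions c _) s) :
    omegaYM₁ T₀ α (gradField s) = gradField (omegaYM₁ T₀ α s) :=
  hs.omegaYM₁_map hT₀ hα gradFun (fun _ hu _ hv => gradFun_add hu hv)
    fun t _ hu => gradFun_smul t hu

/-- By the product rule `ω_U` hits either one of the scalar factors, which stays in `𝒮^𝔤` by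
assumption, or the innermost vector field. -/
theorem omegaYM₁_adList_mem (hT₀ : IsPropagator 0 T₀) (hα : α ∈ spaceV L)
    {l : List (QField c ι J (ι → ℝ))} (hl : ∀ s ∈ l, InS L s)
    (hl' : ∀ s ∈ l, InS L (omegaYM₁ T₀ α s)) {v : QField c ι J (Fin 4 → ι → ℝ)}
    (hv : v ∈ spaceV L) (hv' : omegaYM₁ T₀ α v ∈ spaceV L) :
    adList L l v ∈ spaceV L ∧ omegaYM₁ T₀ α (adList L l v) ∈ spaceV L := by
  induction l with
  | nil => exact ⟨hv, hv'⟩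
  | cons s l ih =>
    obtain ⟨h1, h2⟩ := ih (fun t ht => hl t (List.mem_cons_of_mem _ ht))
      fun t ht => hl' t (List.mem_cons_of_mem _ ht)
    have hs := hl s (by simp)
    refine ⟨adVec_mem_spaceV hs h1, ?_⟩
    have : omegaYM₁ T₀ α (adList L (s :: l) v) =
        adVec L (omegaYM₁ T₀ α s) (adList L l v) + adVec L s (omegaYM₁ T₀ α (adList L l v)) :=
      hs.expands.omegaYM₁_bilin hT₀ (mem_stringFunctions_of_mem_spaceV hα)
        (expands_of_mem_spaceV h1) (bracketLin L)
    rw [this]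
    exact Submodule.add_mem _ (adVec_mem_spaceV (hl' s (by simp)) h1) (adVec_mem_spaceV hs h2)

/-- Induction along the construction of `𝒮^𝔤`: `ω_U` sends `A` to `α ∈ 𝒱^𝔤`, commutes with gradients
and string integration, and obeys the product rule on brackets. -/
theorem InS.omegaYM₁ (hT₀ : IsPropagator 0 T₀) (hα : α ∈ spaceV L) {s : QField c ι J (ι → ℝ)}
    (h : InS L s) : InS L (omegaYM₁ T₀ α s) := by
  have hα' := mem_stringFunctions_of_mem_spaceV hα
  have hA : gaugeField ∈ spaceV (c := c) (J := J) L :=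
    adList_gaugeField_mem (l := []) (by simp)
  have hA' : StringQFT.omegaYM₁ T₀ α gaugeField ∈ spaceV (c := c) (J := J) L := by
    rwa [omegaYM₁_gaugeField hT₀ hα']
  induction h with
  | zero =>
    have : StringQFT.omegaYM₁ T₀ α (0 : QField c ι J (ι → ℝ)) = 0 := omegaYM₁_const hT₀ hα' 0
    rw [this]; exact InS.zero
  | add hs ht h h' =>
    rw [hs.expands.omegaYM₁_add hT₀ hα' ht.expands]; exact h.add h'
  | smul r hs h => rw [hs.expands.omegaYM₁_smul hT₀ hα']; exact h.smul r
  | potential l hl hl' =>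
    obtain ⟨h1, h2⟩ := omegaYM₁_adList_mem hT₀ hα hl hl' hA hA'
    rw [omegaYM₁_stringIntField hT₀ hα' (expands_of_mem_spaceV h1)]
    exact inS_stringIntField h2
  | gradient l s₀ _ hl hs hl' hs' =>
    obtain ⟨h1, h2⟩ := omegaYM₁_adList_mem hT₀ hα hl hl' (gradField_mem hs)
      (by rw [omegaYM₁_gradField hT₀ hα' hs.expands]; exact gradField_mem hs')
    rw [omegaYM₁_stringIntField hT₀ hα' (expands_of_mem_spaceV h1)]
    exact inS_stringIntField h2

theorem omegaYM₁_mem_spaceV (hT₀ : IsPropagator 0 T₀) (hα : α ∈ spaceV L)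
    {v : QField c ι J (Fin 4 → ι → ℝ)} (hv : v ∈ spaceV L) : omegaYM₁ T₀ α v ∈ spaceV L := by
  have hα' := mem_stringFunctions_of_mem_spaceV hα
  induction hv using Submodule.span_induction with
  | mem v hv =>
    rcases hv with ⟨l, hl, rfl⟩ | ⟨l, s₀, hl, hs₀, rfl⟩
    · refine (omegaYM₁_adList_mem hT₀ hα hl (fun t ht => (hl t ht).omegaYM₁ hT₀ hα)
        (adList_gaugeField_mem (l := []) (by simp)) ?_).2
      exact (omegaYM₁_gaugeField hT₀ hα').symm ▸ hα
    · refine (omegaYM₁_adList_mem hT₀ hα hl (fun t ht => (hl t ht).omegaYM₁ hT₀ hα)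
        (gradField_mem hs₀) ?_).2
      rw [omegaYM₁_gradField hT₀ hα' hs₀.expands]
      exact gradField_mem (hs₀.omegaYM₁ hT₀ hα)
  | zero =>
    have : omegaYM₁ T₀ α (0 : QField c ι J (Fin 4 → ι → ℝ)) = 0 := omegaYM₁_const hT₀ hα' 0
    rw [this]; exact Submodule.zero_mem _
  | add v w hv hw h h' =>
    rw [(expands_of_mem_spaceV hv).omegaYM₁_add hT₀ hα' (expands_of_mem_spaceV hw)]
    exact Submodule.add_mem _ h h'
  | smul t v hv h =>
    rw [(expands_of_mem_spaceV hv).omegaYM₁_smul hT₀ hα']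
    exact Submodule.smul_mem _ _ h

theorem GaugeAlgebra.bracket_antisymm (L : GaugeAlgebra ι d) (u v : ι → ℝ) :
    L.bracket u v = -L.bracket v u := by
  funext e
  simp only [GaugeAlgebra.bracket, Pi.neg_apply, ← Finset.sum_neg_distrib]
  rw [Finset.sum_comm]
  refine Finset.sum_congr rfl fun b _ => Finset.sum_congr rfl fun a _ => ?_
  rw [L.antisymm b a]
  ring

theorem pderiv_bracket (L : GaugeAlgebra ι d) {u v : Spacetime → ι → ℝ} (hu : ContDiff ℝ ∞ u)
    (hv : ContDiff ℝ ∞ v) (ν : Fin 4) (x : Spacetime) :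
    pderiv ν (fun y => L.bracket (u y) (v y)) x =
      L.bracket (pderiv ν u x) (v x) + L.bracket (u x) (pderiv ν v x) := by
  have hu' := contDiff_pi.mp hu
  have hv' := contDiff_pi.mp hv
  have hb : ∀ e, (fun y => L.bracket (u y) (v y) e) =
      fun y => ∑ a, ∑ b, L.struct a b e * (u y a * v y b) := fun e => by
    funext y
    simp [GaugeAlgebra.bracket, mul_assoc]
  have hd : ∀ a b : ι, ContDiff ℝ ∞ ((fun y => u y a) * fun y => v y b) := fun a b =>
    (hu' a).mul (hv' b)
  have hsm : ContDiff ℝ ∞ fun y => L.bracket (u y) (v y) := by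
    refine contDiff_pi.mpr fun e => ?_
    rw [hb e]
    exact ContDiff.sum fun a _ => ContDiff.sum fun b _ => contDiff_const.mul (hd a b)
  funext e
  rw [pderiv_pi hsm, hb e, Pi.add_apply]
  have hs : (fun y => ∑ a, ∑ b, L.struct a b e * (u y a * v y b)) =
      fun y => ∑ p : ι × ι, (L.struct p.1 p.2 e • ((fun y => u y p.1) * fun y => v y p.2)) y := by
    funext y
    rw [Fintype.sum_prod_type]
    rfl
  rw [hs, pderiv, fderiv_fun_sum (fun p _ => ContDiff.differentiable
    (show ContDiff ℝ ∞ (L.struct p.1 p.2 e • _) from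
      contDiff_const.smul (hd p.1 p.2)) (by simp) x)]
  simp only [GaugeAlgebra.bracket]
  rw [ContinuousLinearMap.sum_apply, ← Finset.sum_add_distrib]
  rw [Fintype.sum_prod_type]
  refine Finset.sum_congr rfl fun a _ => ?_
  rw [← Finset.sum_add_distrib]
  refine Finset.sum_congr rfl fun b _ => ?_
  have := congrFun (pderiv_const_smul (hd a b) (L.struct a b e) ν) x
  rw [pderiv_mul (hu' a) (hv' b)] at this
  refine this.trans ?_
  simp only [Pi.smul_apply, Pi.add_apply, Pi.mul_apply, smul_eq_mul]
  rw [pderiv_pi hu, pderiv_pi hv]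
  ring

/-- The vector field `i[s, ∂t] - i[t, ∂s]` lies in `𝒱^𝔤` and is the gradient of `i[s, t]`; its
string integral is `-i[s, t]`. So `𝒮^𝔤` is a Lie algebra, although no brackets of scalars occur
among its generators. -/
theorem InS.bracket {s t : QField c ι J (ι → ℝ)} (hs : InS L s) (ht : InS L t) :
    InS L fun Ψ x => L.bracket (s Ψ x) (t Ψ x) := by
  have h1 := inS_stringIntField (Submodule.sub_mem _ (adVec_mem_spaceV hs (gradField_mem ht))
    (adVec_mem_spaceV ht (gradField_mem hs)))
  have h2 : adVec L s (gradField t) - adVec L t (gradField s) =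
      gradField fun Ψ x => L.bracket (s Ψ x) (t Ψ x) := by
    funext Ψ x ν
    refine Eq.symm ((pderiv_bracket L (hs.expands.mem Ψ).1 (ht.expands.mem Ψ).1 ν x).trans ?_)
    rw [L.bracket_antisymm (pderiv ν (s Ψ) x), neg_add_eq_sub]
    rfl
  have h3 : stringIntField (gradField fun Ψ x => L.bracket (s Ψ x) (t Ψ x)) =
      -(fun Ψ x => L.bracket (s Ψ x) (t Ψ x) : QField c ι J (ι → ℝ)) :=
    funext fun Ψ => stringInt_gradFun (bracket_apply_mem L (hs.expands.mem Ψ) (ht.expands.mem Ψ))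
  rw [h2, h3] at h1
  simpa using h1.neg

end OmegaYM

/-! ### The algebra generated by the components of the scalar fields -/

section FieldAlgebra

variable {c : StringFunction} {ι d J : Type*} [Fintype ι] [Fintype d] [Fintype J]
  {T₀ : Distr ℂ} {α : QField c ι J (Fin 4 → ι → ℝ)} {L : GaugeAlgebra ι d}

/-- A component of a scalar field. -/
def component (s : QField c ι J (ι → ℝ)) (a : ι) : QField c ι J ℂ := fun Ψ x => (s Ψ x a : ℂ)

/-- The algebra generated by the components of the fields in `𝒮^𝔤`. -/
def fieldAlgebra (L : GaugeAlgebra ι d) : Subalgebra ℂ (QField c ι J ℂ) :=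
  Algebra.adjoin ℂ {X | ∃ s a, InS L s ∧ X = component s a}

theorem component_mem {s : QField c ι J (ι → ℝ)} (hs : InS L s) (a : ι) :
    component s a ∈ fieldAlgebra (c := c) (J := J) L :=
  Algebra.subset_adjoin ⟨s, a, hs, rfl⟩

/-- A component of a function, as a complex-valued function. -/
def componentLin (a : ι) : (Spacetime → ι → ℝ) →ₗ[ℝ] (Spacetime → ℂ) where
  toFun u x := (u x a : ℂ)
  map_add' u v := by funext x; simp
  map_smul' t u := by funext x; simp

theorem componentLin_mem_smooth {u : Spacetime → ι → ℝ} (hu : ContDiff ℝ ∞ u) (a : ι) :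
    componentLin a u ∈ smoothFunctions ℂ :=
  Complex.ofRealCLM.contDiff.comp (contDiff_pi.mp hu a)

/-- The pointwise product of functions. -/
def mulLin : (Spacetime → ℂ) →ₗ[ℝ] (Spacetime → ℂ) →ₗ[ℝ] (Spacetime → ℂ) :=
  LinearMap.mk₂ ℝ (fun u v => u * v) (fun _ _ _ => add_mul _ _ _)
    (fun _ _ _ => smul_mul_assoc _ _ _) (fun _ _ _ => mul_add _ _ _)
    (fun _ _ _ => mul_smul_comm _ _ _)

theorem mulLin_mem_smooth {u v : Spacetime → ℂ} (hu : u ∈ smoothFunctions ℂ)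
    (hv : v ∈ smoothFunctions ℂ) : mulLin u v ∈ smoothFunctions ℂ :=
  ContDiff.mul (𝔸 := ℂ) (mem_smoothFunctions.mp hu) (mem_smoothFunctions.mp hv)

theorem const_mem_smooth {E : Type*} [NormedAddCommGroup E] [NormedSpace ℝ E] (z : E) :
    (fun _ => z) ∈ smoothFunctions E := mem_smoothFunctions.mpr contDiff_const

theorem InS.expands_component {s : QField c ι J (ι → ℝ)} (hs : InS L s) (a : ι) :
    Expands (smoothFunctions ℂ) (component s a) :=
  hs.expands.mapLin (componentLin a) fun _ hu => componentLin_mem_smooth hu.1 a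

theorem expands_of_mem_fieldAlgebra {X : QField c ι J ℂ} (hX : X ∈ fieldAlgebra L) :
    Expands (smoothFunctions ℂ) X := by
  induction hX using Algebra.adjoin_induction with
  | mem X hX =>
    obtain ⟨s, a, hs, rfl⟩ := hX
    exact hs.expands_component a
  | algebraMap z => exact fun Φ => ⟨_, hasExp_const (const_mem_smooth z)⟩
  | add X Y _ _ hX hY => exact hX.add hY
  | mul X Y _ _ hX hY => exact hX.bilin hY mulLin fun u hu v hv => mulLin_mem_smooth hu hv

theorem onlyPotential_of_mem_fieldAlgebra {X : QField c ι J ℂ} (hX : X ∈ fieldAlgebra L) :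
    OnlyPotential X := by
  induction hX using Algebra.adjoin_induction with
  | mem X hX =>
    obtain ⟨s, a, hs, rfl⟩ := hX
    exact fun Φ Ψ h => congrArg (componentLin a) (hs.onlyPotential Φ Ψ h)
  | algebraMap z => exact fun _ _ _ => rfl
  | add X Y _ _ hX hY => exact fun Φ Ψ h => congrArg₂ (· + ·) (hX Φ Ψ h) (hY Φ Ψ h)
  | mul X Y _ _ hX hY => exact fun Φ Ψ h => congrArg₂ (· * ·) (hX Φ Ψ h) (hY Φ Ψ h)

theorem omegaYM₁_component (hT₀ : IsPropagator 0 T₀) (hα : ∀ Ψ, α Ψ ∈ stringFunctions c _)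
    {s : QField c ι J (ι → ℝ)} (hs : InS L s) (a : ι) :
    omegaYM₁ T₀ α (component s a) = component (omegaYM₁ T₀ α s) a :=
  hs.expands.omegaYM₁_map hT₀ hα (componentLin a) (fun _ _ _ _ => map_add _ _ _)
    fun _ _ _ => map_smul _ _ _

theorem omegaYM₁_mul (hT₀ : IsPropagator 0 T₀) (hα : ∀ Ψ, α Ψ ∈ stringFunctions c _)
    {M : Submodule ℝ (Spacetime → ℂ)} {X Y : QField c ι J ℂ} (hX : Expands M X)
    (hY : Expands M Y) :
    omegaYM₁ T₀ α (X * Y) = omegaYM₁ T₀ α X * Y + X * omegaYM₁ T₀ α Y :=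
  hX.omegaYM₁_bilin hT₀ hα hY mulLin

theorem omegaYM₁_mem_fieldAlgebra (hT₀ : IsPropagator 0 T₀) (hα : α ∈ spaceV L)
    {X : QField c ι J ℂ} (hX : X ∈ fieldAlgebra L) : omegaYM₁ T₀ α X ∈ fieldAlgebra L := by
  have hα' := mem_stringFunctions_of_mem_spaceV hα
  induction hX using Algebra.adjoin_induction with
  | mem X hX =>
    obtain ⟨s, a, hs, rfl⟩ := hX
    rw [omegaYM₁_component hT₀ hα' hs]
    exact component_mem (hs.omegaYM₁ hT₀ hα) a
  | algebraMap z =>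
    have : omegaYM₁ T₀ α (algebraMap ℂ (QField c ι J ℂ) z) = 0 := omegaYM₁_const hT₀ hα' _
    rw [this]; exact Subalgebra.zero_mem _
  | add X Y hX hY h h' =>
    rw [(expands_of_mem_fieldAlgebra hX).omegaYM₁_add hT₀ hα' (expands_of_mem_fieldAlgebra hY)]
    exact Subalgebra.add_mem _ h h'
  | mul X Y hX hY ihX ihY =>
    rw [omegaYM₁_mul hT₀ hα' (expands_of_mem_fieldAlgebra hX) (expands_of_mem_fieldAlgebra hY)]
    exact Subalgebra.add_mem _ (Subalgebra.mul_mem _ ihX hY) (Subalgebra.mul_mem _ hX ihY)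

/-- The obstruction map as a derivation of the field algebra. -/
def omegaDerivation (hT₀ : IsPropagator 0 T₀) (hα : α ∈ spaceV L) :
    Derivation ℂ (fieldAlgebra (c := c) (J := J) L) (fieldAlgebra (c := c) (J := J) L) :=
  Derivation.mk'
    { toFun := fun X => ⟨omegaYM₁ T₀ α X, omegaYM₁_mem_fieldAlgebra hT₀ hα X.2⟩
      map_add' := fun X Y => Subtype.ext ((expands_of_mem_fieldAlgebra X.2).omegaYM₁_add hT₀
        (mem_stringFunctions_of_mem_spaceV hα) (expands_of_mem_fieldAlgebra Y.2))
      map_smul' := fun z X => Subtype.ext ((expands_of_mem_fieldAlgebra X.2).omegaYM₁_map hT₀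
        (mem_stringFunctions_of_mem_spaceV hα) (fun u => z • u) (fun _ _ _ _ => smul_add _ _ _)
        fun _ _ _ => smul_comm _ _ _) }
    fun X Y => Subtype.ext ((omegaYM₁_mul hT₀ (mem_stringFunctions_of_mem_spaceV hα)
        (expands_of_mem_fieldAlgebra X.2) (expands_of_mem_fieldAlgebra Y.2)).trans (by
          rw [add_comm]; exact congrArg₂ (· + ·) rfl (mul_comm _ _)))

end FieldAlgebra

/-! ### Series of operators acting on series -/

section Action

open PowerSeries

variable {A : Type*} [Ring A] [Algebra ℝ A]

/-- The action of a power series of operators on a power series. -/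
def act (P : PowerSeries (Module.End ℝ A)) (Y : PowerSeries A) : PowerSeries A :=
  PowerSeries.mk fun n => ∑ k ∈ Finset.HasAntidiagonal.antidiagonal n, coeff k.1 P (coeff k.2 Y)

theorem coeff_act (P : PowerSeries (Module.End ℝ A)) (Y : PowerSeries A) (n : ℕ) :
    coeff n (act P Y) =
      ∑ k ∈ Finset.HasAntidiagonal.antidiagonal n, coeff k.1 P (coeff k.2 Y) := by simp [act]

theorem sum_antidiagonal_assoc {V : Type*} [AddCommMonoid V] (f : ℕ → ℕ → ℕ → V) (n : ℕ) :
    ∑ k ∈ Finset.HasAntidiagonal.antidiagonal n,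
        ∑ l ∈ Finset.HasAntidiagonal.antidiagonal k.1, f l.1 l.2 k.2 =
      ∑ k ∈ Finset.HasAntidiagonal.antidiagonal n,
        ∑ l ∈ Finset.HasAntidiagonal.antidiagonal k.2, f k.1 l.1 l.2 := by
  simp only [Finset.sum_sigma']
  apply Finset.sum_nbij' (fun ⟨⟨_i, j⟩, ⟨k, l⟩⟩ ↦ ⟨(k, l + j), (l, j)⟩)
    (fun ⟨⟨i, _j⟩, ⟨k, l⟩⟩ ↦ ⟨(i + k, l), (i, k)⟩) <;>
    simp only [Finset.mem_sigma, Finset.HasAntidiagonal.mem_antidiagonal] <;> rintro ⟨⟨i, j⟩, k, l⟩ h <;>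
    simp only at h ⊢ <;> grind

theorem act_mul (P Q : PowerSeries (Module.End ℝ A)) (Y : PowerSeries A) :
    act (P * Q) Y = act P (act Q Y) := by
  ext n
  simp only [coeff_act, coeff_mul, LinearMap.sum_apply, map_sum]
  exact sum_antidiagonal_assoc (fun i j k => coeff i P (coeff j Q (coeff k Y))) n

theorem act_add (P Q : PowerSeries (Module.End ℝ A)) (Y : PowerSeries A) :
    act (P + Q) Y = act P Y + act Q Y := by
  ext n
  simp [coeff_act, Finset.sum_add_distrib]

theorem act_sub (P Q : PowerSeries (Module.End ℝ A)) (Y : PowerSeries A) :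
    act (P - Q) Y = act P Y - act Q Y := by
  ext n
  simp [coeff_act, Finset.sum_sub_distrib]

theorem act_smul (r : ℝ) (P : PowerSeries (Module.End ℝ A)) (Y : PowerSeries A) :
    act (r • P) Y = r • act P Y := by
  ext n
  simp [coeff_act, Finset.smul_sum]

theorem act_add_right (P : PowerSeries (Module.End ℝ A)) (Y Z : PowerSeries A) :
    act P (Y + Z) = act P Y + act P Z := by
  ext n
  simp [coeff_act, Finset.sum_add_distrib]

theorem act_one (Y : PowerSeries A) : act 1 Y = Y := by
  ext n
  rw [coeff_act, Finset.sum_eq_single (0, n)]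
  · simp
  · intro k hk hne
    have h : k.1 ≠ 0 := fun h => hne (Prod.ext h (by
      have := Finset.HasAntidiagonal.mem_antidiagonal.mp hk
      simp only; omega))
    simp [coeff_one, h]
  · intro h
    exact absurd (Finset.HasAntidiagonal.mem_antidiagonal.mpr (by simp)) h

theorem OrdGE.act {m n : ℕ} {P : PowerSeries (Module.End ℝ A)} (hP : OrdGE m P)
    {Y : PowerSeries A} (hY : OrdGE n Y) : OrdGE (m + n) (act P Y) := by
  intro k hk
  rw [coeff_act]
  refine Finset.sum_eq_zero fun ij hij => ?_
  have := Finset.HasAntidiagonal.mem_antidiagonal.mp hij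
  rcases lt_or_ge ij.1 m with h | h
  · simp [hP _ h]
  · simp [hY ij.2 (by omega)]

theorem act_pow (P : PowerSeries (Module.End ℝ A)) (Y : PowerSeries A) (j : ℕ) :
    act (P ^ j) Y = (act P)^[j] Y := by
  induction j with
  | zero => simp [act_one]
  | succ j ih => rw [pow_succ', act_mul, ih, Function.iterate_succ_apply']

/-- `e^T Y` for an order-raising operation `T`. -/
def seriesExp (T : PowerSeries A → PowerSeries A) (Y : PowerSeries A) : PowerSeries A :=
  fsum fun j => ((j.factorial : ℝ)⁻¹) • T^[j] Y

/-- Products of operator series act as compositions, so the exponential of a series of operators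
acts by the order-truncated sum that also defines `expMap` and `expMatrixMap`. -/
theorem act_pexp {P : PowerSeries (Module.End ℝ A)} (hP : OrdGE 1 P) (Y : PowerSeries A) :
    act (pexp P) Y = seriesExp (act P) Y := by
  ext n
  rw [seriesExp, coeff_fsum]
  simp_rw [← act_pow]
  have h : ∀ k ≤ n, coeff k (pexp P) =
      ∑ j ∈ Finset.range (n + 1), coeff k (((j.factorial : ℝ)⁻¹) • P ^ j) := fun k hk =>
    coeff_fsum_of_lt (ordGE_pexp_term hP) (by omega)
  rw [coeff_act]
  have h2 : ∀ j, coeff n (((j.factorial : ℝ)⁻¹) • act (P ^ j) Y) =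
      ∑ k ∈ Finset.HasAntidiagonal.antidiagonal n,
        (coeff k.1 (((j.factorial : ℝ)⁻¹) • P ^ j) : Module.End ℝ A) (coeff k.2 Y) := fun j => by
    rw [← act_smul, coeff_act]
  simp_rw [h2]
  rw [Finset.sum_comm]
  refine Finset.sum_congr rfl fun k hk => ?_
  have := Finset.HasAntidiagonal.mem_antidiagonal.mp hk
  rw [h k.1 (by omega), LinearMap.sum_apply]

/-- Right multiplication by a power series, as a power series of operators. -/
def rightMul (b : PowerSeries A) : PowerSeries (Module.End ℝ A) :=
  PowerSeries.mk fun n => LinearMap.mulRight ℝ (coeff n b)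

theorem coeff_rightMul (b : PowerSeries A) (n : ℕ) :
    coeff n (rightMul b) = LinearMap.mulRight ℝ (coeff n b) := by simp [rightMul]

theorem act_rightMul (b Y : PowerSeries A) : act (rightMul b) Y = Y * b := by
  ext n
  rw [coeff_act, coeff_mul, ← Finset.Nat.sum_antidiagonal_swap]
  simp [coeff_rightMul]

theorem OrdGE.rightMul {n : ℕ} {b : PowerSeries A} (hb : OrdGE n b) :
    OrdGE n (rightMul b) := fun m hm => by rw [coeff_rightMul, hb m hm]; ext; simp

theorem rightMul_sub (b b' : PowerSeries A) : rightMul (b - b') = rightMul b - rightMul b' := by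
  ext n x
  simp [coeff_rightMul, mul_sub]

theorem act_pexp_rightMul {b : PowerSeries A} (hb : OrdGE 1 b) (Y : PowerSeries A) :
    act (pexp (rightMul b)) Y = Y * pexp b := by
  rw [act_pexp hb.rightMul]
  have h : ∀ j, (act (rightMul b))^[j] Y = Y * b ^ j := by
    intro j
    induction j with
    | zero => simp
    | succ j ih => rw [Function.iterate_succ_apply', ih, act_rightMul, pow_succ, mul_assoc]
  ext n
  rw [seriesExp, coeff_fsum, coeff_mul]
  have h' : ∀ k ≤ n, coeff k (pexp b) =
      ∑ j ∈ Finset.range (n + 1), coeff k (((j.factorial : ℝ)⁻¹) • b ^ j) := fun k hk =>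
    coeff_fsum_of_lt (ordGE_pexp_term hb) (by omega)
  simp_rw [h, ← mul_smul_comm, coeff_mul]
  rw [Finset.sum_comm]
  refine Finset.sum_congr rfl fun k hk => ?_
  have := Finset.HasAntidiagonal.mem_antidiagonal.mp hk
  rw [h' k.2 (by omega), Finset.mul_sum]

/-- The Baker-Campbell-Hausdorff theorem for derivations and right multiplications. -/
theorem exists_act_pexp_eq {N : Submodule ℝ A} (hN : IsLieClosed N)
    {D : PowerSeries (Module.End ℝ A)} (hD1 : OrdGE 1 D)
    (hD : ∀ n x y, coeff n D (x * y) = coeff n D x * y + x * coeff n D y)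
    (hDN : ∀ n, ∀ x ∈ N, coeff n D x ∈ N) {p : PowerSeries A} (hp1 : OrdGE 1 p)
    (hp : CoeffsIn N p) :
    ∃ b, OrdGE 1 b ∧ CoeffsIn N b ∧
      ∀ Y, act (pexp (D + rightMul b)) Y = act (pexp D) Y * pexp p := by
  -- The right multiplications by `N`, the ideal of the argument: `[T, R_x] = R_{T x}` for a
  -- derivation `T` and `[R_x, R_y] = R_{yx - xy}`. Together with the derivations that preserve `N`
  -- they span a Lie algebra.
  let I : Submodule ℝ (Module.End ℝ A) :=
    { carrier := {T | ∃ x ∈ N, T = LinearMap.mulRight ℝ x}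
      zero_mem' := ⟨0, N.zero_mem, by ext; simp⟩
      add_mem' := by
        rintro _ _ ⟨x, hx, rfl⟩ ⟨y, hy, rfl⟩
        exact ⟨x + y, N.add_mem hx hy, by ext; simp [mul_add]⟩
      smul_mem' := by
        rintro r _ ⟨x, hx, rfl⟩
        exact ⟨r • x, N.smul_mem r hx, by ext; simp⟩ }
  let Der : Submodule ℝ (Module.End ℝ A) :=
    { carrier := {T | (∀ x y, T (x * y) = T x * y + x * T y) ∧ ∀ x ∈ N, T x ∈ N}
      zero_mem' := ⟨by simp, by simp⟩
      add_mem' := by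
        rintro T T' ⟨h1, h2⟩ ⟨h1', h2'⟩
        refine ⟨fun x y => ?_, fun x hx => N.add_mem (h2 x hx) (h2' x hx)⟩
        simp only [LinearMap.add_apply, h1, h1', add_mul, mul_add]
        abel
      smul_mem' := by
        rintro r T ⟨h1, h2⟩
        refine ⟨fun x y => ?_, fun x hx => N.smul_mem r (h2 x hx)⟩
        simp [h1] }
  have hDerI : ∀ T ∈ Der, ∀ U ∈ I, T * U - U * T ∈ I := by
    rintro T ⟨h1, h2⟩ _ ⟨x, hx, rfl⟩
    refine ⟨T x, h2 x hx, ?_⟩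
    ext y
    simp [h1]
  have hII : ∀ T ∈ I, ∀ U ∈ I, T * U - U * T ∈ I := by
    rintro _ ⟨x, hx, rfl⟩ _ ⟨y, hy, rfl⟩
    refine ⟨y * x - x * y, hN y hy x hx, ?_⟩
    ext z
    simp [mul_sub, mul_assoc]
  have hDD : ∀ T ∈ Der, ∀ U ∈ Der, T * U - U * T ∈ Der := by
    rintro T ⟨h1, h2⟩ U ⟨h1', h2'⟩
    refine ⟨fun x y => ?_, fun x hx => N.sub_mem (h2 _ (h2' x hx)) (h2' _ (h2 x hx))⟩
    simp only [LinearMap.sub_apply, Module.End.mul_apply, h1, h1', map_add, sub_mul, mul_sub]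
    abel
  have hI : ∀ T ∈ Der ⊔ I, ∀ U ∈ I, T * U - U * T ∈ I := by
    intro T hT U hU
    obtain ⟨T₁, hT₁, T₂, hT₂, rfl⟩ := Submodule.mem_sup.mp hT
    have e : (T₁ + T₂) * U - U * (T₁ + T₂) = (T₁ * U - U * T₁) + (T₂ * U - U * T₂) := by
      noncomm_ring
    rw [e]
    exact I.add_mem (hDerI _ hT₁ _ hU) (hII _ hT₂ _ hU)
  have hS : IsLieClosed (Der ⊔ I) := by
    intro T hT U hU
    obtain ⟨U₁, hU₁, U₂, hU₂, rfl⟩ := Submodule.mem_sup.mp hU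
    have e : T * (U₁ + U₂) - (U₁ + U₂) * T = (T * U₁ - U₁ * T) + (T * U₂ - U₂ * T) := by
      noncomm_ring
    rw [e]
    refine Submodule.add_mem _ ?_ (le_sup_right (a := Der) (hI T hT U₂ hU₂))
    obtain ⟨T₁, hT₁, T₂, hT₂, rfl⟩ := Submodule.mem_sup.mp hT
    have e : (T₁ + T₂) * U₁ - U₁ * (T₁ + T₂) = (T₁ * U₁ - U₁ * T₁) - (U₁ * T₂ - T₂ * U₁) := by
      noncomm_ring
    rw [e]
    exact Submodule.sub_mem _ (le_sup_left (b := I) (hDD _ hT₁ _ hU₁))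
      (le_sup_right (a := Der) (hDerI _ hU₁ _ hT₂))
  obtain ⟨Z, hZ1, hZI, hZ⟩ := exists_pexp_add_eq_mul hS le_sup_right hI hD1 hp1.rightMul
    (fun n => le_sup_left (b := I) (show coeff n D ∈ Der from ⟨hD n, hDN n⟩))
    (fun n => show coeff n (rightMul p) ∈ I from ⟨_, hp n, coeff_rightMul p n⟩)
  choose b hb hb' using hZI
  have hZb : Z = rightMul (PowerSeries.mk b) := by
    ext1 n
    rw [coeff_rightMul, coeff_mk, hb' n]
  refine ⟨PowerSeries.mk b, ordGE_one_iff.mpr ?_, fun n => by simpa using hb n, fun Y => ?_⟩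
  · have h := hb' 0
    rw [ordGE_one_iff.mp hZ1] at h
    have := LinearMap.congr_fun h 1
    simpa using this.symm
  · rw [← hZb, hZ, act_mul, act_pexp_rightMul hp1]

theorem act_one_eq_zero {D : PowerSeries (Module.End ℝ A)}
    (hD : ∀ n x y, coeff n D (x * y) = coeff n D x * y + x * coeff n D y) :
    act D 1 = 0 := by
  have h : ∀ n, coeff n D 1 = 0 := fun n => by simpa using hD n 1 1
  ext n
  rw [coeff_act]
  refine Finset.sum_eq_zero fun k _ => ?_
  rw [coeff_one]
  split_ifs <;> simp [h]

/-- Derivations annihilate `1`, so only the zeroth term of the exponential survives. -/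
theorem act_pexp_one {D : PowerSeries (Module.End ℝ A)} (hD1 : OrdGE 1 D)
    (hD : ∀ n x y, coeff n D (x * y) = coeff n D x * y + x * coeff n D y) :
    act (pexp D) 1 = 1 := by
  rw [act_pexp hD1, seriesExp]
  have h : ∀ j, (act D)^[j + 1] (1 : PowerSeries A) = 0 := by
    intro j
    rw [← act_pow, pow_succ, act_mul, act_one_eq_zero hD]
    ext n
    simp [coeff_act]
  ext n
  rw [coeff_fsum, Finset.sum_range_succ']
  simp [h]

/-- The generator of a right multiplication is determined by the exponential applied to `1`. -/
theorem eq_of_act_pexp_one_eq {D : PowerSeries (Module.End ℝ A)} (hD1 : OrdGE 1 D)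
    {b b' : PowerSeries A} (hb : OrdGE 1 b) (hb' : OrdGE 1 b')
    (h : act (pexp (D + rightMul b)) 1 = act (pexp (D + rightMul b')) 1) : b = b' := by
  have key : ∀ n, OrdGE n (b - b') := by
    intro n
    induction n with
    | zero => exact ordGE_zero _
    | succ n ih =>
      have h1 : OrdGE n ((D + rightMul b) - (D + rightMul b')) := by
        rw [add_sub_add_left_eq_sub, ← rightMul_sub]
        exact ih.rightMul
      have h2 := ((pexp_sub_pexp_ordGE (hD1.add hb.rightMul) (hD1.add hb'.rightMul) h1).act
        (ordGE_zero (1 : PowerSeries A))).neg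
      -- Since the exponentials agree on `1` and `D` cancels, the nonlinear parts applied to `1`
      -- differ by `b' - b`; they agree to one order more than the generators do.
      have e : -act (pexp (D + rightMul b) - (D + rightMul b) -
          (pexp (D + rightMul b') - (D + rightMul b'))) 1 = b - b' := by
        simp only [act_sub, act_add, h, act_rightMul, one_mul]
        abel
      rwa [e] at h2
  ext n
  have := key (n + 1) n (by omega)
  rwa [map_sub, sub_eq_zero] at this

theorem OrdGE.coeff_two_mul {p q : PowerSeries A} (hp : OrdGE 1 p) (hq : OrdGE 1 q) :
    coeff 2 (p * q) = coeff 1 p * coeff 1 q := by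
  have h := ordGE_one_iff.mp hp
  have h' := ordGE_one_iff.mp hq
  simp only [coeff_mul, Finset.Nat.antidiagonal_succ]
  simp [h, h']

theorem OrdGE.coeff_three_mul {p q : PowerSeries A} (hp : OrdGE 1 p) (hq : OrdGE 1 q) :
    coeff 3 (p * q) = coeff 1 p * coeff 2 q + coeff 2 p * coeff 1 q := by
  have h := ordGE_one_iff.mp hp
  have h' := ordGE_one_iff.mp hq
  simp only [coeff_mul, Finset.Nat.antidiagonal_succ]
  simp [h, h']

theorem OrdGE.coeff_two_act {P : PowerSeries (Module.End ℝ A)} {q : PowerSeries A}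
    (hp : OrdGE 1 P) (hq : OrdGE 1 q) : coeff 2 (StringQFT.act P q) = coeff 1 P (coeff 1 q) := by
  have h := ordGE_one_iff.mp hp
  have h' := ordGE_one_iff.mp hq
  simp only [coeff_act, Finset.Nat.antidiagonal_succ]
  simp [h, h']

theorem OrdGE.coeff_three_act {P : PowerSeries (Module.End ℝ A)} {q : PowerSeries A}
    (hp : OrdGE 1 P) (hq : OrdGE 1 q) : coeff 3 (StringQFT.act P q) =
      coeff 1 P (coeff 2 q) + coeff 2 P (coeff 1 q) := by
  have h := ordGE_one_iff.mp hp
  have h' := ordGE_one_iff.mp hq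
  simp only [coeff_act, Finset.Nat.antidiagonal_succ]
  simp [h, h']

theorem act_mul_right {D : PowerSeries (Module.End ℝ A)}
    (hD : ∀ n x y, coeff n D (x * y) = coeff n D x * y + x * coeff n D y) (Y Z : PowerSeries A) :
    act D (Y * Z) = act D Y * Z + Y * act D Z := by
  ext n
  simp only [coeff_act, coeff_mul, map_sum, hD, Finset.sum_add_distrib, map_add, Finset.sum_mul,
    Finset.mul_sum]
  congr 1
  · exact (sum_antidiagonal_assoc (fun i j k => coeff i D (coeff j Y) * coeff k Z) n).symm
  · rw [← sum_antidiagonal_assoc (fun i j k => coeff j Y * coeff i D (coeff k Z)) n,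
      ← sum_antidiagonal_assoc (fun i j k => coeff i Y * coeff j D (coeff k Z)) n]
    refine Finset.sum_congr rfl fun k _ => ?_
    rw [← Finset.Nat.sum_antidiagonal_swap]
    rfl

/-- The relative Baker-Campbell-Hausdorff series up to third order. -/
theorem coeff_eq_of_act_pexp_one {D : PowerSeries (Module.End ℝ A)} (hD1 : OrdGE 1 D)
    (hD : ∀ n x y, coeff n D (x * y) = coeff n D x * y + x * coeff n D y)
    {b p : PowerSeries A} (hb : OrdGE 1 b) (hp : OrdGE 1 p)
    (h : act (pexp (D + rightMul b)) 1 = pexp p) {n : ℕ} (hn : n ≤ 3) :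
    coeff n b = coeff n (p - (1 / 2 : ℝ) • act D p +
      (1 / 12 : ℝ) • ((p * act D p - act D p * p) + act D (act D p))) := by
  have hDp : OrdGE 2 (act D p) := hD1.act hp
  have hDDp : OrdGE 3 (act D (act D p)) := hD1.act hDp
  have hDb : OrdGE 2 (act D b) := hD1.act hb
  rw [act_pexp (hD1.add hb.rightMul)] at h
  -- The first three iterates on `1`, simplified by `D 1 = 0`. Comparison with `e^p` at orders `1`,
  -- `2`, `3` gives the coefficients of `b` successively.
  have i1 : (act (D + rightMul b))^[1] (1 : PowerSeries A) = b := by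
    simp [act_add, act_one_eq_zero hD, act_rightMul]
  have i2 : (act (D + rightMul b))^[2] (1 : PowerSeries A) = act D b + b * b := by
    rw [Function.iterate_succ_apply', i1, act_add, act_rightMul]
  have i3 : (act (D + rightMul b))^[3] (1 : PowerSeries A) =
      act D (act D b) + (act D b * b + b * act D b) + (act D b + b * b) * b := by
    rw [Function.iterate_succ_apply', i2, act_add, act_rightMul, act_add_right, act_mul_right hD]
  have h0 := ordGE_one_iff.mp hb
  have h0' := ordGE_one_iff.mp hp
  have e1 : coeff 1 b = coeff 1 p := by
    have := congrArg (coeff 1) h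
    simp only [seriesExp, coeff_fsum, coeff_pexp, Finset.sum_range_succ, i1, Finset.sum_range_zero]
      at this
    simpa [coeff_one] using this
  have e2 : coeff 2 b = coeff 2 p - (1 / 2 : ℝ) • coeff 1 D (coeff 1 p) := by
    have := congrArg (coeff 2) h
    simp only [seriesExp, coeff_fsum, coeff_pexp, Finset.sum_range_succ, i1, i2,
      Finset.sum_range_zero, PowerSeries.coeff_smul, map_add, hb.coeff_two_mul hb, pow_two,
      hp.coeff_two_mul hp, hD1.coeff_two_act hb, e1] at this
    simp only [Function.iterate_zero, id_eq, pow_zero, pow_one, coeff_one, Nat.factorial] at this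
    norm_num at this
    rw [← sub_eq_zero] at this ⊢
    rw [← this]
    module
  -- Inserting the second order produces terms with weight `1/4`. Against the weights `1/6` and
  -- `1/3` from the cubic term of the exponential they leave `± 1/12`.
  have e3 : coeff 3 b = coeff 3 p - (1 / 2 : ℝ) • (coeff 1 D (coeff 2 p) + coeff 2 D (coeff 1 p)) +
      (1 / 12 : ℝ) • (coeff 1 p * coeff 1 D (coeff 1 p) - coeff 1 D (coeff 1 p) * coeff 1 p +
        coeff 1 D (coeff 1 D (coeff 1 p))) := by
    have := congrArg (coeff 3) h
    have hb2 : coeff 2 (b * b) = coeff 1 b * coeff 1 b := hb.coeff_two_mul hb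
    have hbb : OrdGE 1 (b * b) := (hb.mul hb).mono (by omega)
    have hp2 : coeff 2 (p * p) = coeff 1 p * coeff 1 p := hp.coeff_two_mul hp
    have hpp : OrdGE 1 (p * p) := (hp.mul hp).mono (by omega)
    have z1 : coeff 1 (b * b) = 0 := (hb.mul hb) 1 (by omega)
    have z1' : coeff 1 (p * p) = 0 := (hp.mul hp) 1 (by omega)
    have z2 : coeff 1 (act D b) = 0 := hDb 1 (by omega)
    have hDb1 := hDb.mono (show 1 ≤ 2 by omega)
    simp only [seriesExp, coeff_fsum, coeff_pexp, Finset.sum_range_succ, i1, i2, i3,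
      Finset.sum_range_zero, PowerSeries.coeff_smul, map_add, hb.coeff_three_mul hb, pow_two,
      pow_succ p 2,
      hp.coeff_three_mul hp, hD1.coeff_three_act hb, hD1.coeff_three_act hDb1,
      (hDb1.add hbb).coeff_three_mul hb, hDb1.coeff_three_mul hb, hb.coeff_three_mul hDb1,
      hpp.coeff_three_mul hp, z1, z1', z2, hb2, hp2, hD1.coeff_two_act hb, e1, e2] at this
    simp only [Function.iterate_zero, id_eq, pow_zero, pow_one, coeff_one, Nat.factorial] at this
    norm_num at this
    simp only [mul_sub, sub_mul, add_mul, smul_add, smul_sub, mul_smul_comm, smul_mul_assoc,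
      smul_smul] at this ⊢
    norm_num at this ⊢
    rw [← sub_eq_zero] at this ⊢
    rw [← this]
    module
  have hn' : n = 0 ∨ n = 1 ∨ n = 2 ∨ n = 3 := by omega
  have hDp1 := hDp.mono (show 1 ≤ 2 by omega)
  have w1 : coeff 1 (act D p) = 0 := hDp 1 (by omega)
  have m1 : OrdGE 3 (p * act D p) := hp.mul hDp
  have m2 : OrdGE 3 (act D p * p) := hDp.mul hp
  simp only [map_add, map_sub, PowerSeries.coeff_smul]
  rcases hn' with rfl | rfl | rfl | rfl
  · rw [h0, h0', hDp 0 (by omega), m1 0 (by omega), m2 0 (by omega), hDDp 0 (by omega)]; simp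
  · rw [e1, hDp 1 (by omega), m1 1 (by omega), m2 1 (by omega), hDDp 1 (by omega)]; simp
  · rw [e2, m1 2 (by omega), m2 2 (by omega), hDDp 2 (by omega), hD1.coeff_two_act hp]; simp
  · rw [e3, hD1.coeff_three_act hp, hp.coeff_three_mul hDp1, hDp1.coeff_three_mul hp, w1,
      hD1.coeff_three_act hDp1, w1, hD1.coeff_two_act hp]
    simp

/-- A homomorphism that intertwines two operators intertwines their exponentials. -/
theorem map_seriesExp {C : Type*} [Ring C] [Algebra ℝ C] (φ : A →ₐ[ℝ] C)
    {T : PowerSeries A → PowerSeries A} {U : PowerSeries C → PowerSeries C}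
    (h : ∀ Y, PowerSeries.map (φ : A →+* C) (T Y) = U (PowerSeries.map (φ : A →+* C) Y))
    (Y : PowerSeries A) : PowerSeries.map (φ : A →+* C) (seriesExp T Y) =
      seriesExp U (PowerSeries.map (φ : A →+* C) Y) := by
  have hj : ∀ j, PowerSeries.map (φ : A →+* C) (T^[j] Y) =
      U^[j] (PowerSeries.map (φ : A →+* C) Y) := by
    intro j
    induction j with
    | zero => rfl
    | succ j ih => rw [Function.iterate_succ_apply', Function.iterate_succ_apply', h, ih]
  ext n
  simp only [seriesExp, coeff_fsum, PowerSeries.coeff_map, map_sum, ← hj, PowerSeries.coeff_smul]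
  exact Finset.sum_congr rfl fun j _ => map_smul φ _ _

/-- The Baker-Campbell-Hausdorff theorem simultaneously in two algebras. -/
theorem exists_act_pexp_eq_prod {C : Type*} [Ring C] [Algebra ℝ C] {N : Submodule ℝ (A × C)}
    (hN : IsLieClosed N) {D₁ : PowerSeries (Module.End ℝ A)} {D₂ : PowerSeries (Module.End ℝ C)}
    (hD₁ : OrdGE 1 D₁) (hD₂ : OrdGE 1 D₂)
    (hD₁' : ∀ n x y, coeff n D₁ (x * y) = coeff n D₁ x * y + x * coeff n D₁ y)
    (hD₂' : ∀ n x y, coeff n D₂ (x * y) = coeff n D₂ x * y + x * coeff n D₂ y)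
    (hDN : ∀ n, ∀ x ∈ N, (coeff n D₁ x.1, coeff n D₂ x.2) ∈ N) {p₁ : PowerSeries A}
    {p₂ : PowerSeries C} (hp₁ : OrdGE 1 p₁) (hp₂ : OrdGE 1 p₂)
    (hp : ∀ n, (coeff n p₁, coeff n p₂) ∈ N) :
    ∃ (b₁ : PowerSeries A) (b₂ : PowerSeries C), OrdGE 1 b₁ ∧ OrdGE 1 b₂ ∧
      (∀ n, (coeff n b₁, coeff n b₂) ∈ N) ∧
      (∀ Y, act (pexp (D₁ + rightMul b₁)) Y = act (pexp D₁) Y * pexp p₁) ∧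
      ∀ Y, act (pexp (D₂ + rightMul b₂)) Y = act (pexp D₂) Y * pexp p₂ := by
  -- The two operator series act diagonally on the product algebra. The exponent found there has
  -- coefficients in `N`, which couples its two components; the projections give the two identities.
  let D : PowerSeries (Module.End ℝ (A × C)) :=
    PowerSeries.mk fun m => LinearMap.prodMap (coeff m D₁) (coeff m D₂)
  have hDc : ∀ m x, coeff m D x = (coeff m D₁ x.1, coeff m D₂ x.2) := fun m x => by
    simp only [D, coeff_mk]; rfl
  have hD1 : OrdGE 1 D := by
    rw [ordGE_one_iff]
    refine LinearMap.ext fun x => ?_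
    rw [hDc, ordGE_one_iff.mp hD₁, ordGE_one_iff.mp hD₂]
    rfl
  have hD : ∀ m x y, coeff m D (x * y) = coeff m D x * y + x * coeff m D y := fun m x y => by
    rw [hDc, hDc, hDc]
    exact Prod.ext (hD₁' m x.1 y.1) (hD₂' m x.2 y.2)
  obtain ⟨b, hb1, hbN, hb⟩ := exists_act_pexp_eq hN hD1 hD
    (fun m x hx => by rw [hDc]; exact hDN m x hx) (p := pairSeries p₁ p₂) (hp₁.pairSeries hp₂)
    (fun m => by simpa [pairSeries] using hp m)
  refine ⟨PowerSeries.map (AlgHom.fst ℝ A C : A × C →+* A) b,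
    PowerSeries.map (AlgHom.snd ℝ A C : A × C →+* C) b, hb1.map _, hb1.map _,
    fun m => by simpa using hbN m, fun Y => ?_, fun Y => ?_⟩
  · have h := congrArg (PowerSeries.map (AlgHom.fst ℝ A C : A × C →+* A)) (hb (pairSeries Y 0))
    have hact : ∀ Y, PowerSeries.map (AlgHom.fst ℝ A C : A × C →+* A) (act D Y) =
        act D₁ (PowerSeries.map (AlgHom.fst ℝ A C : A × C →+* A) Y) := by
      intro Y
      ext1 m
      simp only [PowerSeries.coeff_map, coeff_act, map_sum]
      refine Finset.sum_congr rfl fun k _ => ?_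
      rw [hDc]
      rfl
    rw [map_mul, act_pexp (hD1.add hb1.rightMul), act_pexp hD1, map_pexp, map_fst_pairSeries,
      map_seriesExp (AlgHom.fst ℝ A C) (U := act (D₁ + rightMul
        (PowerSeries.map (AlgHom.fst ℝ A C : A × C →+* A) b)))
        (fun Y => by rw [act_add, act_add, act_rightMul, act_rightMul, map_add, hact, map_mul]),
      map_seriesExp (AlgHom.fst ℝ A C) hact, map_fst_pairSeries] at h
    rw [act_pexp (hD₁.add (hb1.map _).rightMul), act_pexp hD₁]
    exact h
  · have h := congrArg (PowerSeries.map (AlgHom.snd ℝ A C : A × C →+* C)) (hb (pairSeries 0 Y))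
    have hact : ∀ Y, PowerSeries.map (AlgHom.snd ℝ A C : A × C →+* C) (act D Y) =
        act D₂ (PowerSeries.map (AlgHom.snd ℝ A C : A × C →+* C) Y) := by
      intro Y
      ext1 m
      simp only [PowerSeries.coeff_map, coeff_act, map_sum]
      refine Finset.sum_congr rfl fun k _ => ?_
      rw [hDc]
      rfl
    rw [map_mul, act_pexp (hD1.add hb1.rightMul), act_pexp hD1, map_pexp, map_snd_pairSeries,
      map_seriesExp (AlgHom.snd ℝ A C) (U := act (D₂ + rightMul
        (PowerSeries.map (AlgHom.snd ℝ A C : A × C →+* C) b)))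
        (fun Y => by rw [act_add, act_add, act_rightMul, act_rightMul, map_add, hact, map_mul]),
      map_seriesExp (AlgHom.snd ℝ A C) hact, map_snd_pairSeries] at h
    rw [act_pexp (hD₂.add (hb1.map _).rightMul), act_pexp hD₂]
    exact h

end Action

/-! ### Lie-algebra-valued matrices -/

section LieElement

open PowerSeries

variable {R : Type*} [CommRing R] [Algebra ℂ R] {ι n : Type*} [Fintype ι] [Fintype n]

/-- The matrix `i ∑ s_a ρ_a` with entries in `R`. -/
def lieElement (ρ : ι → Matrix n n ℂ) (s : ι → R) : Matrix n n R :=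
  Complex.I • ∑ a, s a • (ρ a).map (algebraMap ℂ R)

theorem lieElement_apply (ρ : ι → Matrix n n ℂ) (s : ι → R) (i j : n) :
    lieElement ρ s i j = algebraMap ℂ R Complex.I * ∑ a, s a * algebraMap ℂ R (ρ a i j) := by
  simp [lieElement, Matrix.sum_apply, Algebra.smul_def]

theorem lieElement_add (ρ : ι → Matrix n n ℂ) (s t : ι → R) :
    lieElement ρ (s + t) = lieElement ρ s + lieElement ρ t := by
  simp [lieElement, add_smul, Finset.sum_add_distrib]

theorem lieElement_zero (ρ : ι → Matrix n n ℂ) : lieElement ρ (0 : ι → R) = 0 := by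
  simp [lieElement]

theorem lieElement_smul (ρ : ι → Matrix n n ℂ) (z : ℂ) (s : ι → R) :
    lieElement ρ (z • s) = z • lieElement ρ s := by
  simp only [lieElement, Pi.smul_apply, smul_assoc, ← Finset.smul_sum]
  rw [smul_comm]

theorem lieElement_map {R' : Type*} [CommRing R'] [Algebra ℂ R'] (φ : R →ₐ[ℂ] R')
    (ρ : ι → Matrix n n ℂ) (s : ι → R) :
    (lieElement ρ s).map φ = lieElement ρ (fun a => φ (s a)) := by
  ext i j
  simp [lieElement_apply]

theorem lieElement_map_derivation (δ : Derivation ℂ R R) (ρ : ι → Matrix n n ℂ) (s : ι → R) :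
    (lieElement ρ s).map δ = lieElement ρ (fun a => δ (s a)) := by
  ext i j
  rw [Matrix.map_apply, lieElement_apply, lieElement_apply, ← Algebra.smul_def,
    ← Algebra.smul_def, Derivation.map_smul, map_sum]
  congr 1
  refine Finset.sum_congr rfl fun a _ => ?_
  rw [mul_comm, ← Algebra.smul_def, Derivation.map_smul, Algebra.smul_def, mul_comm]

/-- The factor `i` built into `lieElement` matches the convention `i[ρ_a, ρ_b] = f ρ`: one of the
two factors is absorbed in it, so elements with real components are closed under commutators. -/
theorem lieElement_commutator {ρ : ι → Matrix n n ℂ} {f : ι → ι → ι → ℝ}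
    (h : ∀ a b, Complex.I • (ρ a * ρ b - ρ b * ρ a) = ∑ e, (f a b e : ℂ) • ρ e) (s t : ι → R) :
    lieElement ρ s * lieElement ρ t - lieElement ρ t * lieElement ρ s =
      lieElement ρ fun e => ∑ a, ∑ b, algebraMap ℂ R (f a b e) * s a * t b := by
  have h1 : lieElement ρ s * lieElement ρ t - lieElement ρ t * lieElement ρ s =
      Complex.I • ∑ a, ∑ b, (s a * t b) •
        (Complex.I • (ρ a * ρ b - ρ b * ρ a)).map (algebraMap ℂ R) := by
    have e : ∀ a b, (Complex.I • (ρ a * ρ b - ρ b * ρ a)).map (algebraMap ℂ R) = Complex.I •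
        ((ρ a).map (algebraMap ℂ R) * (ρ b).map (algebraMap ℂ R) -
          (ρ b).map (algebraMap ℂ R) * (ρ a).map (algebraMap ℂ R)) := by
      intro a b
      rw [← Matrix.map_mul, ← Matrix.map_mul]
      ext i j
      simp only [Matrix.map_apply, Matrix.smul_apply, Matrix.sub_apply, smul_eq_mul, map_mul,
        map_sub, Algebra.smul_def]
    simp only [e, lieElement, smul_mul_smul_comm, Finset.sum_mul_sum]
    rw [Finset.sum_comm (f := fun a b => (t a * s b) • ((ρ a).map (algebraMap ℂ R) *
      (ρ b).map (algebraMap ℂ R))), ← smul_sub, ← Finset.sum_sub_distrib, mul_smul,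
      Finset.smul_sum (r := Complex.I)]
    congr 1
    refine Finset.sum_congr rfl fun a _ => ?_
    rw [← Finset.sum_sub_distrib, Finset.smul_sum]
    refine Finset.sum_congr rfl fun b _ => ?_
    rw [smul_comm (s a * t b), mul_comm (t b), ← smul_sub]
  rw [h1, lieElement]
  congr 1
  have h2 : ∀ a b, (Complex.I • (ρ a * ρ b - ρ b * ρ a)).map (algebraMap ℂ R) =
      ∑ e, (algebraMap ℂ R (f a b e)) • (ρ e).map (algebraMap ℂ R) := by
    intro a b
    rw [h]
    ext i j
    simp only [Matrix.map_apply, Matrix.sum_apply, Matrix.smul_apply, smul_eq_mul, map_sum, map_mul]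
  simp only [h2, Finset.smul_sum, smul_smul, Finset.sum_smul]
  symm
  rw [Finset.sum_comm]
  refine Finset.sum_congr rfl fun a _ => ?_
  rw [Finset.sum_comm]
  refine Finset.sum_congr rfl fun b _ => Finset.sum_congr rfl fun e _ => ?_
  congr 1
  ring

theorem coeff_toSeries_lieMatrix (ρ : ι → Matrix n n ℂ) [DecidableEq n] (v : ι → PowerSeries R)
    (m : ℕ) : coeff m (toSeries (Complex.I • lieMatrix ρ v)) =
      lieElement ρ fun a => coeff m (v a) := by
  ext i j
  rw [coeff_toSeries, Matrix.map_apply, Matrix.smul_apply, PowerSeries.coeff_smul, lieElement_apply,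
    lieMatrix, Matrix.sum_apply, Algebra.smul_def, map_sum]
  congr 1
  refine Finset.sum_congr rfl fun a _ => ?_
  rw [Matrix.smul_apply, Matrix.map_apply, smul_eq_mul]
  rw [PowerSeries.algebraMap_apply, coeff_mul_C]

end LieElement

/-! ### Entrywise action of derivations on matrices. -/

section MatrixDerivation

variable {R : Type*} [CommRing R] [Algebra ℝ R] {n : Type*} [Fintype n]

/-- A linear map acting on the entries of matrices. -/
def matrixDerivation (δ : R →ₗ[ℝ] R) : Module.End ℝ (Matrix n n R) where
  toFun Y := Y.map δ
  map_add' Y Z := by ext i j; simp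
  map_smul' r Y := by ext i j; simp

theorem matrixDerivation_apply (δ : R →ₗ[ℝ] R) (Y : Matrix n n R) :
    matrixDerivation δ Y = Y.map δ := rfl

theorem matrixDerivation_mul {δ : R →ₗ[ℝ] R} (h : ∀ x y, δ (x * y) = δ x * y + x * δ y)
    (Y Z : Matrix n n R) : matrixDerivation δ (Y * Z) =
      matrixDerivation δ Y * Z + Y * matrixDerivation δ Z := by
  ext i j
  simp only [matrixDerivation_apply, Matrix.map_apply, Matrix.mul_apply, Matrix.add_apply, map_sum,
    h, Finset.sum_add_distrib]

end MatrixDerivation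

/-! ### The relative Baker-Campbell-Hausdorff series for fields -/

section FieldBCH

open PowerSeries

variable {c : StringFunction} {ι d J n : Type*} [Fintype ι] [Fintype d] [DecidableEq d]
  [Fintype J] [DecidableEq J] [Fintype n] [DecidableEq n]
  {T₀ : Distr ℂ} {α : FieldSeries c ι J (Fin 4 → ι → ℝ)} {L : GaugeAlgebra ι d}
  {β γ : FieldSeries c ι J (ι → ℝ)}

instance instCommRingFieldAlgebra : CommRing (fieldAlgebra (c := c) (J := J) L) := inferInstance

instance instAlgebraRealFieldAlgebra : Algebra ℝ (fieldAlgebra (c := c) (J := J) L) := inferInstance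

instance instRingMatrixFieldAlgebra :
    Ring (Matrix n n (fieldAlgebra (c := c) (J := J) L)) := Matrix.instRing

instance instAlgebraRealMatrixFieldAlgebra :
    Algebra ℝ (Matrix n n (fieldAlgebra (c := c) (J := J) L)) := Matrix.instAlgebra

/-- The components of a scalar field as elements of the field algebra. -/
def scalarLift {s : QField c ι J (ι → ℝ)} (hs : InS L s) :
    ι → fieldAlgebra (c := c) (J := J) L := fun a => ⟨component s a, component_mem hs a⟩

/-- The power series `iρ(β)` of matrices. -/
def lieSeries (ρ : ι → Matrix n n ℂ) (hβ : ∀ m, InS L (β m)) :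
    PowerSeries (Matrix n n (fieldAlgebra (c := c) (J := J) L)) :=
  PowerSeries.mk fun m => lieElement ρ (scalarLift (hβ m))

/-- The obstruction map as a real linear map on the field algebra. -/
def omegaLin {v : QField c ι J (Fin 4 → ι → ℝ)} (hT₀ : IsPropagator 0 T₀) (hv : v ∈ spaceV L) :
    fieldAlgebra (c := c) (J := J) L →ₗ[ℝ] fieldAlgebra (c := c) (J := J) L :=
  (omegaDerivation hT₀ hv).toLinearMap.restrictScalars ℝ

theorem omegaLin_mul {v : QField c ι J (Fin 4 → ι → ℝ)} (hT₀ : IsPropagator 0 T₀)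
    (hv : v ∈ spaceV L) (x y : fieldAlgebra (c := c) (J := J) L) :
    omegaLin hT₀ hv (x * y) = omegaLin hT₀ hv x * y + x * omegaLin hT₀ hv y := by
  refine ((omegaDerivation hT₀ hv).leibniz x y).trans ?_
  rw [add_comm, smul_eq_mul, smul_eq_mul, mul_comm y]
  rfl

theorem lieElement_map_omegaLin {v : QField c ι J (Fin 4 → ι → ℝ)} (hT₀ : IsPropagator 0 T₀)
    (hv : v ∈ spaceV L) (ρ : ι → Matrix n n ℂ) {s : QField c ι J (ι → ℝ)} (hs : InS L s) :
    (lieElement ρ (scalarLift hs)).map (omegaLin hT₀ hv) =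
      lieElement ρ (scalarLift (hs.omegaYM₁ hT₀ hv)) := by
  refine (lieElement_map_derivation (omegaDerivation hT₀ hv) ρ _).trans ?_
  congr 1
  funext a
  exact Subtype.ext (omegaYM₁_component hT₀ (mem_stringFunctions_of_mem_spaceV hv) hs a)

/-- The obstruction map of a mediator series, as a series of operators on matrices. -/
def omegaSeries (n : Type*) [Fintype n] (hT₀ : IsPropagator 0 T₀) (hα : InGV L α) :
    PowerSeries (Module.End ℝ (Matrix n n (fieldAlgebra (c := c) (J := J) L))) :=
  PowerSeries.mk fun m => matrixDerivation (omegaLin hT₀ (hα.2 m))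

theorem coeff_omegaSeries (hT₀ : IsPropagator 0 T₀) (hα : InGV L α) (m : ℕ)
    (Y : Matrix n n (fieldAlgebra (c := c) (J := J) L)) :
    coeff m (omegaSeries n hT₀ hα) Y = Y.map (omegaLin hT₀ (hα.2 m)) := by
  simp only [omegaSeries, coeff_mk]
  rfl

theorem omegaLin_zero (hT₀ : IsPropagator 0 T₀) (hα : InGV L α)
    (x : fieldAlgebra (c := c) (J := J) L) : omegaLin hT₀ (hα.2 0) x = 0 := by
  refine Subtype.ext ?_
  change omegaYM₁ T₀ (α 0) (x : QField c ι J ℂ) = 0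
  rw [hα.1]
  exact omegaYM₁_zero_left hT₀ _

theorem ordGE_omegaSeries (hT₀ : IsPropagator 0 T₀) (hα : InGV L α) :
    OrdGE 1 (omegaSeries (c := c) (J := J) n hT₀ hα) := by
  rw [ordGE_one_iff]
  refine LinearMap.ext fun Y => ?_
  rw [coeff_omegaSeries]
  exact Matrix.ext fun i j => omegaLin_zero hT₀ hα (Y i j)

theorem omegaSeries_mul (hT₀ : IsPropagator 0 T₀) (hα : InGV L α) (m : ℕ)
    (Y Z : Matrix n n (fieldAlgebra (c := c) (J := J) L)) :
    coeff m (omegaSeries n hT₀ hα) (Y * Z) =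
      coeff m (omegaSeries n hT₀ hα) Y * Z + Y * coeff m (omegaSeries n hT₀ hα) Z := by
  simp only [omegaSeries, coeff_mk]
  exact matrixDerivation_mul (omegaLin_mul hT₀ (hα.2 m)) Y Z

theorem coeff_lieSeries (ρ : ι → Matrix n n ℂ) (hβ : ∀ m, InS L (β m)) (m : ℕ) :
    coeff m (lieSeries ρ hβ) = lieElement ρ (scalarLift (hβ m)) := by simp [lieSeries]

theorem scalarLift_zero {s : QField c ι J (ι → ℝ)} (hs : InS L s) (h : s = 0) :
    scalarLift hs = 0 := by
  subst h
  funext a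
  refine Subtype.ext ?_
  funext Ψ x
  simp [scalarLift, component]

theorem ordGE_lieSeries (ρ : ι → Matrix n n ℂ) (hβ : InGS L β) :
    OrdGE 1 (lieSeries ρ hβ.2) := by
  rw [ordGE_one_iff, coeff_lieSeries, scalarLift_zero _ hβ.1, lieElement_zero]

theorem scalarLift_add {s t : QField c ι J (ι → ℝ)} (hs : InS L s) (ht : InS L t) :
    scalarLift (hs.add ht) = scalarLift hs + scalarLift ht := by
  funext a
  refine Subtype.ext ?_
  funext Ψ x
  simp [scalarLift, component]

theorem scalarLift_smul (r : ℝ) {s : QField c ι J (ι → ℝ)} (hs : InS L s) :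
    scalarLift (hs.smul r) = (r : ℂ) • scalarLift hs := by
  funext a
  refine Subtype.ext ?_
  funext Ψ x
  simp [scalarLift, component]

theorem lieElement_scalarLift_commutator {ρ : ι → Matrix n n ℂ}
    (hρ : ∀ a b, Complex.I • (ρ a * ρ b - ρ b * ρ a) = ∑ e, (L.struct a b e : ℂ) • ρ e)
    {s t : QField c ι J (ι → ℝ)} (hs : InS L s) (ht : InS L t) :
    lieElement ρ (scalarLift hs) * lieElement ρ (scalarLift ht) -
      lieElement ρ (scalarLift ht) * lieElement ρ (scalarLift hs) =
      lieElement ρ (scalarLift (hs.bracket ht)) := by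
  rw [lieElement_commutator hρ]
  congr 1
  funext e
  refine Subtype.ext ?_
  have hcoe : ((∑ a, ∑ b, algebraMap ℂ (fieldAlgebra (c := c) (J := J) L) (L.struct a b e) *
      scalarLift hs a * scalarLift ht b : fieldAlgebra (c := c) (J := J) L) : QField c ι J ℂ) =
      ∑ a, ∑ b, algebraMap ℂ (QField c ι J ℂ) (L.struct a b e) *
        component s a * component t b := by
    push_cast
    rfl
  rw [hcoe]
  funext Ψ x
  simp only [Finset.sum_apply, Pi.mul_apply, scalarLift, component, GaugeAlgebra.bracket,
    Complex.ofReal_sum, Complex.ofReal_mul]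
  rfl

/-- The Lie algebra of the matrices `(iξ(s), iτ(s))`. -/
def lieSubmodule (L : GaugeAlgebra ι d) (π : GaugeRep L J) :
    Submodule ℝ (Matrix d d (fieldAlgebra (c := c) (J := J) L) ×
      Matrix J J (fieldAlgebra (c := c) (J := J) L)) where
  carrier := {x | ∃ (s : QField c ι J (ι → ℝ)) (hs : InS L s),
    x = (lieElement L.gen (scalarLift hs), lieElement π.gen (scalarLift hs))}
  zero_mem' := ⟨0, InS.zero, by
    rw [scalarLift_zero _ rfl, lieElement_zero, lieElement_zero]; rfl⟩
  add_mem' := by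
    rintro _ _ ⟨s, hs, rfl⟩ ⟨t, ht, rfl⟩
    refine ⟨s + t, hs.add ht, ?_⟩
    rw [scalarLift_add, lieElement_add, lieElement_add]
    rfl
  smul_mem' := by
    rintro r _ ⟨s, hs, rfl⟩
    refine ⟨r • s, hs.smul r, ?_⟩
    rw [scalarLift_smul, lieElement_smul, lieElement_smul]
    rfl

theorem isLieClosed_lieSubmodule (L : GaugeAlgebra ι d) (π : GaugeRep L J) :
    IsLieClosed (lieSubmodule (c := c) L π) := by
  rintro _ ⟨s, hs, rfl⟩ _ ⟨t, ht, rfl⟩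
  refine ⟨_, hs.bracket ht, ?_⟩
  rw [← lieElement_scalarLift_commutator L.comm hs ht,
    ← lieElement_scalarLift_commutator π.comm hs ht]
  rfl

/-- Real linear independence of the `ξ_a`, applied at each configuration and point. Nothing similar
is assumed of the `τ_a`, so `β` has to be recovered from the defining representation. -/
theorem eq_of_lieElement_eq (L : GaugeAlgebra ι d) {s t : QField c ι J (ι → ℝ)} (hs : InS L s)
    (ht : InS L t) (h : lieElement L.gen (scalarLift hs) = lieElement L.gen (scalarLift ht)) :
    s = t := by
  funext Ψ x
  have h1 : ∀ i j, (∑ a, (s Ψ x a : ℂ) * L.gen a i j) = ∑ a, (t Ψ x a : ℂ) * L.gen a i j := by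
    intro i j
    have h2 : ∀ {u : QField c ι J (ι → ℝ)} (hu : InS L u),
        ((lieElement L.gen (scalarLift hu) i j : fieldAlgebra (c := c) (J := J) L) :
          QField c ι J ℂ) Ψ x = Complex.I * ∑ a, (u Ψ x a : ℂ) * L.gen a i j := by
      intro u hu
      rw [lieElement_apply]
      have hcoe : ((algebraMap ℂ (fieldAlgebra (c := c) (J := J) L) Complex.I *
          ∑ a, scalarLift hu a * algebraMap ℂ (fieldAlgebra (c := c) (J := J) L) (L.gen a i j) :
            fieldAlgebra (c := c) (J := J) L) : QField c ι J ℂ) =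
          algebraMap ℂ (QField c ι J ℂ) Complex.I * ∑ a, component u a *
            algebraMap ℂ (QField c ι J ℂ) (L.gen a i j) := by
        push_cast
        rfl
      rw [hcoe]
      simp only [Pi.mul_apply, Finset.sum_apply]
      rfl
    have := congrFun (congrFun (congrArg Subtype.val (congrFun (congrFun h i) j)) Ψ) x
    rw [h2 hs, h2 ht] at this
    exact mul_left_cancel₀ Complex.I_ne_zero this
  have h3 : ∑ a, (s Ψ x a - t Ψ x a) • L.gen a = 0 := by
    ext i j
    have := h1 i j
    rw [← sub_eq_zero, ← Finset.sum_sub_distrib] at this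
    rw [Matrix.sum_apply, Matrix.zero_apply, ← this]
    refine Finset.sum_congr rfl fun a _ => ?_
    rw [Matrix.smul_apply, Complex.real_smul]
    push_cast
    ring
  funext a
  exact sub_eq_zero.mp (Fintype.linearIndependent_iff.mp L.independent _ h3 a)

/-- The relative Baker-Campbell-Hausdorff series, simultaneously in both representations. -/
theorem exists_bch (π : GaugeRep L J) (hT₀ : IsPropagator 0 T₀) (hα : InGV L α) (hγ : InGS L γ) :
    ∃ (β : FieldSeries c ι J (ι → ℝ)) (hβ : InGS L β),
      (∀ Y : PowerSeries (Matrix d d (fieldAlgebra (c := c) (J := J) L)),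
        act (pexp (omegaSeries (L := L) d hT₀ hα + rightMul (lieSeries L.gen hβ.2))) Y =
        act (pexp (omegaSeries (L := L) d hT₀ hα)) Y * pexp (lieSeries L.gen hγ.2)) ∧
      (∀ Y : PowerSeries (Matrix J J (fieldAlgebra (c := c) (J := J) L)),
        act (pexp (omegaSeries (L := L) J hT₀ hα + rightMul (lieSeries π.gen hβ.2))) Y =
        act (pexp (omegaSeries (L := L) J hT₀ hα)) Y * pexp (lieSeries π.gen hγ.2)) := by
  obtain ⟨b₁, b₂, hb₁, -, hbN, hb, hb'⟩ :=
    exists_act_pexp_eq_prod (isLieClosed_lieSubmodule (c := c) L π)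
      (ordGE_omegaSeries hT₀ hα) (ordGE_omegaSeries hT₀ hα) (omegaSeries_mul hT₀ hα)
      (omegaSeries_mul hT₀ hα)
      (by
        rintro m _ ⟨s, hs, rfl⟩
        exact ⟨_, hs.omegaYM₁ hT₀ (hα.2 m),
          Prod.ext ((coeff_omegaSeries hT₀ hα m _).trans (lieElement_map_omegaLin hT₀ _ _ hs))
            ((coeff_omegaSeries hT₀ hα m _).trans (lieElement_map_omegaLin hT₀ _ _ hs))⟩)
      (ordGE_lieSeries L.gen hγ) (ordGE_lieSeries π.gen hγ)
      (fun m => ⟨γ m, hγ.2 m, by rw [coeff_lieSeries, coeff_lieSeries]⟩)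
  -- Each pair of coefficients comes from one scalar field, so the same `β` appears in both
  -- representations; its constant term vanishes by independence of the `ξ_a`.
  choose β hβ hβb using hbN
  have hβ0 : β 0 = 0 := by
    refine eq_of_lieElement_eq L (hβ 0) InS.zero ?_
    rw [scalarLift_zero InS.zero rfl, lieElement_zero, ← ordGE_one_iff.mp hb₁]
    exact (congrArg Prod.fst (hβb 0)).symm
  have e₁ : b₁ = lieSeries L.gen hβ := by
    ext1 m
    rw [coeff_lieSeries]
    exact congrArg Prod.fst (hβb m)
  have e₂ : b₂ = lieSeries π.gen hβ := by
    ext1 m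
    rw [coeff_lieSeries]
    exact congrArg Prod.snd (hβb m)
  subst e₁ e₂
  exact ⟨β, ⟨hβ0, hβ⟩, hb, hb'⟩

end FieldBCH

/-! ### The Baker-Campbell-Hausdorff identity on the enveloping algebra -/

section Envelope

open PowerSeries

variable {c : StringFunction} {ι d J n : Type*} [Fintype ι] [Fintype d] [DecidableEq d]
  [Fintype J] [DecidableEq J] [Fintype n] [DecidableEq n]
  {T₀ : Distr ℂ} {α : FieldSeries c ι J (Fin 4 → ι → ℝ)} {L : GaugeAlgebra ι d}
  {β γ : FieldSeries c ι J (ι → ℝ)}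

/-- The inclusion of matrices over the field algebra into matrices of fields. -/
def matrixVal (L : GaugeAlgebra ι d) (n : Type*) [Fintype n] [DecidableEq n] :
    Matrix n n (fieldAlgebra (c := c) (J := J) L) →ₐ[ℝ] Matrix n n (QField c ι J ℂ) :=
  ((fieldAlgebra (c := c) (J := J) L).val.restrictScalars ℝ).mapMatrix

theorem matrixVal_apply (Y : Matrix n n (fieldAlgebra (c := c) (J := J) L)) (i j : n) :
    matrixVal L n Y i j = (Y i j : QField c ι J ℂ) := rfl

/-- A power series of matrices over the field algebra as a matrix of power series of fields. -/
def embedSeries (Y : PowerSeries (Matrix n n (fieldAlgebra (c := c) (J := J) L))) :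
    Matrix n n (PowerSeries (QField c ι J ℂ)) :=
  Matrix.of fun i j => PowerSeries.mk fun m => ((coeff m Y i j : fieldAlgebra (c := c) (J := J) L) :
    QField c ι J ℂ)

theorem coeff_embedSeries (Y : PowerSeries (Matrix n n (fieldAlgebra (c := c) (J := J) L)))
    (i j : n) (m : ℕ) : coeff m (embedSeries Y i j) = (coeff m Y i j : QField c ι J ℂ) := by
  simp [embedSeries]

theorem toSeries_embedSeries (Y : PowerSeries (Matrix n n (fieldAlgebra (c := c) (J := J) L))) :
    toSeries (embedSeries Y) = PowerSeries.map
      (matrixVal (c := c) (J := J) L n : Matrix n n (fieldAlgebra (c := c) (J := J) L) →+*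
        Matrix n n (QField c ι J ℂ)) Y := by
  ext1 m
  rw [coeff_toSeries, PowerSeries.coeff_map]
  exact Matrix.ext fun i j => coeff_embedSeries Y i j m

theorem embedSeries_add (Y Z : PowerSeries (Matrix n n (fieldAlgebra (c := c) (J := J) L))) :
    embedSeries (Y + Z) = embedSeries Y + embedSeries Z :=
  toSeries_injective (by simp only [toSeries_embedSeries, toSeries_add, map_add])

theorem embedSeries_mul (Y Z : PowerSeries (Matrix n n (fieldAlgebra (c := c) (J := J) L))) :
    embedSeries (Y * Z) = embedSeries Y * embedSeries Z :=
  toSeries_injective (by simp only [toSeries_embedSeries, toSeries_mul, map_mul])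

theorem embedSeries_one :
    embedSeries (1 : PowerSeries (Matrix n n (fieldAlgebra (c := c) (J := J) L))) = 1 :=
  toSeries_injective (by rw [toSeries_embedSeries, toSeries_one, map_one])

theorem embedSeries_injective : Function.Injective
    (embedSeries : PowerSeries (Matrix n n (fieldAlgebra (c := c) (J := J) L)) → _) := by
  intro Y Z h
  ext1 m
  refine Matrix.ext fun i j => Subtype.ext ?_
  rw [← coeff_embedSeries, h, coeff_embedSeries]

theorem map_lieSeries (ρ : ι → Matrix n n ℂ) (hγ : ∀ m, InS L (γ m)) :
    PowerSeries.map (matrixVal (c := c) (J := J) L n : Matrix n n (fieldAlgebra (c := c) (J := J) L) →+*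
        Matrix n n (QField c ι J ℂ)) (lieSeries ρ hγ) =
      toSeries (Complex.I • lieMatrix ρ (toComponents γ)) := by
  ext1 m
  rw [PowerSeries.coeff_map, coeff_lieSeries, coeff_toSeries_lieMatrix]
  refine (lieElement_map (fieldAlgebra (c := c) (J := J) L).val ρ _).trans ?_
  congr 1
  funext a
  simp only [toComponents, coeff_mk]
  rfl

theorem embedSeries_lieSeries (ρ : ι → Matrix n n ℂ) (hγ : ∀ m, InS L (γ m)) :
    embedSeries (lieSeries ρ hγ) = Complex.I • lieMatrix ρ (toComponents γ) :=
  toSeries_injective (by rw [toSeries_embedSeries, map_lieSeries])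

theorem embedSeries_pexp (ρ : ι → Matrix n n ℂ) (hγ : ∀ m, InS L (γ m)) :
    embedSeries (pexp (lieSeries ρ hγ)) = dressingFactor ρ γ :=
  toSeries_injective (by
    rw [toSeries_embedSeries, map_pexp, map_lieSeries, dressingFactor,
      toSeries_matrixExp (fun r => rfl)])

theorem expMatrixMap_embedSeries
    {T : Matrix n n (PowerSeries (QField c ι J ℂ)) → Matrix n n (PowerSeries (QField c ι J ℂ))}
    {U : PowerSeries (Matrix n n (fieldAlgebra (c := c) (J := J) L)) →
      PowerSeries (Matrix n n (fieldAlgebra (c := c) (J := J) L))}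
    (h : ∀ Y, T (embedSeries Y) = embedSeries (U Y))
    (Y : PowerSeries (Matrix n n (fieldAlgebra (c := c) (J := J) L))) :
    expMatrixMap T (embedSeries Y) = embedSeries (seriesExp U Y) := by
  have hk : ∀ k, T^[k] (embedSeries Y) = embedSeries (U^[k] Y) := by
    intro k
    induction k with
    | zero => rfl
    | succ k ih => rw [Function.iterate_succ_apply', Function.iterate_succ_apply', ih, h]
  refine Matrix.ext fun i j => PowerSeries.ext fun m => ?_
  rw [coeff_embedSeries]
  simp only [expMatrixMap, Matrix.of_apply, coeff_mk, hk, coeff_embedSeries, seriesExp, coeff_fsum,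
    PowerSeries.coeff_smul, Matrix.sum_apply, Matrix.smul_apply, AddSubmonoidClass.coe_finsetSum]
  refine Finset.sum_congr rfl fun k _ => ?_
  funext Ψ x
  change ((k.factorial : ℂ)⁻¹) * _ = ((k.factorial : ℝ)⁻¹) • _
  rw [Complex.real_smul]
  push_cast
  rfl

theorem omegaMatrix_embedSeries (hT₀ : IsPropagator 0 T₀) (hα : InGV L α)
    (Y : PowerSeries (Matrix n n (fieldAlgebra (c := c) (J := J) L))) :
    omegaMatrix T₀ α (embedSeries Y) = embedSeries (act (omegaSeries n hT₀ hα) Y) := by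
  refine Matrix.ext fun i j => PowerSeries.ext fun m => ?_
  rw [coeff_embedSeries]
  simp only [omegaMatrix, Matrix.map_apply, coeff_mk, omegaYM, coeff_embedSeries, coeff_act,
    Matrix.sum_apply, AddSubmonoidClass.coe_finsetSum, coeff_omegaSeries]
  rfl

/-- The enveloping algebra has coefficients in the field algebra, where `ω_U` is known to be a
derivation; for arbitrary functionals of the configuration this is not available. -/
theorem exists_embedSeries_eq {Y : Matrix d d (PowerSeries (QField c ι J ℂ))}
    (hY : Y ∈ envelope (c := c) (J := J) L) :
    ∃ Z : PowerSeries (Matrix d d (fieldAlgebra (c := c) (J := J) L)), embedSeries Z = Y := by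
  induction hY using Algebra.adjoin_induction with
  | mem Y hY =>
    obtain ⟨s, hs, rfl⟩ := hY
    refine ⟨PowerSeries.mk fun m => ∑ a, scalarLift (hs m) a •
      (L.gen a).map (algebraMap ℂ (fieldAlgebra (c := c) (J := J) L)), ?_⟩
    refine Matrix.ext fun i j => PowerSeries.ext fun m => ?_
    rw [coeff_embedSeries, coeff_mk, lieMatrix, Matrix.sum_apply, Matrix.sum_apply, map_sum,
      AddSubmonoidClass.coe_finsetSum]
    refine Finset.sum_congr rfl fun a _ => ?_
    rw [Matrix.smul_apply, Matrix.smul_apply, Matrix.map_apply, Matrix.map_apply, smul_eq_mul,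
      smul_eq_mul, PowerSeries.algebraMap_apply, coeff_mul_C, toComponents, coeff_mk]
    rfl
  | algebraMap z =>
    refine ⟨PowerSeries.mk fun m => if m = 0 then algebraMap ℂ _ z else 0, ?_⟩
    refine Matrix.ext fun i j => PowerSeries.ext fun m => ?_
    rw [coeff_embedSeries, coeff_mk, Matrix.algebraMap_matrix_apply]
    by_cases hm : m = 0
    · subst hm
      rw [if_pos rfl, Matrix.algebraMap_matrix_apply]
      split_ifs
      · rw [PowerSeries.algebraMap_apply, coeff_zero_C]; rfl
      · rw [map_zero]; rfl
    · rw [if_neg hm]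
      split_ifs
      · rw [PowerSeries.algebraMap_apply, coeff_C, if_neg hm]; rfl
      · rw [map_zero]; rfl
  | add Y Z _ _ hY hZ =>
    obtain ⟨Y, rfl⟩ := hY
    obtain ⟨Z, rfl⟩ := hZ
    exact ⟨Y + Z, embedSeries_add Y Z⟩
  | mul Y Z _ _ hY hZ =>
    obtain ⟨Y, rfl⟩ := hY
    obtain ⟨Z, rfl⟩ := hZ
    exact ⟨Y * Z, embedSeries_mul Y Z⟩

theorem expMatrixMap_bch (hT₀ : IsPropagator 0 T₀) (hα : InGV L α) (hβ : InGS L β)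
    (ρ : ι → Matrix n n ℂ) (Y : PowerSeries (Matrix n n (fieldAlgebra (c := c) (J := J) L))) :
    expMatrixMap (fun Z => omegaMatrix T₀ α Z + Z * (Complex.I • lieMatrix ρ (toComponents β)))
      (embedSeries Y) =
      embedSeries (act (pexp (omegaSeries n hT₀ hα + rightMul (lieSeries ρ hβ.2))) Y) := by
  rw [act_pexp ((ordGE_omegaSeries hT₀ hα).add (ordGE_lieSeries _ hβ).rightMul)]
  refine expMatrixMap_embedSeries (fun Y => ?_) Y
  rw [omegaMatrix_embedSeries hT₀ hα, act_add, act_rightMul, embedSeries_add, embedSeries_mul,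
    embedSeries_lieSeries]

theorem expMatrixMap_omegaMatrix (hT₀ : IsPropagator 0 T₀) (hα : InGV L α)
    (Y : PowerSeries (Matrix n n (fieldAlgebra (c := c) (J := J) L))) :
    expMatrixMap (omegaMatrix T₀ α) (embedSeries Y) =
      embedSeries (act (pexp (omegaSeries n hT₀ hα)) Y) := by
  rw [act_pexp (ordGE_omegaSeries hT₀ hα)]
  exact expMatrixMap_embedSeries (fun Y => omegaMatrix_embedSeries hT₀ hα Y) Y

theorem isBCH_of_act (hT₀ : IsPropagator 0 T₀) (hα : InGV L α) (hβ : InGS L β) (hγ : InGS L γ)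
    (h : ∀ Y : PowerSeries (Matrix d d (fieldAlgebra (c := c) (J := J) L)),
      act (pexp (omegaSeries d hT₀ hα + rightMul (lieSeries L.gen hβ.2))) Y =
        act (pexp (omegaSeries d hT₀ hα)) Y * pexp (lieSeries L.gen hγ.2)) :
    IsBCH L T₀ α γ β := by
  intro Y hY
  obtain ⟨Y, rfl⟩ := exists_embedSeries_eq hY
  rw [expMatrixMap_bch hT₀ hα hβ, expMatrixMap_omegaMatrix hT₀ hα, h, embedSeries_mul,
    embedSeries_pexp]

theorem act_pexp_omegaSeries_one (n : Type*) [Fintype n] [DecidableEq n] (hT₀ : IsPropagator 0 T₀)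
    (hα : InGV L α) : act (pexp (omegaSeries (c := c) (J := J) n hT₀ hα)) 1 = 1 :=
  act_pexp_one (ordGE_omegaSeries hT₀ hα) (omegaSeries_mul hT₀ hα)

/-- As `e^{ω_U}` fixes `1`, testing the identity on the unit isolates `e^{iγ}`. This single instance
suffices for uniqueness and for the low orders. -/
theorem IsBCH.act_one (hT₀ : IsPropagator 0 T₀) (hα : InGV L α) (hβ : InGS L β) (hγ : InGS L γ)
    (h : IsBCH L T₀ α γ β) :
    act (pexp (omegaSeries d hT₀ hα + rightMul (lieSeries L.gen hβ.2))) 1 =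
      pexp (lieSeries L.gen hγ.2) := by
  have h1 := h (embedSeries (1 : PowerSeries (Matrix d d (fieldAlgebra (c := c) (J := J) L))))
    (by rw [embedSeries_one]; exact Subalgebra.one_mem _)
  rw [expMatrixMap_bch hT₀ hα hβ, expMatrixMap_omegaMatrix hT₀ hα,
    act_pexp_omegaSeries_one d hT₀ hα, ← embedSeries_pexp _ hγ.2,
    ← embedSeries_mul, one_mul] at h1
  exact embedSeries_injective h1

theorem IsBCH.unique (hT₀ : IsPropagator 0 T₀) (hα : InGV L α) (hγ : InGS L γ) (hβ : InGS L β)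
    {β' : FieldSeries c ι J (ι → ℝ)} (hβ' : InGS L β') (h : IsBCH L T₀ α γ β)
    (h' : IsBCH L T₀ α γ β') : β' = β := by
  have h1 := eq_of_act_pexp_one_eq (ordGE_omegaSeries hT₀ hα) (ordGE_lieSeries _ hβ')
    (ordGE_lieSeries _ hβ) ((h'.act_one hT₀ hα hβ' hγ).trans (h.act_one hT₀ hα hβ hγ).symm)
  funext m
  refine eq_of_lieElement_eq L (hβ'.2 m) (hβ.2 m) ?_
  rw [← coeff_lieSeries, ← coeff_lieSeries, h1]

theorem InS.sum {κ : Type*} (t : Finset κ) {s : κ → QField c ι J (ι → ℝ)}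
    (h : ∀ k ∈ t, InS L (s k)) : InS L (∑ k ∈ t, s k) := by
  classical
  induction t using Finset.induction_on with
  | empty => exact InS.zero
  | insert k t hk ih =>
    rw [Finset.sum_insert hk]
    exact (h k (Finset.mem_insert_self k t)).add (ih fun j hj => h j (Finset.mem_insert_of_mem hj))

theorem inS_omegaYM (hT₀ : IsPropagator 0 T₀) (hα : InGV L α) (hγ : ∀ m, InS L (γ m)) (m : ℕ) :
    InS L (omegaYM T₀ α γ m) :=
  InS.sum _ fun k _ => (hγ k.2).omegaYM₁ hT₀ (hα.2 k.1)

theorem inS_seriesBracket (hβ : ∀ m, InS L (β m)) (hγ : ∀ m, InS L (γ m)) (m : ℕ) :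
    InS L (seriesBracket L β γ m) := by
  have : seriesBracket L β γ m = ∑ k ∈ Finset.HasAntidiagonal.antidiagonal m,
      (fun Ψ x => L.bracket (β k.1 Ψ x) (γ k.2 Ψ x) : QField c ι J (ι → ℝ)) := by
    funext Ψ x
    simp only [seriesBracket, Finset.sum_apply]
  rw [this]
  exact InS.sum _ fun k _ => (hβ k.1).bracket (hγ k.2)

theorem scalarLift_congr {s t : QField c ι J (ι → ℝ)} (hs : InS L s) (ht : InS L t) (h : s = t) :
    scalarLift hs = scalarLift ht := by
  subst h; rfl

theorem lieElement_scalarLift_sum (ρ : ι → Matrix n n ℂ) {κ : Type*} (t : Finset κ)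
    {s : κ → QField c ι J (ι → ℝ)} (h : ∀ k, InS L (s k)) (h' : InS L (∑ k ∈ t, s k)) :
    lieElement ρ (scalarLift h') = ∑ k ∈ t, lieElement ρ (scalarLift (h k)) := by
  classical
  induction t using Finset.induction_on with
  | empty => rw [scalarLift_zero h' Finset.sum_empty, lieElement_zero, Finset.sum_empty]
  | insert k t hk ih =>
    have ht : InS L (∑ k ∈ t, s k) := InS.sum t fun k _ => h k
    rw [scalarLift_congr h' ((h k).add ht) (Finset.sum_insert hk),
      scalarLift_add (h k) ht, lieElement_add,
      ih ht, Finset.sum_insert hk]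

theorem act_omegaSeries_lieSeries (hT₀ : IsPropagator 0 T₀) (hα : InGV L α) (ρ : ι → Matrix n n ℂ)
    (hγ : ∀ m, InS L (γ m)) : act (omegaSeries n hT₀ hα) (lieSeries ρ hγ) =
      lieSeries ρ (inS_omegaYM hT₀ hα hγ) := by
  ext1 m
  rw [coeff_act, coeff_lieSeries]
  refine Eq.trans ?_ (lieElement_scalarLift_sum ρ _
    (fun k : ℕ × ℕ => (hγ k.2).omegaYM₁ hT₀ (hα.2 k.1)) _).symm
  refine Finset.sum_congr rfl fun k _ => ?_
  rw [coeff_omegaSeries, coeff_lieSeries, lieElement_map_omegaLin]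

theorem lieSeries_commutator {ρ : ι → Matrix n n ℂ}
    (hρ : ∀ a b, Complex.I • (ρ a * ρ b - ρ b * ρ a) = ∑ e, (L.struct a b e : ℂ) • ρ e)
    (hβ : ∀ m, InS L (β m)) (hγ : ∀ m, InS L (γ m)) :
    lieSeries ρ hβ * lieSeries ρ hγ - lieSeries ρ hγ * lieSeries ρ hβ =
      lieSeries ρ (inS_seriesBracket hβ hγ) := by
  ext1 m
  rw [coeff_lieSeries, map_sub, coeff_mul, coeff_mul,
    ← Finset.Nat.sum_antidiagonal_swap (n := m)
      (f := fun ij => coeff ij.1 (lieSeries ρ hγ) * coeff ij.2 (lieSeries ρ hβ)),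
    ← Finset.sum_sub_distrib]
  have e : seriesBracket L β γ m = ∑ k ∈ Finset.HasAntidiagonal.antidiagonal m,
      (fun Ψ x => L.bracket (β k.1 Ψ x) (γ k.2 Ψ x) : QField c ι J (ι → ℝ)) := by
    funext Ψ x
    simp only [seriesBracket, Finset.sum_apply]
  rw [scalarLift_congr (inS_seriesBracket hβ hγ m)
    (InS.sum _ fun k _ => (hβ k.1).bracket (hγ k.2)) e]
  refine Eq.trans ?_ (lieElement_scalarLift_sum ρ _
    (fun k : ℕ × ℕ => (hβ k.1).bracket (hγ k.2)) _).symm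
  refine Finset.sum_congr rfl fun k _ => ?_
  rw [← lieElement_scalarLift_commutator hρ (hβ k.1) (hγ k.2)]
  simp only [coeff_lieSeries, Prod.swap]

theorem lieElement_scalarLift_smul (ρ : ι → Matrix n n ℂ) (r : ℝ) {s : QField c ι J (ι → ℝ)}
    (hs : InS L s) :
    lieElement ρ (scalarLift (hs.smul r)) = r • lieElement ρ (scalarLift hs) := by
  rw [scalarLift_smul, lieElement_smul]
  rfl

theorem IsBCH.lowOrder (hT₀ : IsPropagator 0 T₀) (hα : InGV L α) (hβ : InGS L β) (hγ : InGS L γ)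
    (h : IsBCH L T₀ α γ β) {m : ℕ} (hm : m ≤ 3) : β m = bchLowOrder L T₀ α γ m := by
  have h1 := coeff_eq_of_act_pexp_one (ordGE_omegaSeries hT₀ hα) (omegaSeries_mul hT₀ hα)
    (ordGE_lieSeries _ hβ) (ordGE_lieSeries _ hγ) (h.act_one hT₀ hα hβ hγ) hm
  have i1 := inS_omegaYM hT₀ hα hγ.2
  have i2 := inS_omegaYM hT₀ hα i1
  have i3 := inS_seriesBracket hγ.2 i1
  have hS : InS L (bchLowOrder L T₀ α γ m) := by
    have := ((hγ.2 m).add ((i1 m).smul (1 / 2)).neg).add (((i3 m).add (i2 m)).smul (1 / 12))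
    rwa [← sub_eq_add_neg] at this
  refine eq_of_lieElement_eq L (hβ.2 m) hS ?_
  rw [act_omegaSeries_lieSeries hT₀ hα, act_omegaSeries_lieSeries hT₀ hα,
    lieSeries_commutator L.comm] at h1
  simp only [map_add, map_sub, PowerSeries.coeff_smul, coeff_lieSeries] at h1
  rw [h1]
  have e : bchLowOrder L T₀ α γ m = γ m + (-(1 / 2) : ℝ) • omegaYM T₀ α γ m +
      (1 / 12 : ℝ) • (seriesBracket L γ (omegaYM T₀ α γ) m +
        omegaYM T₀ α (omegaYM T₀ α γ) m) := by
    rw [neg_smul, ← sub_eq_add_neg]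
    rfl
  rw [scalarLift_congr hS (((hγ.2 m).add ((i1 m).smul _)).add (((i3 m).add (i2 m)).smul _)) e,
    scalarLift_add ((hγ.2 m).add ((i1 m).smul _)) (((i3 m).add (i2 m)).smul _),
    scalarLift_add (hγ.2 m) ((i1 m).smul _), lieElement_add, lieElement_add,
    lieElement_scalarLift_smul L.gen _ (i1 m),
    lieElement_scalarLift_smul L.gen _ ((i3 m).add (i2 m)), scalarLift_add (i3 m) (i2 m),
    lieElement_add, neg_smul, sub_eq_add_neg]

end Envelope

/-! ### The dressed quark field -/

section Pi

variable {c : StringFunction} {ι J : Type*} [Fintype ι] [Fintype J]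

theorem hasExp_pi {κ : Type*} [Fintype κ] {E : κ → Type*} [∀ i, NormedAddCommGroup (E i)]
    [∀ i, NormedSpace ℝ (E i)] {M : ∀ i, Submodule ℝ (Spacetime → E i)}
    {Φ : ℕ → Config c ι J} {X : QField c ι J (∀ i, E i)} {f : ∀ i, ℕ → Spacetime → E i}
    (h : ∀ i, HasExp (M i) Φ (fun Ψ x => X Ψ x i) (f i)) :
    HasExp ⊤ Φ X fun k x i => f i k x := by
  intro N
  choose D r _ hf hD ht using fun i => h i N
  refine ⟨∑ i, D i, fun k x i => r i k x, fun _ => trivial, fun k hk => ?_, fun k hk => ?_,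
    fun t => ?_⟩
  · funext x i
    exact congrFun (hf i k hk) x
  -- The sum of the degree bounds is a common bound for all components.
  · funext x i
    exact congrFun (hD i k ((Finset.single_le_sum (fun _ _ => Nat.zero_le _)
      (Finset.mem_univ i)).trans hk)) x
  · funext x i
    rw [Finset.sum_apply, Finset.sum_apply]
    have h1 := congrFun (ht i t) x
    rw [sum_range_extend (hD i)
      (Finset.single_le_sum (fun _ _ => Nat.zero_le _) (Finset.mem_univ i)), Finset.sum_apply] at h1
    exact h1

end Pi

/-! ### Action of the obstruction maps on the quark field. -/

section Quark

open PowerSeries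

variable {c : StringFunction} {ι d J : Type*} [Fintype ι] [Fintype d] [DecidableEq d]
  [Fintype J] [DecidableEq J]
  {T₀ Δ : Distr ℂ} {α : FieldSeries c ι J (Fin 4 → ι → ℝ)} {L : GaugeAlgebra ι d}
  {β γ : FieldSeries c ι J (ι → ℝ)}

/-- A component of the quark field as a linear functional of the configuration. -/
def quarkComponentLin (k : J) (σ : Fin 4) : Config c ι J →ₗ[ℝ] (Spacetime → ℂ) where
  toFun Ψ x := Ψ.2.1.1 x k σ
  map_add' _ _ := rfl
  map_smul' _ _ := rfl

theorem hasExp_quarkField (Φ : ℕ → Config c ι J) (k : J) (σ : Fin 4) :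
    HasExp (smoothFunctions ℂ) Φ (fun Ψ x => quarkField Ψ x k σ)
      fun n x => quarkField (Φ n) x k σ :=
  hasExp_of_linear (M := smoothFunctions ℂ) (quarkComponentLin (c := c) (ι := ι) k σ) fun Ψ =>
    contDiff_pi.mp (contDiff_pi.mp (mem_smoothFunctions.mp Ψ.2.1.2) k) σ

/-- The quark field multiplied by a matrix of fields. -/
def quarkApply (Y : Matrix J J (QField c ι J ℂ)) : QField c ι J (J → Fin 4 → ℂ) :=
  fun Ψ x j σ => ∑ k, Y j k Ψ x * quarkField Ψ x k σ

theorem hasExp_quarkApply {Y : Matrix J J (QField c ι J ℂ)} {Φ : ℕ → Config c ι J}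
    {f : J → J → ℕ → Spacetime → ℂ} (h : ∀ j k, HasExp (smoothFunctions ℂ) Φ (Y j k) (f j k)) :
    HasExp ⊤ Φ (quarkApply Y) fun n x j σ => ∑ k,
      ∑ l ∈ Finset.HasAntidiagonal.antidiagonal n, f j k l.1 x * quarkField (Φ l.2) x k σ := by
  refine hasExp_pi (M := fun _ => ⊤) (f := fun j n x σ => ∑ k,
      ∑ l ∈ Finset.HasAntidiagonal.antidiagonal n, f j k l.1 x * quarkField (Φ l.2) x k σ)
      fun j => ?_
  refine hasExp_pi (M := fun _ => smoothFunctions ℂ) (f := fun σ n x => ∑ k,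
      ∑ l ∈ Finset.HasAntidiagonal.antidiagonal n, f j k l.1 x * quarkField (Φ l.2) x k σ)
      fun σ => ?_
  have h1 := HasExp.sum Finset.univ fun k _ => (h j k).bilin (hasExp_quarkField Φ k σ) mulLin
    fun u hu v hv => mulLin_mem_smooth hu hv
  convert h1 using 1
  · funext Ψ x
    simp only [quarkApply, Finset.sum_apply]
    rfl
  · funext n x
    simp only [Finset.sum_apply]
    rfl

theorem lineVariation_quarkApply {Y : Matrix J J (QField c ι J ℂ)}
    (hY : ∀ j k, Expands (smoothFunctions ℂ) (Y j k)) (Ψ δ : Config c ι J) (x : Spacetime) (j : J)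
    (σ : Fin 4) : lineVariation (quarkApply Y) Ψ δ x j σ =
      ∑ k, (lineVariation (Y j k) Ψ δ x * quarkField Ψ x k σ + Y j k Ψ x * quarkField δ x k σ) := by
  choose f hf h0 h1 using fun j k => (hY j k).hasExp_line (Ψ := Ψ) (δ := δ)
  rw [(hasExp_quarkApply hf).lineVariation_eq]
  refine Finset.sum_congr rfl fun k _ => ?_
  rw [h0, h1, Finset.Nat.antidiagonal_succ]
  simp [linePath, add_comm]

/-- The direction of variation has no quark component, so `ψ` is a constant and only the matrix is
differentiated. -/
theorem omegaYM₁_quarkApply {v : QField c ι J (Fin 4 → ι → ℝ)} (hT₀ : IsPropagator 0 T₀)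
    (hv : v ∈ spaceV L) (Y : Matrix J J (fieldAlgebra (c := c) (J := J) L)) :
    omegaYM₁ T₀ v (quarkApply (matrixVal L J Y)) =
      quarkApply (matrixVal L J (Y.map (omegaLin hT₀ hv))) := by
  have hv' := mem_stringFunctions_of_mem_spaceV hv
  funext Ψ x j σ
  rw [omegaYM₁_eq hT₀ hv', lineVariation_quarkApply
    (Y := matrixVal L J Y) fun j k => expands_of_mem_fieldAlgebra (L := L) (Y j k).2]
  refine Finset.sum_congr rfl fun k _ => ?_
  rw [← omegaYM₁_eq hT₀ hv']
  have h0 : quarkField (potentialDirection (J := J) (hv' Ψ)) x k σ = 0 := rfl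
  rw [h0, mul_zero, add_zero]
  rfl

theorem lineVariation_of_onlyPotential {E : Type*} [NormedAddCommGroup E] [NormedSpace ℝ E]
    {X : QField c ι J E} (hX : OnlyPotential X) (Ψ δ : Config c ι J) (hδ : δ.1 = 0) :
    lineVariation X Ψ δ = 0 := by
  funext x
  have h : ∀ t : ℝ, X (Ψ + t • δ) = X Ψ := fun t => hX _ _ (by
    change Ψ.1 + t • δ.1 = Ψ.1
    rw [hδ, smul_zero, add_zero])
  simp only [lineVariation, h]
  exact deriv_const _ _

theorem lieElement_scalarLift_apply {n : Type*} [Fintype n] (ρ : ι → Matrix n n ℂ)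
    {s : QField c ι J (ι → ℝ)} (hs : InS L s) (i j : n) (Ψ : Config c ι J) (x : Spacetime) :
    ((lieElement ρ (scalarLift hs) i j : fieldAlgebra (c := c) (J := J) L) :
      QField c ι J ℂ) Ψ x = Complex.I * ∑ a, (s Ψ x a : ℂ) * ρ a i j := by
  rw [lieElement_apply]
  have hcoe : ((algebraMap ℂ (fieldAlgebra (c := c) (J := J) L) Complex.I *
      ∑ a, scalarLift hs a * algebraMap ℂ (fieldAlgebra (c := c) (J := J) L) (ρ a i j) :
        fieldAlgebra (c := c) (J := J) L) : QField c ι J ℂ) =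
      algebraMap ℂ (QField c ι J ℂ) Complex.I * ∑ a, component s a *
        algebraMap ℂ (QField c ι J ℂ) (ρ a i j) := by
    push_cast
    rfl
  rw [hcoe]
  simp only [Pi.mul_apply, Finset.sum_apply]
  rfl

theorem gaugeRep_map_apply (π : GaugeRep L J) (s : ι → ℝ) (i j : J) :
    π.map s i j = ∑ a, (s a : ℂ) * π.gen a i j := by
  simp only [GaugeRep.map, Matrix.sum_apply, Matrix.smul_apply, smul_eq_mul]

theorem contractionQuark_mem (π : GaugeRep L J) {Γ : Fin 4 → Matrix (Fin 4) (Fin 4) ℂ}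
    (hΓ : IsDirac Γ) {m : ℝ} (hΔ : IsPropagator m Δ) {s : QField c ι J (ι → ℝ)} {Ψ : Config c ι J}
    (hs : ContDiff ℝ ∞ (s Ψ)) : contractionQuark π Γ m Δ s Ψ ∈ smoothFunctions _ := by
  refine mem_smoothFunctions.mpr (contDiff_pi.mpr fun j => contDiff_pi.mpr fun σ => ?_)
  simp only [contractionQuark_eq π hΓ hΔ hs]
  exact contDiff_const.mul (ContDiff.sum fun k _ => (contDiff_gaugeRep_map π hs j k).mul
    (contDiff_pi.mp (contDiff_pi.mp (mem_smoothFunctions.mp Ψ.2.1.2) k) σ))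

theorem contractionAntiquark_mem (π : GaugeRep L J) {Γ : Fin 4 → Matrix (Fin 4) (Fin 4) ℂ}
    (hΓ : IsDirac Γ) {m : ℝ} (hΔ : IsPropagator m Δ) {s : QField c ι J (ι → ℝ)} {Ψ : Config c ι J}
    (hs : ContDiff ℝ ∞ (s Ψ)) : contractionAntiquark π Γ m Δ s Ψ ∈ smoothFunctions _ := by
  refine mem_smoothFunctions.mpr (contDiff_pi.mpr fun j => contDiff_pi.mpr fun σ => ?_)
  simp only [contractionAntiquark_eq π hΓ hΔ hs]
  exact contDiff_const.mul (ContDiff.sum fun k _ =>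
    (contDiff_pi.mp (contDiff_pi.mp (mem_smoothFunctions.mp Ψ.2.2.2) k) σ).mul
    (contDiff_gaugeRep_map π hs k j))

/-- Here the matrix is the constant, as it depends on the potential only, and `ψ` varies by
`iπ(s)ψ`. The new factor stands between `Y` and `ψ`, so it multiplies `Y` from the right. -/
theorem omegaQuark₁_quarkApply (π : GaugeRep L J) {Γ : Fin 4 → Matrix (Fin 4) (Fin 4) ℂ}
    (hΓ : IsDirac Γ) {m : ℝ} (hΔ : IsPropagator m Δ) {s : QField c ι J (ι → ℝ)} (hs : InS L s)
    (Y : Matrix J J (fieldAlgebra (c := c) (J := J) L)) :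
    omegaQuark₁ π Γ m Δ s (quarkApply (matrixVal L J Y)) =
      quarkApply (matrixVal L J (Y * lieElement π.gen (scalarLift hs))) := by
  funext Ψ x j σ
  have hsΨ := (hs.expands.mem Ψ).1
  rw [omegaQuark₁, variation_eq_lineVariation (Submodule.zero_mem _)
    (contractionQuark_mem π hΓ hΔ hsΨ) (contractionAntiquark_mem π hΓ hΔ hsΨ),
    lineVariation_quarkApply (Y := matrixVal L J Y)
      fun j k => expands_of_mem_fieldAlgebra (L := L) (Y j k).2]
  have h1 : ∀ k, lineVariation (matrixVal L J Y j k) Ψ (⟨0, Submodule.zero_mem _⟩,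
      ⟨_, contractionQuark_mem π hΓ hΔ hsΨ⟩, ⟨_, contractionAntiquark_mem π hΓ hΔ hsΨ⟩) = 0 :=
    fun k => lineVariation_of_onlyPotential
      (onlyPotential_of_mem_fieldAlgebra (L := L) (Y j k).2) _ _ rfl
  have h3 : ∀ k, matrixVal L J (Y * lieElement π.gen (scalarLift hs)) j k Ψ x =
      ∑ i, matrixVal L J Y j i Ψ x * (Complex.I * π.map (s Ψ x) i k) := by
    intro k
    rw [map_mul, Matrix.mul_apply]
    simp only [Finset.sum_apply, Pi.mul_apply]
    refine Finset.sum_congr rfl fun i _ => ?_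
    congr 1
    rw [matrixVal_apply, lieElement_scalarLift_apply, gaugeRep_map_apply]
  rw [quarkApply]
  simp only [h3, Finset.sum_mul]
  rw [Finset.sum_comm]
  refine Finset.sum_congr rfl fun i _ => ?_
  refine (congrArg₂ (· + ·) ((congrArg (· * quarkField Ψ x i σ) (congrFun (h1 i) x)).trans
    (zero_mul _)) rfl).trans ?_
  rw [zero_add]
  change matrixVal L J Y j i Ψ x * contractionQuark π Γ m Δ s Ψ x i σ = _
  rw [contractionQuark_eq π hΓ hΔ hsΨ, Finset.mul_sum, Finset.mul_sum]
  refine Finset.sum_congr rfl fun k _ => ?_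
  ring

/-- The power series of fields obtained by applying a matrix power series to the quark field. -/
def quarkSeries (Y : PowerSeries (Matrix J J (fieldAlgebra (c := c) (J := J) L))) :
    FieldSeries c ι J (J → Fin 4 → ℂ) := fun n => quarkApply (matrixVal L J (coeff n Y))

theorem quarkApply_add (Y Z : Matrix J J (QField c ι J ℂ)) :
    quarkApply (Y + Z) = quarkApply Y + quarkApply Z := by
  funext Ψ x j σ
  simp [quarkApply, add_mul, Finset.sum_add_distrib]

theorem quarkApply_smul (r : ℝ) (Y : Matrix J J (QField c ι J ℂ)) :
    quarkApply (r • Y) = r • quarkApply Y := by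
  funext Ψ x j σ
  simp [quarkApply, Finset.mul_sum, mul_assoc]

theorem quarkApply_sum {κ : Type*} (s : Finset κ) (Y : κ → Matrix J J (QField c ι J ℂ)) :
    quarkApply (∑ i ∈ s, Y i) = ∑ i ∈ s, quarkApply (Y i) := by
  let φ : Matrix J J (QField c ι J ℂ) →+ QField c ι J (J → Fin 4 → ℂ) :=
    AddMonoidHom.mk' quarkApply quarkApply_add
  exact map_sum φ Y s

theorem omegaYM_quarkSeries (hT₀ : IsPropagator 0 T₀) (hα : InGV L α)
    (Y : PowerSeries (Matrix J J (fieldAlgebra (c := c) (J := J) L))) :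
    omegaYM T₀ α (quarkSeries Y) = quarkSeries (act (omegaSeries J hT₀ hα) Y) := by
  funext n
  rw [quarkSeries, coeff_act, map_sum, quarkApply_sum, omegaYM]
  refine Finset.sum_congr rfl fun k _ => ?_
  rw [quarkSeries, omegaYM₁_quarkApply hT₀ (hα.2 k.1), coeff_omegaSeries]

theorem omegaQuark_quarkSeries (π : GaugeRep L J) {Γ : Fin 4 → Matrix (Fin 4) (Fin 4) ℂ}
    (hΓ : IsDirac Γ) {m : ℝ} (hΔ : IsPropagator m Δ) (hβ : ∀ n, InS L (β n))
    (Y : PowerSeries (Matrix J J (fieldAlgebra (c := c) (J := J) L))) :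
    omegaQuark π Γ m Δ β (quarkSeries Y) = quarkSeries (Y * lieSeries π.gen hβ) := by
  funext n
  rw [quarkSeries, coeff_mul, map_sum, quarkApply_sum, omegaQuark,
    ← Finset.Nat.sum_antidiagonal_swap]
  refine Finset.sum_congr rfl fun k _ => ?_
  rw [quarkSeries, coeff_lieSeries]
  exact omegaQuark₁_quarkApply π hΓ hΔ (hβ k.2) _

theorem expMap_quarkSeries
    {T : FieldSeries c ι J (J → Fin 4 → ℂ) → FieldSeries c ι J (J → Fin 4 → ℂ)}
    {U : PowerSeries (Matrix J J (fieldAlgebra (c := c) (J := J) L)) →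
      PowerSeries (Matrix J J (fieldAlgebra (c := c) (J := J) L))}
    (h : ∀ Y, T (quarkSeries Y) = quarkSeries (U Y))
    (Y : PowerSeries (Matrix J J (fieldAlgebra (c := c) (J := J) L))) :
    expMap T (quarkSeries Y) = quarkSeries (seriesExp U Y) := by
  have hk : ∀ k, T^[k] (quarkSeries Y) = quarkSeries (U^[k] Y) := by
    intro k
    induction k with
    | zero => rfl
    | succ k ih => rw [Function.iterate_succ_apply', Function.iterate_succ_apply', ih, h]
  funext n
  rw [quarkSeries, seriesExp, coeff_fsum, map_sum, quarkApply_sum, expMap]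
  refine Finset.sum_congr rfl fun k _ => ?_
  rw [hk, PowerSeries.coeff_smul, map_smul, quarkApply_smul, quarkSeries]

theorem quarkSeries_one : quarkSeries (1 : PowerSeries (Matrix J J
    (fieldAlgebra (c := c) (J := J) L))) = constSeries quarkField := by
  funext n
  rw [quarkSeries, constSeries, coeff_one]
  split_ifs
  · rw [map_one]
    funext Ψ x j σ
    simp only [quarkApply, Matrix.one_apply]
    rw [Finset.sum_eq_single j]
    · simp
    · intro k _ hk
      simp [Ne.symm hk]
    · simp
  · rw [map_zero]
    funext Ψ x j σ
    simp [quarkApply]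

/-- The passage from field theory to algebra: `ω` preserves fields of the form `Yψ`, and `ψ` itself
corresponds to `Y = 1`. -/
theorem dressedQuark_eq (π : GaugeRep L J) {Γ : Fin 4 → Matrix (Fin 4) (Fin 4) ℂ}
    (hΓ : IsDirac Γ) {m : ℝ} (hT₀ : IsPropagator 0 T₀) (hΔ : IsPropagator m Δ) (hα : InGV L α)
    (hβ : InGS L β) : dressedQuark π Γ m T₀ Δ α β =
      quarkSeries (act (pexp (omegaSeries J hT₀ hα + rightMul (lieSeries π.gen hβ.2))) 1) := by
  rw [act_pexp ((ordGE_omegaSeries hT₀ hα).add (ordGE_lieSeries _ hβ).rightMul), dressedQuark,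
    ← quarkSeries_one (L := L)]
  refine expMap_quarkSeries (fun Y => ?_) 1
  rw [omegaYM_quarkSeries hT₀ hα, omegaQuark_quarkSeries π hΓ hΔ hβ.2, act_add, act_rightMul]
  funext n
  rw [Pi.add_apply, quarkSeries, quarkSeries, quarkSeries, map_add, map_add, quarkApply_add]

theorem rotatedQuark_eq (π : GaugeRep L J) (hγ : ∀ n, InS L (γ n)) :
    rotatedQuark π γ = quarkSeries (pexp (lieSeries π.gen hγ)) := by
  funext n Ψ x j σ
  rw [rotatedQuark, ← embedSeries_pexp _ hγ]
  simp only [coeff_embedSeries]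
  rfl

/-- Since the coefficients do not depend on `ψ`, it may be replaced by a constant field with a
single nonzero component, which reads off one matrix entry. -/
theorem quarkSeries_injective : Function.Injective
    (quarkSeries : PowerSeries (Matrix J J (fieldAlgebra (c := c) (J := J) L)) → _) := by
  intro Y Z h
  ext1 n
  refine Matrix.ext fun j k => Subtype.ext (funext fun Ψ => funext fun x => ?_)
  let Ψ' : Config c ι J := (Ψ.1, ⟨fun _ => Pi.single k (Pi.single 0 1), const_mem_smooth _⟩, 0)
  have h1 : ∀ Y : PowerSeries (Matrix J J (fieldAlgebra (c := c) (J := J) L)),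
      quarkSeries Y n Ψ' x j 0 = (coeff n Y j k : QField c ι J ℂ) Ψ x := by
    intro Y
    rw [quarkSeries, quarkApply, Finset.sum_eq_single k]
    · have : quarkField Ψ' x k 0 = 1 := by simp [Ψ', quarkField]
      rw [this, mul_one, matrixVal_apply]
      exact congrFun (onlyPotential_of_mem_fieldAlgebra (L := L) (coeff n Y j k).2 Ψ' Ψ rfl) x
    · intro i _ hi
      have : quarkField Ψ' x i 0 = 0 := by simp [Ψ', quarkField, hi]
      rw [this, mul_zero]
    · simp
  rw [← h1, h, h1]

/-- The mediator contains `β` only in the combination `π(β)`. For a representation that is not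
faithful, `β` itself is not determined by it. -/
theorem quarkMediator_congr (π : GaugeRep L J) (Γ : Fin 4 → Matrix (Fin 4) (Fin 4) ℂ)
    {β' : FieldSeries c ι J (ι → ℝ)} (hβ : ∀ n, InS L (β n)) (hβ' : ∀ n, InS L (β' n))
    (h : lieSeries π.gen hβ' = lieSeries π.gen hβ) :
    quarkMediator π Γ β' = quarkMediator π Γ β := by
  have h1 : ∀ n Ψ x j k, ∑ a, (β' n Ψ x a : ℂ) * π.gen a j k =
      ∑ a, (β n Ψ x a : ℂ) * π.gen a j k := by
    intro n Ψ x j k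
    have h2 : lieElement π.gen (scalarLift (hβ' n)) = lieElement π.gen (scalarLift (hβ n)) := by
      rw [← coeff_lieSeries, ← coeff_lieSeries, h]
    have h3 := lieElement_scalarLift_apply π.gen (hβ' n) j k Ψ x
    rw [h2, lieElement_scalarLift_apply π.gen (hβ n) j k Ψ x] at h3
    exact (mul_left_cancel₀ Complex.I_ne_zero h3).symm
  have h4 : ∀ (b : FieldSeries c ι J (ι → ℝ)) μ n Ψ x, quarkMediator π Γ b μ n Ψ x =
      ∑ j, ∑ k, ∑ σ, ∑ ρ, antiquarkField Ψ x j σ * Γ μ σ ρ * quarkField Ψ x k ρ *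
        ∑ a, (b n Ψ x a : ℂ) * π.gen a j k := by
    intro b μ n Ψ x
    simp only [quarkMediator, current, Finset.mul_sum]
    rw [Finset.sum_comm]
    refine Finset.sum_congr rfl fun j _ => ?_
    rw [Finset.sum_comm]
    refine Finset.sum_congr rfl fun k _ => ?_
    rw [Finset.sum_comm]
    refine Finset.sum_congr rfl fun σ _ => ?_
    rw [Finset.sum_comm]
    refine Finset.sum_congr rfl fun ρ _ => Finset.sum_congr rfl fun a _ => ?_
    ring
  funext μ n Ψ x
  rw [h4, h4]
  simp only [h1]

theorem quarkMediator_unique (π : GaugeRep L J) {Γ : Fin 4 → Matrix (Fin 4) (Fin 4) ℂ}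
    (hΓ : IsDirac Γ) {m : ℝ} (hT₀ : IsPropagator 0 T₀) (hΔ : IsPropagator m Δ) (hα : InGV L α)
    {β' : FieldSeries c ι J (ι → ℝ)} (hβ : InGS L β) (hβ' : InGS L β')
    (h : dressedQuark π Γ m T₀ Δ α β' = dressedQuark π Γ m T₀ Δ α β) :
    quarkMediator π Γ β' = quarkMediator π Γ β := by
  rw [dressedQuark_eq π hΓ hT₀ hΔ hα hβ, dressedQuark_eq π hΓ hT₀ hΔ hα hβ'] at h
  exact quarkMediator_congr π Γ hβ.2 hβ'.2 (eq_of_act_pexp_one_eq (ordGE_omegaSeries hT₀ hα)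
    (ordGE_lieSeries _ hβ') (ordGE_lieSeries _ hβ) (quarkSeries_injective h))

end Quark

/-! ### Matrix-valued functions on spacetime -/

section CoeffsIn

open PowerSeries

variable {B : Type*} [Ring B] [Algebra ℝ B] {S : Submodule ℝ B}

theorem CoeffsIn.mul (hS : ∀ x ∈ S, ∀ y ∈ S, x * y ∈ S) {p q : PowerSeries B} (hp : CoeffsIn S p)
    (hq : CoeffsIn S q) : CoeffsIn S (p * q) := fun n => by
  rw [coeff_mul]
  exact Submodule.sum_mem _ fun k _ => hS _ (hp _) _ (hq _)

theorem CoeffsIn.pow_succ (hS : ∀ x ∈ S, ∀ y ∈ S, x * y ∈ S) {p : PowerSeries B}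
    (hp : CoeffsIn S p) (k : ℕ) : CoeffsIn S (p ^ (k + 1)) := by
  induction k with
  | zero => simpa using hp
  | succ k ih => rw [_root_.pow_succ]; exact ih.mul hS hp

/-- The unit is split off because `S` need not contain it: functions subject to the support
condition are closed under products, but constants in general do not belong to them. -/
theorem CoeffsIn.pexp_sub_one (hS : ∀ x ∈ S, ∀ y ∈ S, x * y ∈ S) {p : PowerSeries B}
    (hp : CoeffsIn S p) : CoeffsIn S (pexp p - 1) := fun n => by
  have h : coeff n (pexp p - 1) =
      ∑ k ∈ Finset.range n, (((k + 1).factorial : ℝ)⁻¹) • coeff n (p ^ (k + 1)) := by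
    rw [map_sub, coeff_pexp, Finset.sum_range_succ']
    simp
  rw [h]
  exact Submodule.sum_mem _ fun k _ => S.smul_mem _ (hp.pow_succ hS k n)

theorem CoeffsIn.mul_sub_one (hS : ∀ x ∈ S, ∀ y ∈ S, x * y ∈ S) {p q : PowerSeries B}
    (hp : CoeffsIn S (p - 1)) (hq : CoeffsIn S (q - 1)) : CoeffsIn S (p * q - 1) := by
  have h : p * q - 1 = (p - 1) * (q - 1) + (p - 1) + (q - 1) := by noncomm_ring
  rw [h]
  exact ((hp.mul hS hq).add hp).add hq

theorem coeffsIn_one (h : (1 : B) ∈ S) : CoeffsIn S (1 : PowerSeries B) := fun n => by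
  rw [coeff_one]
  split_ifs
  exacts [h, S.zero_mem]

theorem CoeffsIn.pexp (hS : ∀ x ∈ S, ∀ y ∈ S, x * y ∈ S) (h1 : (1 : B) ∈ S) {p : PowerSeries B}
    (hp : CoeffsIn S p) : CoeffsIn S (pexp p) := by
  simpa using (hp.pexp_sub_one hS).add (coeffsIn_one h1)

end CoeffsIn

/-! ### Coefficientwise derivatives and intertwining of covariant derivatives. -/

section MatrixFunctions

open PowerSeries

variable {c : StringFunction} {ι n : Type*} [Fintype ι] [Fintype n] [DecidableEq n]

instance instRingMatrixFunction : Ring (Matrix n n (Spacetime → ℂ)) := Matrix.instRing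

instance instAlgebraRealMatrixFunction : Algebra ℝ (Matrix n n (Spacetime → ℂ)) :=
  Matrix.instAlgebra

/-- The matrices of functions whose entries lie in a given space. -/
def entriesIn (n : Type*) (M : Submodule ℝ (Spacetime → ℂ)) :
    Submodule ℝ (Matrix n n (Spacetime → ℂ)) where
  carrier := {Y | ∀ i j, Y i j ∈ M}
  zero_mem' _ _ := M.zero_mem
  add_mem' hY hZ i j := M.add_mem (hY i j) (hZ i j)
  smul_mem' r _ hY i j := M.smul_mem r (hY i j)

theorem entriesIn_mul {M : Submodule ℝ (Spacetime → ℂ)} (hM : ∀ f ∈ M, ∀ g ∈ M, f * g ∈ M)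
    (Y : Matrix n n (Spacetime → ℂ)) (hY : Y ∈ entriesIn n M) (Z : Matrix n n (Spacetime → ℂ))
    (hZ : Z ∈ entriesIn n M) : Y * Z ∈ entriesIn n M := fun i j => by
  rw [Matrix.mul_apply]
  exact Submodule.sum_mem _ fun k _ => hM _ (hY i k) _ (hZ k j)

theorem smoothFunctions_mul (f : Spacetime → ℂ) (hf : f ∈ smoothFunctions ℂ) (g : Spacetime → ℂ)
    (hg : g ∈ smoothFunctions ℂ) : f * g ∈ smoothFunctions ℂ := mulLin_mem_smooth hf hg

theorem stringFunctions_mul (f : Spacetime → ℂ) (hf : f ∈ stringFunctions c ℂ)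
    (g : Spacetime → ℂ) (hg : g ∈ stringFunctions c ℂ) : f * g ∈ stringFunctions c ℂ :=
  mul_mem_stringFunctions hf.1 hg

theorem one_mem_entriesIn_smooth :
    (1 : Matrix n n (Spacetime → ℂ)) ∈ entriesIn n (smoothFunctions ℂ) := fun i j => by
  rw [Matrix.one_apply]
  split_ifs
  exacts [const_mem_smooth 1, Submodule.zero_mem _]

/-- The entrywise, coefficientwise derivative. -/
def seriesPderiv (μ : Fin 4) (p : PowerSeries (Matrix n n (Spacetime → ℂ))) :
    PowerSeries (Matrix n n (Spacetime → ℂ)) :=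
  PowerSeries.mk fun k => (coeff k p).map (pderiv μ)

theorem coeff_seriesPderiv (μ : Fin 4) (p : PowerSeries (Matrix n n (Spacetime → ℂ))) (k : ℕ) :
    coeff k (seriesPderiv μ p) = (coeff k p).map (pderiv μ) := by simp [seriesPderiv]

theorem pderiv_zero (μ : Fin 4) : pderiv μ (0 : Spacetime → ℂ) = 0 := by
  funext x
  simp [pderiv]

theorem pderiv_sum {κ : Type*} (s : Finset κ) {f : κ → Spacetime → ℂ}
    (hf : ∀ i ∈ s, f i ∈ smoothFunctions ℂ) (μ : Fin 4) :
    pderiv μ (∑ i ∈ s, f i) = ∑ i ∈ s, pderiv μ (f i) := by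
  classical
  induction s using Finset.induction_on with
  | empty => simp [pderiv_zero]
  | insert i s hi ih =>
    have h1 := fun j hj => hf j (Finset.mem_insert_of_mem hj)
    rw [Finset.sum_insert hi, Finset.sum_insert hi, ← ih h1]
    exact pderiv_add (mem_smoothFunctions.mp (hf i (Finset.mem_insert_self _ _)))
      (mem_smoothFunctions.mp (Submodule.sum_mem _ h1)) μ

theorem map_pderiv_mul {Y Z : Matrix n n (Spacetime → ℂ)}
    (hY : Y ∈ entriesIn n (smoothFunctions ℂ)) (hZ : Z ∈ entriesIn n (smoothFunctions ℂ))
    (μ : Fin 4) : (Y * Z).map (pderiv μ) = Y.map (pderiv μ) * Z + Y * Z.map (pderiv μ) := by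
  ext1 i j
  rw [Matrix.map_apply, Matrix.add_apply, Matrix.mul_apply, Matrix.mul_apply, Matrix.mul_apply,
    pderiv_sum _ fun k _ => smoothFunctions_mul _ (hY i k) _ (hZ k j), ← Finset.sum_add_distrib]
  exact Finset.sum_congr rfl fun k _ =>
    pderiv_mul (mem_smoothFunctions.mp (hY i k)) (mem_smoothFunctions.mp (hZ k j)) μ

theorem map_pderiv_sum {κ : Type*} (s : Finset κ) {Y : κ → Matrix n n (Spacetime → ℂ)}
    (hY : ∀ i ∈ s, Y i ∈ entriesIn n (smoothFunctions ℂ)) (μ : Fin 4) :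
    (∑ k ∈ s, Y k).map (pderiv μ) = ∑ k ∈ s, (Y k).map (pderiv μ) := by
  ext1 i j
  rw [Matrix.map_apply, Matrix.sum_apply, Matrix.sum_apply, pderiv_sum s fun k hk => hY k hk i j]
  rfl

theorem map_pderiv_smul (r : ℝ) {Y : Matrix n n (Spacetime → ℂ)}
    (hY : Y ∈ entriesIn n (smoothFunctions ℂ)) (μ : Fin 4) :
    (r • Y).map (pderiv μ) = r • Y.map (pderiv μ) := by
  ext1 i j
  exact pderiv_const_smul (mem_smoothFunctions.mp (hY i j)) r μ

/-- On arbitrary functions `pderiv` is neither linear nor a derivation, so smoothness of the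
coefficients is carried along. For the same reason `seriesPderiv_pexp` goes through `deriv_pexp_eq`
instead of `map_pexp_eq`. -/
theorem seriesPderiv_mul {p q : PowerSeries (Matrix n n (Spacetime → ℂ))}
    (hp : CoeffsIn (entriesIn n (smoothFunctions ℂ)) p)
    (hq : CoeffsIn (entriesIn n (smoothFunctions ℂ)) q) (μ : Fin 4) :
    seriesPderiv μ (p * q) = seriesPderiv μ p * q + p * seriesPderiv μ q := by
  ext1 k
  rw [coeff_seriesPderiv, map_add, coeff_mul, coeff_mul, coeff_mul,
    map_pderiv_sum _ fun l _ => entriesIn_mul smoothFunctions_mul _ (hp l.1) _ (hq l.2),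
    ← Finset.sum_add_distrib]
  refine Finset.sum_congr rfl fun l _ => ?_
  rw [map_pderiv_mul (hp _) (hq _), coeff_seriesPderiv, coeff_seriesPderiv]

theorem seriesPderiv_one (μ : Fin 4) :
    seriesPderiv μ (1 : PowerSeries (Matrix n n (Spacetime → ℂ))) = 0 := by
  have h : ∀ z : ℂ, pderiv μ (fun _ : Spacetime => z) = 0 := fun z => by
    funext x
    simp [pderiv]
  ext1 k
  rw [coeff_seriesPderiv, coeff_one, map_zero]
  split_ifs
  · ext1 i j
    rw [Matrix.map_apply, Matrix.one_apply]
    split_ifs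
    exacts [h 1, h 0]
  · ext1 i j
    exact h 0

theorem OrdGE.seriesPderiv {m : ℕ} {p : PowerSeries (Matrix n n (Spacetime → ℂ))} (hp : OrdGE m p)
    (μ : Fin 4) : OrdGE m (seriesPderiv μ p) := fun k hk => by
  rw [coeff_seriesPderiv, hp k hk]
  ext1 i j
  exact pderiv_zero μ

/-- The logarithmic derivative of the exponential of a matrix-valued function. -/
theorem seriesPderiv_pexp {P : PowerSeries (Matrix n n (Spacetime → ℂ))} (hP1 : OrdGE 1 P)
    (hP : CoeffsIn (entriesIn n (smoothFunctions ℂ)) P) (μ : Fin 4) :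
    seriesPderiv μ (pexp P) = logDeriv P (seriesPderiv μ P) * pexp P := by
  have hk : ∀ k, CoeffsIn (entriesIn n (smoothFunctions ℂ)) (P ^ k) := fun k => by
    cases k with
    | zero => rw [pow_zero]; exact coeffsIn_one one_mem_entriesIn_smooth
    | succ k => exact hP.pow_succ (entriesIn_mul smoothFunctions_mul) k
  refine deriv_pexp_eq (z := fun k => seriesPderiv μ (P ^ k)) hP1 (hP1.seriesPderiv μ)
    (by simp only [pow_zero, seriesPderiv_one])
    (fun k => by
      rw [pow_succ', seriesPderiv_mul hP (hk k)]) ?_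
  ext1 m
  rw [coeff_seriesPderiv, coeff_fsum, coeff_pexp,
    map_pderiv_sum _ fun k _ => Submodule.smul_mem _ _ (hk k m)]
  refine Finset.sum_congr rfl fun k _ => ?_
  rw [map_pderiv_smul _ (hk k m), PowerSeries.coeff_smul, coeff_seriesPderiv]

/-- `∂_μ U = g (B_μ U - U A_μ)`: multiplication by `U` intertwines the covariant derivatives with
potentials `A` and `B`. -/
def Intertwines (U : PowerSeries (Matrix n n (Spacetime → ℂ)))
    (B A : Fin 4 → PowerSeries (Matrix n n (Spacetime → ℂ))) : Prop :=
  ∀ μ, seriesPderiv μ U = X * (B μ * U - U * A μ)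

variable {U V : PowerSeries (Matrix n n (Spacetime → ℂ))}
  {A B C : Fin 4 → PowerSeries (Matrix n n (Spacetime → ℂ))}

theorem Intertwines.mul (hU : Intertwines U C B) (hV : Intertwines V B A)
    (hU' : CoeffsIn (entriesIn n (smoothFunctions ℂ)) U)
    (hV' : CoeffsIn (entriesIn n (smoothFunctions ℂ)) V) : Intertwines (U * V) C A := fun μ => by
  rw [seriesPderiv_mul hU' hV', hU μ, hV μ, ← mul_assoc U, (commute_X U).eq]
  noncomm_ring

/-- Differentiating `U V = 1` expresses `∂V` by `∂U`. -/
theorem Intertwines.inv (hU : Intertwines U B A)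
    (hU' : CoeffsIn (entriesIn n (smoothFunctions ℂ)) U)
    (hV' : CoeffsIn (entriesIn n (smoothFunctions ℂ)) V) (hUV : U * V = 1) (hVU : V * U = 1) :
    Intertwines V A B := fun μ => by
  have h := seriesPderiv_mul hU' hV' μ
  rw [hUV, seriesPderiv_one, hU μ] at h
  have h1 : seriesPderiv μ V = V * (U * seriesPderiv μ V) := by rw [← mul_assoc, hVU, one_mul]
  rw [h1, eq_neg_of_add_eq_zero_right h.symm]
  calc V * -(X * (B μ * U - U * A μ) * V) = -(V * X * (B μ * (U * V) - U * A μ * V)) := by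
        noncomm_ring
    _ = X * (V * U * A μ * V - V * B μ) := by
        rw [hUV, (commute_X V).eq]
        noncomm_ring
    _ = X * (A μ * V - V * B μ) := by rw [hVU, one_mul]

end MatrixFunctions

/-! ### Lie-algebra-valued functions and gauge transformations -/

section LieFunctions

open PowerSeries

variable {c : StringFunction} {ι d J n : Type*} [Fintype ι] [Fintype d] [DecidableEq d]
  [Fintype J] [DecidableEq J] [Fintype n] [DecidableEq n]

/-- The matrix-valued function `i ∑ u_a ρ_a`. -/
def functionLie (ρ : ι → Matrix n n ℂ) :
    (Spacetime → ι → ℝ) →ₗ[ℝ] Matrix n n (Spacetime → ℂ) where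
  toFun u := lieElement ρ fun a => componentLin a u
  map_add' u v := by
    rw [← lieElement_add]
    congr 1
    funext a
    exact map_add (componentLin a) u v
  map_smul' r u := by
    have h : (fun a => componentLin a (r • u)) = (r : ℂ) • fun a => componentLin a u := by
      funext a
      exact map_smul (componentLin a) r u
    rw [h, lieElement_smul]
    rfl

theorem functionLie_apply (ρ : ι → Matrix n n ℂ) (u : Spacetime → ι → ℝ) (i j : n)
    (x : Spacetime) : functionLie ρ u i j x = Complex.I * ∑ a, (u x a : ℂ) * ρ a i j := by
  change lieElement ρ (fun a => componentLin a u) i j x = _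
  rw [lieElement_apply]
  simp only [Pi.mul_apply, Finset.sum_apply]
  rfl

theorem functionLie_injective (L : GaugeAlgebra ι d) : Function.Injective (functionLie L.gen) := by
  refine (injective_iff_map_eq_zero _).mpr fun u hu => ?_
  funext x a
  have h : ∑ a, u x a • L.gen a = 0 := by
    ext i j
    have h1 := congrFun (congrFun (congrFun hu i) j) x
    rw [functionLie_apply] at h1
    have h2 := (mul_eq_zero.mp h1).resolve_left Complex.I_ne_zero
    simpa [Matrix.sum_apply] using h2
  exact Fintype.linearIndependent_iff.mp L.independent _ h a

theorem functionLie_commutator {L : GaugeAlgebra ι d} {ρ : ι → Matrix n n ℂ}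
    (hρ : ∀ a b, Complex.I • (ρ a * ρ b - ρ b * ρ a) = ∑ e, (L.struct a b e : ℂ) • ρ e)
    (u v : Spacetime → ι → ℝ) :
    functionLie ρ u * functionLie ρ v - functionLie ρ v * functionLie ρ u =
      functionLie ρ fun x => L.bracket (u x) (v x) := by
  change lieElement ρ _ * lieElement ρ _ - lieElement ρ _ * lieElement ρ _ = lieElement ρ _
  rw [lieElement_commutator hρ]
  congr 1
  funext e x
  simp only [Finset.sum_apply, Pi.mul_apply]
  change _ = ((L.bracket (u x) (v x) e : ℝ) : ℂ)
  rw [GaugeAlgebra.bracket]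
  push_cast
  rfl

theorem functionLie_mem_stringFunctions (ρ : ι → Matrix n n ℂ) {u : Spacetime → ι → ℝ}
    (hu : u ∈ stringFunctions c (ι → ℝ)) :
    functionLie ρ u ∈ entriesIn n (stringFunctions c ℂ) := fun i j => by
  refine mem_stringFunctions_of_support_subset hu ?_ ?_
  · have h : functionLie ρ u i j = fun x => Complex.I * ∑ a, (u x a : ℂ) * ρ a i j :=
      funext (functionLie_apply ρ u i j)
    rw [h]
    exact contDiff_const.mul (ContDiff.sum fun a _ =>
      (mem_smoothFunctions.mp (componentLin_mem_smooth hu.1 a)).mul contDiff_const)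
  · intro x hx
    refine subset_tsupport _ fun h0 => hx ?_
    rw [functionLie_apply, h0]
    simp

theorem entriesIn_string_le : entriesIn n (stringFunctions c ℂ) ≤ entriesIn n (smoothFunctions ℂ) :=
  fun _ h i j => (h i j).1

theorem functionLie_map_pderiv (ρ : ι → Matrix n n ℂ) {u : Spacetime → ι → ℝ}
    (hu : ContDiff ℝ ∞ u) (μ : Fin 4) :
    (functionLie ρ u).map (pderiv μ) = functionLie ρ (pderiv μ u) := by
  ext i j x
  rw [Matrix.map_apply, functionLie_apply]
  have h : functionLie ρ u i j = Complex.I • ∑ a, (ρ a i j) • componentLin a u := by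
    funext x
    rw [functionLie_apply, Pi.smul_apply, Finset.sum_apply, smul_eq_mul]
    congr 1
    exact Finset.sum_congr rfl fun a _ => mul_comm _ _
  have hs : ∀ a, componentLin a u ∈ smoothFunctions ℂ := componentLin_mem_smooth hu
  have hs' : ∀ a, ρ a i j • componentLin a u ∈ smoothFunctions ℂ := fun a =>
    mem_smoothFunctions.mpr (contDiff_const.smul (mem_smoothFunctions.mp (hs a)))
  rw [h, pderiv_const_smul (mem_smoothFunctions.mp (Submodule.sum_mem _ fun a _ => hs' a)),
    pderiv_sum _ fun a _ => hs' a, Pi.smul_apply, Finset.sum_apply, smul_eq_mul]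
  congr 1
  refine Finset.sum_congr rfl fun a _ => ?_
  rw [pderiv_const_smul (mem_smoothFunctions.mp (hs a)), Pi.smul_apply, smul_eq_mul, mul_comm]
  congr 1
  have h1 : HasFDerivAt (componentLin a u)
      ((Complex.ofRealCLM.comp (ContinuousLinearMap.proj (R := ℝ) (φ := fun _ : ι => ℝ) a)).comp
        (fderiv ℝ u x)) x :=
    (Complex.ofRealCLM.comp (ContinuousLinearMap.proj (R := ℝ) (φ := fun _ : ι => ℝ) a)).hasFDerivAt.comp
      x (hu.differentiable (by simp) x).hasFDerivAt
  rw [pderiv, h1.fderiv]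
  rfl

/-- The functions with values in the Lie algebra spanned by `i ρ_a`, trivial along the strings. -/
def lieFunctions (c : StringFunction) (ρ : ι → Matrix n n ℂ) :
    Submodule ℝ (Matrix n n (Spacetime → ℂ)) :=
  (stringFunctions c (ι → ℝ)).map (functionLie ρ)

theorem isLieClosed_lieFunctions {L : GaugeAlgebra ι d} {ρ : ι → Matrix n n ℂ}
    (hρ : ∀ a b, Complex.I • (ρ a * ρ b - ρ b * ρ a) = ∑ e, (L.struct a b e : ℂ) • ρ e) :
    IsLieClosed (lieFunctions c ρ) := by
  rintro _ ⟨u, hu, rfl⟩ _ ⟨v, hv, rfl⟩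
  exact ⟨_, bracket_apply_mem L hu hv, (functionLie_commutator hρ u v).symm⟩

/-- The power series `∑ gᵐ i ρ(θ_m)`. -/
def functionLieSeries (ρ : ι → Matrix n n ℂ) (θ : ℕ → Spacetime → ι → ℝ) :
    PowerSeries (Matrix n n (Spacetime → ℂ)) := PowerSeries.mk fun m => functionLie ρ (θ m)

theorem coeff_functionLieSeries (ρ : ι → Matrix n n ℂ) (θ : ℕ → Spacetime → ι → ℝ) (m : ℕ) :
    coeff m (functionLieSeries ρ θ) = functionLie ρ (θ m) := by simp [functionLieSeries]

variable {ρ : ι → Matrix n n ℂ} {θ s a b : ℕ → Spacetime → ι → ℝ}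

theorem functionLieSeries_neg : functionLieSeries ρ (-θ) = -functionLieSeries ρ θ := by
  ext1 m
  rw [map_neg, coeff_functionLieSeries, coeff_functionLieSeries, Pi.neg_apply, map_neg]

theorem ordGE_functionLieSeries (hθ : θ 0 = 0) : OrdGE 1 (functionLieSeries ρ θ) :=
  ordGE_one_iff.mpr (by rw [coeff_functionLieSeries, hθ, map_zero])

theorem coeffsIn_functionLieSeries (hθ : ∀ m, θ m ∈ stringFunctions c (ι → ℝ)) :
    CoeffsIn (lieFunctions c ρ) (functionLieSeries ρ θ) := fun m => by
  rw [coeff_functionLieSeries]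
  exact Submodule.mem_map_of_mem (hθ m)

theorem coeffsIn_string_functionLieSeries (hθ : ∀ m, θ m ∈ stringFunctions c (ι → ℝ)) :
    CoeffsIn (entriesIn n (stringFunctions c ℂ)) (functionLieSeries ρ θ) := fun m => by
  rw [coeff_functionLieSeries]
  exact functionLie_mem_stringFunctions ρ (hθ m)

theorem coeffsIn_smooth_functionLieSeries (hθ : ∀ m, θ m ∈ stringFunctions c (ι → ℝ)) :
    CoeffsIn (entriesIn n (smoothFunctions ℂ)) (functionLieSeries ρ θ) := fun m =>
  entriesIn_string_le (coeffsIn_string_functionLieSeries hθ m)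

theorem coeffsIn_smooth_pexp (hθ : ∀ m, θ m ∈ stringFunctions c (ι → ℝ)) :
    CoeffsIn (entriesIn n (smoothFunctions ℂ)) (pexp (functionLieSeries ρ θ)) :=
  (coeffsIn_smooth_functionLieSeries hθ).pexp (entriesIn_mul smoothFunctions_mul)
    one_mem_entriesIn_smooth

theorem toSeries_functionComponents :
    toSeries (Complex.I • lieMatrix ρ (functionComponents θ)) = functionLieSeries ρ θ := by
  ext1 m
  rw [coeff_toSeries_lieMatrix, coeff_functionLieSeries]
  change lieElement ρ _ = lieElement ρ _
  congr 1
  funext a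
  rw [functionComponents, coeff_mk]
  rfl

theorem toSeries_gaugeFunction :
    toSeries (gaugeFunction ρ θ) = pexp (functionLieSeries ρ θ) := by
  rw [gaugeFunction, toSeries_matrixExp (fun r => rfl), toSeries_functionComponents]

theorem toSeries_X_smul {R : Type*} [CommRing R] (Y : Matrix n n (PowerSeries R)) :
    toSeries ((X : PowerSeries R) • Y) = X * toSeries Y := by
  ext m i j
  rw [coeff_toSeries, Matrix.map_apply, Matrix.smul_apply, smul_eq_mul]
  cases m with
  | zero => rw [coeff_zero_X_mul, coeff_zero_X_mul]; rfl
  | succ m => rw [coeff_succ_X_mul, coeff_succ_X_mul, coeff_toSeries]; rfl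

theorem toSeries_mapCoeff_pderiv (μ : Fin 4) (Y : Matrix n n (PowerSeries (Spacetime → ℂ))) :
    toSeries (mapCoeff (pderiv μ) Y) = seriesPderiv μ (toSeries Y) := by
  ext m i j
  rw [coeff_seriesPderiv, coeff_toSeries, coeff_toSeries]
  simp [mapCoeff]

/-- Multiplying the law by `i` turns the potentials into Lie algebra elements and the inhomogeneous
term `i U ∂U⁻¹` into `-U ∂U⁻¹`. -/
theorem transform_iff_toSeries {R : Type*} [CommRing R] [Algebra ℂ R]
    (M N U U' Z : Matrix n n (PowerSeries R)) :
    (X : PowerSeries R) • M = U * ((X : PowerSeries R) • N) * U' + Complex.I • (U * Z) ↔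
      X * toSeries (Complex.I • M) =
        toSeries U * (X * toSeries (Complex.I • N)) * toSeries U' - toSeries U * toSeries Z := by
  have hI : Function.Injective fun Y : Matrix n n (PowerSeries R) => toSeries (Complex.I • Y) := by
    intro Y Z h
    have h1 := congrArg (fun W => (-Complex.I) • W) (toSeries_injective h)
    simpa [smul_smul] using h1
  have hr : Complex.I • (U * ((X : PowerSeries R) • N) * U' + Complex.I • (U * Z)) =
      U * ((X : PowerSeries R) • (Complex.I • N)) * U' + -(U * Z) := by
    rw [smul_add, smul_smul, Complex.I_mul_I, neg_one_smul, smul_comm X Complex.I, Matrix.mul_smul,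
      Matrix.mul_smul, Matrix.mul_smul, Matrix.smul_mul, Matrix.smul_mul, Matrix.smul_mul]
  rw [← hI.eq_iff, hr, smul_comm Complex.I X, toSeries_add, toSeries_neg, toSeries_mul,
    toSeries_mul, toSeries_mul, toSeries_X_smul, toSeries_X_smul, sub_eq_add_neg]

/-- The transformation law of potentials in terms of intertwining of covariant derivatives. -/
theorem transform_iff_intertwines (hs0 : s 0 = 0) (hs : ∀ m, s m ∈ stringFunctions c (ι → ℝ))
    (A B : PowerSeries (Matrix n n (Spacetime → ℂ))) (μ : Fin 4) :
    X * B = pexp (functionLieSeries ρ s) * (X * A) * pexp (functionLieSeries ρ (-s)) -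
        pexp (functionLieSeries ρ s) * seriesPderiv μ (pexp (functionLieSeries ρ (-s))) ↔
    seriesPderiv μ (pexp (functionLieSeries ρ s)) =
      X * (B * pexp (functionLieSeries ρ s) - pexp (functionLieSeries ρ s) * A) := by
  have h1 := pexp_mul_pexp_neg (ordGE_functionLieSeries (ρ := ρ) hs0)
  have h2 := pexp_neg_mul_pexp (ordGE_functionLieSeries (ρ := ρ) hs0)
  rw [← functionLieSeries_neg] at h1 h2
  -- Differentiating `U U⁻¹ = 1` replaces `-U ∂U⁻¹` by `(∂U) U⁻¹`; multiplying by `U` on the right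
  -- then gives the intertwining form.
  have h3 := seriesPderiv_mul (coeffsIn_smooth_pexp (ρ := ρ) hs)
    (coeffsIn_smooth_pexp (ρ := ρ) fun m => Submodule.neg_mem _ (hs m)) μ
  change seriesPderiv μ (_ * pexp (functionLieSeries ρ (-s))) =
    _ * pexp (functionLieSeries ρ (-s)) + _ * seriesPderiv μ (pexp (functionLieSeries ρ (-s))) at h3
  rw [h1, seriesPderiv_one] at h3
  generalize pexp (functionLieSeries ρ s) = U at *
  generalize pexp (functionLieSeries ρ (-s)) = U' at *
  rw [sub_eq_add_neg, ← eq_neg_of_add_eq_zero_left h3.symm]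
  have e : U * (X * A) * U' = X * (U * A * U') := by
    rw [← mul_assoc U, (commute_X U).eq]
    noncomm_ring
  rw [e]
  constructor
  · intro h
    calc seriesPderiv μ U = seriesPderiv μ U * (U' * U) := by rw [h2, mul_one]
      _ = (X * B - X * (U * A * U')) * U := by rw [h]; noncomm_ring
      _ = X * (B * U - U * A * (U' * U)) := by noncomm_ring
      _ = X * (B * U - U * A) := by rw [h2, mul_one]
  · intro h
    calc X * B = X * B * (U * U') := by rw [h1, mul_one]
      _ = X * (U * A * U') + X * (B * U - U * A) * U' := by noncomm_ring
      _ = X * (U * A * U') + seriesPderiv μ U * U' := by rw [h]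

theorem gaugeTransform_iff_intertwines (hs0 : s 0 = 0)
    (hs : ∀ m, s m ∈ stringFunctions c (ι → ℝ)) (μ : Fin 4) :
    (X : PowerSeries (Spacetime → ℂ)) • lieMatrix ρ (functionComponents b) =
      gaugeFunction ρ s * ((X : PowerSeries (Spacetime → ℂ)) • lieMatrix ρ (functionComponents a)) *
          gaugeFunction ρ (-s) +
        Complex.I • (gaugeFunction ρ s * mapCoeff (pderiv μ) (gaugeFunction ρ (-s))) ↔
    seriesPderiv μ (pexp (functionLieSeries ρ s)) =
      X * (functionLieSeries ρ b * pexp (functionLieSeries ρ s) -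
        pexp (functionLieSeries ρ s) * functionLieSeries ρ a) := by
  rw [transform_iff_toSeries, toSeries_functionComponents, toSeries_functionComponents,
    toSeries_mapCoeff_pderiv, toSeries_gaugeFunction, toSeries_gaugeFunction,
    transform_iff_intertwines hs0 hs]

end LieFunctions

/-! ### Uniqueness and existence of gauge transformations -/

section Transformations

open PowerSeries

variable {c : StringFunction} {ι d J n : Type*} [Fintype ι] [Fintype d] [DecidableEq d]
  [Fintype J] [DecidableEq J] [Fintype n] [DecidableEq n]

/-- A function, trivial along the strings, whose gradient is a combination of vector fields with
vanishing string integral vanishes. -/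
theorem eq_zero_of_pderiv {s : Spacetime → ℝ} (hs : s ∈ stringFunctions c ℝ)
    {b : Spacetime → Fin 4 → ι → ℝ} (hb : b ∈ stringFunctions c (Fin 4 → ι → ℝ))
    (hb0 : stringInt c b = 0) (k : ι → ℝ)
    (h : ∀ μ, pderiv μ s = fun x => ∑ a, k a * b x μ a) : s = 0 := by
  have hba : ∀ a μ, (fun y => b y μ a) ∈ stringFunctions c ℝ := fun a μ =>
    mem_stringFunctions_pi.mp (mem_stringFunctions_pi.mp hb μ) a
  let g : ι → Fin 4 → stringFunctions c ℝ := fun a μ => ⟨_, hba a μ⟩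
  have hg : ∀ a, scalarStringIntLin c (g a) = 0 := fun a => Subtype.ext (by
    funext x
    have := congrFun (congrFun hb0 x) a
    rwa [stringInt_apply] at this)
  have h1 : scalarStringIntLin c (∑ a, k a • g a) = 0 := by
    rw [map_sum]
    exact Finset.sum_eq_zero fun a _ => by rw [map_smul, hg, smul_zero]
  have h2 : (fun μ => (((∑ a, k a • g a) μ : stringFunctions c ℝ) : Spacetime → ℝ)) =
      fun μ => pderiv μ s := by
    funext μ
    rw [h μ, Finset.sum_apply, Submodule.coe_sum]
    funext x
    rw [Finset.sum_apply]
    rfl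
  have h3 : scalarStringInt c (fun μ => pderiv μ s) = 0 := by
    rw [← h2]
    exact congrArg Subtype.val h1
  -- The string integral of the gradient of `s` is `-s`, while by the assumption on `b` it is zero.
  rw [scalarStringInt_pderiv hs] at h3
  exact neg_eq_zero.mp h3

theorem comp_mem_stringFunctions {f : Spacetime → ℂ} (hf : f ∈ stringFunctions c ℂ)
    (ℓ : ℂ →L[ℝ] ℝ) : (fun x => ℓ (f x)) ∈ stringFunctions c ℝ :=
  mem_stringFunctions_of_support_subset hf (ℓ.contDiff.comp hf.1) fun x hx =>
    subset_tsupport _ fun h0 => hx (by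
      change ℓ (f x) = 0
      rw [h0, map_zero])

theorem pderiv_comp {f : Spacetime → ℂ} (hf : ContDiff ℝ ∞ f) (ℓ : ℂ →L[ℝ] ℝ) (μ : Fin 4)
    (x : Spacetime) : pderiv μ (fun x => ℓ (f x)) x = ℓ (pderiv μ f x) := by
  have h : HasFDerivAt (fun x => ℓ (f x)) (ℓ.comp (fderiv ℝ f x)) x :=
    ℓ.hasFDerivAt.comp x (hf.differentiable (by simp) x).hasFDerivAt
  rw [pderiv, h.fderiv]
  rfl

/-- String integration concerns real functions. A real-linear functional of a matrix entry has a
gradient that is a real combination of the components of `b`, and the real and imaginary parts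
together give the entry. -/
theorem eq_zero_of_map_pderiv {ρ : ι → Matrix n n ℂ} {Y : Matrix n n (Spacetime → ℂ)}
    (hY : Y ∈ entriesIn n (stringFunctions c ℂ)) {b : Spacetime → Fin 4 → ι → ℝ}
    (hb : b ∈ stringFunctions c (Fin 4 → ι → ℝ)) (hb0 : stringInt c b = 0)
    (h : ∀ μ, Y.map (pderiv μ) = functionLie ρ fun x => b x μ) : Y = 0 := by
  have hℓ : ∀ (ℓ : ℂ →L[ℝ] ℝ) i j, (fun x => ℓ (Y i j x)) = 0 := by
    intro ℓ i j
    refine eq_zero_of_pderiv (comp_mem_stringFunctions (hY i j) ℓ) hb hb0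
      (fun a => ℓ (Complex.I * ρ a i j)) fun μ => ?_
    funext x
    have h1 := congrFun (congrFun (congrFun (h μ) i) j) x
    rw [Matrix.map_apply, functionLie_apply] at h1
    rw [pderiv_comp (hY i j).1, h1, Finset.mul_sum, map_sum]
    refine Finset.sum_congr rfl fun a _ => ?_
    have e : Complex.I * ((b x μ a : ℂ) * ρ a i j) = b x μ a • (Complex.I * ρ a i j) := by
      rw [Complex.real_smul]
      ring
    rw [e, map_smul, smul_eq_mul, mul_comm]
  ext i j x
  exact Complex.ext (congrFun (hℓ Complex.reCLM i j) x) (congrFun (hℓ Complex.imCLM i j) x)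

/-- The factor `g` in the intertwining relation makes the gradient of `V_{m+1}` depend on `V_0, …,
V_m` only. If these agree with the series `1`, that gradient is `iρ(b_m - b'_m)`, whose string
integral vanishes, so `V_{m+1} = 0`. -/
theorem eq_one_of_intertwines {ρ : ι → Matrix n n ℂ} {V : PowerSeries (Matrix n n (Spacetime → ℂ))}
    (hV : CoeffsIn (entriesIn n (stringFunctions c ℂ)) (V - 1)) (h0 : coeff 0 V = 1)
    {b b' : ℕ → Spacetime → Fin 4 → ι → ℝ}
    (hb : ∀ k, b k ∈ stringFunctions c (Fin 4 → ι → ℝ)) (hb0 : ∀ k, stringInt c (b k) = 0)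
    (hb' : ∀ k, b' k ∈ stringFunctions c (Fin 4 → ι → ℝ)) (hb0' : ∀ k, stringInt c (b' k) = 0)
    (h : Intertwines V (fun μ => functionLieSeries ρ fun k x => b k x μ)
      fun μ => functionLieSeries ρ fun k x => b' k x μ) : V = 1 := by
  ext1 m
  induction m using Nat.strong_induction_on with
  | _ m ih =>
  cases m with
  | zero => rw [h0, coeff_one, if_pos rfl]
  | succ m =>
    have hmem := hV (m + 1)
    rw [map_sub, coeff_one, if_neg (Nat.succ_ne_zero m), sub_zero] at hmem
    rw [coeff_one, if_neg (Nat.succ_ne_zero m)]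
    have hm : b m - b' m ∈ stringFunctions c (Fin 4 → ι → ℝ) := Submodule.sub_mem _ (hb m) (hb' m)
    refine eq_zero_of_map_pderiv (ρ := ρ) hmem hm ?_ fun μ => ?_
    · have h1 := stringInt_add hm (hb' m)
      rw [sub_add_cancel, hb0, hb0', add_zero] at h1
      exact h1.symm
    · have h1 := congrArg (coeff (m + 1)) (h μ)
      have e1 : ∀ B : PowerSeries (Matrix n n (Spacetime → ℂ)), coeff m (B * V) = coeff m B := by
        intro B
        conv_rhs => rw [← mul_one B, coeff_mul]
        rw [coeff_mul]
        refine Finset.sum_congr rfl fun k hk => ?_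
        rw [ih k.2 (by have := Finset.HasAntidiagonal.mem_antidiagonal.mp hk; omega)]
      have e2 : ∀ B : PowerSeries (Matrix n n (Spacetime → ℂ)), coeff m (V * B) = coeff m B := by
        intro B
        conv_rhs => rw [← one_mul B, coeff_mul]
        rw [coeff_mul]
        refine Finset.sum_congr rfl fun k hk => ?_
        rw [ih k.1 (by have := Finset.HasAntidiagonal.mem_antidiagonal.mp hk; omega)]
      rw [coeff_seriesPderiv, coeff_succ_X_mul, map_sub, e1, e2, coeff_functionLieSeries,
        coeff_functionLieSeries, ← map_sub] at h1
      exact h1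

/-- Transformations to potentials with vanishing string integrals are unique. -/
theorem pexp_eq_mul_of_intertwines {ρ : ι → Matrix n n ℂ} {γ γ' θ : ℕ → Spacetime → ι → ℝ}
    (hγ : ∀ m, γ m ∈ stringFunctions c (ι → ℝ))
    (hγ0' : γ' 0 = 0) (hγ' : ∀ m, γ' m ∈ stringFunctions c (ι → ℝ))
    (hθ0 : θ 0 = 0) (hθ : ∀ m, θ m ∈ stringFunctions c (ι → ℝ))
    {A A' : Fin 4 → PowerSeries (Matrix n n (Spacetime → ℂ))}
    {b b' : ℕ → Spacetime → Fin 4 → ι → ℝ}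
    (hb : ∀ k, b k ∈ stringFunctions c (Fin 4 → ι → ℝ)) (hb0 : ∀ k, stringInt c (b k) = 0)
    (hb' : ∀ k, b' k ∈ stringFunctions c (Fin 4 → ι → ℝ)) (hb0' : ∀ k, stringInt c (b' k) = 0)
    (h : Intertwines (pexp (functionLieSeries ρ γ))
      (fun μ => functionLieSeries ρ fun k x => b k x μ) A)
    (h' : Intertwines (pexp (functionLieSeries ρ γ'))
      (fun μ => functionLieSeries ρ fun k x => b' k x μ) A')
    (hΘ : Intertwines (pexp (functionLieSeries ρ (-θ))) A' A) :
    pexp (functionLieSeries ρ γ') =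
      pexp (functionLieSeries ρ γ) * pexp (functionLieSeries ρ θ) := by
  have hθn : ∀ m, (-θ) m ∈ stringFunctions c (ι → ℝ) := fun m => Submodule.neg_mem _ (hθ m)
  have hγn' : ∀ m, (-γ') m ∈ stringFunctions c (ι → ℝ) := fun m => Submodule.neg_mem _ (hγ' m)
  have s1 := coeffsIn_smooth_pexp (ρ := ρ) hγ
  have s2 := coeffsIn_smooth_pexp (ρ := ρ) hγ'
  have s3 := coeffsIn_smooth_pexp (ρ := ρ) hθ
  have s4 := coeffsIn_smooth_pexp (ρ := ρ) hθn
  have s5 := coeffsIn_smooth_pexp (ρ := ρ) hγn'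
  have i1 := pexp_mul_pexp_neg (ordGE_functionLieSeries (ρ := ρ) hθ0)
  have i2 := pexp_neg_mul_pexp (ordGE_functionLieSeries (ρ := ρ) hθ0)
  have i3 := pexp_mul_pexp_neg (ordGE_functionLieSeries (ρ := ρ) hγ0')
  have i4 := pexp_neg_mul_pexp (ordGE_functionLieSeries (ρ := ρ) hγ0')
  rw [← functionLieSeries_neg] at i1 i2 i3 i4
  have hmul := entriesIn_mul (n := n) smoothFunctions_mul
  -- The chain of potentials `b ← A ← A' ← b'`: the product `e^{iγ} e^{iθ} e^{-iγ'}` intertwines the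
  -- two potentials with vanishing string integral, hence equals `1`.
  have t1 := (h.mul (hΘ.inv s4 s3 i2 i1) s1 s3).mul (h'.inv s2 s5 i3 i4) (s1.mul hmul s3) s5
  have smul := entriesIn_mul (n := n) (stringFunctions_mul (c := c))
  have p1 := (coeffsIn_string_functionLieSeries (ρ := ρ) hγ).pexp_sub_one smul
  have p2 := (coeffsIn_string_functionLieSeries (ρ := ρ) hθ).pexp_sub_one smul
  have p3 := (coeffsIn_string_functionLieSeries (ρ := ρ) hγn').pexp_sub_one smul
  have t2 := eq_one_of_intertwines ((p1.mul_sub_one smul p2).mul_sub_one smul p3) (by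
    simp [coeff_mul, coeff_zero_pexp]) hb hb0 hb' hb0' t1
  rw [← one_mul (pexp (functionLieSeries ρ γ')), ← t2, mul_assoc, i4, mul_one]

/-- Equations between products of exponentials hold in all representations. -/
theorem pexp_eq_mul_rep {L : GaugeAlgebra ι d} (π : GaugeRep L J)
    {γ γ' θ : ℕ → Spacetime → ι → ℝ} (hγ : γ 0 = 0) (hγ' : γ' 0 = 0) (hθ : θ 0 = 0)
    (h : pexp (functionLieSeries L.gen γ') =
      pexp (functionLieSeries L.gen γ) * pexp (functionLieSeries L.gen θ)) :
    pexp (functionLieSeries π.gen γ') =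
      pexp (functionLieSeries π.gen γ) * pexp (functionLieSeries π.gen θ) := by
  -- Baker-Campbell-Hausdorff in the product of the two matrix algebras gives a common `z` with
  -- `e^{iγ} e^{iθ} = e^{iz}` in both. In the defining representation the exponential and the Lie
  -- algebra map are injective, so `z = γ'`.
  let Λ : (Spacetime → ι → ℝ) →ₗ[ℝ]
      Matrix d d (Spacetime → ℂ) × Matrix J J (Spacetime → ℂ) :=
    (functionLie L.gen).prod (functionLie π.gen)
  have hΛ : IsLieClosed (LinearMap.range Λ) := by
    rintro _ ⟨u, rfl⟩ _ ⟨v, rfl⟩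
    exact ⟨_, (Prod.ext (functionLie_commutator L.comm u v)
      (functionLie_commutator π.comm u v)).symm⟩
  have hs : ∀ s : ℕ → Spacetime → ι → ℝ, CoeffsIn (LinearMap.range Λ)
      (pairSeries (functionLieSeries L.gen s) (functionLieSeries π.gen s)) := fun s m =>
    ⟨s m, by simp [pairSeries, coeff_functionLieSeries, Λ]⟩
  have ho : ∀ s : ℕ → Spacetime → ι → ℝ, s 0 = 0 →
      OrdGE 1 (pairSeries (functionLieSeries L.gen s) (functionLieSeries π.gen s)) :=
    fun s hs => (ordGE_functionLieSeries hs).pairSeries (ordGE_functionLieSeries hs)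
  obtain ⟨Z, hZ1, hZ, hZe⟩ := exists_pexp_eq_mul hΛ (ho γ hγ) (ho θ hθ) (hs γ) (hs θ)
  choose z hz using hZ
  have hZz : Z = pairSeries (functionLieSeries L.gen z) (functionLieSeries π.gen z) := by
    ext1 m
    rw [← hz m]
    simp [pairSeries, coeff_functionLieSeries, Λ]
  have e1 := congrArg (PowerSeries.map (AlgHom.fst ℝ (Matrix d d (Spacetime → ℂ))
    (Matrix J J (Spacetime → ℂ)) : _ →+* Matrix d d (Spacetime → ℂ))) hZe
  have e2 := congrArg (PowerSeries.map (AlgHom.snd ℝ (Matrix d d (Spacetime → ℂ))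
    (Matrix J J (Spacetime → ℂ)) : _ →+* Matrix J J (Spacetime → ℂ))) hZe
  rw [map_mul, map_pexp, map_pexp, map_pexp, hZz, map_fst_pairSeries, map_fst_pairSeries,
    map_fst_pairSeries] at e1
  rw [map_mul, map_pexp, map_pexp, map_pexp, hZz, map_snd_pairSeries, map_snd_pairSeries,
    map_snd_pairSeries] at e2
  have hz0 : OrdGE 1 (functionLieSeries L.gen z) := by
    have := hZ1.map (AlgHom.fst ℝ (Matrix d d (Spacetime → ℂ))
      (Matrix J J (Spacetime → ℂ)) : _ →+* Matrix d d (Spacetime → ℂ))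
    rwa [hZz, map_fst_pairSeries] at this
  have hzγ := pexp_injective hz0 (ordGE_functionLieSeries hγ') (e1.trans h.symm)
  have : z = γ' := by
    funext m
    refine functionLie_injective L ?_
    rw [← coeff_functionLieSeries, ← coeff_functionLieSeries, hzγ]
  rw [← this, e2]

/-- The gauge transform of a potential by `e^{iθ}` is a power series of potentials. -/
theorem exists_intertwines {L : GaugeAlgebra ι d} {ρ : ι → Matrix n n ℂ}
    (hρ : ∀ a b, Complex.I • (ρ a * ρ b - ρ b * ρ a) = ∑ e, (L.struct a b e : ℂ) • ρ e)
    {s a : ℕ → Spacetime → ι → ℝ} (hs0 : s 0 = 0) (hs : ∀ m, s m ∈ stringFunctions c (ι → ℝ))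
    (ha : ∀ m, a m ∈ stringFunctions c (ι → ℝ)) (μ : Fin 4) :
    ∃ b : ℕ → Spacetime → ι → ℝ, (∀ m, b m ∈ stringFunctions c (ι → ℝ)) ∧
      seriesPderiv μ (pexp (functionLieSeries ρ s)) =
        X * (functionLieSeries ρ b * pexp (functionLieSeries ρ s) -
          pexp (functionLieSeries ρ s) * functionLieSeries ρ a) := by
  have hS := isLieClosed_lieFunctions (c := c) hρ
  have o := ordGE_functionLieSeries (ρ := ρ) hs0
  have hP := coeffsIn_functionLieSeries (ρ := ρ) hs
  have hdP : seriesPderiv μ (functionLieSeries ρ s) =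
      functionLieSeries ρ fun m => pderiv μ (s m) := by
    ext1 m
    rw [coeff_seriesPderiv, coeff_functionLieSeries, coeff_functionLieSeries,
      functionLie_map_pderiv ρ (hs m).1]
  have hy : CoeffsIn (lieFunctions c ρ) (seriesPderiv μ (functionLieSeries ρ s)) := by
    rw [hdP]
    exact coeffsIn_functionLieSeries fun m => pderiv_mem_stringFunctions (hs m) μ
  have h1 := hP.logDeriv hS hy
  have h2 := conj_pexp hS o hP (coeffsIn_functionLieSeries (ρ := ρ) ha)
  have d := seriesPderiv_pexp o (coeffsIn_smooth_functionLieSeries hs) μ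
  have o1 := ordGE_logDeriv o (o.seriesPderiv μ)
  have u1 := pexp_neg_mul_pexp o
  choose u hu hub using h1
  choose v hv hvb using h2
  -- The required series is the logarithmic derivative divided by `X` plus the conjugated potential.
  -- The division is an index shift, legitimate because the logarithmic derivative has no constant
  -- term.
  refine ⟨fun m => u (m + 1) + v m, fun m => Submodule.add_mem _ (hu _) (hv _), ?_⟩
  have hl : logDeriv (functionLieSeries ρ s) (seriesPderiv μ (functionLieSeries ρ s)) =
      X * (functionLieSeries ρ (fun m => u (m + 1) + v m) -
        pexp (functionLieSeries ρ s) * functionLieSeries ρ a * pexp (-functionLieSeries ρ s)) := by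
    ext1 m
    cases m with
    | zero => rw [ordGE_one_iff.mp o1, coeff_zero_X_mul]
    | succ m =>
      rw [coeff_succ_X_mul, map_sub, ← hvb, ← hub, coeff_functionLieSeries, map_add,
        add_sub_cancel_right]
  rw [d, hl, mul_assoc, sub_mul, mul_assoc _ (pexp (-_)), u1, mul_one]

end Transformations

/-! ### Evaluation of power series of fields at power series of configurations -/

section Evaluation

open PowerSeries

variable {c : StringFunction} {ι d J n : Type*} [Fintype ι] [Fintype d] [DecidableEq d]
  [Fintype J] [DecidableEq J] [Fintype n] [DecidableEq n]
  {E F : Type*} [NormedAddCommGroup E] [NormedSpace ℝ E] [NormedAddCommGroup F] [NormedSpace ℝ F]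
  {M : Submodule ℝ (Spacetime → E)} {Φ : ℕ → Config c ι J} {X Y : FieldSeries c ι J E}

theorem evalSeries_eq {f : ℕ → ℕ → Spacetime → E} (h : ∀ k, HasExp M Φ (X k) (f k)) (m : ℕ) :
    evalSeries X Φ m = ∑ k ∈ Finset.HasAntidiagonal.antidiagonal m, f k.1 k.2 := by
  funext x
  rw [evalSeries, Finset.sum_apply]
  exact Finset.sum_congr rfl fun k _ => (h k.1).iteratedDeriv_eq k.2 x

theorem evalSeries_congr {m : ℕ} (h : ∀ k ≤ m, X k = Y k) :
    evalSeries X Φ m = evalSeries Y Φ m := by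
  funext x
  refine Finset.sum_congr rfl fun k hk => ?_
  rw [h k.1 (by have := Finset.HasAntidiagonal.mem_antidiagonal.mp hk; omega)]

theorem evalSeries_mem (h : ∀ k, Expands M (X k)) (m : ℕ) : evalSeries X Φ m ∈ M := by
  choose f hf using fun k => h k Φ
  rw [evalSeries_eq hf]
  exact Submodule.sum_mem _ fun k _ => (hf k.1).mem k.2

theorem map_sum_of_mem (T : (Spacetime → E) → Spacetime → F)
    (hadd : ∀ u ∈ M, ∀ v ∈ M, T (u + v) = T u + T v)
    (hsmul : ∀ (t : ℝ), ∀ u ∈ M, T (t • u) = t • T u) {κ : Type*} (s : Finset κ)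
    {f : κ → Spacetime → E} (hf : ∀ i ∈ s, f i ∈ M) : T (∑ i ∈ s, f i) = ∑ i ∈ s, T (f i) := by
  classical
  induction s using Finset.induction_on with
  | empty => simpa using hsmul 0 0 M.zero_mem
  | insert i s hi ih =>
    have h1 := fun j hj => hf j (Finset.mem_insert_of_mem hj)
    rw [Finset.sum_insert hi, Finset.sum_insert hi, ← ih h1]
    exact hadd _ (hf i (Finset.mem_insert_self _ _)) _ (Submodule.sum_mem _ h1)

theorem evalSeries_map (h : ∀ k, Expands M (X k)) (T : (Spacetime → E) → Spacetime → F)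
    (hadd : ∀ u ∈ M, ∀ v ∈ M, T (u + v) = T u + T v)
    (hsmul : ∀ (t : ℝ), ∀ u ∈ M, T (t • u) = t • T u) (m : ℕ) :
    evalSeries (fun k Ψ => T (X k Ψ)) Φ m = T (evalSeries X Φ m) := by
  choose f hf using fun k => h k Φ
  rw [evalSeries_eq hf, evalSeries_eq fun k => (hf k).map (M' := ⊤) T hadd hsmul fun _ _ => trivial,
    map_sum_of_mem T hadd hsmul _ fun k _ => (hf k.1).mem k.2]

theorem evalSeries_mapLin (h : ∀ k, Expands M (X k)) (T : (Spacetime → E) →ₗ[ℝ] (Spacetime → F))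
    (m : ℕ) : evalSeries (fun k Ψ => T (X k Ψ)) Φ m = T (evalSeries X Φ m) :=
  evalSeries_map h T (fun u _ v _ => map_add T u v) (fun t u _ => map_smul T t u) m

theorem evalSeries_sum {κ : Type*} (s : Finset κ) {X : κ → FieldSeries c ι J E}
    (h : ∀ i ∈ s, ∀ k, Expands M (X i k)) (m : ℕ) :
    evalSeries (fun k => ∑ i ∈ s, X i k) Φ m = ∑ i ∈ s, evalSeries (X i) Φ m := by
  have h1 : ∀ i, ∃ f : ℕ → ℕ → Spacetime → E, i ∈ s → ∀ k, HasExp M Φ (X i k) (f k) := by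
    intro i
    by_cases hi : i ∈ s
    · choose f hf using fun k => h i hi k Φ
      exact ⟨f, fun _ => hf⟩
    · exact ⟨0, fun h => absurd h hi⟩
  choose f hf using h1
  rw [evalSeries_eq fun k => HasExp.sum s fun i hi => hf i hi k,
    Finset.sum_congr rfl fun i hi => evalSeries_eq (hf i hi) m, Finset.sum_comm]
  exact Finset.sum_congr rfl fun k _ => Finset.sum_apply _ _ _

theorem sum_antidiagonal_antidiagonal {V : Type*} [AddCommMonoid V] (f : ℕ → ℕ → ℕ → ℕ → V)
    (m : ℕ) :
    ∑ k ∈ Finset.HasAntidiagonal.antidiagonal m, ∑ p ∈ Finset.HasAntidiagonal.antidiagonal k.1,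
        ∑ q ∈ Finset.HasAntidiagonal.antidiagonal k.2, f p.1 p.2 q.1 q.2 =
      ∑ k ∈ Finset.HasAntidiagonal.antidiagonal m, ∑ p ∈ Finset.HasAntidiagonal.antidiagonal k.1,
        ∑ q ∈ Finset.HasAntidiagonal.antidiagonal k.2, f p.1 q.1 p.2 q.2 := by
  simp only [Finset.sum_sigma']
  apply Finset.sum_nbij' (fun ⟨(_, _), ⟨(a, b), (r, s)⟩⟩ ↦ ⟨(a + r, b + s), ⟨(a, r), (b, s)⟩⟩)
    (fun ⟨(_, _), ⟨(a, b), (r, s)⟩⟩ ↦ ⟨(a + r, b + s), ⟨(a, r), (b, s)⟩⟩) <;>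
    simp only [Finset.mem_sigma, Finset.HasAntidiagonal.mem_antidiagonal] <;>
    rintro ⟨⟨i, j⟩, ⟨a, b⟩, r, s⟩ h <;> simp only at h ⊢ <;> grind

/-- Two Cauchy products, in the order of the field series and in the order of the path, are
interchanged. -/
theorem evalSeries_mul {X Y : FieldSeries c ι J ℂ} (hX : ∀ k, Expands (smoothFunctions ℂ) (X k))
    (hY : ∀ k, Expands (smoothFunctions ℂ) (Y k)) (m : ℕ) :
    evalSeries (fun k => ∑ l ∈ Finset.HasAntidiagonal.antidiagonal k, X l.1 * Y l.2) Φ m =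
      ∑ l ∈ Finset.HasAntidiagonal.antidiagonal m, evalSeries X Φ l.1 * evalSeries Y Φ l.2 := by
  choose f hf using fun k => hX k Φ
  choose g hg using fun k => hY k Φ
  refine (evalSeries_eq (fun k => HasExp.sum (Finset.HasAntidiagonal.antidiagonal k) fun l _ =>
    (hf l.1).bilin (hg l.2) mulLin fun u hu v hv => mulLin_mem_smooth hu hv) m).trans ?_
  simp only [evalSeries_eq hf, evalSeries_eq hg, Finset.sum_apply, Finset.sum_mul_sum]
  exact sum_antidiagonal_antidiagonal (fun a b r s => f a r * g b s) m

/-- Puts the original configuration on the same footing as its gauge transform: both enter as power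
series of configurations. -/
theorem evalSeries_linePath (X : FieldSeries c ι J E) (Ψ : Config c ι J) (m : ℕ) :
    evalSeries X (linePath Ψ 0) m = X m Ψ := by
  have hpath : ∀ (l : ℕ) (t : ℝ), ∑ k ∈ Finset.range (l + 1), t ^ k • linePath Ψ 0 k = Ψ := by
    intro l t
    rw [Finset.sum_range_succ', Finset.sum_eq_zero fun k _ => ?_]
    · simp [linePath]
    · have : linePath Ψ 0 (k + 1) = 0 := by cases k <;> rfl
      rw [this]
      exact DistribMulAction.toDistribSMul.smul_zero _
  funext x
  rw [evalSeries, Finset.sum_eq_single (m, 0)]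
  · simp only [hpath]
    simp
  · rintro ⟨k, l⟩ hkl hne
    have hl : l ≠ 0 := by
      rintro rfl
      have := Finset.HasAntidiagonal.mem_antidiagonal.mp hkl
      exact hne (by simpa using this)
    simp only [hpath]
    rw [iteratedDeriv_const, if_neg hl, smul_zero]
  · intro h
    exact absurd (Finset.HasAntidiagonal.mem_antidiagonal.mpr (by simp)) h

/-- The coefficients are matrices of fields that can be expanded along power series of
configurations. -/
def Regular (p : PowerSeries (Matrix n n (QField c ι J ℂ))) : Prop :=
  ∀ k i j, Expands (smoothFunctions ℂ) (coeff k p i j)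

/-- Entrywise evaluation at a power series of configurations. -/
def evalMatrix (Φ : ℕ → Config c ι J) (p : PowerSeries (Matrix n n (QField c ι J ℂ))) :
    PowerSeries (Matrix n n (Spacetime → ℂ)) :=
  PowerSeries.mk fun m => Matrix.of fun i j => evalSeries (fun k => coeff k p i j) Φ m

variable {p q : PowerSeries (Matrix n n (QField c ι J ℂ))}

theorem coeff_evalMatrix (p : PowerSeries (Matrix n n (QField c ι J ℂ))) (m : ℕ) (i j : n) :
    coeff m (evalMatrix Φ p) i j = evalSeries (fun k => coeff k p i j) Φ m := by
  rw [evalMatrix, coeff_mk]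
  rfl

theorem Expands.sum {κ : Type*} (s : Finset κ) {X : κ → QField c ι J E}
    (h : ∀ i ∈ s, Expands M (X i)) : Expands M (∑ i ∈ s, X i) := by
  classical
  induction s using Finset.induction_on with
  | empty => exact expands_zero
  | insert i s hi ih =>
    rw [Finset.sum_insert hi]
    exact (h i (Finset.mem_insert_self _ _)).add
      (ih fun j hj => h j (Finset.mem_insert_of_mem hj))

theorem Expands.mul {X Y : QField c ι J ℂ} (hX : Expands (smoothFunctions ℂ) X)
    (hY : Expands (smoothFunctions ℂ) Y) : Expands (smoothFunctions ℂ) (X * Y) :=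
  hX.bilin hY mulLin fun _ hu _ hv => mulLin_mem_smooth hu hv

theorem coeff_mul_apply (p q : PowerSeries (Matrix n n (QField c ι J ℂ))) (m : ℕ) (i j : n) :
    coeff m (p * q) i j = ∑ l, ∑ k ∈ Finset.HasAntidiagonal.antidiagonal m,
      coeff k.1 p i l * coeff k.2 q l j := by
  rw [coeff_mul, Matrix.sum_apply, Finset.sum_comm]
  rfl

theorem Regular.mul (hp : Regular p) (hq : Regular q) : Regular (p * q) := fun m i j => by
  rw [coeff_mul_apply]
  exact Expands.sum _ fun l _ => Expands.sum _ fun k _ => (hp _ _ _).mul (hq _ _ _)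

theorem evalMatrix_mul (hp : Regular p) (hq : Regular q) :
    evalMatrix Φ (p * q) = evalMatrix Φ p * evalMatrix Φ q := by
  ext1 m
  ext1 i j
  rw [coeff_evalMatrix, coeff_mul, Matrix.sum_apply]
  simp only [coeff_mul_apply, Matrix.mul_apply, coeff_evalMatrix]
  rw [evalSeries_sum (M := smoothFunctions ℂ) Finset.univ fun l _ m => Expands.sum _ fun k _ =>
    (hp _ _ _).mul (hq _ _ _), Finset.sum_comm]
  exact Finset.sum_congr rfl fun l _ => evalSeries_mul (fun k => hp k i l) (fun k => hq k l j) m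

theorem evalMatrix_sub (hp : Regular p) (hq : Regular q) :
    evalMatrix Φ (p - q) = evalMatrix Φ p - evalMatrix Φ q := by
  ext1 m
  ext1 i j
  choose f hf using fun k => hp k i j Φ
  choose g hg using fun k => hq k i j Φ
  rw [map_sub, Matrix.sub_apply, coeff_evalMatrix, coeff_evalMatrix, coeff_evalMatrix,
    evalSeries_eq hf, evalSeries_eq hg, ← Finset.sum_sub_distrib]
  have e : (fun k => coeff k (p - q) i j) = fun k => coeff k p i j + (-1 : ℝ) • coeff k q i j := by
    funext k
    rw [map_sub, Matrix.sub_apply, neg_one_smul, sub_eq_add_neg]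
  rw [e, evalSeries_eq fun k => (hf k).add ((hg k).smul (-1))]
  refine Finset.sum_congr rfl fun k _ => ?_
  rw [Pi.add_apply, Pi.smul_apply, neg_one_smul, sub_eq_add_neg]

theorem expands_const (z : ℂ) : Expands (smoothFunctions ℂ) (fun _ _ => z : QField c ι J ℂ) :=
  fun _ => ⟨_, hasExp_const (const_mem_smooth z)⟩

theorem coeff_one_apply {R : Type*} [CommRing R] (m : ℕ) (i j : n) :
    (coeff m (1 : PowerSeries (Matrix n n R)) : Matrix n n R) i j =
      if m = 0 then if i = j then 1 else 0 else 0 := by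
  rw [coeff_one]
  split_ifs with h1 h2
  · rw [h2, Matrix.one_apply_eq]
  · rw [Matrix.one_apply_ne h2]
  · rfl

theorem regular_one : Regular (1 : PowerSeries (Matrix n n (QField c ι J ℂ))) := fun m i j => by
  rw [coeff_one_apply]
  split_ifs
  exacts [expands_const 1, expands_zero, expands_zero]

theorem evalMatrix_one : evalMatrix Φ (1 : PowerSeries (Matrix n n (QField c ι J ℂ))) = 1 := by
  ext1 m
  ext1 i j
  rw [coeff_evalMatrix, coeff_one_apply]
  simp only [coeff_one_apply]
  have h : ∀ k, HasExp (smoothFunctions ℂ) Φ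
      (if k = 0 then if i = j then 1 else 0 else 0 : QField c ι J ℂ)
      fun l => if l = 0 then if k = 0 then if i = j then 1 else 0 else 0 else 0 := by
    intro k
    have h1 := hasExp_const (Φ := Φ)
      (const_mem_smooth (if k = 0 then if i = j then (1 : ℂ) else 0 else 0))
    convert h1 using 1
    · split_ifs <;> rfl
    · funext l
      split_ifs <;> rfl
  rw [evalSeries_eq h, Finset.sum_eq_single (m, 0)]
  · simp
  · rintro ⟨k, l⟩ hkl hne
    refine if_neg fun hl : l = 0 => hne ?_
    have := Finset.HasAntidiagonal.mem_antidiagonal.mp hkl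
    subst hl
    simpa using this
  · intro h
    exact absurd (Finset.HasAntidiagonal.mem_antidiagonal.mpr (by simp)) h

theorem Regular.pow (hp : Regular p) (k : ℕ) : Regular (p ^ k) := by
  induction k with
  | zero => rw [pow_zero]; exact regular_one
  | succ k ih => rw [pow_succ]; exact ih.mul hp

theorem evalMatrix_pow (hp : Regular p) (k : ℕ) : evalMatrix Φ (p ^ k) = evalMatrix Φ p ^ k := by
  induction k with
  | zero => rw [pow_zero, pow_zero, evalMatrix_one]
  | succ k ih => rw [pow_succ, pow_succ, evalMatrix_mul (hp.pow k) hp, ih]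

theorem coeff_pexp_apply {R : Type*} [CommRing R] [Algebra ℝ R] (p : PowerSeries (Matrix n n R))
    (m : ℕ) (i j : n) : (coeff m (pexp p) : Matrix n n R) i j =
      ∑ k ∈ Finset.range (m + 1), ((k.factorial : ℝ)⁻¹) • (coeff m (p ^ k) : Matrix n n R) i j := by
  rw [coeff_pexp, Matrix.sum_apply]
  rfl

theorem evalSeries_smul (h : ∀ k, Expands M (X k)) (r : ℝ) (m : ℕ) :
    evalSeries (fun k => r • X k) Φ m = r • evalSeries X Φ m :=
  evalSeries_map h (fun u => r • u) (fun _ _ _ _ => smul_add _ _ _)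
    (fun _ _ _ => smul_comm _ _ _) m

theorem Regular.pexp (hp : Regular p) : Regular (pexp p) := fun m i j => by
  rw [coeff_pexp_apply]
  exact Expands.sum _ fun k _ => (hp.pow k m i j).smul _

theorem evalMatrix_pexp (hp1 : OrdGE 1 p) (hp : Regular p) :
    evalMatrix Φ (pexp p) = pexp (evalMatrix Φ p) := by
  ext1 m
  ext1 i j
  -- The truncation of the exponential depends on the order. As `p` starts at first order, all
  -- orders up to `m` may use the same finite sum, which can then be evaluated term by term.
  have h : evalSeries (fun k => coeff k (StringQFT.pexp p) i j) Φ m = evalSeries (fun k =>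
      ∑ l ∈ Finset.range (m + 1), ((l.factorial : ℝ)⁻¹) • coeff k (p ^ l) i j) Φ m := by
    refine evalSeries_congr fun k hk => ?_
    rw [coeff_pexp_apply]
    refine Finset.sum_subset (Finset.range_mono (by omega)) fun l _ hl => ?_
    rw [hp1.pow l k (by simpa using hl), Matrix.zero_apply, smul_zero]
  have h2 : evalSeries (fun k =>
      ∑ l ∈ Finset.range (m + 1), ((l.factorial : ℝ)⁻¹) • coeff k (p ^ l) i j) Φ m =
      ∑ l ∈ Finset.range (m + 1), evalSeries (fun k =>
        ((l.factorial : ℝ)⁻¹) • coeff k (p ^ l) i j) Φ m :=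
    evalSeries_sum (M := smoothFunctions ℂ) (Finset.range (m + 1))
      (fun l _ k => (hp.pow l k i j).smul ((l.factorial : ℝ)⁻¹)) m
  rw [coeff_evalMatrix, coeff_pexp_apply, h, h2]
  refine Finset.sum_congr rfl fun l _ => ?_
  rw [← evalMatrix_pow hp l, coeff_evalMatrix]
  exact evalSeries_smul (fun k => hp.pow l k i j) _ m

theorem Regular.X_mul (hp : Regular p) : Regular (PowerSeries.X * p) := fun m i j => by
  cases m with
  | zero => rw [coeff_zero_X_mul]; exact expands_zero
  | succ m => rw [coeff_succ_X_mul]; exact hp m i j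

theorem evalSeries_zero_coeff {X : FieldSeries c ι J E} (h : X 0 = 0) :
    evalSeries X Φ 0 = 0 := by
  funext x
  simp [evalSeries, h]

theorem evalMatrix_X_mul (p : PowerSeries (Matrix n n (QField c ι J ℂ))) :
    evalMatrix Φ (PowerSeries.X * p) = PowerSeries.X * evalMatrix Φ p := by
  ext1 m
  ext1 i j
  rw [coeff_evalMatrix]
  have h0 : (coeff 0 (PowerSeries.X * p) : Matrix n n (QField c ι J ℂ)) i j = 0 := by
    rw [coeff_zero_X_mul]; rfl
  cases m with
  | zero =>
    rw [coeff_zero_X_mul, evalSeries_zero_coeff h0]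
    rfl
  | succ m =>
    rw [coeff_succ_X_mul, coeff_evalMatrix]
    funext x
    rw [evalSeries, Finset.Nat.antidiagonal_succ, Finset.sum_cons, Finset.sum_map, evalSeries]
    have hz : iteratedDeriv (m + 1) (fun t : ℝ => (coeff 0 (PowerSeries.X * p) :
        Matrix n n (QField c ι J ℂ)) i j (∑ l ∈ Finset.range (m + 1 + 1), t ^ l • Φ l) x) 0 = 0 := by
      rw [h0]
      change iteratedDeriv (m + 1) (fun _ : ℝ => (0 : ℂ)) 0 = 0
      rw [iteratedDeriv_const, if_neg (Nat.succ_ne_zero m)]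
    rw [hz, smul_zero, zero_add]
    refine Finset.sum_congr rfl fun k _ => ?_
    change _ • iteratedDeriv k.2 (fun t : ℝ => (coeff (k.1 + 1) (PowerSeries.X * p) :
        Matrix n n (QField c ι J ℂ)) i j (∑ l ∈ Finset.range (k.2 + 1), t ^ l • Φ l) x) 0 = _
    rw [coeff_succ_X_mul]
    rfl

end Evaluation

/-! ### The dressing transformation at a power series of configurations -/

section FieldEvaluation

open PowerSeries

variable {c : StringFunction} {ι d J n : Type*} [Fintype ι] [Fintype d] [DecidableEq d]
  [Fintype J] [DecidableEq J] [Fintype n] [DecidableEq n]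
  {Φ : ℕ → Config c ι J}

/-- The coefficientwise derivative of a power series of matrices of fields. -/
def seriesFieldDeriv (μ : Fin 4) (p : PowerSeries (Matrix n n (QField c ι J ℂ))) :
    PowerSeries (Matrix n n (QField c ι J ℂ)) :=
  PowerSeries.mk fun k => (coeff k p).map (fieldDeriv μ)

theorem coeff_seriesFieldDeriv (μ : Fin 4) (p : PowerSeries (Matrix n n (QField c ι J ℂ))) (k : ℕ) :
    coeff k (seriesFieldDeriv μ p) = (coeff k p).map (fieldDeriv μ) := by
  rw [seriesFieldDeriv, coeff_mk]

theorem toSeries_mapCoeff_fieldDeriv (μ : Fin 4) (Y : Matrix n n (PowerSeries (QField c ι J ℂ))) :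
    toSeries (mapCoeff (fieldDeriv μ) Y) = seriesFieldDeriv μ (toSeries Y) := by
  ext1 m
  ext1 i j
  rw [coeff_seriesFieldDeriv, coeff_toSeries, coeff_toSeries]
  simp [mapCoeff]

theorem expands_fieldDeriv {X : QField c ι J ℂ} (hX : Expands (smoothFunctions ℂ) X) (μ : Fin 4) :
    Expands (smoothFunctions ℂ) (fieldDeriv μ X) :=
  hX.map (pderiv μ)
    (fun _ hu _ hv => pderiv_add (mem_smoothFunctions.mp hu) (mem_smoothFunctions.mp hv) μ)
    (fun t _ hu => pderiv_const_smul (mem_smoothFunctions.mp hu) t μ)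
    fun _ hu => mem_smoothFunctions.mpr (contDiff_pderiv (mem_smoothFunctions.mp hu) μ)

theorem Regular.seriesFieldDeriv {p : PowerSeries (Matrix n n (QField c ι J ℂ))} (hp : Regular p)
    (μ : Fin 4) : Regular (seriesFieldDeriv μ p) := fun k i j => by
  rw [coeff_seriesFieldDeriv]
  exact expands_fieldDeriv (hp k i j) μ

theorem evalMatrix_seriesFieldDeriv {p : PowerSeries (Matrix n n (QField c ι J ℂ))}
    (hp : Regular p) (μ : Fin 4) :
    evalMatrix Φ (seriesFieldDeriv μ p) = seriesPderiv μ (evalMatrix Φ p) := by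
  ext1 m
  ext1 i j
  rw [coeff_evalMatrix, coeff_seriesPderiv, Matrix.map_apply, coeff_evalMatrix]
  simp only [coeff_seriesFieldDeriv]
  exact evalSeries_map (fun k => hp k i j) (pderiv μ)
    (fun _ hu _ hv => pderiv_add (mem_smoothFunctions.mp hu) (mem_smoothFunctions.mp hv) μ)
    (fun t _ hu => pderiv_const_smul (mem_smoothFunctions.mp hu) t μ) m

/-- The power series `∑ gᵐ i ρ(s_m)` of matrices of fields. -/
def fieldLieSeries (ρ : ι → Matrix n n ℂ) (s : FieldSeries c ι J (ι → ℝ)) :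
    PowerSeries (Matrix n n (QField c ι J ℂ)) :=
  PowerSeries.mk fun m => Matrix.of fun i j Ψ => functionLie ρ (s m Ψ) i j

variable {ρ : ι → Matrix n n ℂ} {s : FieldSeries c ι J (ι → ℝ)}

theorem coeff_fieldLieSeries (ρ : ι → Matrix n n ℂ) (s : FieldSeries c ι J (ι → ℝ)) (m : ℕ)
    (i j : n) : coeff m (fieldLieSeries ρ s) i j = fun Ψ => functionLie ρ (s m Ψ) i j := by
  rw [fieldLieSeries, coeff_mk]
  rfl

theorem toSeries_toComponents (ρ : ι → Matrix n n ℂ) (s : FieldSeries c ι J (ι → ℝ)) :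
    toSeries (Complex.I • lieMatrix ρ (toComponents s)) = fieldLieSeries ρ s := by
  ext1 m
  ext1 i j
  rw [coeff_toSeries_lieMatrix, coeff_fieldLieSeries, lieElement_apply]
  funext Ψ x
  rw [functionLie_apply]
  simp only [Pi.mul_apply, Finset.sum_apply, toComponents, coeff_mk]
  rfl

theorem toSeries_dressingFactor (ρ : ι → Matrix n n ℂ) (s : FieldSeries c ι J (ι → ℝ)) :
    toSeries (dressingFactor ρ s) = pexp (fieldLieSeries ρ s) := by
  rw [dressingFactor, toSeries_matrixExp (fun r => rfl), toSeries_toComponents]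

theorem ordGE_fieldLieSeries (hs : s 0 = 0) : OrdGE 1 (fieldLieSeries ρ s) := by
  refine ordGE_one_iff.mpr ?_
  ext1 i j
  rw [coeff_fieldLieSeries, hs]
  funext Ψ
  change functionLie ρ 0 i j = 0
  rw [map_zero]
  rfl

/-- An entry of `functionLie` as a linear map. -/
def functionLieEntry (ρ : ι → Matrix n n ℂ) (i j : n) :
    (Spacetime → ι → ℝ) →ₗ[ℝ] (Spacetime → ℂ) where
  toFun u := functionLie ρ u i j
  map_add' u v := by rw [map_add]; rfl
  map_smul' r u := by rw [map_smul]; rfl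

theorem regular_fieldLieSeries (hs : ∀ m, Expands (stringFunctions c (ι → ℝ)) (s m)) :
    Regular (fieldLieSeries ρ s) := fun m i j => by
  rw [coeff_fieldLieSeries]
  exact (hs m).mapLin (functionLieEntry ρ i j) fun u hu =>
    (functionLie_mem_stringFunctions ρ hu i j).1

theorem evalMatrix_fieldLieSeries (hs : ∀ m, Expands (stringFunctions c (ι → ℝ)) (s m)) :
    evalMatrix Φ (fieldLieSeries ρ s) = functionLieSeries ρ (evalSeries s Φ) := by
  ext1 m
  ext1 i j
  rw [coeff_evalMatrix, coeff_functionLieSeries]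
  simp only [coeff_fieldLieSeries]
  exact evalSeries_mapLin hs (functionLieEntry ρ i j) m

theorem evalSeries_neg (hs : ∀ m, Expands (stringFunctions c (ι → ℝ)) (s m)) :
    evalSeries (-s) Φ = -evalSeries s Φ := by
  funext m
  have h := evalSeries_smul (Φ := Φ) hs (-1) m
  rw [neg_one_smul] at h
  rw [Pi.neg_apply, ← h]
  refine evalSeries_congr fun k _ => ?_
  rw [neg_one_smul]
  rfl

/-- `A_μ(c)` as a vector field. -/
def stringPotentialField : QField c ι J (Fin 4 → ι → ℝ) := fun Ψ x μ => stringPotential μ Ψ x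

/-- String integration commutes with `∂_μ`, which gives the gradient term, and `-I_c^ν(∂_ν A_μ) =
A_μ`. -/
theorem stringPotentialField_eq : (stringPotentialField : QField c ι J (Fin 4 → ι → ℝ)) =
    gaugeField + gradField (stringIntField gaugeField) := by
  funext Ψ x μ a
  have hA : (gaugeField Ψ : Spacetime → Fin 4 → ι → ℝ) ∈ stringFunctions c _ := Ψ.1.2
  have hAa : ∀ ν, (fun y => gaugeField Ψ y ν a) ∈ stringFunctions c ℝ := fun ν =>
    mem_stringFunctions_pi.mp (mem_stringFunctions_pi.mp hA ν) a
  have hAν : ∀ ν, (fun y => gaugeField Ψ y ν) ∈ stringFunctions c (ι → ℝ) := fun ν =>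
    mem_stringFunctions_pi.mp hA ν
  let g₁ : Fin 4 → stringFunctions c ℝ := fun ν =>
    ⟨pderiv μ fun y => gaugeField Ψ y ν a, pderiv_mem_stringFunctions (hAa ν) μ⟩
  let g₂ : Fin 4 → stringFunctions c ℝ := fun ν =>
    ⟨pderiv ν fun y => gaugeField Ψ y μ a, pderiv_mem_stringFunctions (hAa μ) ν⟩
  have h1 : (fun ν y => fieldStrength μ ν Ψ y a) = fun ν => ((g₁ - g₂) ν : Spacetime → ℝ) := by
    funext ν y
    change pderiv μ (fun y => gaugeField Ψ y ν) y a - pderiv ν (fun y => gaugeField Ψ y μ) y a =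
      pderiv μ (fun y => gaugeField Ψ y ν a) y - pderiv ν (fun y => gaugeField Ψ y μ a) y
    rw [pderiv_pi (hAν ν).1, pderiv_pi (hAν μ).1]
  have h2 : stringPotential μ Ψ x a = ((scalarStringIntLin c (g₁ - g₂) : stringFunctions c ℝ) :
      Spacetime → ℝ) x := by
    rw [stringPotential, stringInt_apply, h1]
    rfl
  have h3 : ((scalarStringIntLin c g₂ : stringFunctions c ℝ) : Spacetime → ℝ) =
      -fun y => gaugeField Ψ y μ a := scalarStringInt_pderiv (hAa μ)
  have h4 : ((scalarStringIntLin c g₁ : stringFunctions c ℝ) : Spacetime → ℝ) =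
      pderiv μ (scalarStringInt c fun ν y => gaugeField Ψ y ν a) := by
    funext y
    change scalarStringInt c (fun ν => pderiv μ fun y => gaugeField Ψ y ν a) y = _
    rw [scalarStringInt, scalarStringInt, Finset.sum_apply, pderiv, fderiv_sum fun ν _ =>
      ((contDiff_stringPair (hAa ν) ν).differentiable (by simp) y), ContinuousLinearMap.sum_apply]
    refine Finset.sum_congr rfl fun ν _ => ?_
    exact (congrFun (pderiv_stringPair (hAa ν) ν μ) y).symm
  change stringPotential μ Ψ x a = gaugeField Ψ x μ a + pderiv μ (stringInt c (gaugeField Ψ)) x a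
  rw [h2, map_sub, Submodule.coe_sub, Pi.sub_apply, h3, h4, pderiv_pi (stringInt_mem hA).1]
  simp only [stringInt_apply]
  change _ - -gaugeField Ψ x μ a = _
  rw [sub_neg_eq_add, add_comm]

variable {L : GaugeAlgebra ι d} {T₀ : Distr ℂ} {α : FieldSeries c ι J (Fin 4 → ι → ℝ)}

theorem stringPotentialField_mem : (stringPotentialField : QField c ι J _) ∈ spaceV L := by
  have h : (gaugeField : QField c ι J (Fin 4 → ι → ℝ)) ∈ spaceV L :=
    adList_gaugeField_mem (l := []) (by simp)
  rw [stringPotentialField_eq]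
  exact Submodule.add_mem _ h (gradField_mem (inS_stringIntField h))

theorem stringIntField_add {v w : QField c ι J (Fin 4 → ι → ℝ)} (hv : v ∈ spaceV L)
    (hw : w ∈ spaceV L) : stringIntField (v + w) = stringIntField v + stringIntField w :=
  funext fun Ψ => stringInt_add (mem_stringFunctions_of_mem_spaceV hv Ψ)
    (mem_stringFunctions_of_mem_spaceV hw Ψ)

theorem stringIntField_smul (r : ℝ) {v : QField c ι J (Fin 4 → ι → ℝ)} (hv : v ∈ spaceV L) :
    stringIntField (r • v) = r • stringIntField v :=
  funext fun Ψ => stringInt_smul r (mem_stringFunctions_of_mem_spaceV hv Ψ)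

/-- The string integrals of `A` and of the gradient of `I_c(A)` are opposite: the string-localized
potential is in axial gauge. -/
theorem stringIntField_stringPotentialField (L : GaugeAlgebra ι d) :
    stringIntField (stringPotentialField : QField c ι J (Fin 4 → ι → ℝ)) = 0 := by
  have h : (gaugeField : QField c ι J (Fin 4 → ι → ℝ)) ∈ spaceV L :=
    adList_gaugeField_mem (l := []) (by simp)
  rw [stringPotentialField_eq, stringIntField_add h (gradField_mem (inS_stringIntField h)),
    stringIntField_gradField (inS_stringIntField h).expands, add_neg_cancel]

/-- The vector fields in `𝒱^𝔤` with vanishing string integral. -/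
def axialSpace (L : GaugeAlgebra ι d) : Submodule ℝ (QField c ι J (Fin 4 → ι → ℝ)) where
  carrier := {v | v ∈ spaceV L ∧ stringIntField v = 0}
  zero_mem' := by
    refine ⟨Submodule.zero_mem _, ?_⟩
    have h := stringIntField_smul 0 (Submodule.zero_mem (spaceV (c := c) (J := J) L))
    rwa [zero_smul, zero_smul] at h
  add_mem' hv hw := ⟨Submodule.add_mem _ hv.1 hw.1, by
    rw [stringIntField_add hv.1 hw.1, hv.2, hw.2, add_zero]⟩
  smul_mem' r _ hv := ⟨Submodule.smul_mem _ r hv.1, by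
    rw [stringIntField_smul r hv.1, hv.2, smul_zero]⟩

/-- String integration commutes with `ω_U`, so the axial condition passes from `A(c)` to the dressed
potential. -/
theorem omegaYM₁_mem_axialSpace (hT₀ : IsPropagator 0 T₀) {w v : QField c ι J (Fin 4 → ι → ℝ)}
    (hw : w ∈ spaceV L) (hv : v ∈ axialSpace L) : omegaYM₁ T₀ w v ∈ axialSpace L := by
  have hw' := mem_stringFunctions_of_mem_spaceV hw
  refine ⟨omegaYM₁_mem_spaceV hT₀ hw hv.1, ?_⟩
  rw [← omegaYM₁_stringIntField hT₀ hw' (expands_of_mem_spaceV hv.1), hv.2]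
  exact omegaYM₁_const hT₀ hw' 0

theorem omegaYM_iterate_mem_axialSpace (hT₀ : IsPropagator 0 T₀) (hα : InGV L α)
    {v : FieldSeries c ι J (Fin 4 → ι → ℝ)} (hv : ∀ m, v m ∈ axialSpace L) (k m : ℕ) :
    (omegaYM T₀ α)^[k] v m ∈ axialSpace L := by
  induction k generalizing m with
  | zero => exact hv m
  | succ k ih =>
    rw [Function.iterate_succ_apply']
    exact Submodule.sum_mem _ fun l _ => omegaYM₁_mem_axialSpace hT₀ (hα.2 l.1) (ih l.2)

theorem omegaYM_iterate_apply (hT₀ : IsPropagator 0 T₀) (hα : InGV L α)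
    {v : FieldSeries c ι J (Fin 4 → ι → ℝ)} (hv : ∀ m, v m ∈ axialSpace L) (μ : Fin 4) (k : ℕ) :
    (omegaYM T₀ α)^[k] (fun m Ψ x => v m Ψ x μ) = fun m Ψ x => (omegaYM T₀ α)^[k] v m Ψ x μ := by
  induction k with
  | zero => rfl
  | succ k ih =>
    rw [Function.iterate_succ_apply', Function.iterate_succ_apply', ih]
    funext m Ψ x
    rw [omegaYM, omegaYM, Finset.sum_apply, Finset.sum_apply, Finset.sum_apply, Finset.sum_apply,
      Finset.sum_apply]
    refine Finset.sum_congr rfl fun l _ => ?_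
    have h := (expands_of_mem_spaceV
      (omegaYM_iterate_mem_axialSpace hT₀ hα hv k l.2).1).omegaYM₁_map hT₀
      (mem_stringFunctions_of_mem_spaceV (hα.2 l.1)) (fun u x => u x μ)
      (fun _ _ _ _ => rfl) fun _ _ _ => rfl
    exact congrFun (congrFun h Ψ) x

/-- The dressed potential `e^{ω_U}(A_μ(c))` as a vector field. -/
def dressedPotential (T₀ : Distr ℂ) (α : FieldSeries c ι J (Fin 4 → ι → ℝ)) :
    FieldSeries c ι J (Fin 4 → ι → ℝ) := expMap (omegaYM T₀ α) (constSeries stringPotentialField)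

theorem constSeries_stringPotentialField_mem (L : GaugeAlgebra ι d) (m : ℕ) :
    constSeries (stringPotentialField : QField c ι J (Fin 4 → ι → ℝ)) m ∈ axialSpace L := by
  rw [constSeries]
  split_ifs
  exacts [⟨stringPotentialField_mem, stringIntField_stringPotentialField L⟩,
    Submodule.zero_mem _]

theorem dressedPotential_mem (hT₀ : IsPropagator 0 T₀) (hα : InGV L α) (m : ℕ) :
    dressedPotential T₀ α m ∈ axialSpace L := by
  rw [dressedPotential, expMap]
  exact Submodule.sum_mem _ fun k _ => Submodule.smul_mem _ _
    (omegaYM_iterate_mem_axialSpace hT₀ hα (constSeries_stringPotentialField_mem L) k m)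

theorem dressedPotential_apply (hT₀ : IsPropagator 0 T₀) (hα : InGV L α) (μ : Fin 4) :
    expMap (omegaYM T₀ α) (constSeries (stringPotential μ)) =
      fun m Ψ x => dressedPotential T₀ α m Ψ x μ := by
  have h0 : (constSeries (stringPotential μ) : FieldSeries c ι J (ι → ℝ)) =
      fun m Ψ x => constSeries stringPotentialField m Ψ x μ := by
    funext m Ψ x
    rw [constSeries, constSeries]
    split_ifs <;> rfl
  funext m Ψ x
  rw [expMap, dressedPotential, expMap, Finset.sum_apply, Finset.sum_apply, Finset.sum_apply,
    Finset.sum_apply, Finset.sum_apply]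
  refine Finset.sum_congr rfl fun k _ => ?_
  rw [h0, omegaYM_iterate_apply hT₀ hα (constSeries_stringPotentialField_mem L)]
  rfl

theorem evalSeries_dressedPotential_mem (hT₀ : IsPropagator 0 T₀) (hα : InGV L α)
    (Φ : ℕ → Config c ι J) (m : ℕ) :
    evalSeries (dressedPotential T₀ α) Φ m ∈ stringFunctions c (Fin 4 → ι → ℝ) :=
  evalSeries_mem (fun k => expands_of_mem_spaceV (dressedPotential_mem hT₀ hα k).1) m

theorem stringInt_evalSeries_dressedPotential (hT₀ : IsPropagator 0 T₀) (hα : InGV L α)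
    (Φ : ℕ → Config c ι J) (m : ℕ) :
    stringInt c (evalSeries (dressedPotential T₀ α) Φ m) = 0 := by
  rw [← evalSeries_map (fun k => expands_of_mem_spaceV (dressedPotential_mem hT₀ hα k).1)
    (stringInt c) (fun _ hu _ hv => stringInt_add hu hv) (fun t _ hu => stringInt_smul t hu)]
  have h : (fun k Ψ => stringInt c (dressedPotential T₀ α k Ψ)) =
      (fun _ => 0 : FieldSeries c ι J (ι → ℝ)) :=
    funext fun k => (dressedPotential_mem hT₀ hα k).2
  rw [h, evalSeries_eq (M := ⊤) (f := fun _ => 0) fun k => hasExp_zero]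
  exact Finset.sum_eq_zero fun _ _ => rfl

theorem evalSeries_gaugeField (Φ : ℕ → Config c ι J) (μ : Fin 4) :
    evalSeries (constSeries fun Ψ x => gaugeField Ψ x μ) Φ = fun m x => gaugeField (Φ m) x μ := by
  funext m
  have h : ∀ k, HasExp ⊤ Φ ((constSeries fun Ψ x => gaugeField Ψ x μ :
      FieldSeries c ι J (ι → ℝ)) k) fun l x => if k = 0 then gaugeField (Φ l) x μ else 0 := by
    intro k
    by_cases hk : k = 0
    · simp only [constSeries, if_pos hk]
      exact (hasExp_gaugeField Φ).map (fun u x => u x μ) (fun _ _ _ _ => rfl) (fun _ _ _ => rfl)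
        fun _ _ => trivial
    · simp only [constSeries, if_neg hk]
      exact hasExp_zero
  rw [evalSeries_eq h, Finset.sum_eq_single (0, m)]
  · simp
  · rintro ⟨k, l⟩ hkl hne
    have hk : k ≠ 0 := by
      rintro rfl
      have := Finset.HasAntidiagonal.mem_antidiagonal.mp hkl
      exact hne (by simpa using this)
    simp only [if_neg hk]
    rfl
  · intro h
    exact absurd (Finset.HasAntidiagonal.mem_antidiagonal.mpr (by simp)) h

theorem expands_constSeries_gaugeField (μ : Fin 4) (m : ℕ) : Expands (stringFunctions c (ι → ℝ))
    ((constSeries fun Ψ x => gaugeField Ψ x μ : FieldSeries c ι J (ι → ℝ)) m) := by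
  rw [constSeries]
  split_ifs
  · exact expands_gaugeField.map (fun u x => u x μ) (fun _ _ _ _ => rfl) (fun _ _ _ => rfl)
      fun _ hu => mem_stringFunctions_pi.mp hu μ
  · exact expands_zero

/-- The dressing transformation, evaluated at a power series of configurations. -/
theorem IsYangMillsDressing.intertwines {γ : FieldSeries c ι J (ι → ℝ)}
    (h : IsYangMillsDressing L T₀ γ α) (hT₀ : IsPropagator 0 T₀) (hγ : InGS L γ) (hα : InGV L α)
    (Φ : ℕ → Config c ι J) :
    Intertwines (pexp (functionLieSeries L.gen (evalSeries γ Φ)))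
      (fun μ => functionLieSeries L.gen fun m x => evalSeries (dressedPotential T₀ α) Φ m x μ)
      fun μ => functionLieSeries L.gen fun m x => gaugeField (Φ m) x μ := by
  intro μ
  have hγe : ∀ m, Expands (stringFunctions c (ι → ℝ)) (γ m) := fun m => (hγ.2 m).expands
  have hγn : ∀ m, Expands (stringFunctions c (ι → ℝ)) ((-γ) m) := fun m => (hγ.2 m).neg.expands
  have hγn0 : (-γ) 0 = 0 := by rw [Pi.neg_apply, hγ.1, neg_zero]
  have hv : ∀ m, Expands (stringFunctions c (ι → ℝ))
      (fun Ψ x => dressedPotential T₀ α m Ψ x μ) := fun m =>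
    (expands_of_mem_spaceV (dressedPotential_mem hT₀ hα m).1).map (fun u x => u x μ)
      (fun _ _ _ _ => rfl) (fun _ _ _ => rfl) fun _ hu => mem_stringFunctions_pi.mp hu μ
  have hve : evalSeries (fun m Ψ x => dressedPotential T₀ α m Ψ x μ) Φ =
      fun m x => evalSeries (dressedPotential T₀ α) Φ m x μ := funext fun m =>
    evalSeries_map (fun k => expands_of_mem_spaceV (dressedPotential_mem hT₀ hα k).1)
      (fun u x => u x μ) (fun _ _ _ _ => rfl) (fun _ _ _ => rfl) m
  have h1 := h μ
  rw [transform_iff_toSeries, toSeries_toComponents, toSeries_toComponents,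
    toSeries_mapCoeff_fieldDeriv, toSeries_dressingFactor, toSeries_dressingFactor,
    dressedPotential_apply hT₀ hα] at h1
  -- On series with expandable coefficients the evaluation respects sums, products, exponentials and
  -- `∂_μ`, so the identity of functionals becomes one of matrix-valued functions.
  have h2 := congrArg (evalMatrix Φ) h1
  have r1 := regular_fieldLieSeries (ρ := L.gen) hγe
  have r2 := regular_fieldLieSeries (ρ := L.gen) hγn
  have ha := expands_constSeries_gaugeField (c := c) (ι := ι) (J := J) μ
  have r3 := (regular_fieldLieSeries (ρ := L.gen) ha).X_mul
  rw [evalMatrix_X_mul, evalMatrix_sub ((r1.pexp.mul r3).mul r2.pexp)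
    (r1.pexp.mul (r2.pexp.seriesFieldDeriv μ)), evalMatrix_mul (r1.pexp.mul r3) r2.pexp,
    evalMatrix_mul r1.pexp r3, evalMatrix_mul r1.pexp (r2.pexp.seriesFieldDeriv μ),
    evalMatrix_seriesFieldDeriv r2.pexp, evalMatrix_X_mul,
    evalMatrix_pexp (ordGE_fieldLieSeries (ρ := L.gen) hγ.1) r1,
    evalMatrix_pexp (ordGE_fieldLieSeries (ρ := L.gen) hγn0) r2,
    evalMatrix_fieldLieSeries (ρ := L.gen) hγe, evalMatrix_fieldLieSeries (ρ := L.gen) hγn,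
    evalMatrix_fieldLieSeries (ρ := L.gen) hv,
    evalMatrix_fieldLieSeries (ρ := L.gen) ha, evalSeries_neg hγe, hve,
    evalSeries_gaugeField] at h2
  exact (transform_iff_intertwines (ρ := L.gen) (evalSeries_zero_coeff hγ.1)
    (evalSeries_mem hγe) _ _ μ).mp h2

end FieldEvaluation

/-! ### Gauge invariance of the dressed quark field -/

section GaugeInvariance

open PowerSeries

variable {c : StringFunction} {ι d J n : Type*} [Fintype ι] [Fintype d] [DecidableEq d]
  [Fintype J] [DecidableEq J] [Fintype n] [DecidableEq n]
  {L : GaugeAlgebra ι d} {T₀ : Distr ℂ} {α : FieldSeries c ι J (Fin 4 → ι → ℝ)}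
  {γ : FieldSeries c ι J (ι → ℝ)}

theorem evalSeries_quarkApply {p : PowerSeries (Matrix J J (QField c ι J ℂ))} (hp : Regular p)
    (Φ : ℕ → Config c ι J) (m : ℕ) (x : Spacetime) (j : J) (σ : Fin 4) :
    evalSeries (fun k => quarkApply (coeff k p)) Φ m x j σ =
      ∑ l ∈ Finset.HasAntidiagonal.antidiagonal m, ∑ i,
        coeff l.1 (evalMatrix Φ p) j i x * quarkField (Φ l.2) x i σ := by
  choose f hf using fun k j i => hp k j i Φ
  rw [evalSeries_eq fun k => hasExp_quarkApply (hf k)]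
  have h : ∀ l i, coeff l (evalMatrix Φ p) j i x =
      ∑ k ∈ Finset.HasAntidiagonal.antidiagonal l, f k.1 j i k.2 x := by
    intro l i
    rw [coeff_evalMatrix, evalSeries_eq fun k => hf k j i, Finset.sum_apply]
  simp only [h, Finset.sum_apply, Finset.sum_mul]
  rw [Finset.sum_comm]
  conv_rhs => rw [Finset.sum_comm]
  refine Finset.sum_congr rfl fun i _ => ?_
  exact (sum_antidiagonal_assoc (fun k l q => f k j i l x * quarkField (Φ q) x i σ) m).symm

theorem rotatedQuark_eq_quarkApply (π : GaugeRep L J) (γ : FieldSeries c ι J (ι → ℝ)) :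
    rotatedQuark π γ = fun k => quarkApply (coeff k (pexp (fieldLieSeries π.gen γ))) := by
  funext k Ψ x j σ
  rw [← toSeries_dressingFactor, coeff_toSeries]
  rfl

theorem coeff_gaugeFunction (ρ : ι → Matrix n n ℂ) (θ : ℕ → Spacetime → ι → ℝ) (m : ℕ) (i j : n) :
    coeff m (gaugeFunction ρ θ i j) = coeff m (pexp (functionLieSeries ρ θ)) i j := by
  rw [← toSeries_gaugeFunction, coeff_toSeries]
  rfl

theorem contDiff_coeff_gaugeFunction (ρ : ι → Matrix n n ℂ) {θ : ℕ → Spacetime → ι → ℝ}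
    (hθ : ∀ m, θ m ∈ stringFunctions c (ι → ℝ)) (m : ℕ) (i j : n) :
    ContDiff ℝ ∞ (coeff m (gaugeFunction ρ θ i j)) := by
  rw [coeff_gaugeFunction]
  exact mem_smoothFunctions.mp (coeffsIn_smooth_pexp hθ m i j)

variable {θ : ℕ → Spacetime → ι → ℝ}

theorem isGaugeTransform_iff (π : GaugeRep L J) (hθ0 : θ 0 = 0)
    (hθ : ∀ m, θ m ∈ stringFunctions c (ι → ℝ)) (Φ : Config c ι J) (Φ' : ℕ → Config c ι J) :
    IsGaugeTransform π θ Φ Φ' ↔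
      Intertwines (pexp (functionLieSeries L.gen (-θ)))
        (fun μ => functionLieSeries L.gen fun m x => gaugeField (Φ' m) x μ)
        (fun μ => functionLieSeries L.gen fun m x => if m = 0 then gaugeField Φ x μ else 0) ∧
      (∀ m x j σ, quarkField (Φ' m) x j σ =
        ∑ k, coeff m (gaugeFunction π.gen (-θ) j k) x * quarkField Φ x k σ) ∧
      ∀ m x j σ, antiquarkField (Φ' m) x j σ =
        ∑ k, antiquarkField Φ x k σ * coeff m (gaugeFunction π.gen θ k j) x := by
  have hn0 : (-θ) 0 = 0 := by rw [Pi.neg_apply, hθ0, neg_zero]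
  have hn : ∀ m, (-θ) m ∈ stringFunctions c (ι → ℝ) := fun m => Submodule.neg_mem _ (hθ m)
  refine and_congr (forall_congr' fun μ => ?_) Iff.rfl
  have h := gaugeTransform_iff_intertwines (ρ := L.gen)
    (a := fun m x => if m = 0 then gaugeField Φ x μ else 0)
    (b := fun m x => gaugeField (Φ' m) x μ) hn0 hn μ
  rwa [neg_neg] at h

theorem functionLieSeries_injective (L : GaugeAlgebra ι d) :
    Function.Injective (functionLieSeries L.gen) := fun s t h => funext fun m =>
  functionLie_injective L (by rw [← coeff_functionLieSeries, ← coeff_functionLieSeries, h])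

/-- The law prescribes `gA'`; cancelling `g` and using independence of the `ξ_a` fixes `A'`. The
quark components are given explicitly. -/
theorem IsGaugeTransform.unique {π : GaugeRep L J} {Φ : Config c ι J} {Φ₁ Φ₂ : ℕ → Config c ι J}
    (h₁ : IsGaugeTransform π θ Φ Φ₁) (h₂ : IsGaugeTransform π θ Φ Φ₂) : Φ₁ = Φ₂ := by
  have hA : ∀ μ, (fun m x => gaugeField (Φ₁ m) x μ) = fun m x => gaugeField (Φ₂ m) x μ := by
    intro μ
    refine functionLieSeries_injective L ?_
    have h := congrArg (fun Y => toSeries (Complex.I • Y)) ((h₁.1 μ).trans (h₂.1 μ).symm)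
    simp only [smul_comm Complex.I (X : PowerSeries (Spacetime → ℂ)), toSeries_X_smul,
      toSeries_functionComponents] at h
    ext1 m
    have hm := congrArg (coeff (m + 1)) h
    rwa [coeff_succ_X_mul, coeff_succ_X_mul] at hm
  funext m
  refine Prod.ext (Subtype.ext ?_) (Prod.ext (Subtype.ext ?_) (Subtype.ext ?_))
  · funext x μ
    exact congrFun (congrFun (hA μ) m) x
  · funext x j σ
    exact (h₁.2.1 m x j σ).trans (h₂.2.1 m x j σ).symm
  · funext x j σ
    exact (h₁.2.2 m x j σ).trans (h₂.2.2 m x j σ).symm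

theorem exists_isGaugeTransform (π : GaugeRep L J) (hθ0 : θ 0 = 0)
    (hθ : ∀ m, θ m ∈ stringFunctions c (ι → ℝ)) (Φ : Config c ι J) :
    ∃ Φ' : ℕ → Config c ι J, IsGaugeTransform π θ Φ Φ' := by
  have hn0 : (-θ) 0 = 0 := by rw [Pi.neg_apply, hθ0, neg_zero]
  have hn : ∀ m, (-θ) m ∈ stringFunctions c (ι → ℝ) := fun m => Submodule.neg_mem _ (hθ m)
  have hA : ∀ (μ : Fin 4) (m : ℕ), (fun x => if m = 0 then gaugeField Φ x μ else 0) ∈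
      stringFunctions c (ι → ℝ) := by
    intro μ m
    by_cases hm : m = 0
    · simp only [if_pos hm]
      exact mem_stringFunctions_pi.mp Φ.1.2 μ
    · simp only [if_neg hm]
      exact Submodule.zero_mem _
  choose b hb hbe using fun μ => exists_intertwines L.comm hn0 hn (hA μ) μ
  have hψ : ∀ j σ, ContDiff ℝ ∞ fun x => quarkField Φ x j σ := fun j σ =>
    contDiff_pi.mp (contDiff_pi.mp (mem_smoothFunctions.mp Φ.2.1.2) j) σ
  have hψ' : ∀ j σ, ContDiff ℝ ∞ fun x => antiquarkField Φ x j σ := fun j σ =>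
    contDiff_pi.mp (contDiff_pi.mp (mem_smoothFunctions.mp Φ.2.2.2) j) σ
  refine ⟨fun m => (⟨fun x μ => b μ m x, mem_stringFunctions_pi.mpr fun μ => hb μ m⟩,
    ⟨fun x j σ => ∑ k, coeff m (gaugeFunction π.gen (-θ) j k) x * quarkField Φ x k σ,
      mem_smoothFunctions.mpr (contDiff_pi.mpr fun j => contDiff_pi.mpr fun σ =>
        ContDiff.sum fun k _ => (contDiff_coeff_gaugeFunction π.gen hn m j k).mul (hψ k σ))⟩,
    ⟨fun x j σ => ∑ k, antiquarkField Φ x k σ * coeff m (gaugeFunction π.gen θ k j) x,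
      mem_smoothFunctions.mpr (contDiff_pi.mpr fun j => contDiff_pi.mpr fun σ =>
        ContDiff.sum fun k _ => (hψ' k σ).mul (contDiff_coeff_gaugeFunction π.gen hθ m k j))⟩),
    (isGaugeTransform_iff π hθ0 hθ Φ _).mpr ⟨hbe, fun _ _ _ _ => rfl, fun _ _ _ _ => rfl⟩⟩

/-- Both `W[Φ']` and `W[Φ] Θ` carry the transformed potential to one with vanishing string integral,
so they coincide, first in the defining representation and then in `π`. The factor `π(Θ)` cancels
against `ψ' = π(Θ⁻¹)ψ`. -/
theorem isGaugeInvariant_rotatedQuark (π : GaugeRep L J) (hT₀ : IsPropagator 0 T₀)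
    (hγ : InGS L γ) (hα : InGV L α) (hYM : IsYangMillsDressing L T₀ γ α) :
    IsGaugeInvariant π (rotatedQuark π γ) := by
  intro θ hθ0 hθ Φ
  refine ⟨?_, fun Φ' hΦ' m x => ?_⟩
  · obtain ⟨Φ', h⟩ := exists_isGaugeTransform π hθ0 hθ Φ
    exact ⟨Φ', h, fun Φ'' h' => h'.unique h⟩
  obtain ⟨hA, hψ, -⟩ := (isGaugeTransform_iff π hθ0 hθ Φ Φ').mp hΦ'
  have hγe : ∀ m, Expands (stringFunctions c (ι → ℝ)) (γ m) := fun m => (hγ.2 m).expands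
  have hreg := regular_fieldLieSeries (ρ := π.gen) hγe
  have hord := ordGE_fieldLieSeries (ρ := π.gen) hγ.1
  have h1 := hYM.intertwines hT₀ hγ hα (linePath Φ 0)
  have h2 := hYM.intertwines hT₀ hγ hα Φ'
  have hpath : (fun μ => functionLieSeries L.gen fun m x => gaugeField (linePath Φ 0 m) x μ) =
      fun μ => functionLieSeries L.gen fun m x => if m = 0 then gaugeField Φ x μ else 0 := by
    funext μ
    congr 1
    funext m x
    rcases m with _ | _ | m <;> rfl
  rw [hpath] at h1
  have h3 := pexp_eq_mul_rep π (evalSeries_zero_coeff hγ.1) (evalSeries_zero_coeff hγ.1) hθ0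
    (pexp_eq_mul_of_intertwines (evalSeries_mem hγe) (evalSeries_zero_coeff hγ.1)
      (evalSeries_mem hγe) hθ0 hθ (evalSeries_dressedPotential_mem hT₀ hα _)
      (stringInt_evalSeries_dressedPotential hT₀ hα _) (evalSeries_dressedPotential_mem hT₀ hα _)
      (stringInt_evalSeries_dressedPotential hT₀ hα _) h1 h2 hA)
  have h4 : pexp (functionLieSeries π.gen (evalSeries γ Φ')) *
      pexp (functionLieSeries π.gen (-θ)) =
        evalMatrix (linePath Φ 0) (pexp (fieldLieSeries π.gen γ)) := by
    rw [h3, mul_assoc, functionLieSeries_neg, pexp_mul_pexp_neg (ordGE_functionLieSeries hθ0),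
      mul_one, evalMatrix_pexp hord hreg, evalMatrix_fieldLieSeries hγe]
  funext j σ
  rw [rotatedQuark_eq_quarkApply, evalSeries_quarkApply hreg.pexp]
  have h5 : ∀ k, coeff m (pexp (fieldLieSeries π.gen γ)) j k Φ x =
      ∑ l ∈ Finset.HasAntidiagonal.antidiagonal m, ∑ i,
        coeff l.1 (pexp (functionLieSeries π.gen (evalSeries γ Φ'))) j i x *
          coeff l.2 (gaugeFunction π.gen (-θ) i k) x := by
    intro k
    have h6 : coeff m (evalMatrix (linePath Φ 0) (pexp (fieldLieSeries π.gen γ))) j k x =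
        coeff m (pexp (fieldLieSeries π.gen γ)) j k Φ x := by
      rw [coeff_evalMatrix, evalSeries_linePath]
    rw [← h6, ← h4, coeff_mul, Matrix.sum_apply, Finset.sum_apply]
    refine Finset.sum_congr rfl fun l _ => ?_
    rw [Matrix.mul_apply, Finset.sum_apply]
    refine Finset.sum_congr rfl fun i _ => ?_
    rw [coeff_gaugeFunction]
    rfl
  rw [evalMatrix_pexp hord hreg, evalMatrix_fieldLieSeries hγe]
  change _ = ∑ k, coeff m (pexp (fieldLieSeries π.gen γ)) j k Φ x * quarkField Φ x k σ
  -- With `h5` and the law for `ψ'`, both sides become the same sum over the orders of `W[Φ']` and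
  -- `Θ⁻¹` and over two matrix indices.
  simp only [h5, hψ, Finset.sum_mul, Finset.mul_sum]
  rw [Finset.sum_congr rfl fun l _ => Finset.sum_comm, Finset.sum_comm]
  refine Finset.sum_congr rfl fun k _ => Finset.sum_congr rfl fun l _ =>
    Finset.sum_congr rfl fun i _ => ?_
  rw [mul_assoc]

end GaugeInvariance

end

end StringQFT

/-! ### The proposition. -/

theorem propositionp {ι d J : Type*} [Fintype ι] [Fintype d] [DecidableEq d]
    [Fintype J] [DecidableEq J]
    (c : StringFunction) (L : GaugeAlgebra ι d) (π : GaugeRep L J)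
    (Γ : Fin 4 → Matrix (Fin 4) (Fin 4) ℂ) (hΓ : IsDirac Γ) (m : ℝ)
    (T₀ Δ : Distr ℂ) (hT₀ : IsPropagator 0 T₀) (hΔ : IsPropagator m Δ)
    (γ : FieldSeries c ι J (ι → ℝ)) (hγ : InGS L γ)
    (α : FieldSeries c ι J (Fin 4 → ι → ℝ)) (hα : InGV L α)
    (hYM : IsYangMillsDressing L T₀ γ α) :
    ∃ β : FieldSeries c ι J (ι → ℝ), InGS L β ∧
      dressedQuark π Γ m T₀ Δ α β = rotatedQuark π γ ∧
      (∀ β' : FieldSeries c ι J (ι → ℝ), InGS L β' →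
        dressedQuark π Γ m T₀ Δ α β' = rotatedQuark π γ →
        quarkMediator π Γ β' = quarkMediator π Γ β) ∧
      IsBCH L T₀ α γ β ∧
      (∀ β' : FieldSeries c ι J (ι → ℝ), InGS L β' → IsBCH L T₀ α γ β' → β' = β) ∧
      (∀ n ≤ 3, β n = bchLowOrder L T₀ α γ n) ∧
      IsGaugeInvariant π (dressedQuark π Γ m T₀ Δ α β) := by
  obtain ⟨β, hβ, hL, hJ⟩ := exists_bch π hT₀ hα hγ
  -- The identity in the representation `π`, applied to `1`, which `e^{ω_U}` fixes.
  have hdress : dressedQuark π Γ m T₀ Δ α β = rotatedQuark π γ := by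
    rw [dressedQuark_eq π hΓ hT₀ hΔ hα hβ, rotatedQuark_eq π hγ.2, hJ,
      act_pexp_omegaSeries_one J, one_mul]
  have hbch : IsBCH L T₀ α γ β := isBCH_of_act hT₀ hα hβ hγ hL
  refine ⟨β, hβ, hdress, fun β' hβ' h => ?_, hbch, fun β' hβ' h => ?_, fun n hn => ?_, ?_⟩
  · exact quarkMediator_unique π hΓ hT₀ hΔ hα hβ hβ' (h.trans hdress.symm)
  · exact IsBCH.unique hT₀ hα hγ hβ hβ' hbch h
  · exact hbch.lowOrder hT₀ hα hβ hγ hn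
  · rw [hdress]
    exact isGaugeInvariant_rotatedQuark π hT₀ hγ hα hYM
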